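/- Let $\Gamma\subset\mathbb{R}^n$ be a connected, locally Lipschitz hypersurface separating $\mathbb{R}^n$ into two disjoint domains $\Omega_1,\Omega_2$ (near each of its points $\Gamma$ is, in suitable orthonormal coordinates, a Lipschitz graph with $\Omega_1$ below it and $\Omega_2$ above it). Let $s\in(0,1)$, $0<\lambda\le\Lambda<\infty$, let $A$ be a measurable field of symmetric matrices on $\Omega_1$ with $\lambda|\xi|^2\le\langle A\xi,\xi\rangle\le\Lambda|\xi|^2$, and let $a$ be a symmetric measurable function on $(\mathbb{R}^n\times\mathbb{R}^n)\setminus(\Omega_1\times\Omega_1)$ with values in $[0,\Lambda]$ and $a(x,y)\ge\lambda$ for $x\in\Omega_2$, $y\in\mathbb{R}^n$. For $\epsilon>0$ put $$B_L^\epsilon[u,v]=\int_{\Omega_1/\epsilon}\langle A(\epsilon x)\nabla u,\nabla v\rangle\,dx,\qquad B_N^\epsilon[u,v]=\iint_{(\mathbb{R}^n\times\mathbb{R}^n)\setminus(\Omega_1/\epsilon\times\Omega_1/\epsilon)}\frac{[u(x)-u(y)]\,a(\epsilon x,\epsilon y)\,[v(x)-v(y)]}{|x-y|^{n+2s}}\,dx\,dy,$$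 and $f^\epsilon(x)=f(\epsilon x)$, $b^\epsilon(x)=b(\epsilon x)$. Let $\Omega\subset\mathbb{R}^n$ be open and bounded. A function $u$ solves $(P_\epsilon)$ in $\Omega$ if for all $\varphi\in C_c^\infty(\Omega)$ $$B_L^\epsilon[u,\varphi]+\epsilon^{2(1-s)}B_N^\epsilon[u,\varphi]=\epsilon^2\int_\Omega f^\epsilon\varphi+\epsilon\int_\Omega u\,\langle b^\epsilon,\nabla\varphi\rangle ,$$ all integrals converging absolutely; it solves $(P_\epsilon^\delta)$ if the same holds with the term $\delta\int_\Omega\langle\nabla u,\nabla\varphi\rangle$ added on the left. For $\phi:\mathbb{R}^n\to[0,\infty)$ let $$M(\phi)=\max\Big\{\sup_{x\neq y}\frac{|\phi(x)-\phi(y)|}{|x-y|},\ \sup_x\frac{\phi(x)}{1+|x|^{s/2}}\Big\}\in[0,\infty].$$ Let $2\le q<\infty$, $S<\infty$ and $\epsilon_0>0$. Then there is a constant $C_0$, depending only on $n,s,\lambda,\Lambda,\Omega,q,S$ and $\epsilon_0$, such that the following holds for all $\Gamma,\Omega_1,\Omega_2,A,a$ as above and every $\epsilon\in(0,\epsilon_0]$.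 Assume $f^\epsilon,b^\epsilon\in L^q(\Omega)$, $\operatorname{div} b^\epsilon=0$ in $\Omega$ in the sense of distributions, $\|\epsilon b^\epsilon\|_{L^q(\Omega)}\le S$, and that $u_0:\mathbb{R}^n\to\mathbb{R}$ is uniformly Lipschitz with $|u_0|\le\psi$ for some $\psi$ with $M(\psi)<\infty$. Then there is a function $u$ such that: 1. $u-u_0\in H^1(\Omega_1/\epsilon)\cap H^s(\mathbb{R}^n)$, $u=u_0$ on $\Omega^c$, and $u$ solves $(P_\epsilon)$ in $\Omega$. 2. There are $\delta_k>0$ with $\delta_k\to0$ and solutions $u_k$ of $(P_\epsilon^{\delta_k})$ in $\Omega$ with $u_k-u_0\in H^1(\mathbb{R}^n)$ and $u_k=u_0$ on $\Omega^c$, such that $u_k-u_0\rightharpoonup u-u_0$ weakly in $H^1(\Omega_1/\epsilon)\cap H^s(\mathbb{R}^n)$. 3. For every $\phi:\mathbb{R}^n\to[0,\infty)$ with $|u_0|\le\phi$ on $\Omega^c$ and $M(\phi)<\infty$, $$\int_{\Omega_1/\epsilon}|\nabla(u-\phi)_+|^2+\epsilon^{2(1-s)}\int_{\Omega_2/\epsilon}\int_{\mathbb{R}^n}\frac{[(u-\phi)_+(x)-(u-\phi)_+(y)]^2}{|x-y|^{n+2s}}\,dy\,dx\le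 C_0\Big[\big(\|\epsilon^2f^\epsilon\|_{L^q(\Omega)}^2+M(\phi)^2\big)\,|\{u>\phi\}|^{\frac{q-2}{q}}+\int_\Omega(u-\phi)_+^2\Big].$$ -/

import Mathlib

open MeasureTheory Filter Topology
open scoped ENNReal NNReal ContDiff

noncomputable section

namespace LocalNonlocal

/-- Euclidean space of dimension `n`. -/
abbrev Rn (n : ℕ) : Type := EuclideanSpace ℝ (Fin n)

variable {n : ℕ}

/-- The class `C_c^∞(U)` of test functions on `U`. -/
structure IsTestFunction (U : Set (Rn n)) (φ : Rn n → ℝ) : Prop where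
  smooth : ContDiff ℝ ∞ φ
  compact : HasCompactSupport φ
  supp : tsupport φ ⊆ U

/-- `G` is a weak (distributional) gradient of `v` on the open set `U`. -/
structure HasWeakGradient (U : Set (Rn n)) (v : Rn n → ℝ) (G : Rn n → Rn n) : Prop where
  locInt : LocallyIntegrableOn v U volume
  locInt_grad : LocallyIntegrableOn G U volume
  parts : ∀ φ : Rn n → ℝ, IsTestFunction U φ →
    ∫ x in U, v x • gradient φ x = -∫ x in U, φ x • G x

/-- `v` has a weak gradient on `U`. -/
def WeaklyDifferentiable (U : Set (Rn n)) (v : Rn n → ℝ) : Prop :=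
  ∃ G : Rn n → Rn n, HasWeakGradient U v G

open Classical in
/-- The weak gradient of `v` on `U` (unique up to null sets); it is used only for functions that
are weakly differentiable on `U`. -/
def weakGrad (U : Set (Rn n)) (v : Rn n → ℝ) : Rn n → Rn n :=
  if h : WeaklyDifferentiable U v then h.choose else 0

theorem hasWeakGradient_weakGrad {U : Set (Rn n)} {v : Rn n → ℝ}
    (h : WeaklyDifferentiable U v) : HasWeakGradient U v (weakGrad U v) := by
  rw [weakGrad, dif_pos h]
  exact h.choose_spec

/-- Weak gradients on an open set are unique almost everywhere. -/
theorem HasWeakGradient.ae_eq {U : Set (Rn n)} (hU : IsOpen U) {v : Rn n → ℝ}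
    {G H : Rn n → Rn n} (hG : HasWeakGradient U v G) (hH : HasWeakGradient U v H) :
    ∀ᵐ x, x ∈ U → G x = H x := by
  have key : ∀ᵐ x, x ∈ U → (G - H) x = 0 := by
    refine hU.ae_eq_zero_of_integral_contDiff_smul_eq_zero
      (hG.locInt_grad.sub hH.locInt_grad) ?_
    intro g hg hgc hgU
    have hint : ∀ F : Rn n → Rn n, LocallyIntegrableOn F U volume →
        Integrable (fun x => g x • F x) := by
      intro F hF
      have hK : IntegrableOn F (tsupport g) volume :=
        hF.integrableOn_compact_subset hgU hgc.isCompact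
      have h1 : IntegrableOn (fun x => g x • F x) (tsupport g) volume :=
        hK.continuousOn_smul hg.continuous.continuousOn hgc.isCompact
      rw [← integrableOn_iff_integrable_of_support_subset (s := tsupport g)]
      · exact h1
      · intro x hx
        refine subset_tsupport g ?_
        intro h0
        exact hx (by simp [h0])
    have hres : ∀ F : Rn n → Rn n, ∫ x in U, g x • F x = ∫ x, g x • F x := by
      intro F
      refine setIntegral_eq_integral_of_forall_compl_eq_zero ?_
      intro x hx
      have : g x = 0 := by
        by_contra h0
        exact hx (hgU (subset_tsupport g h0))
      simp [this]
    have e1 := hG.parts g ⟨hg, hgc, hgU⟩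
    have e2 := hH.parts g ⟨hg, hgc, hgU⟩
    rw [hres] at e1 e2
    have e3 : ∫ x, g x • G x = ∫ x, g x • H x := neg_injective (e1.symm.trans e2)
    simp only [Pi.sub_apply, smul_sub]
    rw [integral_sub (hint G hG.locInt_grad) (hint H hH.locInt_grad), e3, sub_self]
  filter_upwards [key] with x hx hxU
  exact sub_eq_zero.mp (hx hxU)

/-- The Sobolev space `H¹(U)`. -/
structure MemH1 (U : Set (Rn n)) (v : Rn n → ℝ) : Prop where
  memLp : MemLp v 2 (volume.restrict U)
  weakDiff : WeaklyDifferentiable U v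
  memLp_grad : MemLp (weakGrad U v) 2 (volume.restrict U)

/-- The square of the Gagliardo seminorm of `v` on `ℝⁿ`. -/
def gagliardo (s : ℝ) (v : Rn n → ℝ) : ℝ≥0∞ :=
  ∫⁻ x, ∫⁻ y, ENNReal.ofReal ((v x - v y) ^ 2 / ‖x - y‖ ^ ((n : ℝ) + 2 * s))

/-- The fractional Sobolev space `H^s(ℝⁿ)`, `0 < s < 1`. -/
structure MemHs (s : ℝ) (v : Rn n → ℝ) : Prop where
  memLp : MemLp v 2 volume
  gagliardo_lt : gagliardo s v < ⊤

/-- The energy space `H¹(U) ∩ H^s(ℝⁿ)`. -/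
structure MemEnergy (s : ℝ) (U : Set (Rn n)) (v : Rn n → ℝ) : Prop where
  memH1 : MemH1 U v
  memHs : MemHs s v

/-- The inner product of the Hilbert space `H¹(U) ∩ H^s(ℝⁿ)`. -/
def energyInner (s : ℝ) (U : Set (Rn n)) (v w : Rn n → ℝ) : ℝ :=
  (∫ x, v x * w x) + (∫ x in U, inner ℝ (weakGrad U v x) (weakGrad U w x)) +
    ∫ p : Rn n × Rn n, (v p.1 - v p.2) * (w p.1 - w p.2) / ‖p.1 - p.2‖ ^ ((n : ℝ) + 2 * s)

/-- Weak convergence `v k ⇀ v` in the Hilbert space `H¹(U) ∩ H^s(ℝⁿ)`. -/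
def WeakTendsto (s : ℝ) (U : Set (Rn n)) (v : ℕ → Rn n → ℝ) (w : Rn n → ℝ) : Prop :=
  (∀ k, MemEnergy s U (v k)) ∧ MemEnergy s U w ∧
    ∀ z : Rn n → ℝ, MemEnergy s U z →
      Tendsto (fun k => energyInner s U (v k) z) atTop (𝓝 (energyInner s U w z))

/-- `Γ` is a connected, locally Lipschitz hypersurface separating `ℝⁿ` into the two domains `Ω₁`
and `Ω₂`: near each of its points, in suitable orthonormal coordinates with vertical direction `ν`,
it is the graph of a Lipschitz function `g` of the horizontal component, with `Ω₁` below and `Ω₂`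
above. -/
structure IsLipschitzInterface (Γ Ω₁ Ω₂ : Set (Rn n)) : Prop where
  isOpen₁ : IsOpen Ω₁
  isOpen₂ : IsOpen Ω₂
  connected₁ : IsConnected Ω₁
  connected₂ : IsConnected Ω₂
  disjoint : Disjoint Ω₁ Ω₂
  compl_eq : Γᶜ = Ω₁ ∪ Ω₂
  connected : IsConnected Γ
  graph : ∀ p ∈ Γ, ∃ ν : Rn n, ‖ν‖ = 1 ∧ ∃ r : ℝ, 0 < r ∧ ∃ g : Rn n → ℝ,
    (∃ K : ℝ≥0, LipschitzWith K g) ∧ ∀ x ∈ Metric.ball p r,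
      (x ∈ Ω₁ ↔ inner ℝ ν x < g (x - (inner ℝ ν x : ℝ) • ν)) ∧
      (x ∈ Γ ↔ inner ℝ ν x = g (x - (inner ℝ ν x : ℝ) • ν)) ∧
      (x ∈ Ω₂ ↔ g (x - (inner ℝ ν x : ℝ) • ν) < inner ℝ ν x)

/-- `A` is a measurable field of symmetric matrices (self-adjoint operators) on `Ω₁` with
`lam |ξ|² ≤ ⟨A ξ, ξ⟩ ≤ Lam |ξ|²`. -/
structure IsEllipticMatrix (lam Lam : ℝ) (Ω₁ : Set (Rn n)) (A : Rn n → Rn n →L[ℝ] Rn n) :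
    Prop where
  measurable : AEStronglyMeasurable A (volume.restrict Ω₁)
  symm : ∀ x ∈ Ω₁, ∀ ξ η : Rn n, inner ℝ (A x ξ) η = inner ℝ ξ (A x η)
  lower : ∀ x ∈ Ω₁, ∀ ξ : Rn n, lam * ‖ξ‖ ^ 2 ≤ inner ℝ (A x ξ) ξ
  upper : ∀ x ∈ Ω₁, ∀ ξ : Rn n, inner ℝ (A x ξ) ξ ≤ Lam * ‖ξ‖ ^ 2

/-- `a` is a symmetric measurable function on the complement of `Ω₁ × Ω₁` with values in
`[0, Lam]`, and `lam ≤ a(x, y)` for `x ∈ Ω₂`, `y ∈ ℝⁿ`. -/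
structure IsEllipticKernel (lam Lam : ℝ) (Ω₁ Ω₂ : Set (Rn n)) (a : Rn n → Rn n → ℝ) : Prop where
  measurable : AEStronglyMeasurable (fun p : Rn n × Rn n => a p.1 p.2)
    (volume.restrict (Ω₁ ×ˢ Ω₁)ᶜ)
  symm : ∀ x y : Rn n, (x, y) ∉ Ω₁ ×ˢ Ω₁ → a x y = a y x
  nonneg : ∀ x y : Rn n, (x, y) ∉ Ω₁ ×ˢ Ω₁ → 0 ≤ a x y
  upper : ∀ x y : Rn n, (x, y) ∉ Ω₁ ×ˢ Ω₁ → a x y ≤ Lam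
  lower : ∀ x ∈ Ω₂, ∀ y : Rn n, lam ≤ a x y

/-- `div b = 0` in the sense of distributions on `U`. -/
def IsDivFree (U : Set (Rn n)) (b : Rn n → Rn n) : Prop :=
  ∀ φ : Rn n → ℝ, IsTestFunction U φ → ∫ x in U, inner ℝ (b x) (gradient φ x) = 0

/-- The rescaled set `U / ε`. -/
def rescale (ε : ℝ) (U : Set (Rn n)) : Set (Rn n) := {x | ε • x ∈ U}

/-- The integrand of the rescaled local form `B_L^ε[u, φ]`, for a smooth second argument. -/
def localIntegrand (Ω₁ : Set (Rn n)) (A : Rn n → Rn n →L[ℝ] Rn n) (ε : ℝ) (u φ : Rn n → ℝ)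
    (x : Rn n) : ℝ :=
  inner ℝ (A (ε • x) (weakGrad (rescale ε Ω₁) u x)) (gradient φ x)

/-- The integrand of the rescaled nonlocal form `B_N^ε[u, φ]`. -/
def nonlocalIntegrand (s : ℝ) (a : Rn n → Rn n → ℝ) (ε : ℝ) (u φ : Rn n → ℝ)
    (p : Rn n × Rn n) : ℝ :=
  (u p.1 - u p.2) * a (ε • p.1) (ε • p.2) * (φ p.1 - φ p.2) / ‖p.1 - p.2‖ ^ ((n : ℝ) + 2 * s)

/-- The rescaled local form `B_L^ε`. -/
def formL (Ω₁ : Set (Rn n)) (A : Rn n → Rn n →L[ℝ] Rn n) (ε : ℝ) (u φ : Rn n → ℝ) : ℝ :=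
  ∫ x in rescale ε Ω₁, localIntegrand Ω₁ A ε u φ x

/-- The rescaled nonlocal form `B_N^ε`, an integral over the complement of
`(Ω₁ / ε) × (Ω₁ / ε)`. -/
def formN (s : ℝ) (Ω₁ : Set (Rn n)) (a : Rn n → Rn n → ℝ) (ε : ℝ) (u φ : Rn n → ℝ) : ℝ :=
  ∫ p in (rescale ε Ω₁ ×ˢ rescale ε Ω₁)ᶜ, nonlocalIntegrand s a ε u φ p

/-- `u` is a weak solution on `Ω` of the rescaled problem with viscosity `δ`: for every
`φ ∈ C_c^∞(Ω)` all integrals below converge absolutely and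
`B_L^ε[u,φ] + ε^(2(1-s)) B_N^ε[u,φ] + δ ∫_Ω ⟨∇u,∇φ⟩ = ε² ∫ f^ε φ + ε ∫ u ⟨b^ε,∇φ⟩`. -/
structure SolvesViscous (s : ℝ) (Ω₁ Ω : Set (Rn n)) (A : Rn n → Rn n →L[ℝ] Rn n)
    (a : Rn n → Rn n → ℝ) (f : Rn n → ℝ) (b : Rn n → Rn n) (ε δ : ℝ) (u : Rn n → ℝ) : Prop where
  weakDiff₁ : WeaklyDifferentiable (rescale ε Ω₁) u
  weakDiff : WeaklyDifferentiable Ω u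
  integrable_local : ∀ φ, IsTestFunction Ω φ →
    IntegrableOn (localIntegrand Ω₁ A ε u φ) (rescale ε Ω₁)
  integrable_nonlocal : ∀ φ, IsTestFunction Ω φ →
    IntegrableOn (nonlocalIntegrand s a ε u φ) (rescale ε Ω₁ ×ˢ rescale ε Ω₁)ᶜ
  integrable_viscous : ∀ φ, IsTestFunction Ω φ →
    IntegrableOn (fun x => (inner ℝ (weakGrad Ω u x) (gradient φ x) : ℝ)) Ω
  integrable_source : ∀ φ, IsTestFunction Ω φ → IntegrableOn (fun x => f (ε • x) * φ x) Ω
  integrable_drift : ∀ φ, IsTestFunction Ω φ →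
    IntegrableOn (fun x => u x * (inner ℝ (b (ε • x)) (gradient φ x) : ℝ)) Ω
  equation : ∀ φ, IsTestFunction Ω φ →
    formL Ω₁ A ε u φ + ε ^ (2 * (1 - s)) * formN s Ω₁ a ε u φ
        + δ * (∫ x in Ω, (inner ℝ (weakGrad Ω u x) (gradient φ x) : ℝ))
      = ε ^ 2 * (∫ x in Ω, f (ε • x) * φ x)
        + ε * ∫ x in Ω, u x * (inner ℝ (b (ε • x)) (gradient φ x) : ℝ)

/-- `u` is a weak solution on `Ω` of the rescaled problem: for every `φ ∈ C_c^∞(Ω)` all integrals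
below converge absolutely and
`B_L^ε[u,φ] + ε^(2(1-s)) B_N^ε[u,φ] = ε² ∫ f^ε φ + ε ∫ u ⟨b^ε,∇φ⟩`. -/
structure Solves (s : ℝ) (Ω₁ Ω : Set (Rn n)) (A : Rn n → Rn n →L[ℝ] Rn n)
    (a : Rn n → Rn n → ℝ) (f : Rn n → ℝ) (b : Rn n → Rn n) (ε : ℝ) (u : Rn n → ℝ) : Prop where
  weakDiff₁ : WeaklyDifferentiable (rescale ε Ω₁) u
  integrable_local : ∀ φ, IsTestFunction Ω φ →
    IntegrableOn (localIntegrand Ω₁ A ε u φ) (rescale ε Ω₁)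
  integrable_nonlocal : ∀ φ, IsTestFunction Ω φ →
    IntegrableOn (nonlocalIntegrand s a ε u φ) (rescale ε Ω₁ ×ˢ rescale ε Ω₁)ᶜ
  integrable_source : ∀ φ, IsTestFunction Ω φ → IntegrableOn (fun x => f (ε • x) * φ x) Ω
  integrable_drift : ∀ φ, IsTestFunction Ω φ →
    IntegrableOn (fun x => u x * (inner ℝ (b (ε • x)) (gradient φ x) : ℝ)) Ω
  equation : ∀ φ, IsTestFunction Ω φ →
    formL Ω₁ A ε u φ + ε ^ (2 * (1 - s)) * formN s Ω₁ a ε u φ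
      = ε ^ 2 * (∫ x in Ω, f (ε • x) * φ x)
        + ε * ∫ x in Ω, u x * (inner ℝ (b (ε • x)) (gradient φ x) : ℝ)

/-- `M(φ) = max { sup_{x,y} |φ(x)-φ(y)| / |x-y| , sup_x φ(x) / (1+|x|^{s/2}) }` for `φ ≥ 0`,
with values in `[0, ∞]`. -/
def flatness (s : ℝ) (φ : Rn n → ℝ) : ℝ≥0∞ :=
  max (⨆ (x : Rn n) (y : Rn n), edist (φ x) (φ y) / edist x y)
    (⨆ x : Rn n, ENNReal.ofReal (φ x / (1 + ‖x‖ ^ (s / 2))))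

/-- The positive part `(u - φ)_+`. -/
def truncation (u φ : Rn n → ℝ) (x : Rn n) : ℝ := max (u x - φ x) 0

/-- The localized energy inequality for `u` and the barrier `φ` with constant `C`:
`∫_{Ω₁/ε} |∇(u-φ)_+|² + ε^(2(1-s)) ∫_{Ω₂/ε} ∫_{ℝⁿ} [(u-φ)_+(x)-(u-φ)_+(y)]² / |x-y|^(n+2s) dy dx`
`≤ C [ (‖ε² f^ε‖²_{L^q(Ω)} + M(φ)²) |{u > φ}|^((q-2)/q) + ∫_Ω (u-φ)_+² ]`. -/
def EnergyInequality (s q : ℝ) (Ω₁ Ω₂ Ω : Set (Rn n)) (f : Rn n → ℝ) (ε : ℝ) (C : ℝ≥0)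
    (u φ : Rn n → ℝ) : Prop :=
  WeaklyDifferentiable (rescale ε Ω₁) (truncation u φ) ∧
  (∫⁻ x in rescale ε Ω₁, ‖weakGrad (rescale ε Ω₁) (truncation u φ) x‖ₑ ^ 2)
      + ENNReal.ofReal (ε ^ (2 * (1 - s))) *
        (∫⁻ x in rescale ε Ω₂, ∫⁻ y, ENNReal.ofReal
          ((truncation u φ x - truncation u φ y) ^ 2 / ‖x - y‖ ^ ((n : ℝ) + 2 * s)))
    ≤ (C : ℝ≥0∞) *
      (((eLpNorm (fun x => ε ^ 2 * f (ε • x)) (ENNReal.ofReal q) (volume.restrict Ω)) ^ 2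
            + flatness s φ ^ 2) * (volume {x | φ x < u x}) ^ ((q - 2) / q)
        + ∫⁻ x in Ω, ENNReal.ofReal (truncation u φ x ^ 2))

end LocalNonlocal

end

open LocalNonlocal

open MeasureTheory Filter Topology
open scoped ENNReal NNReal ContDiff

noncomputable section

namespace LocalNonlocal

variable {n : ℕ}

/-! ### Integrals of powers of the norm -/

/-! Write v = u - u₀, in rescaled variables, with all coefficients extended by zero. Only b ∈ L² is
used for existence, so the drift is not bounded on the energy space and Lax–Milgram does not apply.
Since div b = 0, however, the drift is skew: ∫ ζ⟨b, ∇ζ⟩ = ½ ∫ ⟨b, ∇(ζ²)⟩ = 0 for Lipschitz ζ with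
compact support in Ω. The form is therefore coercive on such functions, and Lions' projection
theorem (`exists_lions`), which needs coercivity on test functions only, produces a solution in the
closure of the test functions. Lipschitz rather than smooth tests are used because they survive
products and truncations; mollification (`integral_inner_gradient_eq_zero`) extends div b = 0 to
them.

Coercivity (`exists_coercivity`): the gradient on U₁ and the difference quotients with one entry in
U₂ control the full H^s norm. A pair of nearby points of U₁ is joined by a segment. If the segment
stays in U₁, its oscillation is an integral of the gradient. If not, it meets the interface, and
both endpoints are compared with a ball of comparable size inside U₂, which exists because the
interface is a Lipschitz graph.

The viscosity is δ = τ². It is built into the norm: the energy space consists of triples (function,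
weighted gradient, difference quotient), with gradient weight 1 on U₁ and τ elsewhere. The
coercivity constant and the size of the right-hand side do not depend on τ, so the viscous solutions
are bounded. A weak limit exists as τ → 0, the viscous term is O(τ), and boundedness in H^s with
support in a bounded set gives strong L² convergence (`tendsto_eLpNorm_of_weak`).

The energy inequality comes from testing with (u-φ)_+. Monotonicity handles the local and nonlocal
forms, Young's inequality the barrier terms, and the drift splits as ζ⟨b, ∇u⟩ = ⟨b, ∇Q⟩ + ζ⟨b, ∇φ⟩,
where ζ = F(u-φ) and Q is the primitive of F evaluated at u-φ; the first summand integrates to zero.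
Since (u-φ)_+ need not be an admissible test function, the test is made with a smoothed bounded
truncation of w + u₀ - φ, with w a Lipschitz approximation of a viscous solution; the error is an
inner product with a vanishing factor (`IsViscous.exists_test`). A diagonal choice and lower
semicontinuity give the inequality for the limit (`CoupledProblem.energy_limit`). Hölder's
inequality turns integrals over the superlevel set into powers of its measure.

The coercivity constant depends on the interface, but it serves existence only. The energy
inequality uses just the ellipticity bounds, a kernel constant of Ω, S and ε₀, so C₀ is independent
of the interface. -/

theorem lintegral_norm_rpow_tail_one_lt_top {α : ℝ} (hα : (n : ℝ) < α) :
    ∫⁻ h : Rn n in {h | 1 ≤ ‖h‖}, ENNReal.ofReal (‖h‖ ^ (-α)) < ⊤ := by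
  have h0 : 0 < α := lt_of_le_of_lt (Nat.cast_nonneg n) hα
  have hfin := finite_integral_one_add_norm (E := Rn n) (μ := volume) (r := α) (by simpa using hα)
  have hms : MeasurableSet {h : Rn n | 1 ≤ ‖h‖} :=
    (isClosed_le continuous_const continuous_norm).measurableSet
  calc ∫⁻ h : Rn n in {h | 1 ≤ ‖h‖}, ENNReal.ofReal (‖h‖ ^ (-α))
      ≤ ∫⁻ h : Rn n in {h | 1 ≤ ‖h‖},
          ENNReal.ofReal (2 ^ α) * ENNReal.ofReal ((1 + ‖h‖) ^ (-α)) := by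
        refine setLIntegral_mono (by fun_prop) fun h hh => ?_
        rw [← ENNReal.ofReal_mul (by positivity)]
        refine ENNReal.ofReal_le_ofReal ?_
        have hh' : (1 : ℝ) ≤ ‖h‖ := hh
        have h1 : (2 * ‖h‖) ^ (-α) ≤ (1 + ‖h‖) ^ (-α) :=
          Real.rpow_le_rpow_of_nonpos (by linarith) (by linarith) (by linarith)
        calc ‖h‖ ^ (-α) = 2 ^ α * (2 * ‖h‖) ^ (-α) := by
              rw [Real.mul_rpow (by norm_num) (by positivity), ← mul_assoc,
                ← Real.rpow_add (by norm_num)]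
              simp
          _ ≤ _ := by gcongr
    _ ≤ ∫⁻ h : Rn n, ENNReal.ofReal (2 ^ α) * ENNReal.ofReal ((1 + ‖h‖) ^ (-α)) :=
        setLIntegral_le_lintegral _ _
    _ < ⊤ := by
        rw [lintegral_const_mul _ (by fun_prop)]
        exact ENNReal.mul_lt_top ENNReal.ofReal_lt_top hfin

/-- The dilation h ↦ ρ h reduces every radius to ρ = 1; the Jacobian ρⁿ and the homogeneity ρ^(-α)
give the exponent n - α. -/
theorem exists_lintegral_norm_rpow_tail_le {α : ℝ} (hα : (n : ℝ) < α) :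
    ∃ C : ℝ≥0, ∀ ρ : ℝ, 0 < ρ →
      ∫⁻ h : Rn n in {h | ρ ≤ ‖h‖}, ENNReal.ofReal (‖h‖ ^ (-α))
        ≤ C * ENNReal.ofReal (ρ ^ ((n : ℝ) - α)) := by
  have hfin := lintegral_norm_rpow_tail_one_lt_top hα
  refine ⟨(∫⁻ h : Rn n in {h | 1 ≤ ‖h‖}, ENNReal.ofReal (‖h‖ ^ (-α))).toNNReal, fun ρ hρ => ?_⟩
  rw [ENNReal.coe_toNNReal hfin.ne]
  have hms : ∀ r : ℝ, MeasurableSet {h : Rn n | r ≤ ‖h‖} := fun r =>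
    (isClosed_le continuous_const continuous_norm).measurableSet
  have hmap := Measure.map_addHaar_smul (volume : Measure (Rn n)) hρ.ne'
  set F : Rn n → ℝ≥0∞ := {h : Rn n | ρ ≤ ‖h‖}.indicator (fun h => ENNReal.ofReal (‖h‖ ^ (-α)))
    with hF
  have hFm : Measurable F := Measurable.indicator (by fun_prop) (hms ρ)
  have e1 : ∫⁻ h, F (ρ • h) = ENNReal.ofReal (|(ρ ^ n)⁻¹|) * ∫⁻ h, F h := by
    rw [← lintegral_map (μ := volume) (g := fun h : Rn n => ρ • h) hFm (by fun_prop), hmap]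
    simp
  have e2 : ∀ h, F (ρ • h) = ENNReal.ofReal (ρ ^ (-α)) *
      {h : Rn n | 1 ≤ ‖h‖}.indicator (fun h => ENNReal.ofReal (‖h‖ ^ (-α))) h := by
    intro h
    have hiff : ρ ≤ ‖ρ • h‖ ↔ 1 ≤ ‖h‖ := by
      rw [norm_smul, Real.norm_of_nonneg hρ.le]
      exact le_mul_iff_one_le_right hρ
    by_cases hh : 1 ≤ ‖h‖
    · rw [hF, Set.indicator_of_mem (by exact hiff.2 hh), Set.indicator_of_mem (by exact hh),
        ← ENNReal.ofReal_mul (by positivity), norm_smul, Real.norm_of_nonneg hρ.le,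
        Real.mul_rpow hρ.le (norm_nonneg _)]
    · rw [hF, Set.indicator_of_notMem (by exact fun h' => hh (hiff.1 h')),
        Set.indicator_of_notMem (by exact hh), mul_zero]
  simp_rw [e2] at e1
  rw [lintegral_const_mul _ (Measurable.indicator (by fun_prop) (hms 1)),
    lintegral_indicator (hms 1), hF, lintegral_indicator (hms ρ)] at e1
  have hpos : 0 < ρ ^ n := by positivity
  rw [abs_of_pos (inv_pos.2 hpos)] at e1
  have e3 : ENNReal.ofReal (ρ ^ n) * (ENNReal.ofReal ((ρ ^ n)⁻¹) *
      ∫⁻ h : Rn n in {h | ρ ≤ ‖h‖}, ENNReal.ofReal (‖h‖ ^ (-α)))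
      = ∫⁻ h : Rn n in {h | ρ ≤ ‖h‖}, ENNReal.ofReal (‖h‖ ^ (-α)) := by
    rw [← mul_assoc, ← ENNReal.ofReal_mul hpos.le, mul_inv_cancel₀ hpos.ne']
    simp
  rw [← e3, ← e1, ← mul_assoc, ← ENNReal.ofReal_mul hpos.le, mul_comm]
  gcongr
  rw [sub_eq_add_neg, Real.rpow_add hρ, Real.rpow_natCast]

theorem lintegral_norm_rpow_ball_lt_top (hn : 1 ≤ n) {α : ℝ} (hα : α < n) (R : ℝ) :
    ∫⁻ h : Rn n in Metric.ball 0 R, ENNReal.ofReal (‖h‖ ^ (-α)) < ⊤ := by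
  have := integrableOn_ball_of_norm_le_rpow (μ := (volume : Measure (Rn n))) (by simpa using hn)
    (f := fun h : Rn n => ‖h‖ ^ (-α)) (C := 1) (α := α) (r := R) (by simpa using hα)
    (by
      refine Eventually.of_forall fun x => ?_
      rw [Real.norm_of_nonneg (by positivity), one_mul])
    (by apply Measurable.aestronglyMeasurable; fun_prop)
  exact this.lintegral_lt_top

/-- The Gagliardo energy density at a point of a ball, for functions with linear modulus and
growth of order `s / 2`. -/
theorem exists_lintegral_sq_sub_le (hn : 1 ≤ n) {s : ℝ} (hs₀ : 0 < s) (hs₁ : s < 1) {R : ℝ}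
    (hR : 0 ≤ R) : ∃ C : ℝ≥0, ∀ (g : Rn n → ℝ) (M : ℝ), 0 ≤ M →
      (∀ x y, |g x - g y| ≤ M * ‖x - y‖) → (∀ x, |g x| ≤ M * (1 + ‖x‖ ^ (s / 2))) →
      ∀ x, ‖x‖ ≤ R →
      ∫⁻ y, ENNReal.ofReal ((g x - g y) ^ 2 / ‖x - y‖ ^ ((n : ℝ) + 2 * s))
        ≤ C * ENNReal.ofReal (M ^ 2) := by
  have hnear := lintegral_norm_rpow_ball_lt_top (n := n) hn
    (α := (n : ℝ) + 2 * s - 2) (by linarith) 1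
  have hfar := lintegral_norm_rpow_tail_one_lt_top (n := n) (α := (n : ℝ) + s) (by linarith)
  set I₁ := ∫⁻ h : Rn n in Metric.ball 0 1, ENNReal.ofReal (‖h‖ ^ (-((n : ℝ) + 2 * s - 2)))
  set I₂ := ∫⁻ h : Rn n in {h | 1 ≤ ‖h‖}, ENNReal.ofReal (‖h‖ ^ (-((n : ℝ) + s)))
  have hfin : I₁ + ENNReal.ofReal (16 * (R + 1) ^ 2) * I₂ < ⊤ :=
    ENNReal.add_lt_top.2 ⟨hnear, ENNReal.mul_lt_top ENNReal.ofReal_lt_top hfar⟩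
  refine ⟨(I₁ + ENNReal.ofReal (16 * (R + 1) ^ 2) * I₂).toNNReal, fun g M hM hL hg x hx => ?_⟩
  rw [ENNReal.coe_toNNReal hfin.ne]
  have hms : MeasurableSet {h : Rn n | 1 ≤ ‖h‖} :=
    (isClosed_le continuous_const continuous_norm).measurableSet
  set k₁ : Rn n → ℝ≥0∞ := (Metric.ball 0 1).indicator
    (fun h => ENNReal.ofReal (‖h‖ ^ (-((n : ℝ) + 2 * s - 2))))
  set k₂ : Rn n → ℝ≥0∞ := {h : Rn n | 1 ≤ ‖h‖}.indicator
    (fun h => ENNReal.ofReal (‖h‖ ^ (-((n : ℝ) + s))))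
  have hk₁ : Measurable k₁ := Measurable.indicator (by fun_prop) measurableSet_ball
  have hk₂ : Measurable k₂ := Measurable.indicator (by fun_prop) hms
  have hpt : ∀ y, ENNReal.ofReal ((g x - g y) ^ 2 / ‖x - y‖ ^ ((n : ℝ) + 2 * s))
      ≤ (k₁ (x - y) + ENNReal.ofReal (16 * (R + 1) ^ 2) * k₂ (x - y)) * ENNReal.ofReal (M ^ 2) := by
    intro y
    by_cases hxy : x = y
    · subst hxy; simp
    have hr : 0 < ‖x - y‖ := norm_pos_iff.2 (sub_ne_zero.2 hxy)
    set r := ‖x - y‖ with hrdef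
    -- Near x the Lipschitz bound lowers the kernel exponent to n + 2s - 2 < n, which is integrable
    -- at the origin because s < 1. Far from x the squared growth of order s/2 leaves the exponent n
    -- + s > n, which is integrable at infinity because s > 0.
    by_cases h1 : r < 1
    · have hk : k₁ (x - y) = ENNReal.ofReal (r ^ (-((n : ℝ) + 2 * s - 2))) :=
        Set.indicator_of_mem (by simpa [← hrdef] using h1) _
      calc ENNReal.ofReal ((g x - g y) ^ 2 / r ^ ((n : ℝ) + 2 * s))
          ≤ ENNReal.ofReal (r ^ (-((n : ℝ) + 2 * s - 2)) * M ^ 2) := by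
            refine ENNReal.ofReal_le_ofReal ?_
            have h2 : (g x - g y) ^ 2 ≤ (M * r) ^ 2 := by
              rw [← sq_abs]; exact pow_le_pow_left₀ (abs_nonneg _) (hL x y) 2
            rw [div_le_iff₀ (by positivity)]
            calc (g x - g y) ^ 2 ≤ (M * r) ^ 2 := h2
              _ = r ^ (-((n : ℝ) + 2 * s - 2)) * r ^ ((n : ℝ) + 2 * s) * M ^ 2 := by
                rw [← Real.rpow_add hr]
                rw [show (-((n : ℝ) + 2 * s - 2) + ((n : ℝ) + 2 * s)) = (2 : ℕ) by push_cast; ring,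
                  Real.rpow_natCast]
                ring
              _ = _ := by ring
        _ = k₁ (x - y) * ENNReal.ofReal (M ^ 2) := by
            rw [hk, ENNReal.ofReal_mul (by positivity)]
        _ ≤ _ := by gcongr; exact le_self_add
    · have h1' : 1 ≤ r := not_lt.1 h1
      have hk : k₂ (x - y) = ENNReal.ofReal (r ^ (-((n : ℝ) + s))) :=
        Set.indicator_of_mem (by simpa [← hrdef] using h1') _
      -- Since r ≥ 1 and ‖x‖ ≤ R, both x and y have norm at most (R + 1) r. Each value of g is then
      -- at most 2 (R + 1) M r^(s/2), and the square of the sum of the two bounds produces 16 (R +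
      -- 1)².
      have hb : ∀ z : Rn n, ‖z‖ ≤ (R + 1) * r →
          |g z| ≤ M * (2 * (R + 1) * r ^ (s / 2)) := by
        intro z hz
        refine (hg z).trans (mul_le_mul_of_nonneg_left ?_ hM)
        have e1 : ‖z‖ ^ (s / 2) ≤ (R + 1) * r ^ (s / 2) := by
          calc ‖z‖ ^ (s / 2) ≤ ((R + 1) * r) ^ (s / 2) :=
                Real.rpow_le_rpow (norm_nonneg _) hz (by linarith)
            _ = (R + 1) ^ (s / 2) * r ^ (s / 2) := Real.mul_rpow (by linarith) hr.le
            _ ≤ (R + 1) ^ (1 : ℝ) * r ^ (s / 2) := by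
                gcongr
                · linarith
                · linarith
            _ = _ := by rw [Real.rpow_one]
        have e2 : 1 ≤ r ^ (s / 2) := Real.one_le_rpow h1' (by linarith)
        nlinarith
      have hyn : ‖y‖ ≤ (R + 1) * r := by
        calc ‖y‖ = ‖x - (x - y)‖ := by congr 1; abel
          _ ≤ ‖x‖ + r := norm_sub_le _ _
          _ ≤ _ := by nlinarith
      have hxn : ‖x‖ ≤ (R + 1) * r := by nlinarith
      have h2 : |g x - g y| ≤ M * (4 * (R + 1) * r ^ (s / 2)) := by
        calc |g x - g y| ≤ |g x| + |g y| := abs_sub _ _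
          _ ≤ _ := by linarith [hb x hxn, hb y hyn]
      calc ENNReal.ofReal ((g x - g y) ^ 2 / r ^ ((n : ℝ) + 2 * s))
          ≤ ENNReal.ofReal ((16 * (R + 1) ^ 2) * r ^ (-((n : ℝ) + s)) * M ^ 2) := by
            refine ENNReal.ofReal_le_ofReal ?_
            have h3 : (g x - g y) ^ 2 ≤ (M * (4 * (R + 1) * r ^ (s / 2))) ^ 2 := by
              rw [← sq_abs]; exact pow_le_pow_left₀ (abs_nonneg _) h2 2
            rw [div_le_iff₀ (by positivity)]
            calc (g x - g y) ^ 2 ≤ (M * (4 * (R + 1) * r ^ (s / 2))) ^ 2 := h3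
              _ = 16 * (R + 1) ^ 2 * (r ^ (s / 2) * r ^ (s / 2)) * M ^ 2 := by ring
              _ = 16 * (R + 1) ^ 2 * (r ^ (-((n : ℝ) + s)) * r ^ ((n : ℝ) + 2 * s)) * M ^ 2 := by
                rw [← Real.rpow_add hr, ← Real.rpow_add hr]
                congr 3
                ring
              _ = _ := by ring
        _ = ENNReal.ofReal (16 * (R + 1) ^ 2) * k₂ (x - y) * ENNReal.ofReal (M ^ 2) := by
            rw [hk, ENNReal.ofReal_mul (by positivity), ENNReal.ofReal_mul (by positivity)]
        _ ≤ _ := by gcongr; exact le_add_self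
  calc ∫⁻ y, ENNReal.ofReal ((g x - g y) ^ 2 / ‖x - y‖ ^ ((n : ℝ) + 2 * s))
      ≤ ∫⁻ y, (k₁ (x - y) + ENNReal.ofReal (16 * (R + 1) ^ 2) * k₂ (x - y))
          * ENNReal.ofReal (M ^ 2) := lintegral_mono hpt
    _ = ∫⁻ h, (k₁ h + ENNReal.ofReal (16 * (R + 1) ^ 2) * k₂ h) * ENNReal.ofReal (M ^ 2) :=
        lintegral_sub_left_eq_self (fun h => (k₁ h + ENNReal.ofReal (16 * (R + 1) ^ 2) * k₂ h)
          * ENNReal.ofReal (M ^ 2)) x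
    _ = _ := by
        rw [lintegral_mul_const _ (by fun_prop), lintegral_add_left hk₁,
          lintegral_const_mul _ hk₂, lintegral_indicator measurableSet_ball,
          lintegral_indicator hms]

/-! ### Lipschitz functions and their gradients -/

/-- Lipschitz functions with compact support in `U`. -/
structure LipTest (U : Set (Rn n)) (ζ : Rn n → ℝ) : Prop where
  lip : ∃ K : ℝ≥0, LipschitzWith K ζ
  compact : HasCompactSupport ζ
  supp : tsupport ζ ⊆ U

theorem inner_gradient (g : Rn n → ℝ) (x v : Rn n) : inner ℝ (gradient g x) v = fderiv ℝ g x v := by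
  simp [gradient]

theorem norm_gradient (g : Rn n → ℝ) (x : Rn n) : ‖gradient g x‖ = ‖fderiv ℝ g x‖ := by
  simp [gradient]

theorem measurable_gradient (g : Rn n → ℝ) : Measurable (gradient g) :=
  (InnerProductSpace.toDual ℝ (Rn n)).symm.continuous.measurable.comp (measurable_fderiv ℝ g)

theorem norm_gradient_le {g : Rn n → ℝ} {K : ℝ≥0} (hg : LipschitzWith K g) (x : Rn n) :
    ‖gradient g x‖ ≤ K := by
  rw [norm_gradient]
  exact norm_fderiv_le_of_lipschitz ℝ hg

theorem gradient_add {f g : Rn n → ℝ} {x : Rn n} (hf : DifferentiableAt ℝ f x)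
    (hg : DifferentiableAt ℝ g x) :
    gradient (fun y => f y + g y) x = gradient f x + gradient g x := by
  refine ext_inner_right ℝ fun v => ?_
  rw [inner_add_left, inner_gradient, inner_gradient, inner_gradient, fderiv_fun_add hf hg]
  rfl

theorem gradient_sub {f g : Rn n → ℝ} {x : Rn n} (hf : DifferentiableAt ℝ f x)
    (hg : DifferentiableAt ℝ g x) :
    gradient (fun y => f y - g y) x = gradient f x - gradient g x := by
  refine ext_inner_right ℝ fun v => ?_
  rw [inner_sub_left, inner_gradient, inner_gradient, inner_gradient, fderiv_fun_sub hf hg]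
  rfl

theorem gradient_mul {f g : Rn n → ℝ} {x : Rn n} (hf : DifferentiableAt ℝ f x)
    (hg : DifferentiableAt ℝ g x) :
    gradient (fun y => f y * g y) x = f x • gradient g x + g x • gradient f x := by
  refine ext_inner_right ℝ fun v => ?_
  rw [inner_add_left, real_inner_smul_left, real_inner_smul_left, inner_gradient, inner_gradient,
    inner_gradient, fderiv_fun_mul hf hg]
  simp

theorem gradient_comp {T : ℝ → ℝ} {h : Rn n → ℝ} {x : Rn n} {T' : ℝ}
    (hT : HasDerivAt T T' (h x)) (hh : DifferentiableAt ℝ h x) :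
    gradient (fun y => T (h y)) x = T' • gradient h x := by
  refine ext_inner_right ℝ fun v => ?_
  have := (hT.comp_hasFDerivAt x hh.hasFDerivAt).fderiv
  rw [real_inner_smul_left, inner_gradient, inner_gradient]
  change fderiv ℝ (T ∘ h) x v = _
  rw [this]
  simp

theorem gradient_eq_zero_of_notMem_tsupport {ζ : Rn n → ℝ} {x : Rn n} (hx : x ∉ tsupport ζ) :
    gradient ζ x = 0 := by
  have : ζ =ᶠ[𝓝 x] fun _ => 0 := notMem_tsupport_iff_eventuallyEq.1 hx
  rw [gradient, this.fderiv_eq]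
  simp

theorem LipTest.gradient_eq_zero {U : Set (Rn n)} {ζ : Rn n → ℝ} (h : LipTest U ζ) {x : Rn n}
    (hx : x ∉ U) : gradient ζ x = 0 :=
  gradient_eq_zero_of_notMem_tsupport fun h' => hx (h.supp h')

theorem LipTest.eq_zero {U : Set (Rn n)} {ζ : Rn n → ℝ} (h : LipTest U ζ) {x : Rn n}
    (hx : x ∉ U) : ζ x = 0 :=
  image_eq_zero_of_notMem_tsupport fun h' => hx (h.supp h')

theorem IsTestFunction.lipTest {U : Set (Rn n)} {φ : Rn n → ℝ} (h : IsTestFunction U φ) :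
    LipTest U φ where
  lip := by
    obtain ⟨K, hK⟩ := ContDiff.lipschitzWith_of_hasCompactSupport h.compact h.smooth (by simp)
    exact ⟨K, hK⟩
  compact := h.compact
  supp := h.supp

theorem LipTest.ae_differentiableAt {U : Set (Rn n)} {ζ : Rn n → ℝ} (h : LipTest U ζ) :
    ∀ᵐ x, DifferentiableAt ℝ ζ x := by
  obtain ⟨K, hK⟩ := h.lip
  exact hK.ae_differentiableAt

theorem LipTest.continuous {U : Set (Rn n)} {ζ : Rn n → ℝ} (h : LipTest U ζ) : Continuous ζ := by
  obtain ⟨K, hK⟩ := h.lip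
  exact hK.continuous

theorem LipTest.exists_bound {U : Set (Rn n)} {ζ : Rn n → ℝ} (h : LipTest U ζ) :
    ∃ B : ℝ, 0 ≤ B ∧ ∀ x, |ζ x| ≤ B := by
  obtain ⟨B, hB⟩ := h.compact.exists_bound_of_continuous h.continuous
  exact ⟨B, (norm_nonneg _).trans (hB 0), hB⟩

/-- The Lipschitz functions with compact support in `U`, as a subspace of all functions. -/
def lipTest (U : Set (Rn n)) : Submodule ℝ (Rn n → ℝ) where
  carrier := {ζ | LipTest U ζ}
  add_mem' := by
    rintro f g ⟨⟨K, hK⟩, hfc, hfs⟩ ⟨⟨L, hL⟩, hgc, hgs⟩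
    exact ⟨⟨K + L, hK.add hL⟩, hfc.add hgc,
      (tsupport_add f g).trans (Set.union_subset hfs hgs)⟩
  zero_mem' := ⟨⟨0, LipschitzWith.const 0⟩, HasCompactSupport.zero, by
    rw [show tsupport (0 : Rn n → ℝ) = ∅ by simp]; exact Set.empty_subset _⟩
  smul_mem' := by
    rintro c f ⟨⟨K, hK⟩, hfc, hfs⟩
    refine ⟨⟨‖c‖₊ * K, ?_⟩, hfc.smul_left (f := fun _ => c), ?_⟩
    · refine LipschitzWith.of_dist_le_mul fun x y => ?_
      have := hK.dist_le_mul x y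
      simp only [Pi.smul_apply, smul_eq_mul, NNReal.coe_mul, coe_nnnorm]
      rw [Real.dist_eq, ← mul_sub, abs_mul, ← Real.dist_eq, mul_assoc, Real.norm_eq_abs]
      gcongr
    · exact (tsupport_smul_subset_right (fun _ => c) f).trans hfs

/-- The factor g may be unbounded, but only its values on the compact support of ζ matter. The
Lipschitz estimate is made when the first point lies in that support, the other cases being
symmetric or trivial. The product of a test function with u₀ or φ is the intended use. -/
theorem LipTest.mul_lipschitz {U : Set (Rn n)} {ζ g : Rn n → ℝ} (h : LipTest U ζ) {L : ℝ≥0}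
    (hg : LipschitzWith L g) : LipTest U (fun x => ζ x * g x) := by
  obtain ⟨K, hK⟩ := h.lip
  obtain ⟨B, hB0, hB⟩ := h.exists_bound
  obtain ⟨G, hG⟩ := h.compact.isCompact.exists_bound_of_continuousOn hg.continuous.continuousOn
  have hK' := fun x y => hK.dist_le_mul x y
  have hg' := fun x y => hg.dist_le_mul x y
  simp only [Real.dist_eq] at hK' hg'
  have key : ∀ x y, x ∈ tsupport ζ → |ζ x * g x - ζ y * g y| ≤ (K * |G| + B * L) * dist x y := by
    intro x y hx
    calc |ζ x * g x - ζ y * g y| = |(ζ x - ζ y) * g x + ζ y * (g x - g y)| := by congr 1; ring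
      _ ≤ |ζ x - ζ y| * |g x| + |ζ y| * |g x - g y| := by
          rw [← abs_mul, ← abs_mul]; exact abs_add_le _ _
      _ ≤ (K * dist x y) * |G| + B * (L * dist x y) := by
          exact add_le_add
            (mul_le_mul (hK' x y) ((hG x hx).trans (le_abs_self _)) (abs_nonneg _) (by positivity))
            (mul_le_mul (hB y) (hg' x y) (abs_nonneg _) hB0)
      _ = _ := by ring
  refine ⟨⟨K * ‖G‖₊ + ‖B‖₊ * L, LipschitzWith.of_dist_le_mul fun x y => ?_⟩, h.compact.mul_right,
    (tsupport_mul_subset_left (f := ζ) (g := g)).trans h.supp⟩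
  rw [Real.dist_eq]
  have e : ((K * ‖G‖₊ + ‖B‖₊ * L : ℝ≥0) : ℝ) = K * |G| + B * L := by
    push_cast
    rw [Real.norm_eq_abs, Real.norm_of_nonneg hB0]
  rw [e]
  by_cases hx : x ∈ tsupport ζ
  · exact key x y hx
  by_cases hy : y ∈ tsupport ζ
  · rw [abs_sub_comm, dist_comm]; exact key y x hy
  · rw [image_eq_zero_of_notMem_tsupport hx, image_eq_zero_of_notMem_tsupport hy]
    simp only [zero_mul, sub_zero, abs_zero]
    positivity

theorem LipTest.mul {U : Set (Rn n)} {ζ g : Rn n → ℝ} (h : LipTest U ζ) (hg : LipTest U g) :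
    LipTest U (fun x => ζ x * g x) := by
  obtain ⟨L, hL⟩ := hg.lip
  exact h.mul_lipschitz hL

theorem LipTest.memLp {U : Set (Rn n)} {ζ : Rn n → ℝ} (h : LipTest U ζ) (p : ℝ≥0∞) :
    MemLp ζ p volume :=
  h.continuous.memLp_of_hasCompactSupport h.compact

theorem LipTest.memLp_gradient {U : Set (Rn n)} {ζ : Rn n → ℝ} (h : LipTest U ζ) (p : ℝ≥0∞) :
    MemLp (gradient ζ) p volume := by
  obtain ⟨K, hK⟩ := h.lip
  have hc := h.compact.isCompact
  have hfin : IsFiniteMeasure (volume.restrict (tsupport ζ)) :=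
    ⟨by simpa using hc.measure_lt_top⟩
  have h1 : MemLp (gradient ζ) p (volume.restrict (tsupport ζ)) :=
    MemLp.of_bound (measurable_gradient ζ).aestronglyMeasurable K
      (Eventually.of_forall fun x => norm_gradient_le hK x)
  have h2 := (memLp_indicator_iff_restrict hc.measurableSet).2 h1
  refine h2.congr_norm (measurable_gradient ζ).aestronglyMeasurable
    (Eventually.of_forall fun x => ?_)
  by_cases hx : x ∈ tsupport ζ
  · simp [hx]
  · simp [hx, gradient_eq_zero_of_notMem_tsupport hx]

theorem locallyIntegrable_gradient {g : Rn n → ℝ} {K : ℝ≥0}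
    (hg : LipschitzWith K g) : LocallyIntegrable (gradient g) volume := by
  intro x
  refine ⟨Metric.ball x 1, Metric.ball_mem_nhds x one_pos, ?_⟩
  exact Measure.integrableOn_of_bounded (M := K) measure_ball_lt_top.ne
    (measurable_gradient g).aestronglyMeasurable
    (Eventually.of_forall fun x => norm_gradient_le hg x)

/-- Integration by parts for a Lipschitz function against a compactly supported one. -/
theorem integral_smul_gradient_eq_neg {f g : Rn n → ℝ} {K L : ℝ≥0} (hf : LipschitzWith K f)
    (hg : LipschitzWith L g) (hgc : HasCompactSupport g) :
    ∫ x, f x • gradient g x = -∫ x, g x • gradient f x := by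
  have hgt : LipTest Set.univ g := ⟨⟨L, hg⟩, hgc, Set.subset_univ _⟩
  have i1 : Integrable (fun x => f x • gradient g x) := by
    have h1 : LipTest Set.univ (fun x => g x * f x) := hgt.mul_lipschitz hf
    have : IntegrableOn (fun x => f x • gradient g x) (tsupport g) :=
      (memLp_one_iff_integrable.1 (hgt.memLp_gradient 1)).integrableOn.continuousOn_smul
        hf.continuous.continuousOn hgc.isCompact
    refine (integrableOn_iff_integrable_of_support_subset (s := tsupport g) ?_).1 this
    intro x hx
    by_contra h0
    exact hx (by simp [gradient_eq_zero_of_notMem_tsupport h0])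
  have i2 : Integrable (fun x => g x • gradient f x) := by
    have : IntegrableOn (fun x => g x • gradient f x) (tsupport g) :=
      ((locallyIntegrable_gradient hf).integrableOn_isCompact
        hgc.isCompact).continuousOn_smul hg.continuous.continuousOn hgc.isCompact
    refine (integrableOn_iff_integrable_of_support_subset (s := tsupport g) ?_).1 this
    intro x hx
    by_contra h0
    exact hx (by simp [image_eq_zero_of_notMem_tsupport h0])
  refine ext_inner_left ℝ fun v => ?_
  rw [inner_neg_right, ← integral_inner i1, ← integral_inner i2]
  -- The vector identity is checked against each direction v; by Rademacher's theorem the line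
  -- derivatives agree almost everywhere with the gradient.
  have key := LipschitzWith.integral_lineDeriv_mul_eq (μ := (volume : Measure (Rn n))) hf hg hgc v
  have e1 : ∫ x, lineDeriv ℝ f x v * g x = ∫ x, inner ℝ v (g x • gradient f x) := by
    refine integral_congr_ae ?_
    filter_upwards [hf.ae_differentiableAt] with x hx
    rw [hx.lineDeriv_eq_fderiv, inner_smul_right, real_inner_comm, inner_gradient, mul_comm]
  have e2 : ∫ x, lineDeriv ℝ g x (-v) * f x = -∫ x, inner ℝ v (f x • gradient g x) := by
    rw [← integral_neg]
    refine integral_congr_ae ?_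
    filter_upwards [hg.ae_differentiableAt] with x hx
    rw [hx.lineDeriv_eq_fderiv, inner_smul_right, real_inner_comm, inner_gradient, map_neg]
    ring
  rw [e1, e2] at key
  rw [key, neg_neg]

theorem hasWeakGradient_of_lipschitz {g : Rn n → ℝ} {K : ℝ≥0} (hg : LipschitzWith K g)
    (U : Set (Rn n)) : HasWeakGradient U g (gradient g) where
  locInt := hg.continuous.locallyIntegrable.locallyIntegrableOn U
  locInt_grad := (locallyIntegrable_gradient hg).locallyIntegrableOn U
  parts := by
    intro φ hφ
    have hl := hφ.lipTest
    obtain ⟨L, hL⟩ := hl.lip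
    rw [setIntegral_eq_integral_of_forall_compl_eq_zero
        (fun x hx => by rw [hl.gradient_eq_zero hx, smul_zero]),
      setIntegral_eq_integral_of_forall_compl_eq_zero
        (fun x hx => by rw [hl.eq_zero hx, zero_smul])]
    exact integral_smul_gradient_eq_neg hg hL hφ.compact

/-! ### Divergence-free fields tested with Lipschitz functions -/

/-- Differentiation under the integral, dominated by the Lipschitz constant of ζ. The derivative
must fall on ζ and not on the bump, so that mollified gradients stay bounded as the bump shrinks. -/
theorem gradient_normed_convolution (ρ : ContDiffBump (0 : Rn n)) {ζ : Rn n → ℝ} {K : ℝ≥0}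
    (hζ : LipschitzWith K ζ) (x : Rn n) :
    gradient (convolution (ρ.normed volume) ζ (ContinuousLinearMap.lsmul ℝ ℝ) volume) x
      = convolution (ρ.normed volume) (gradient ζ) (ContinuousLinearMap.lsmul ℝ ℝ) volume x := by
  have hρc : HasCompactSupport (ρ.normed (volume : Measure (Rn n))) := ρ.hasCompactSupport_normed
  have hρ : Continuous (ρ.normed (volume : Measure (Rn n))) := ρ.continuous_normed
  have hρi : Integrable (ρ.normed (volume : Measure (Rn n))) := ρ.integrable_normed
  have hsub : Measure.QuasiMeasurePreserving (fun t : Rn n => x - t) volume volume :=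
    quasiMeasurePreserving_sub_left volume x
  have key := hasFDerivAt_integral_of_dominated_loc_of_lip (𝕜 := ℝ) (μ := (volume : Measure (Rn n)))
    (F := fun y t => ρ.normed volume t • ζ (y - t))
    (F' := fun t => ρ.normed volume t • fderiv ℝ ζ (x - t)) (x₀ := x)
    (bound := fun t => ρ.normed volume t * K) (s := Set.univ) univ_mem
    (Eventually.of_forall fun y => by
      have : Continuous fun t => ρ.normed volume t • ζ (y - t) :=
        hρ.smul (hζ.continuous.comp (by fun_prop))
      exact this.aestronglyMeasurable)
    (by
      have : Continuous fun t => ρ.normed volume t • ζ (x - t) :=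
        hρ.smul (hζ.continuous.comp (by fun_prop))
      exact this.integrable_of_hasCompactSupport hρc.smul_right)
    (by
      refine hρ.aestronglyMeasurable.smul ?_
      exact ((measurable_fderiv ℝ ζ).comp
        (measurable_const.sub measurable_id)).aestronglyMeasurable)
    (Eventually.of_forall fun t => by
      refine LipschitzWith.lipschitzOnWith (LipschitzWith.of_dist_le_mul fun y z => ?_)
      have h1 := hζ.dist_le_mul (y - t) (z - t)
      have h0 : 0 ≤ ρ.normed volume t := ρ.nonneg_normed t
      rw [Real.coe_nnabs, abs_of_nonneg (by positivity), Real.dist_eq, smul_eq_mul, smul_eq_mul,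
        ← mul_sub, abs_mul, abs_of_nonneg h0, mul_assoc]
      rw [Real.dist_eq, dist_sub_right] at h1
      gcongr)
    (hρi.mul_const _)
    (by
      filter_upwards [hsub.ae hζ.ae_differentiableAt] with t ht
      have h1 : HasFDerivAt (fun y => ζ (y - t)) (fderiv ℝ ζ (x - t)) x := by
        have := ht.hasFDerivAt.comp x ((hasFDerivAt_id x).sub_const t)
        simpa [Function.comp_def] using this
      exact h1.const_smul (ρ.normed volume t))
  obtain ⟨hint, hder⟩ := key
  have i1 : Integrable (fun t => ρ.normed volume t • gradient ζ (x - t)) := by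
    refine (hρi.mul_const (K : ℝ)).mono' ?_ (Eventually.of_forall fun t => ?_)
    · exact hρ.aestronglyMeasurable.smul
        ((measurable_gradient ζ).comp (measurable_const.sub measurable_id)).aestronglyMeasurable
    · rw [norm_smul, Real.norm_of_nonneg (ρ.nonneg_normed t)]
      exact mul_le_mul_of_nonneg_left (norm_gradient_le hζ _) (ρ.nonneg_normed t)
  refine ext_inner_left ℝ fun v => ?_
  rw [real_inner_comm, inner_gradient]
  change fderiv ℝ (fun y => ∫ t, ρ.normed volume t • ζ (y - t)) x v
    = inner ℝ v (∫ t, ρ.normed volume t • gradient ζ (x - t))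
  rw [hder.fderiv, ContinuousLinearMap.integral_apply hint, ← integral_inner i1]
  refine integral_congr_ae (Eventually.of_forall fun t => ?_)
  simp only [smul_apply, inner_smul_right]
  rw [real_inner_comm, inner_gradient, smul_eq_mul]

theorem norm_normed_convolution_le (ρ : ContDiffBump (0 : Rn n)) {G : Rn n → Rn n} {K : ℝ}
    (hG : ∀ x, ‖G x‖ ≤ K) (x : Rn n) :
    ‖convolution (ρ.normed volume) G (ContinuousLinearMap.lsmul ℝ ℝ) volume x‖ ≤ K := by
  have hρi : Integrable (ρ.normed (volume : Measure (Rn n))) := ρ.integrable_normed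
  change ‖∫ t, ρ.normed volume t • G (x - t)‖ ≤ K
  calc ‖∫ t, ρ.normed volume t • G (x - t)‖ ≤ ∫ t, ρ.normed volume t * K := by
        refine norm_integral_le_of_norm_le (hρi.mul_const K) (Eventually.of_forall fun t => ?_)
        rw [norm_smul, Real.norm_of_nonneg (ρ.nonneg_normed t)]
        exact mul_le_mul_of_nonneg_left (hG _) (ρ.nonneg_normed t)
    _ = K := by rw [integral_mul_const, ρ.integral_normed, one_mul]

theorem isTestFunction_normed_convolution {U : Set (Rn n)} {ζ : Rn n → ℝ} (hζ : LipTest U ζ)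
    {δ : ℝ} (hδ : Metric.cthickening δ (tsupport ζ) ⊆ U) (ρ : ContDiffBump (0 : Rn n))
    (hρ : ρ.rOut ≤ δ) :
    IsTestFunction U (convolution (ρ.normed volume) ζ (ContinuousLinearMap.lsmul ℝ ℝ) volume) where
  smooth := HasCompactSupport.contDiff_convolution_left _ ρ.hasCompactSupport_normed
    ρ.contDiff_normed hζ.continuous.locallyIntegrable
  compact := HasCompactSupport.convolution _ ρ.hasCompactSupport_normed hζ.compact
  supp := by
    refine subset_trans ?_ hδ
    refine closure_minimal ?_ Metric.isClosed_cthickening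
    refine (support_convolution_subset (L := ContinuousLinearMap.lsmul ℝ ℝ) (μ := volume)).trans ?_
    rintro _ ⟨a, ha, b, hb, rfl⟩
    rw [ρ.support_normed_eq] at ha
    refine Metric.mem_cthickening_of_dist_le _ b _ _ (subset_tsupport ζ hb) ?_
    rw [dist_eq_norm]
    simpa using (mem_ball_zero_iff.1 ha).le.trans hρ

/-- Mollifying ζ gives smooth test functions whose gradients are bounded by the Lipschitz constant
and converge almost everywhere; as b is integrable, dominated convergence applies. -/
theorem integral_inner_gradient_eq_zero {U : Set (Rn n)} (hU : IsOpen U) {b : Rn n → Rn n}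
    (hb : IntegrableOn b U) (hdiv : IsDivFree U b) {ζ : Rn n → ℝ} (hζ : LipTest U ζ) :
    ∫ x in U, (inner ℝ (b x) (gradient ζ x) : ℝ) = 0 := by
  obtain ⟨K, hK⟩ := hζ.lip
  obtain ⟨δ, hδ0, hδ⟩ := hζ.compact.isCompact.exists_cthickening_subset_open hU hζ.supp
  -- The outer radius stays below δ, which keeps the supports inside U. The inner radius is half of
  -- it, because almost everywhere convergence of the mollifications requires a bounded ratio of
  -- radii.
  let ρ : ℕ → ContDiffBump (0 : Rn n) := fun k =>
    ⟨δ / (k + 1) / 2, δ / (k + 1), by positivity, by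
      have : 0 < δ / ((k : ℝ) + 1) := by positivity
      linarith⟩
  have hρ0 : Tendsto (fun k => (ρ k).rOut) atTop (𝓝 0) :=
    tendsto_const_div_atTop_nhds_zero_nat δ |>.comp (tendsto_add_atTop_nat 1) |>.congr fun k => by
      simp [ρ]
  have hρδ : ∀ k, (ρ k).rOut ≤ δ := fun k =>
    div_le_self hδ0.le (by linarith [k.cast_nonneg (α := ℝ)])
  have hconv := ContDiffBump.ae_convolution_tendsto_right_of_locallyIntegrable
    (μ := (volume : Measure (Rn n))) (K := 2) hρ0
    (Eventually.of_forall fun k => by simp only [ρ]; linarith) (locallyIntegrable_gradient hK)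
  have hz : ∀ k, ∫ x in U, (inner ℝ (b x) (convolution ((ρ k).normed volume) (gradient ζ)
      (ContinuousLinearMap.lsmul ℝ ℝ) volume x) : ℝ) = 0 := by
    intro k
    rw [← hdiv _ (isTestFunction_normed_convolution hζ hδ (ρ k) (hρδ k))]
    simp_rw [gradient_normed_convolution (ρ k) hK]
  have hlim : Tendsto (fun k => ∫ x in U, (inner ℝ (b x) (convolution ((ρ k).normed volume)
      (gradient ζ) (ContinuousLinearMap.lsmul ℝ ℝ) volume x) : ℝ)) atTop
      (𝓝 (∫ x in U, (inner ℝ (b x) (gradient ζ x) : ℝ))) := by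
    refine tendsto_integral_of_dominated_convergence (fun x => ‖b x‖ * K) (fun k => ?_)
      (hb.norm.mul_const _) (fun k => Eventually.of_forall fun x => ?_) ?_
    · refine hb.aestronglyMeasurable.inner ?_
      have : Continuous (convolution ((ρ k).normed volume) (gradient ζ)
          (ContinuousLinearMap.lsmul ℝ ℝ) volume) :=
        HasCompactSupport.continuous_convolution_left _ (ρ k).hasCompactSupport_normed
          (ρ k).continuous_normed (locallyIntegrable_gradient hK)
      exact this.aestronglyMeasurable
    · exact (norm_inner_le_norm _ _).trans (mul_le_mul_of_nonneg_left
        (norm_normed_convolution_le (ρ k) (fun y => norm_gradient_le hK y) x) (norm_nonneg _))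
    · filter_upwards [ae_restrict_of_ae hconv] with x hx
      exact Tendsto.inner tendsto_const_nhds hx
  simp_rw [hz] at hlim
  exact (tendsto_nhds_unique hlim tendsto_const_nhds)

/-! ### Difference quotients -/

/-- The normalized difference quotient, whose `L²` norm is the Gagliardo seminorm. -/
def diffQuot (s : ℝ) (v : Rn n → ℝ) (p : Rn n × Rn n) : ℝ :=
  (v p.1 - v p.2) * ‖p.1 - p.2‖ ^ (-(((n : ℝ) + 2 * s) / 2))

theorem diffQuot_mul (s : ℝ) (v w : Rn n → ℝ) (p : Rn n × Rn n) :
    diffQuot s v p * diffQuot s w p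
      = (v p.1 - v p.2) * (w p.1 - w p.2) / ‖p.1 - p.2‖ ^ ((n : ℝ) + 2 * s) := by
  by_cases h : p.1 = p.2
  · simp [diffQuot, h]
  · have hr : 0 < ‖p.1 - p.2‖ := norm_pos_iff.2 (sub_ne_zero.2 h)
    rw [diffQuot, diffQuot, div_eq_mul_inv ((v p.1 - v p.2) * _), ← Real.rpow_neg hr.le,
      show -((n : ℝ) + 2 * s)
      = -(((n : ℝ) + 2 * s) / 2) + -(((n : ℝ) + 2 * s) / 2) by ring, Real.rpow_add hr]
    ring

theorem diffQuot_sq (s : ℝ) (v : Rn n → ℝ) (p : Rn n × Rn n) :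
    diffQuot s v p ^ 2 = (v p.1 - v p.2) ^ 2 / ‖p.1 - p.2‖ ^ ((n : ℝ) + 2 * s) := by
  rw [sq, diffQuot_mul, sq]

theorem diffQuot_add (s : ℝ) (v w : Rn n → ℝ) (p : Rn n × Rn n) :
    diffQuot s (fun x => v x + w x) p = diffQuot s v p + diffQuot s w p := by
  simp only [diffQuot]; ring

theorem diffQuot_sub (s : ℝ) (v w : Rn n → ℝ) (p : Rn n × Rn n) :
    diffQuot s (fun x => v x - w x) p = diffQuot s v p - diffQuot s w p := by
  simp only [diffQuot]; ring

theorem diffQuot_swap (s : ℝ) (v : Rn n → ℝ) (p : Rn n × Rn n) :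
    diffQuot s v p.swap = -diffQuot s v p := by
  simp only [diffQuot, Prod.fst_swap, Prod.snd_swap, norm_sub_rev p.2 p.1]; ring

theorem aestronglyMeasurable_diffQuot (s : ℝ) {v : Rn n → ℝ}
    (hv : AEStronglyMeasurable v volume) :
    AEStronglyMeasurable (diffQuot s v) (volume : Measure (Rn n × Rn n)) := by
  have h1 : AEStronglyMeasurable (fun p : Rn n × Rn n => v p.1) volume := hv.comp_fst
  have h2 : AEStronglyMeasurable (fun p : Rn n × Rn n => v p.2) volume := hv.comp_snd
  refine (h1.sub h2).mul ?_
  apply Measurable.aestronglyMeasurable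
  fun_prop

theorem measurable_diffQuot (s : ℝ) {v : Rn n → ℝ} (hv : Measurable v) :
    Measurable (diffQuot s v) := by
  unfold diffQuot; fun_prop

theorem diffQuot_congr_ae {s : ℝ} {v w : Rn n → ℝ} (h : v =ᵐ[volume] w) :
    diffQuot s v =ᵐ[(volume : Measure (Rn n × Rn n))] diffQuot s w := by
  have h1 := (Measure.quasiMeasurePreserving_fst
    (μ := (volume : Measure (Rn n))) (ν := (volume : Measure (Rn n)))).ae h
  have h2 := (Measure.quasiMeasurePreserving_snd
    (μ := (volume : Measure (Rn n))) (ν := (volume : Measure (Rn n)))).ae h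
  filter_upwards [h1, h2] with p hp1 hp2
  simp only [diffQuot, hp1, hp2]

theorem enorm_sq_eq_ofReal (t : ℝ) : ‖t‖ₑ ^ 2 = ENNReal.ofReal (t ^ 2) := by
  rw [← sq_abs, ENNReal.ofReal_pow (abs_nonneg _), ← Real.norm_eq_abs, ofReal_norm]

theorem setLIntegral_diffQuot_prod_univ (s : ℝ) {v : Rn n → ℝ}
    (hv : AEStronglyMeasurable v volume) (E : Set (Rn n)) :
    ∫⁻ p in E ×ˢ Set.univ, ‖diffQuot s v p‖ₑ ^ 2
      = ∫⁻ x in E, ∫⁻ y, ENNReal.ofReal ((v x - v y) ^ 2 / ‖x - y‖ ^ ((n : ℝ) + 2 * s)) := by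
  have hm := (aestronglyMeasurable_diffQuot s hv).enorm.pow_const 2
  rw [Measure.volume_eq_prod, ← Measure.prod_restrict, Measure.restrict_univ,
    lintegral_prod _ (by
      refine AEMeasurable.mono_measure hm ?_
      rw [Measure.volume_eq_prod]
      exact Measure.prod_mono Measure.restrict_le_self le_rfl)]
  simp_rw [enorm_sq_eq_ofReal, diffQuot_sq]

theorem lintegral_diffQuot (s : ℝ) {v : Rn n → ℝ} (hv : AEStronglyMeasurable v volume) :
    ∫⁻ p, ‖diffQuot s v p‖ₑ ^ 2 = gagliardo s v := by
  have := setLIntegral_diffQuot_prod_univ s hv Set.univ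
  rw [Set.univ_prod_univ, Measure.restrict_univ, Measure.restrict_univ] at this
  exact this

theorem lintegral_enorm_sq_lt_top_iff_memLp {α E : Type*} [MeasurableSpace α]
    [NormedAddCommGroup E] {μ : Measure α} {f : α → E} (hf : AEStronglyMeasurable f μ) :
    MemLp f 2 μ ↔ ∫⁻ x, ‖f x‖ₑ ^ 2 ∂μ < ⊤ := by
  have := eLpNorm_lt_top_iff_lintegral_rpow_enorm_lt_top (f := f) (μ := μ) (p := 2)
    two_ne_zero ENNReal.ofNat_ne_top
  simp only [ENNReal.toReal_ofNat, ENNReal.rpow_ofNat] at this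
  rw [← this]
  exact ⟨fun h => h.2, fun h => ⟨hf, h⟩⟩

theorem eLpNorm_two_sq {α E : Type*} [MeasurableSpace α] [NormedAddCommGroup E] {μ : Measure α}
    (f : α → E) : eLpNorm f 2 μ ^ 2 = ∫⁻ x, ‖f x‖ₑ ^ 2 ∂μ := by
  have h := eLpNorm_nnreal_pow_eq_lintegral (μ := μ) (f := f) (p := 2) two_ne_zero
  simpa using h

theorem setLIntegral_diffQuot_univ_prod (s : ℝ) (v : Rn n → ℝ) (E : Set (Rn n)) :
    ∫⁻ p in Set.univ ×ˢ E, ‖diffQuot s v p‖ₑ ^ 2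
      = ∫⁻ p in E ×ˢ Set.univ, ‖diffQuot s v p‖ₑ ^ 2 := by
  have hsw : MeasurePreserving (Prod.swap : Rn n × Rn n → Rn n × Rn n) volume volume :=
    Measure.measurePreserving_swap
  have := hsw.setLIntegral_comp_preimage_emb MeasurableEquiv.prodComm.measurableEmbedding
    (fun p => ‖diffQuot s v p‖ₑ ^ 2) (E ×ˢ Set.univ)
  rw [← this]
  have hpre : (Prod.swap : Rn n × Rn n → Rn n × Rn n) ⁻¹' (E ×ˢ Set.univ) = Set.univ ×ˢ E := by
    ext p; simp
  rw [hpre]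
  simp_rw [diffQuot_swap, enorm_neg]

/-- The pairs with at least one entry in `E`. -/
def cross (E : Set (Rn n)) : Set (Rn n × Rn n) := E ×ˢ Set.univ ∪ Set.univ ×ˢ E

theorem measurableSet_cross {E : Set (Rn n)} (hE : MeasurableSet E) : MeasurableSet (cross E) :=
  (hE.prod MeasurableSet.univ).union (MeasurableSet.univ.prod hE)

theorem setLIntegral_diffQuot_cross_le (s : ℝ) (v : Rn n → ℝ) (E : Set (Rn n)) :
    ∫⁻ p in cross E, ‖diffQuot s v p‖ₑ ^ 2
      ≤ 2 * ∫⁻ p in E ×ˢ Set.univ, ‖diffQuot s v p‖ₑ ^ 2 := by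
  refine (lintegral_union_le _ _ _).trans ?_
  rw [setLIntegral_diffQuot_univ_prod, two_mul]

/-- `g` is Lipschitz and grows at most like `M (1 + |x|^(s/2))`. -/
structure HasGrowth (s M : ℝ) (g : Rn n → ℝ) : Prop where
  nonneg : 0 ≤ M
  lip : ∀ x y, |g x - g y| ≤ M * ‖x - y‖
  bound : ∀ x, |g x| ≤ M * (1 + ‖x‖ ^ (s / 2))

theorem HasGrowth.lipschitz {s M : ℝ} {g : Rn n → ℝ} (h : HasGrowth s M g) :
    LipschitzWith ⟨M, h.nonneg⟩ g :=
  LipschitzWith.of_dist_le_mul fun x y => by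
    rw [Real.dist_eq, dist_eq_norm]; exact h.lip x y

theorem HasGrowth.sub {s M N : ℝ} {f g : Rn n → ℝ} (hf : HasGrowth s M f)
    (hg : HasGrowth s N g) : HasGrowth s (M + N) (fun x => f x - g x) where
  nonneg := add_nonneg hf.nonneg hg.nonneg
  lip x y := by
    calc |f x - g x - (f y - g y)| = |(f x - f y) - (g x - g y)| := by congr 1; ring
      _ ≤ |f x - f y| + |g x - g y| := abs_sub _ _
      _ ≤ _ := by linarith [hf.lip x y, hg.lip x y]
  bound x := by
    calc |f x - g x| ≤ |f x| + |g x| := abs_sub _ _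
      _ ≤ _ := by linarith [hf.bound x, hg.bound x]

theorem LipTest.exists_hasGrowth {U : Set (Rn n)} {ζ : Rn n → ℝ} (h : LipTest U ζ) (s : ℝ) :
    ∃ M, HasGrowth s M ζ := by
  obtain ⟨K, hK⟩ := h.lip
  obtain ⟨B, hB0, hB⟩ := h.exists_bound
  refine ⟨K + B, by positivity, fun x y => ?_, fun x => ?_⟩
  · have := hK.dist_le_mul x y
    rw [Real.dist_eq, dist_eq_norm] at this
    nlinarith [norm_nonneg (x - y)]
  · have h1 : 0 ≤ ‖x‖ ^ (s / 2) := by positivity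
    have h2 : (0 : ℝ) ≤ K := K.2
    calc |ζ x| ≤ B := hB x
      _ ≤ _ := by nlinarith [mul_nonneg h2 h1, mul_nonneg hB0 h1]

/-- The bound is linear in the measure of E and its constant sees only n, s and the size of Ω. This
is how the nonlocal energy of a barrier is charged to the measure of the superlevel set, and it is
the geometric constant that enters C₀. -/
theorem exists_setLIntegral_diffQuot_le (hn : 1 ≤ n) {s : ℝ} (hs₀ : 0 < s) (hs₁ : s < 1)
    {Ω : Set (Rn n)} (hΩ : Bornology.IsBounded Ω) :
    ∃ C : ℝ≥0, ∀ (g : Rn n → ℝ) (M : ℝ), HasGrowth s M g → ∀ E ⊆ Ω, MeasurableSet E →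
      ∫⁻ p in E ×ˢ Set.univ, ‖diffQuot s g p‖ₑ ^ 2 ≤ C * ENNReal.ofReal (M ^ 2) * volume E := by
  obtain ⟨R, hR0, hR⟩ := hΩ.exists_pos_norm_le
  obtain ⟨C, hC⟩ := exists_lintegral_sq_sub_le (n := n) hn hs₀ hs₁ hR0.le
  refine ⟨C, fun g M hg E hE hEm => ?_⟩
  rw [setLIntegral_diffQuot_prod_univ s hg.lipschitz.continuous.aestronglyMeasurable]
  calc _ ≤ ∫⁻ _ in E, C * ENNReal.ofReal (M ^ 2) :=
        setLIntegral_mono' hEm fun x hx => hC g M hg.nonneg hg.lip hg.bound x (hR x (hE hx))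
    _ = _ := by simp

theorem HasGrowth.memLp_diffQuot_cross (hn : 1 ≤ n) {s : ℝ} (hs₀ : 0 < s) (hs₁ : s < 1)
    {Ω : Set (Rn n)} (hΩ : Bornology.IsBounded Ω) (hΩm : MeasurableSet Ω) {g : Rn n → ℝ}
    {M : ℝ} (hg : HasGrowth s M g) :
    MemLp (diffQuot s g) 2 (volume.restrict (cross Ω)) := by
  obtain ⟨C, hC⟩ := exists_setLIntegral_diffQuot_le (n := n) hn hs₀ hs₁ hΩ
  rw [lintegral_enorm_sq_lt_top_iff_memLp
    (measurable_diffQuot s hg.lipschitz.continuous.measurable).aestronglyMeasurable]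
  refine (setLIntegral_diffQuot_cross_le s g Ω).trans_lt ?_
  refine ENNReal.mul_lt_top (by simp) ((hC g M hg Ω le_rfl hΩm).trans_lt ?_)
  exact ENNReal.mul_lt_top (ENNReal.mul_lt_top (by simp) (by simp)) hΩ.measure_lt_top

theorem diffQuot_eq_zero_of_notMem_cross {s : ℝ} {v : Rn n → ℝ} {E : Set (Rn n)}
    (hv : ∀ x ∉ E, v x = 0) {p : Rn n × Rn n} (hp : p ∉ cross E) : diffQuot s v p = 0 := by
  have h1 : p.1 ∉ E := fun h => hp (Or.inl ⟨h, trivial⟩)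
  have h2 : p.2 ∉ E := fun h => hp (Or.inr ⟨trivial, h⟩)
  simp [diffQuot, hv _ h1, hv _ h2]

theorem LipTest.memLp_diffQuot (hn : 1 ≤ n) {s : ℝ} (hs₀ : 0 < s) (hs₁ : s < 1)
    {U : Set (Rn n)} {ζ : Rn n → ℝ} (h : LipTest U ζ) : MemLp (diffQuot s ζ) 2 volume := by
  obtain ⟨M, hM⟩ := h.exists_hasGrowth s
  have h1 := hM.memLp_diffQuot_cross hn hs₀ hs₁ h.compact.isCompact.isBounded
    h.compact.isCompact.measurableSet
  have hms := measurableSet_cross h.compact.isCompact.measurableSet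
  have h2 := (memLp_indicator_iff_restrict hms).2 h1
  refine h2.congr_norm (measurable_diffQuot s h.continuous.measurable).aestronglyMeasurable
    (Eventually.of_forall fun p => ?_)
  by_cases hp : p ∈ cross (tsupport ζ)
  · simp [hp]
  · rw [Set.indicator_of_notMem hp, diffQuot_eq_zero_of_notMem_cross
      (fun x hx => image_eq_zero_of_notMem_tsupport hx) hp]

/-! ### Geometry of Lipschitz interfaces -/

/-- Two disjoint open sets with negligible common complement, the second of which has interior
corkscrew balls, locally uniformly, near the points of that complement. -/
structure IsCorkscrewPair (U₁ U₂ : Set (Rn n)) : Prop where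
  isOpen₁ : IsOpen U₁
  isOpen₂ : IsOpen U₂
  disjoint : Disjoint U₁ U₂
  nonempty₂ : U₂.Nonempty
  null : volume (U₁ ∪ U₂)ᶜ = 0
  corkscrew : ∀ R : ℝ, ∃ c > 0, ∃ t₀ > 0, ∀ p ∈ (U₁ ∪ U₂)ᶜ, ‖p‖ ≤ R → ∀ t, 0 < t → t < t₀ →
    ∃ z, Metric.ball z (c * t) ⊆ U₂ ∩ Metric.ball p (2 * t)

/-- The quantity is the signed height over the graph. The horizontal projection is estimated crudely
by the factor 2, whence 1 + 2K. The bound tells how large a ball above the graph stays above it. -/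
theorem lipschitz_height {ν : Rn n} (hν : ‖ν‖ = 1) {g : Rn n → ℝ} {K : ℝ≥0}
    (hg : LipschitzWith K g) (x y : Rn n) :
    |(inner ℝ ν x - g (x - (inner ℝ ν x : ℝ) • ν)) - (inner ℝ ν y - g (y - (inner ℝ ν y : ℝ) • ν))|
      ≤ (1 + 2 * K) * ‖x - y‖ := by
  have h1 : |(inner ℝ ν (x - y) : ℝ)| ≤ ‖x - y‖ := by
    simpa [hν] using abs_real_inner_le_norm ν (x - y)
  have h2 := hg.dist_le_mul (x - (inner ℝ ν x : ℝ) • ν) (y - (inner ℝ ν y : ℝ) • ν)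
  rw [Real.dist_eq, dist_eq_norm] at h2
  have h3 : ‖(x - (inner ℝ ν x : ℝ) • ν) - (y - (inner ℝ ν y : ℝ) • ν)‖ ≤ 2 * ‖x - y‖ := by
    have e : (x - (inner ℝ ν x : ℝ) • ν) - (y - (inner ℝ ν y : ℝ) • ν)
        = (x - y) - (inner ℝ ν (x - y) : ℝ) • ν := by
      rw [inner_sub_right, sub_smul]; abel
    rw [e]
    calc _ ≤ ‖x - y‖ + ‖(inner ℝ ν (x - y) : ℝ) • ν‖ := norm_sub_le _ _
      _ ≤ _ := by rw [norm_smul, hν, Real.norm_eq_abs]; linarith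
  rw [inner_sub_right] at h1
  calc _ = |(inner ℝ ν x - inner ℝ ν y) - (g (x - (inner ℝ ν x : ℝ) • ν)
          - g (y - (inner ℝ ν y : ℝ) • ν))| := by congr 1; ring
    _ ≤ |(inner ℝ ν x - inner ℝ ν y : ℝ)| + |g (x - (inner ℝ ν x : ℝ) • ν)
          - g (y - (inner ℝ ν y : ℝ) • ν)| := abs_sub _ _
    _ ≤ _ := by
        have : (0 : ℝ) ≤ K := K.2
        nlinarith [norm_nonneg (x - y)]

theorem sub_inner_smul_add_smul {ν : Rn n} (hν : ‖ν‖ = 1) (x : Rn n) (t : ℝ) :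
    (x + t • ν) - (inner ℝ ν (x + t • ν) : ℝ) • ν = x - (inner ℝ ν x : ℝ) • ν := by
  rw [inner_add_right, inner_smul_right, real_inner_self_eq_norm_sq, hν]
  simp only [one_pow, mul_one, add_smul]
  abel

theorem IsLipschitzInterface.isClosed {Γ Ω₁ Ω₂ : Set (Rn n)} (h : IsLipschitzInterface Γ Ω₁ Ω₂) :
    IsClosed Γ := by
  rw [← isOpen_compl_iff, h.compl_eq]
  exact h.isOpen₁.union h.isOpen₂

/-- Vertical translates of a piece of graph are pairwise disjoint. Infinitely many of them, by the
bounded vectors ν/(k + 1), stay in a bounded region, so the piece must have measure zero. -/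
theorem IsLipschitzInterface.volume_eq_zero {Γ Ω₁ Ω₂ : Set (Rn n)}
    (h : IsLipschitzInterface Γ Ω₁ Ω₂) : volume Γ = 0 := by
  refine measure_null_of_locally_null Γ fun p hp => ?_
  obtain ⟨ν, hν, r, hr, g, -, hgr⟩ := h.graph p hp
  refine ⟨Γ ∩ Metric.ball p r, inter_mem_nhdsWithin Γ (Metric.ball_mem_nhds p hr), ?_⟩
  refine Measure.addHaar_eq_zero_of_disjoint_translates (volume : Measure (Rn n))
    (u := fun k : ℕ => (1 / ((k : ℝ) + 1)) • ν) ?_ ?_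
    (h.isClosed.measurableSet.inter measurableSet_ball)
  · refine Metric.isBounded_closedBall (x := (0 : Rn n)) (r := 1) |>.subset ?_
    rintro _ ⟨k, rfl⟩
    rw [mem_closedBall_zero_iff, norm_smul, hν, mul_one, Real.norm_of_nonneg (by positivity)]
    rw [div_le_one (by positivity)]
    linarith [k.cast_nonneg (α := ℝ)]
  · intro j k hjk
    refine Set.disjoint_left.2 ?_
    rintro _ ⟨a, rfl, x, hx, rfl⟩ ⟨b, rfl, y, hy, hxy⟩
    have hx' := ((hgr x hx.2).2.1).1 hx.1
    have hy' := ((hgr y hy.2).2.1).1 hy.1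
    have e : y + (1 / ((k : ℝ) + 1)) • ν = x + (1 / ((j : ℝ) + 1)) • ν := by
      rw [add_comm y, add_comm x]; exact hxy
    have e1 : y - (inner ℝ ν y : ℝ) • ν = x - (inner ℝ ν x : ℝ) • ν := by
      rw [← sub_inner_smul_add_smul hν y (1 / ((k : ℝ) + 1)), e, sub_inner_smul_add_smul hν]
    have e2 : (inner ℝ ν y : ℝ) = inner ℝ ν x := by rw [hx', hy', e1]
    have e3 : y = x := by
      rw [e2] at e1
      exact sub_left_injective e1
    rw [e3, add_right_inj] at e
    have hν0 : ν ≠ 0 := by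
      rintro rfl; simp at hν
    have e4 := smul_left_injective ℝ hν0 e
    simp only [one_div, inv_inj, add_left_inj, Nat.cast_inj] at e4
    exact hjk e4.symm

/-- Moving from an interface point by t in the vertical direction gains height t, and a ball of
radius t/(2 + 2K) about the new point remains above the graph. Compactness of the interface in a
closed ball makes the constants uniform there. -/
theorem IsLipschitzInterface.isCorkscrewPair {Γ Ω₁ Ω₂ : Set (Rn n)}
    (h : IsLipschitzInterface Γ Ω₁ Ω₂) : IsCorkscrewPair Ω₁ Ω₂ where
  isOpen₁ := h.isOpen₁
  isOpen₂ := h.isOpen₂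
  disjoint := h.disjoint
  nonempty₂ := h.connected₂.nonempty
  null := by rw [← h.compl_eq, compl_compl, h.volume_eq_zero]
  corkscrew := by
    intro R
    rw [← h.compl_eq, compl_compl]
    have hcomp : IsCompact (Γ ∩ Metric.closedBall 0 R) :=
      (isCompact_closedBall 0 R).inter_left h.isClosed
    suffices H : ∃ c > 0, ∃ t₀ > 0, ∀ p ∈ Γ ∩ Metric.closedBall 0 R, p ∈ Γ → ∀ t : ℝ, 0 < t →
        t < t₀ → ∃ z, Metric.ball z (c * t) ⊆ Ω₂ ∩ Metric.ball p (2 * t) by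
      obtain ⟨c, hc, t₀, ht₀, H⟩ := H
      exact ⟨c, hc, t₀, ht₀, fun p hp hpR => H p ⟨hp, by simpa using hpR⟩ hp⟩
    refine hcomp.induction_on (p := fun S => ∃ c > 0, ∃ t₀ > 0, ∀ p ∈ S, p ∈ Γ → ∀ t : ℝ, 0 < t →
        t < t₀ → ∃ z, Metric.ball z (c * t) ⊆ Ω₂ ∩ Metric.ball p (2 * t))
      ⟨1, one_pos, 1, one_pos, by simp⟩ ?_ ?_ ?_
    · rintro S T hST ⟨c, hc, t₀, ht₀, H⟩
      exact ⟨c, hc, t₀, ht₀, fun p hp => H p (hST hp)⟩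
    · rintro S T ⟨c, hc, t₀, ht₀, H⟩ ⟨c', hc', t₀', ht₀', H'⟩
      refine ⟨min c c', lt_min hc hc', min t₀ t₀', lt_min ht₀ ht₀', fun p hp hpΓ t ht htt => ?_⟩
      rcases hp with hp | hp
      · obtain ⟨z, hz⟩ := H p hp hpΓ t ht (htt.trans_le (min_le_left _ _))
        exact ⟨z, (Metric.ball_subset_ball (by gcongr; exact min_le_left _ _)).trans hz⟩
      · obtain ⟨z, hz⟩ := H' p hp hpΓ t ht (htt.trans_le (min_le_right _ _))
        exact ⟨z, (Metric.ball_subset_ball (by gcongr; exact min_le_right _ _)).trans hz⟩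
    · intro q hq
      obtain ⟨ν, hν, r, hr, g, ⟨K, hK⟩, hgr⟩ := h.graph q hq.1
      refine ⟨Metric.ball q (r / 2),
        mem_nhdsWithin_of_mem_nhds (Metric.ball_mem_nhds q (by linarith)),
        1 / (2 + 2 * K), by positivity, r / 4, by linarith, fun p hp hpΓ t ht htr => ?_⟩
      have hK0 : (0 : ℝ) ≤ K := K.2
      have hc1 : 1 / (2 + 2 * (K : ℝ)) ≤ 1 := by
        rw [div_le_one (by positivity)]; linarith
      have hpr : p ∈ Metric.ball q r := Metric.ball_subset_ball (by linarith) hp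
      have hp0 := ((hgr p hpr).2.1).1 hpΓ
      -- The height is t at the centre and varies by at most (1 + 2K)/(2 + 2K) · t < t in the ball,
      -- so it stays positive. The restriction t < r/4 keeps the ball in the graph chart.
      refine ⟨p + t • ν, fun x hx => ?_⟩
      rw [Metric.mem_ball, dist_eq_norm] at hx
      have hxp : dist x p < 2 * t := by
        calc dist x p = ‖(x - (p + t • ν)) + t • ν‖ := by rw [dist_eq_norm]; congr 1; abel
          _ ≤ ‖x - (p + t • ν)‖ + ‖t • ν‖ := norm_add_le _ _
          _ < 2 * t := by
            rw [norm_smul, hν, Real.norm_of_nonneg ht.le]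
            nlinarith
      have hxr : x ∈ Metric.ball q r := by
        rw [Metric.mem_ball] at hp ⊢
        calc dist x q ≤ dist x p + dist p q := dist_triangle _ _ _
          _ < r := by linarith
      refine ⟨((hgr x hxr).2.2).2 ?_, hxp⟩
      have hl := lipschitz_height hν hK x (p + t • ν)
      rw [sub_inner_smul_add_smul hν, inner_add_right, inner_smul_right,
        real_inner_self_eq_norm_sq, hν] at hl
      have hlt : (1 + 2 * K) * ‖x - (p + t • ν)‖ < t := by
        calc (1 + 2 * K) * ‖x - (p + t • ν)‖ ≤ (1 + 2 * K) * (1 / (2 + 2 * K) * t) := by gcongr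
          _ = (1 + 2 * K) / (2 + 2 * K) * t := by ring
          _ < 1 * t := by
            gcongr
            rw [div_lt_one (by positivity)]; linarith
          _ = t := one_mul t
      have := (abs_le.1 hl).1
      linarith

theorem IsCorkscrewPair.rescale {U₁ U₂ : Set (Rn n)} (h : IsCorkscrewPair U₁ U₂) {ε : ℝ}
    (hε : 0 < ε) : IsCorkscrewPair (rescale ε U₁) (rescale ε U₂) where
  isOpen₁ := h.isOpen₁.preimage (continuous_const_smul ε)
  isOpen₂ := h.isOpen₂.preimage (continuous_const_smul ε)
  disjoint := h.disjoint.preimage _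
  nonempty₂ := by
    obtain ⟨x, hx⟩ := h.nonempty₂
    refine ⟨ε⁻¹ • x, ?_⟩
    change ε • ε⁻¹ • x ∈ U₂
    rwa [smul_inv_smul₀ hε.ne']
  null := by
    have e : (LocalNonlocal.rescale ε U₁ ∪ LocalNonlocal.rescale ε U₂)ᶜ
        = (fun x : Rn n => ε • x) ⁻¹' (U₁ ∪ U₂)ᶜ := rfl
    rw [e, Measure.addHaar_preimage_smul _ hε.ne', h.null, mul_zero]
  corkscrew := by
    intro R
    obtain ⟨c, hc, t₀, ht₀, H⟩ := h.corkscrew (ε * R)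
    refine ⟨c, hc, t₀ / ε, by positivity, fun p hp hpR t ht htt => ?_⟩
    obtain ⟨z, hz⟩ := H (ε • p) hp (by rw [norm_smul, Real.norm_of_nonneg hε.le]; gcongr) (ε * t)
      (by positivity) (by rwa [lt_div_iff₀ hε, mul_comm] at htt)
    have hd : ∀ x y : Rn n, dist (ε • x) (ε • y) = ε * dist x y := fun x y => by
      rw [dist_smul₀, Real.norm_of_nonneg hε.le]
    refine ⟨ε⁻¹ • z, fun x hx => ?_⟩
    have hx' : ε • x ∈ Metric.ball z (c * (ε * t)) := by
      have h1 := hd x (ε⁻¹ • z)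
      rw [smul_inv_smul₀ hε.ne'] at h1
      rw [Metric.mem_ball] at hx ⊢
      rw [h1]
      nlinarith
    obtain ⟨h2, h3⟩ := hz hx'
    refine ⟨h2, ?_⟩
    rw [Metric.mem_ball, hd] at h3
    rw [Metric.mem_ball]
    nlinarith

/-! ### Coercivity -/

theorem enorm_sq_sub_le (a b c : ℝ) : ‖a - b‖ₑ ^ 2 ≤ 2 * ‖a - c‖ₑ ^ 2 + 2 * ‖b - c‖ₑ ^ 2 := by
  rw [enorm_sq_eq_ofReal, enorm_sq_eq_ofReal, enorm_sq_eq_ofReal,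
    show (2 : ℝ≥0∞) = ENNReal.ofReal 2 by simp, ← ENNReal.ofReal_mul (by norm_num),
    ← ENNReal.ofReal_mul (by norm_num), ← ENNReal.ofReal_add (by positivity) (by positivity)]
  exact ENNReal.ofReal_le_ofReal (by nlinarith [sq_nonneg (a - c + (b - c))])

theorem enorm_diffQuot_sq (s : ℝ) (v : Rn n → ℝ) (x y : Rn n) :
    ‖diffQuot s v (x, y)‖ₑ ^ 2
      = ‖v x - v y‖ₑ ^ 2 * ENNReal.ofReal (‖x - y‖ ^ (-((n : ℝ) + 2 * s))) := by
  rw [enorm_sq_eq_ofReal, enorm_sq_eq_ofReal, diffQuot_sq, ← ENNReal.ofReal_mul (by positivity),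
    Real.rpow_neg (norm_nonneg _), div_eq_mul_inv]

theorem enorm_sub_sq_le_diffQuot {s : ℝ} (hs : 0 < s) (v : Rn n → ℝ) {x y : Rn n} {D : ℝ}
    (hD : ‖x - y‖ ≤ D) :
    ‖v x - v y‖ₑ ^ 2 ≤ ENNReal.ofReal (D ^ ((n : ℝ) + 2 * s)) * ‖diffQuot s v (x, y)‖ₑ ^ 2 := by
  by_cases h : x = y
  · simp [h]
  have hr : 0 < ‖x - y‖ := norm_pos_iff.2 (sub_ne_zero.2 h)
  have hD0 : 0 < D := hr.trans_le hD
  rw [enorm_sq_eq_ofReal, enorm_sq_eq_ofReal, diffQuot_sq, ← ENNReal.ofReal_mul (by positivity)]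
  refine ENNReal.ofReal_le_ofReal ?_
  rw [mul_div_assoc', le_div_iff₀ (by positivity), mul_comm]
  gcongr

theorem lintegral_diffQuot_prod_univ (s : ℝ) {v : Rn n → ℝ} (hv : Measurable v) (E : Set (Rn n)) :
    ∫⁻ p in E ×ˢ Set.univ, ‖diffQuot s v p‖ₑ ^ 2
      = ∫⁻ x in E, ∫⁻ y, ‖diffQuot s v (x, y)‖ₑ ^ 2 := by
  rw [setLIntegral_diffQuot_prod_univ s hv.aestronglyMeasurable]
  simp_rw [enorm_sq_eq_ofReal, diffQuot_sq]

theorem lintegral_diffQuot_univ_prod (s : ℝ) {v : Rn n → ℝ} (hv : Measurable v) (E : Set (Rn n)) :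
    ∫⁻ p in E ×ˢ Set.univ, ‖diffQuot s v p‖ₑ ^ 2
      = ∫⁻ x, ∫⁻ y in E, ‖diffQuot s v (x, y)‖ₑ ^ 2 := by
  rw [← setLIntegral_diffQuot_univ_prod, Measure.volume_eq_prod, ← Measure.prod_restrict,
    Measure.restrict_univ,
    lintegral_prod _ ((measurable_diffQuot s hv).enorm.pow_const 2).aemeasurable]

/-- A Poincaré inequality in two comparisons. A point of U₂ is compared with a ball outside Ω, where
v vanishes; this bounds v on U₂. A point of Ω is then compared with a ball contained in U₂. -/
theorem exists_lintegral_sq_le_diffQuot (hn : 1 ≤ n) {s : ℝ} (hs : 0 < s) {Ω U₂ : Set (Rn n)}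
    (hΩ : Bornology.IsBounded Ω) (hΩm : MeasurableSet Ω) (hU₂ : IsOpen U₂)
    (hne : U₂.Nonempty) :
    ∃ C : ℝ≥0, ∀ v : Rn n → ℝ, Measurable v → (∀ x ∉ Ω, v x = 0) →
      ∫⁻ x, ‖v x‖ₑ ^ 2 ≤ C * ∫⁻ p in U₂ ×ˢ Set.univ, ‖diffQuot s v p‖ₑ ^ 2 := by
  obtain ⟨R, hR0, hR⟩ := hΩ.exists_pos_norm_le
  have : Nontrivial (Rn n) := by
    apply Module.nontrivial_of_finrank_pos (R := ℝ)
    rw [finrank_euclideanSpace_fin]; exact hn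
  -- With ‖z'‖ = R + 2 the unit ball about z' misses Ω, whose points have norm at most R.
  obtain ⟨z', hz'⟩ := exists_norm_eq (Rn n) (show 0 ≤ R + 2 by linarith)
  obtain ⟨z, hz⟩ := hne
  obtain ⟨ρ, hρ, hρU⟩ := Metric.isOpen_iff.1 hU₂ z hz
  set D₁ := ENNReal.ofReal ((2 * R + 3) ^ ((n : ℝ) + 2 * s))
  set D₂ := ENNReal.ofReal ((R + ‖z‖ + ρ) ^ ((n : ℝ) + 2 * s))
  set m₁ := volume (Metric.ball z' 1)
  set m₂ := volume (Metric.ball z ρ)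
  have hm₁ : m₁ ≠ 0 := (Metric.measure_ball_pos _ _ one_pos).ne'
  have hm₂ : m₂ ≠ 0 := (Metric.measure_ball_pos _ _ hρ).ne'
  have hm₁' : m₁ ≠ ⊤ := measure_ball_lt_top.ne
  have hm₂' : m₂ ≠ ⊤ := measure_ball_lt_top.ne
  have hfin : m₂⁻¹ * (2 * D₂ + 2 * volume Ω * (m₁⁻¹ * D₁)) < ⊤ := by
    have := hΩ.measure_lt_top (μ := volume)
    refine ENNReal.mul_lt_top (ENNReal.inv_lt_top.2 (pos_iff_ne_zero.2 hm₂)) ?_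
    refine ENNReal.add_lt_top.2 ⟨ENNReal.mul_lt_top (by simp) ENNReal.ofReal_lt_top, ?_⟩
    exact ENNReal.mul_lt_top (ENNReal.mul_lt_top (by simp) this)
      (ENNReal.mul_lt_top (ENNReal.inv_lt_top.2 (pos_iff_ne_zero.2 hm₁)) ENNReal.ofReal_lt_top)
  refine ⟨(m₂⁻¹ * (2 * D₂ + 2 * volume Ω * (m₁⁻¹ * D₁))).toNNReal, fun v hv hv0 => ?_⟩
  rw [ENNReal.coe_toNNReal hfin.ne]
  set Q := ∫⁻ p in U₂ ×ˢ Set.univ, ‖diffQuot s v p‖ₑ ^ 2 with hQ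
  have hDm : Measurable (fun p : Rn n × Rn n => ‖diffQuot s v p‖ₑ ^ 2) :=
    (measurable_diffQuot s hv).enorm.pow_const 2
  have hvm : Measurable fun x => ‖v x‖ₑ ^ 2 := hv.enorm.pow_const 2
  have step1 : ∫⁻ x in U₂, ‖v x‖ₑ ^ 2 ≤ m₁⁻¹ * D₁ * Q := by
    have h1 : ∀ x, m₁ * ‖v x‖ₑ ^ 2 ≤ D₁ * ∫⁻ y, ‖diffQuot s v (x, y)‖ₑ ^ 2 := by
      intro x
      by_cases hx : x ∈ Ω
      · calc m₁ * ‖v x‖ₑ ^ 2 = ∫⁻ _ in Metric.ball z' 1, ‖v x‖ₑ ^ 2 := by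
              rw [setLIntegral_const, mul_comm]
          _ ≤ ∫⁻ y in Metric.ball z' 1, D₁ * ‖diffQuot s v (x, y)‖ₑ ^ 2 := by
              refine setLIntegral_mono' measurableSet_ball fun y hy => ?_
              rw [Metric.mem_ball, dist_eq_norm] at hy
              have hy1 : ‖z'‖ ≤ ‖y‖ + ‖y - z'‖ := by
                calc ‖z'‖ = ‖y - (y - z')‖ := by congr 1; abel
                  _ ≤ _ := norm_sub_le _ _
              have hy2 : ‖y‖ ≤ ‖z'‖ + ‖y - z'‖ := by
                calc ‖y‖ = ‖z' + (y - z')‖ := by congr 1; abel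
                  _ ≤ _ := norm_add_le _ _
              have hyΩ : y ∉ Ω := fun h => by linarith [hR y h]
              have hD : ‖x - y‖ ≤ 2 * R + 3 := by linarith [norm_sub_le x y, hR x hx]
              have := enorm_sub_sq_le_diffQuot hs v hD
              rwa [hv0 y hyΩ, sub_zero] at this
          _ ≤ ∫⁻ y, D₁ * ‖diffQuot s v (x, y)‖ₑ ^ 2 := setLIntegral_le_lintegral _ _
          _ = _ := lintegral_const_mul _ (hDm.comp measurable_prodMk_left)
      · simp [hv0 x hx]
    have h2 : m₁ * ∫⁻ x in U₂, ‖v x‖ₑ ^ 2 ≤ D₁ * Q := by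
      rw [hQ, lintegral_diffQuot_prod_univ s hv, ← lintegral_const_mul _ hvm,
        ← lintegral_const_mul _ hDm.lintegral_prod_right']
      exact lintegral_mono h1
    calc _ = m₁⁻¹ * (m₁ * ∫⁻ x in U₂, ‖v x‖ₑ ^ 2) := by
          rw [← mul_assoc, ENNReal.inv_mul_cancel hm₁ hm₁', one_mul]
      _ ≤ _ := by rw [mul_assoc]; gcongr
  have h3 : ∀ x ∈ Ω, m₂ * ‖v x‖ₑ ^ 2
      ≤ 2 * D₂ * (∫⁻ y in U₂, ‖diffQuot s v (x, y)‖ₑ ^ 2) + 2 * (m₁⁻¹ * D₁ * Q) := by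
    intro x hx
    calc m₂ * ‖v x‖ₑ ^ 2 = ∫⁻ _ in Metric.ball z ρ, ‖v x‖ₑ ^ 2 := by
          rw [setLIntegral_const, mul_comm]
      _ ≤ ∫⁻ y in Metric.ball z ρ, (2 * D₂ * ‖diffQuot s v (x, y)‖ₑ ^ 2 + 2 * ‖v y‖ₑ ^ 2) := by
          refine setLIntegral_mono' measurableSet_ball fun y hy => ?_
          rw [Metric.mem_ball, dist_eq_norm] at hy
          have hy2 : ‖y‖ ≤ ‖z‖ + ‖y - z‖ := by
            calc ‖y‖ = ‖z + (y - z)‖ := by congr 1; abel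
              _ ≤ _ := norm_add_le _ _
          have hD : ‖x - y‖ ≤ R + ‖z‖ + ρ := by linarith [norm_sub_le x y, hR x hx]
          have h4 := enorm_sub_sq_le_diffQuot hs v hD
          have h5 := enorm_sq_sub_le (v x) 0 (v y)
          simp only [sub_zero, zero_sub, enorm_neg] at h5
          refine h5.trans ?_
          rw [mul_assoc]
          gcongr
      _ ≤ ∫⁻ y in U₂, (2 * D₂ * ‖diffQuot s v (x, y)‖ₑ ^ 2 + 2 * ‖v y‖ₑ ^ 2) :=
          lintegral_mono_set hρU
      _ = 2 * D₂ * (∫⁻ y in U₂, ‖diffQuot s v (x, y)‖ₑ ^ 2) + 2 * ∫⁻ y in U₂, ‖v y‖ₑ ^ 2 := by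
          have hDx : Measurable fun y => ‖diffQuot s v (x, y)‖ₑ ^ 2 :=
            hDm.comp measurable_prodMk_left
          rw [lintegral_add_right _ (hvm.const_mul _), lintegral_const_mul _ hvm,
            lintegral_const_mul _ hDx]
      _ ≤ _ := by gcongr
  have h4 : ∫⁻ x, ‖v x‖ₑ ^ 2 = ∫⁻ x in Ω, ‖v x‖ₑ ^ 2 := by
    rw [← lintegral_indicator hΩm]
    congr 1; ext x
    by_cases hx : x ∈ Ω
    · simp [hx]
    · simp [hx, hv0 x hx]
  have h5 : m₂ * ∫⁻ x, ‖v x‖ₑ ^ 2 ≤ (2 * D₂ + 2 * volume Ω * (m₁⁻¹ * D₁)) * Q := by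
    rw [h4, ← lintegral_const_mul _ hvm]
    calc _ ≤ ∫⁻ x in Ω, (2 * D₂ * (∫⁻ y in U₂, ‖diffQuot s v (x, y)‖ₑ ^ 2)
            + 2 * (m₁⁻¹ * D₁ * Q)) := setLIntegral_mono' hΩm h3
      _ = 2 * D₂ * (∫⁻ x in Ω, ∫⁻ y in U₂, ‖diffQuot s v (x, y)‖ₑ ^ 2)
            + 2 * (m₁⁻¹ * D₁ * Q) * volume Ω := by
          rw [lintegral_add_right _ measurable_const, setLIntegral_const,
            lintegral_const_mul _ hDm.lintegral_prod_right']
      _ ≤ 2 * D₂ * Q + 2 * (m₁⁻¹ * D₁ * Q) * volume Ω := by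
          gcongr
          rw [hQ, lintegral_diffQuot_univ_prod s hv]
          exact setLIntegral_le_lintegral _ _
      _ = _ := by ring
  calc _ = m₂⁻¹ * (m₂ * ∫⁻ x, ‖v x‖ₑ ^ 2) := by
        rw [← mul_assoc, ENNReal.inv_mul_cancel hm₂ hm₂', one_mul]
    _ ≤ _ := by rw [mul_assoc]; gcongr

/-- By Rademacher and Fubini, for almost every x the function is differentiable at almost every
point of the segment. The fundamental theorem of calculus and Cauchy–Schwarz on the unit interval
finish. -/
theorem ae_enorm_sub_sq_le_segment {ζ : Rn n → ℝ} {K : ℝ≥0} (hζ : LipschitzWith K ζ) (h : Rn n) :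
    ∀ᵐ x, ‖ζ x - ζ (x + h)‖ₑ ^ 2
      ≤ ‖h‖ₑ ^ 2 * ∫⁻ t in Set.Ioc (0 : ℝ) 1, ‖gradient ζ (x + t • h)‖ₑ ^ 2 := by
  have hdm : MeasurableSet {p : Rn n × ℝ | DifferentiableAt ℝ ζ (p.1 + p.2 • h)} :=
    (measurableSet_of_differentiableAt ℝ ζ).preimage (by fun_prop)
  have hae : ∀ᵐ x : Rn n, ∀ᵐ t : ℝ, DifferentiableAt ℝ ζ (x + t • h) := by
    refine (Measure.ae_ae_comm (p := fun (x : Rn n) (t : ℝ) => DifferentiableAt ℝ ζ (x + t • h))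
      hdm).2 (Eventually.of_forall fun t => ?_)
    exact (measurePreserving_add_right volume (t • h)).quasiMeasurePreserving.ae
      hζ.ae_differentiableAt
  filter_upwards [hae] with x hx
  have hline : LipschitzWith (K * ‖h‖₊) fun t : ℝ => ζ (x + t • h) :=
    hζ.comp (LipschitzWith.of_dist_le_mul fun t t' => by
      rw [dist_add_left, dist_eq_norm, ← sub_smul, norm_smul, mul_comm, dist_eq_norm]; rfl)
  have hftc := (hline.lipschitzOnWith (s := Set.uIcc 0 1)).absolutelyContinuousOnInterval
    |>.integral_deriv_eq_sub
  have hderiv : ∀ᵐ t : ℝ, deriv (fun t : ℝ => ζ (x + t • h)) t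
      = inner ℝ (gradient ζ (x + t • h)) h := by
    filter_upwards [hx] with t ht
    rw [inner_gradient]
    have h1 : HasDerivAt (fun t : ℝ => x + t • h) h t := by
      simpa using ((hasDerivAt_id t).smul_const h).const_add x
    exact (ht.hasFDerivAt.comp_hasDerivAt t h1).deriv
  rw [intervalIntegral.integral_of_le zero_le_one,
    integral_congr_ae (ae_restrict_of_ae hderiv)] at hftc
  simp only [one_smul, zero_smul, add_zero] at hftc
  have hgm : Measurable fun t : ℝ => gradient ζ (x + t • h) :=
    (measurable_gradient ζ).comp (by fun_prop)
  have h1 : ‖ζ x - ζ (x + h)‖ₑ ≤ ‖h‖ₑ * eLpNorm (fun t : ℝ => gradient ζ (x + t • h)) 2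
      (volume.restrict (Set.Ioc (0 : ℝ) 1)) := by
    have hprob : IsProbabilityMeasure (volume.restrict (Set.Ioc (0 : ℝ) 1)) := ⟨by simp⟩
    rw [← enorm_neg, neg_sub, ← hftc]
    calc _ ≤ ∫⁻ t in Set.Ioc (0 : ℝ) 1, ‖(inner ℝ (gradient ζ (x + t • h)) h : ℝ)‖ₑ :=
          enorm_integral_le_lintegral_enorm _
      _ ≤ ∫⁻ t in Set.Ioc (0 : ℝ) 1, ‖h‖ₑ * ‖gradient ζ (x + t • h)‖ₑ := by
          refine lintegral_mono fun t => ?_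
          rw [mul_comm]
          simp only [enorm_eq_nnnorm]
          exact_mod_cast nnnorm_inner_le_nnnorm (𝕜 := ℝ) (gradient ζ (x + t • h)) h
      _ = ‖h‖ₑ * eLpNorm (fun t : ℝ => gradient ζ (x + t • h)) 1
            (volume.restrict (Set.Ioc (0 : ℝ) 1)) := by
          rw [lintegral_const_mul _ hgm.enorm, eLpNorm_one_eq_lintegral_enorm]
      _ ≤ _ := by
          gcongr
          exact eLpNorm_le_eLpNorm_of_exponent_le (by norm_num) hgm.aestronglyMeasurable
  calc _ ≤ (‖h‖ₑ * eLpNorm (fun t : ℝ => gradient ζ (x + t • h)) 2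
      (volume.restrict (Set.Ioc (0 : ℝ) 1))) ^ 2 := by gcongr
    _ = _ := by rw [mul_pow, eLpNorm_two_sq]

/-- The mean-square oscillation `∫_{z ∈ U, |z - x| < 3 r} |ζ x - ζ z|²`. -/
def oscSq (U : Set (Rn n)) (ζ : Rn n → ℝ) (x : Rn n) (r : ℝ) : ℝ≥0∞ :=
  ∫⁻ z in U, {z | ‖z - x‖ < 3 * r}.indicator (fun z => ‖ζ x - ζ z‖ₑ ^ 2) z

theorem measurable_oscSq {U : Set (Rn n)} {ζ : Rn n → ℝ} (hζ : Measurable ζ) :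
    Measurable fun p : Rn n × Rn n => oscSq U ζ p.2 ‖p.1‖ := by
  have : Measurable fun q : (Rn n × Rn n) × Rn n =>
      {q : (Rn n × Rn n) × Rn n | ‖q.2 - q.1.2‖ < 3 * ‖q.1.1‖}.indicator
        (fun q => ‖ζ q.1.2 - ζ q.2‖ₑ ^ 2) q :=
    Measurable.indicator (by fun_prop) (measurableSet_lt (by fun_prop) (by fun_prop))
  exact this.lintegral_prod_right'

/-- By Fubini the integral in h is done last, for fixed x and z: it runs over ‖h‖ > ‖x - z‖/3 and
yields a multiple of ‖x - z‖^(n - (2n + 2s)), which is exactly the Gagliardo kernel. -/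
theorem exists_lintegral_oscSq_le {s : ℝ} (hs : 0 < s) :
    ∃ C : ℝ≥0, ∀ (U : Set (Rn n)) (ζ : Rn n → ℝ), Measurable ζ →
      ∫⁻ h : Rn n, ∫⁻ x, ENNReal.ofReal (‖h‖ ^ (-(2 * (n : ℝ) + 2 * s))) * oscSq U ζ x ‖h‖
        ≤ C * ∫⁻ p in U ×ˢ Set.univ, ‖diffQuot s ζ p‖ₑ ^ 2 := by
  obtain ⟨C, hC⟩ := exists_lintegral_norm_rpow_tail_le (n := n) (α := 2 * (n : ℝ) + 2 * s)
    (by have : (0 : ℝ) ≤ n := n.cast_nonneg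
        linarith)
  refine ⟨C * ((3 : ℝ) ^ ((n : ℝ) + 2 * s)).toNNReal, fun U ζ hζ => ?_⟩
  set k : Rn n → ℝ≥0∞ := fun h => ENNReal.ofReal (‖h‖ ^ (-(2 * (n : ℝ) + 2 * s))) with hk
  have hkm : Measurable k := by fun_prop
  have hFm : Measurable fun q : (Rn n × Rn n) × Rn n =>
      k q.1.1 * {q : (Rn n × Rn n) × Rn n | ‖q.2 - q.1.2‖ < 3 * ‖q.1.1‖}.indicator
        (fun q => ‖ζ q.1.2 - ζ q.2‖ₑ ^ 2) q :=
    (by fun_prop : Measurable fun q : (Rn n × Rn n) × Rn n => k q.1.1).mul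
      (Measurable.indicator (by fun_prop) (measurableSet_lt (by fun_prop) (by fun_prop)))
  have e1 : ∫⁻ h : Rn n, ∫⁻ x, k h * oscSq U ζ x ‖h‖
      = ∫⁻ x, ∫⁻ z in U, ∫⁻ h : Rn n, k h * {z | ‖z - x‖ < 3 * ‖h‖}.indicator
          (fun z => ‖ζ x - ζ z‖ₑ ^ 2) z := by
    have hm1 : Measurable fun p : Rn n × Rn n => k p.1 * oscSq U ζ p.2 ‖p.1‖ :=
      (hkm.comp measurable_fst).mul (measurable_oscSq hζ)
    rw [lintegral_lintegral_swap hm1.aemeasurable]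
    refine lintegral_congr fun x => ?_
    have hm2 : ∀ h : Rn n, k h * oscSq U ζ x ‖h‖ = ∫⁻ z in U, k h *
        {z | ‖z - x‖ < 3 * ‖h‖}.indicator (fun z => ‖ζ x - ζ z‖ₑ ^ 2) z := by
      intro h
      rw [oscSq, lintegral_const_mul]
      exact Measurable.indicator (by fun_prop) (measurableSet_lt (by fun_prop) (by fun_prop))
    simp_rw [hm2]
    rw [lintegral_lintegral_swap]
    have hm3 : Measurable fun q : Rn n × Rn n => ((q.1, x), q.2) := by fun_prop
    exact (hFm.comp hm3).aemeasurable
  rw [e1, lintegral_diffQuot_univ_prod s hζ,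
    ← lintegral_const_mul _ (((measurable_diffQuot s hζ).enorm.pow_const 2).lintegral_prod_right')]
  refine lintegral_mono fun x => ?_
  have hDx : Measurable fun y => ‖diffQuot s ζ (x, y)‖ₑ ^ 2 :=
    ((measurable_diffQuot s hζ).enorm.pow_const 2).comp measurable_prodMk_left
  rw [← lintegral_const_mul _ hDx]
  refine lintegral_mono fun z => ?_
  by_cases hxz : x = z
  · subst hxz
    have h0 : ∀ h : Rn n, k h * {z | ‖z - x‖ < 3 * ‖h‖}.indicator
        (fun z => ‖ζ x - ζ z‖ₑ ^ 2) x = 0 := fun h => by simp [Set.indicator_apply]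
    simp [h0]
  have hρ : 0 < ‖x - z‖ := norm_pos_iff.2 (sub_ne_zero.2 hxz)
  have hms : MeasurableSet {h : Rn n | ‖x - z‖ / 3 ≤ ‖h‖} :=
    measurableSet_le measurable_const measurable_norm
  calc ∫⁻ h : Rn n, k h * {z | ‖z - x‖ < 3 * ‖h‖}.indicator (fun z => ‖ζ x - ζ z‖ₑ ^ 2) z
      ≤ ∫⁻ h : Rn n, {h : Rn n | ‖x - z‖ / 3 ≤ ‖h‖}.indicator k h * ‖ζ x - ζ z‖ₑ ^ 2 := by
        refine lintegral_mono fun h => ?_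
        by_cases hh : ‖z - x‖ < 3 * ‖h‖
        · have : ‖x - z‖ / 3 ≤ ‖h‖ := by rw [norm_sub_rev]; linarith
          rw [Set.indicator_of_mem (by exact hh), Set.indicator_of_mem (by exact this)]
        · rw [Set.indicator_of_notMem (by exact hh), mul_zero]
          exact zero_le
    _ = (∫⁻ h : Rn n in {h | ‖x - z‖ / 3 ≤ ‖h‖}, k h) * ‖ζ x - ζ z‖ₑ ^ 2 := by
        rw [lintegral_mul_const _ (hkm.indicator hms), lintegral_indicator hms]
    _ ≤ C * ENNReal.ofReal ((‖x - z‖ / 3) ^ ((n : ℝ) - (2 * (n : ℝ) + 2 * s)))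
          * ‖ζ x - ζ z‖ₑ ^ 2 := by
        gcongr
        exact hC _ (by positivity)
    _ = _ := by
        rw [enorm_diffQuot_sq, show (n : ℝ) - (2 * (n : ℝ) + 2 * s) = -((n : ℝ) + 2 * s) by ring,
          div_eq_mul_inv, Real.mul_rpow hρ.le (by norm_num), Real.inv_rpow (by norm_num),
          ← Real.rpow_neg (by norm_num), neg_neg, ENNReal.ofReal_mul (by positivity)]
        push_cast
        simp only [ENNReal.ofReal]
        ring

theorem lintegral_indicator_segment_le {g : Rn n → ℝ≥0∞} (hg : Measurable g) (h : Rn n) :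
    ∫⁻ x, ∫⁻ t in Set.Ioc (0 : ℝ) 1, g (x + t • h) = ∫⁻ x, g x := by
  have hm : Measurable fun q : Rn n × ℝ => g (q.1 + q.2 • h) := hg.comp (by fun_prop)
  rw [lintegral_lintegral_swap hm.aemeasurable]
  simp_rw [lintegral_add_right_eq_self g]
  simp

theorem exists_mem_segment_notMem_union {U₁ U₂ : Set (Rn n)} (h₁ : IsOpen U₁) (h₂ : IsOpen U₂)
    (hd : Disjoint U₁ U₂) {x y : Rn n} (hx : x ∈ U₁) (hs : ¬segment ℝ x y ⊆ U₁) :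
    ∃ p ∈ segment ℝ x y, p ∈ (U₁ ∪ U₂)ᶜ := by
  by_contra! hc
  refine hs ((convex_segment x y).isPreconnected.subset_left_of_subset_union h₁ h₂ hd ?_
    ⟨x, left_mem_segment ℝ x y, hx⟩)
  intro p hp
  by_contra h
  exact hc p hp h

theorem norm_sub_le_of_mem_segment' {x y p : Rn n} (hp : p ∈ segment ℝ x y) :
    ‖p - x‖ ≤ ‖x - y‖ ∧ ‖p - y‖ ≤ ‖x - y‖ := by
  obtain ⟨t, ⟨ht0, ht1⟩, rfl⟩ := (segment_eq_image' ℝ x y) ▸ hp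
  constructor
  · rw [add_sub_cancel_left, norm_smul, Real.norm_of_nonneg ht0, norm_sub_rev]
    exact mul_le_of_le_one_left (norm_nonneg _) ht1
  · have : x + t • (y - x) - y = (1 - t) • (x - y) := by
      rw [sub_smul, one_smul, ← neg_sub x y, smul_neg]; abel
    rw [this, norm_smul, Real.norm_of_nonneg (by linarith)]
    exact mul_le_of_le_one_left (norm_nonneg _) (by linarith)

/-- A third point w is inserted between x and y and averaged over the ball. It lies within 2r of p,
and p within r of both endpoints, hence the radius 3r in `oscSq`. -/
theorem enorm_sub_sq_le_oscSq {U : Set (Rn n)} {ζ : Rn n → ℝ}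
    (hζ : Measurable ζ) {x y p z : Rn n} {r ρ : ℝ} (hpx : ‖p - x‖ ≤ r) (hpy : ‖p - y‖ ≤ r)
    (hz : Metric.ball z ρ ⊆ U ∩ Metric.ball p (2 * r)) :
    volume (Metric.ball z ρ) * ‖ζ x - ζ y‖ₑ ^ 2 ≤ 2 * (oscSq U ζ x r + oscSq U ζ y r) := by
  have hsub : ∀ w q : Rn n, ‖p - q‖ ≤ r → w ∈ Metric.ball z ρ → ‖w - q‖ < 3 * r := by
    intro w q hq hw
    have h1 := (hz hw).2
    rw [Metric.mem_ball, dist_eq_norm] at h1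
    calc ‖w - q‖ = ‖(w - p) + (p - q)‖ := by congr 1; abel
      _ ≤ ‖w - p‖ + ‖p - q‖ := norm_add_le _ _
      _ < 3 * r := by linarith
  have hm : ∀ q : Rn n, Measurable
      ({w | ‖w - q‖ < 3 * r}.indicator (fun w => ‖ζ q - ζ w‖ₑ ^ 2)) := fun q =>
    Measurable.indicator (by fun_prop) (measurableSet_lt (by fun_prop) (by fun_prop))
  calc volume (Metric.ball z ρ) * ‖ζ x - ζ y‖ₑ ^ 2
      = ∫⁻ _ in Metric.ball z ρ, ‖ζ x - ζ y‖ₑ ^ 2 := by rw [setLIntegral_const, mul_comm]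
    _ ≤ ∫⁻ w in Metric.ball z ρ, 2 * ({w | ‖w - x‖ < 3 * r}.indicator
          (fun w => ‖ζ x - ζ w‖ₑ ^ 2) w + {w | ‖w - y‖ < 3 * r}.indicator
          (fun w => ‖ζ y - ζ w‖ₑ ^ 2) w) := by
        refine setLIntegral_mono' measurableSet_ball fun w hw => ?_
        rw [Set.indicator_of_mem (by exact hsub w x hpx hw),
          Set.indicator_of_mem (by exact hsub w y hpy hw), mul_add]
        exact enorm_sq_sub_le _ _ _
    _ ≤ ∫⁻ w in U, 2 * ({w | ‖w - x‖ < 3 * r}.indicator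
          (fun w => ‖ζ x - ζ w‖ₑ ^ 2) w + {w | ‖w - y‖ < 3 * r}.indicator
          (fun w => ‖ζ y - ζ w‖ₑ ^ 2) w) :=
        lintegral_mono_set fun w hw => (hz hw).1
    _ = _ := by
        rw [lintegral_const_mul' _ _ (by simp), lintegral_add_left (hm x)]
        rfl

-- Pairs in U₁ × U₁ are not seen by the nonlocal part of the energy. They are written as (x, x + h)
-- and split in three: long h costs the L² norm (`A₁`), short segments inside U₁ cost the gradient
-- (`A₂`), and short segments leaving U₁ cost difference quotients with an entry in U₂, by way of a
-- corkscrew ball (`A₃`).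
set_option maxHeartbeats 400000 in
theorem exists_setLIntegral_diffQuot_interior_le (hn : 1 ≤ n) {s : ℝ} (hs₀ : 0 < s) (hs₁ : s < 1)
    {U₁ U₂ Ω : Set (Rn n)} (hU : IsCorkscrewPair U₁ U₂) (hΩ : Bornology.IsBounded Ω) :
    ∃ C : ℝ≥0, ∀ ζ : Rn n → ℝ, LipTest Ω ζ →
      ∫⁻ p in U₁ ×ˢ U₁, ‖diffQuot s ζ p‖ₑ ^ 2
        ≤ C * ((∫⁻ x, ‖ζ x‖ₑ ^ 2) + (∫⁻ x in U₁, ‖gradient ζ x‖ₑ ^ 2)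
          + ∫⁻ p in U₂ ×ˢ Set.univ, ‖diffQuot s ζ p‖ₑ ^ 2) := by
  obtain ⟨R, hR0, hR⟩ := hΩ.exists_pos_norm_le
  obtain ⟨c, hc, t₀, ht₀, hcork⟩ := hU.corkscrew (R + 1)
  obtain ⟨C₁, hC₁⟩ := exists_lintegral_norm_rpow_tail_le (n := n) (α := (n : ℝ) + 2 * s)
    (by linarith)
  obtain ⟨C₄, hC₄⟩ := exists_lintegral_oscSq_le (n := n) hs₀
  have hC₂ := lintegral_norm_rpow_ball_lt_top (n := n) hn (α := (n : ℝ) + 2 * s - 2)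
    (by linarith) 1
  set I₂ := ∫⁻ h : Rn n in Metric.ball 0 1, ENNReal.ofReal (‖h‖ ^ (-((n : ℝ) + 2 * s - 2)))
  set R₀ := min 1 t₀ with hR₀
  have hR₀pos : 0 < R₀ := lt_min one_pos ht₀
  set w₀ := volume (Metric.ball (0 : Rn n) 1)
  have hw : w₀ ≠ 0 := (Metric.measure_ball_pos _ _ one_pos).ne'
  have hwt : w₀ ≠ ⊤ := measure_ball_lt_top.ne
  set c₀ := ENNReal.ofReal (c ^ n) * w₀
  have hc₀ : c₀ ≠ 0 := mul_ne_zero (by simpa using pow_pos hc n) hw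
  have hc₀' : c₀ ≠ ⊤ := ENNReal.mul_ne_top ENNReal.ofReal_ne_top hwt
  set K₁ : ℝ≥0∞ := 4 * (C₁ * ENNReal.ofReal (R₀ ^ ((n : ℝ) - ((n : ℝ) + 2 * s))))
  set K₃ : ℝ≥0∞ := c₀⁻¹ * 2
  have hK₃ : K₃ ≠ ⊤ := ENNReal.mul_ne_top (ENNReal.inv_ne_top.2 hc₀) (by simp)
  have hfin : K₁ + I₂ + K₃ * (2 * C₄) < ⊤ := by
    refine ENNReal.add_lt_top.2 ⟨ENNReal.add_lt_top.2 ⟨?_, hC₂⟩, ?_⟩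
    · exact ENNReal.mul_lt_top (by simp) (ENNReal.mul_lt_top (by simp) ENNReal.ofReal_lt_top)
    · exact ENNReal.mul_lt_top hK₃.lt_top (ENNReal.mul_lt_top (by simp) (by simp))
  refine ⟨(K₁ + I₂ + K₃ * (2 * C₄)).toNNReal, fun ζ hζ => ?_⟩
  rw [ENNReal.coe_toNNReal hfin.ne]
  obtain ⟨L, hL⟩ := hζ.lip
  have hζm : Measurable ζ := hζ.continuous.measurable
  have hU₁m := hU.isOpen₁.measurableSet
  set k : Rn n → ℝ≥0∞ := fun h => ENNReal.ofReal (‖h‖ ^ (-((n : ℝ) + 2 * s))) with hk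
  set k₂ : Rn n → ℝ≥0∞ := fun h => ENNReal.ofReal (‖h‖ ^ (-(2 * (n : ℝ) + 2 * s))) with hk₂
  have hkm : Measurable k := by fun_prop
  have hk₂m : Measurable k₂ := by fun_prop
  set g : Rn n → ℝ≥0∞ := U₁.indicator fun x => ‖gradient ζ x‖ₑ ^ 2
  have hgm : Measurable g := ((measurable_gradient ζ).enorm.pow_const 2).indicator hU₁m
  set far : Set (Rn n) := {h | R₀ ≤ ‖h‖}
  have hfar : MeasurableSet far := measurableSet_le measurable_const measurable_norm
  set F : Rn n → Rn n → ℝ≥0∞ := fun x h => (U₁ ×ˢ U₁).indicator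
    (fun p => ‖diffQuot s ζ p‖ₑ ^ 2) (x, x + h) with hF
  have hFm : Measurable fun p : Rn n × Rn n => F p.1 p.2 :=
    (Measurable.indicator ((measurable_diffQuot s hζm).enorm.pow_const 2)
      (hU₁m.prod hU₁m)).comp (by fun_prop)
  set A₁ : Rn n → Rn n → ℝ≥0∞ := fun h x =>
    far.indicator k h * (2 * ‖ζ x‖ₑ ^ 2 + 2 * ‖ζ (x + h)‖ₑ ^ 2)
  set A₂ : Rn n → Rn n → ℝ≥0∞ := fun h x => (Metric.ball 0 R₀).indicator
    (fun h => k h * ‖h‖ₑ ^ 2) h * ∫⁻ t in Set.Ioc (0 : ℝ) 1, g (x + t • h)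
  set A₃ : Rn n → Rn n → ℝ≥0∞ := fun h x => k₂ h * oscSq U₂ ζ x ‖h‖
  have hA₁m : Measurable fun p : Rn n × Rn n => A₁ p.1 p.2 := by
    refine ((hkm.indicator hfar).comp measurable_fst).mul ?_
    fun_prop
  have hA₂m : Measurable fun p : Rn n × Rn n => A₂ p.1 p.2 := by
    refine (((hkm.mul (by fun_prop)).indicator measurableSet_ball).comp measurable_fst).mul ?_
    have : Measurable fun q : (Rn n × Rn n) × ℝ => g (q.1.2 + q.2 • q.1.1) :=
      hgm.comp (by fun_prop)
    exact this.lintegral_prod_right'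
  have hA₃m : Measurable fun p : Rn n × Rn n => A₃ p.1 p.2 :=
    (hk₂m.comp measurable_fst).mul (measurable_oscSq hζm)
  have hFk : ∀ x h, x ∈ U₁ → x + h ∈ U₁ → F x h = ‖ζ x - ζ (x + h)‖ₑ ^ 2 * k h := by
    intro x h hx hh
    rw [hF]
    simp only
    rw [Set.indicator_of_mem (Set.mk_mem_prod hx hh), enorm_diffQuot_sq]
    simp [hk]
  have hpt : ∀ h, ∀ᵐ x, F x h ≤ A₁ h x + A₂ h x + K₃ * (A₃ h x + A₃ h (x + h)) := by
    intro h
    filter_upwards [ae_enorm_sub_sq_le_segment hL h] with x hseg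
    by_cases hx : x ∈ U₁ ∧ x + h ∈ U₁
    swap
    · rw [hF]
      simp only
      rw [Set.indicator_of_notMem (fun h' => hx ⟨h'.1, h'.2⟩)]
      exact zero_le
    rw [hFk x h hx.1 hx.2]
    -- If the difference is nonzero, one endpoint lies in Ω. A crossing point of a segment of length
    -- at most 1 then has norm at most R + 1, so the corkscrew constants chosen for that radius
    -- apply.
    by_cases h0 : ‖ζ x - ζ (x + h)‖ₑ = 0
    · simp [h0]
    by_cases hhR : R₀ ≤ ‖h‖
    · refine le_trans ?_ (le_add_right (le_add_right le_rfl))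
      simp only [A₁]
      rw [Set.indicator_of_mem (by exact hhR), mul_comm]
      gcongr
      simpa using enorm_sq_sub_le (ζ x) (ζ (x + h)) 0
    rw [not_le] at hhR
    by_cases hsub : segment ℝ x (x + h) ⊆ U₁
    · refine le_trans ?_ (le_add_right (le_add_left le_rfl))
      simp only [A₂]
      rw [Set.indicator_of_mem (by simpa using hhR), mul_comm (‖ζ x - ζ (x + h)‖ₑ ^ 2), mul_assoc]
      gcongr
      refine hseg.trans (mul_le_mul' le_rfl ?_)
      refine setLIntegral_mono' measurableSet_Ioc fun t ht => ?_
      have hmem : x + t • h ∈ U₁ := by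
        refine hsub ?_
        rw [segment_eq_image']
        exact ⟨t, ⟨ht.1.le, ht.2⟩, by simp⟩
      simp only [g]
      rw [Set.indicator_of_mem hmem]
    · obtain ⟨p, hp, hpU⟩ := exists_mem_segment_notMem_union hU.isOpen₁ hU.isOpen₂ hU.disjoint
        hx.1 hsub
      obtain ⟨hp1, hp2⟩ := norm_sub_le_of_mem_segment' hp
      have hxh : ‖x - (x + h)‖ = ‖h‖ := by simp
      rw [hxh] at hp1 hp2
      have hpR : ‖p‖ ≤ R + 1 := by
        have hh1 : ‖h‖ ≤ 1 := hhR.le.trans (min_le_left _ _)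
        by_cases hxΩ : x ∈ Ω
        · calc ‖p‖ = ‖x + (p - x)‖ := by congr 1; abel
            _ ≤ ‖x‖ + ‖p - x‖ := norm_add_le _ _
            _ ≤ _ := by linarith [hR x hxΩ]
        · by_cases hyΩ : x + h ∈ Ω
          · calc ‖p‖ = ‖(x + h) + (p - (x + h))‖ := by congr 1; abel
              _ ≤ ‖x + h‖ + ‖p - (x + h)‖ := norm_add_le _ _
              _ ≤ _ := by linarith [hR _ hyΩ]
          · exact absurd (by simp [hζ.eq_zero hxΩ, hζ.eq_zero hyΩ]) h0
      have hh0 : 0 < ‖h‖ := by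
        refine norm_pos_iff.2 fun h' => h0 ?_
        simp [h']
      obtain ⟨z, hz⟩ := hcork p hpU hpR ‖h‖ hh0 (hhR.trans_le (min_le_right _ _))
      have hosc := enorm_sub_sq_le_oscSq hζm hp1 hp2 hz
      have hvol : volume (Metric.ball z (c * ‖h‖)) = c₀ * ENNReal.ofReal (‖h‖ ^ n) := by
        rw [Measure.addHaar_ball_of_pos _ _ (by positivity), mul_pow,
          ENNReal.ofReal_mul (by positivity),
          finrank_euclideanSpace_fin]
        ring
      -- The missing factor ‖h‖ⁿ is supplied by the volume of the corkscrew ball over which the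
      -- comparison is averaged.
      have hkk : k h = k₂ h * ENNReal.ofReal (‖h‖ ^ n) := by
        rw [hk, hk₂]
        simp only
        rw [← ENNReal.ofReal_mul (by positivity), ← Real.rpow_natCast, ← Real.rpow_add hh0]
        congr 2; ring
      refine le_trans ?_ le_add_self
      calc ‖ζ x - ζ (x + h)‖ₑ ^ 2 * k h
          = c₀⁻¹ * c₀ * (‖ζ x - ζ (x + h)‖ₑ ^ 2 * k h) := by
            rw [ENNReal.inv_mul_cancel hc₀ hc₀', one_mul]
        _ = c₀⁻¹ * k₂ h * (volume (Metric.ball z (c * ‖h‖)) * ‖ζ x - ζ (x + h)‖ₑ ^ 2) := by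
            rw [hvol, hkk]; ring
        _ ≤ c₀⁻¹ * k₂ h * (2 * (oscSq U₂ ζ x ‖h‖ + oscSq U₂ ζ (x + h) ‖h‖)) := by gcongr
        _ = _ := by simp only [A₃, K₃]; ring
  set I := ∫⁻ x, ‖ζ x‖ₑ ^ 2 with hI
  set G := ∫⁻ x in U₁, ‖gradient ζ x‖ₑ ^ 2 with hG
  set Q := ∫⁻ p in U₂ ×ˢ Set.univ, ‖diffQuot s ζ p‖ₑ ^ 2 with hQ
  have hζ2 : Measurable fun x => ‖ζ x‖ₑ ^ 2 := hζm.enorm.pow_const 2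
  have i₁ : ∫⁻ h, ∫⁻ x, A₁ h x ≤ K₁ * I := by
    have : ∀ h, ∫⁻ x, A₁ h x = far.indicator k h * (4 * I) := by
      intro h
      simp only [A₁]
      rw [lintegral_const_mul _ (by fun_prop), lintegral_add_left (by fun_prop),
        lintegral_const_mul _ hζ2, lintegral_const_mul _ (by fun_prop),
        lintegral_add_right_eq_self (fun x => ‖ζ x‖ₑ ^ 2) h]
      ring
    simp_rw [this]
    rw [lintegral_mul_const _ (hkm.indicator hfar), lintegral_indicator hfar]
    calc _ ≤ C₁ * ENNReal.ofReal (R₀ ^ ((n : ℝ) - ((n : ℝ) + 2 * s))) * (4 * I) := by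
          gcongr
          exact hC₁ R₀ hR₀pos
      _ = _ := by simp only [K₁]; ring
  have i₂ : ∫⁻ h, ∫⁻ x, A₂ h x ≤ I₂ * G := by
    have hAG : ∀ h, ∫⁻ x, A₂ h x
        = (Metric.ball 0 R₀).indicator (fun h => k h * ‖h‖ₑ ^ 2) h * G := by
      intro h
      simp only [A₂]
      have hm : Measurable fun q : Rn n × ℝ => g (q.1 + q.2 • h) := hgm.comp (by fun_prop)
      rw [lintegral_const_mul _ hm.lintegral_prod_right', lintegral_indicator_segment_le hgm,
        lintegral_indicator hU₁m]
    simp_rw [hAG]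
    have hkh : Measurable fun h : Rn n => k h * ‖h‖ₑ ^ 2 := by fun_prop
    rw [lintegral_mul_const _ (hkh.indicator measurableSet_ball),
      lintegral_indicator measurableSet_ball]
    refine mul_le_mul' ?_ le_rfl
    refine (lintegral_mono_set (Metric.ball_subset_ball (min_le_left _ _))).trans ?_
    refine lintegral_mono fun h => ?_
    by_cases hh : h = 0
    · simp [hh]
    have hh0 : 0 < ‖h‖ := norm_pos_iff.2 hh
    rw [hk]
    simp only
    rw [← ofReal_norm, ← ENNReal.ofReal_pow (norm_nonneg _), ← ENNReal.ofReal_mul (by positivity),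
      ← Real.rpow_natCast, ← Real.rpow_add hh0]
    refine ENNReal.ofReal_le_ofReal (le_of_eq ?_)
    congr 1; push_cast; ring
  have i₃ : ∫⁻ h, ∫⁻ x, A₃ h x ≤ C₄ * Q := hC₄ U₂ ζ hζm
  have i₄ : ∫⁻ h, ∫⁻ x, A₃ h (x + h) ≤ C₄ * Q := by
    refine le_trans (le_of_eq ?_) i₃
    refine lintegral_congr fun h => ?_
    simp only [A₃]
    exact lintegral_add_right_eq_self (fun x => k₂ h * oscSq U₂ ζ x ‖h‖) h
  clear_value A₁ A₂ A₃ K₁ K₃ I₂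
  have hA₃m' : Measurable fun p : Rn n × Rn n => A₃ p.1 (p.2 + p.1) :=
    hA₃m.comp (by fun_prop : Measurable fun p : Rn n × Rn n => (p.1, p.2 + p.1))
  have m₁ : ∀ h, Measurable (A₁ h) := fun h =>
    hA₁m.comp (measurable_const.prodMk measurable_id)
  have m₂ : ∀ h, Measurable (A₂ h) := fun h =>
    hA₂m.comp (measurable_const.prodMk measurable_id)
  have m₃ : ∀ h, Measurable (A₃ h) := fun h =>
    hA₃m.comp (measurable_const.prodMk measurable_id)
  have n₁ : Measurable fun h => ∫⁻ x, A₁ h x := hA₁m.lintegral_prod_right'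
  have n₂ : Measurable fun h => ∫⁻ x, A₂ h x := hA₂m.lintegral_prod_right'
  have n₃ : Measurable fun h => ∫⁻ x, A₃ h x := hA₃m.lintegral_prod_right'
  have e₁ : ∫⁻ p in U₁ ×ˢ U₁, ‖diffQuot s ζ p‖ₑ ^ 2 = ∫⁻ x, ∫⁻ h, F x h := by
    rw [← lintegral_indicator (hU₁m.prod hU₁m), Measure.volume_eq_prod,
      lintegral_prod _ (Measurable.indicator ((measurable_diffQuot s hζm).enorm.pow_const 2)
        (hU₁m.prod hU₁m)).aemeasurable]
    refine lintegral_congr fun x => ?_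
    exact (lintegral_add_left_eq_self (fun y => (U₁ ×ˢ U₁).indicator
      (fun p => ‖diffQuot s ζ p‖ₑ ^ 2) (x, y)) x).symm
  have e₂ : ∫⁻ h, ∫⁻ x, (A₁ h x + A₂ h x + K₃ * (A₃ h x + A₃ h (x + h)))
      = (∫⁻ h, ∫⁻ x, A₁ h x) + (∫⁻ h, ∫⁻ x, A₂ h x) + K₃ * ((∫⁻ h, ∫⁻ x, A₃ h x)
          + ∫⁻ h, ∫⁻ x, A₃ h (x + h)) := by
    have e : ∀ h, ∫⁻ x, (A₁ h x + A₂ h x + K₃ * (A₃ h x + A₃ h (x + h)))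
        = (∫⁻ x, A₁ h x) + (∫⁻ x, A₂ h x) + K₃ * ((∫⁻ x, A₃ h x) + ∫⁻ x, A₃ h (x + h)) := by
      intro h
      rw [lintegral_add_left (f := fun x => A₁ h x + A₂ h x) ((m₁ h).add (m₂ h)),
        lintegral_add_left (m₁ h), lintegral_const_mul' _ _ hK₃, lintegral_add_left (m₃ h)]
    rw [lintegral_congr e,
      lintegral_add_left (f := fun h => (∫⁻ x, A₁ h x) + ∫⁻ x, A₂ h x) (n₁.add n₂),
      lintegral_add_left n₁, lintegral_const_mul' _ _ hK₃, lintegral_add_left n₃]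
  have e₃ : ∫⁻ x, ∫⁻ h, F x h ≤ K₁ * I + I₂ * G + K₃ * (C₄ * Q + C₄ * Q) := by
    rw [lintegral_lintegral_swap hFm.aemeasurable]
    refine (lintegral_mono fun h => lintegral_mono_ae (hpt h)).trans ?_
    rw [e₂]
    exact add_le_add (add_le_add i₁ i₂) (mul_le_mul' le_rfl (add_le_add i₃ i₄))
  rw [e₁]
  refine e₃.trans ?_
  calc K₁ * I + I₂ * G + K₃ * (C₄ * Q + C₄ * Q) = K₁ * I + I₂ * G + K₃ * (2 * C₄) * Q := by ring
    _ ≤ (K₁ + I₂ + K₃ * (2 * C₄)) * I + (K₁ + I₂ + K₃ * (2 * C₄)) * G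
        + (K₁ + I₂ + K₃ * (2 * C₄)) * Q := by
      refine add_le_add (add_le_add (mul_le_mul' ?_ le_rfl) (mul_le_mul' ?_ le_rfl))
        (mul_le_mul' ?_ le_rfl)
      · exact le_add_right le_self_add
      · exact le_add_right le_add_self
      · exact le_add_self
    _ = _ := by ring

/-- Control of the full `H^s` norm by the energy of the coupled problem. -/
theorem exists_coercivity (hn : 1 ≤ n) {s : ℝ} (hs₀ : 0 < s) (hs₁ : s < 1)
    {U₁ U₂ Ω : Set (Rn n)} (hU : IsCorkscrewPair U₁ U₂) (hΩ : Bornology.IsBounded Ω)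
    (hΩm : MeasurableSet Ω) :
    ∃ C : ℝ≥0, ∀ ζ : Rn n → ℝ, LipTest Ω ζ →
      (∫⁻ x, ‖ζ x‖ₑ ^ 2) + ∫⁻ p, ‖diffQuot s ζ p‖ₑ ^ 2
        ≤ C * ((∫⁻ x in U₁, ‖gradient ζ x‖ₑ ^ 2)
          + ∫⁻ p in U₂ ×ˢ Set.univ, ‖diffQuot s ζ p‖ₑ ^ 2) := by
  obtain ⟨C₁, hC₁⟩ := exists_lintegral_sq_le_diffQuot hn hs₀ hΩ hΩm hU.isOpen₂ hU.nonempty₂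
  obtain ⟨C₂, hC₂⟩ := exists_setLIntegral_diffQuot_interior_le hn hs₀ hs₁ hU hΩ
  refine ⟨C₁ + C₂ * (C₁ + 1) + 2, fun ζ hζ => ?_⟩
  have h1 := hC₁ ζ hζ.continuous.measurable fun x hx => hζ.eq_zero hx
  have h2 := hC₂ ζ hζ
  set I := ∫⁻ x, ‖ζ x‖ₑ ^ 2
  set G := ∫⁻ x in U₁, ‖gradient ζ x‖ₑ ^ 2
  set Q := ∫⁻ p in U₂ ×ˢ Set.univ, ‖diffQuot s ζ p‖ₑ ^ 2
  -- A pair outside U₁ × U₁ with no entry in U₂ has an entry in the common complement, which is a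
  -- null set.
  have hcover : (Set.univ : Set (Rn n × Rn n)) ⊆ U₁ ×ˢ U₁ ∪ cross U₂ ∪ cross (U₁ ∪ U₂)ᶜ := by
    intro p _
    simp only [cross, Set.mem_union, Set.mem_prod, Set.mem_univ, Set.mem_compl_iff]
    tauto
  have hnull : (volume : Measure (Rn n × Rn n)) (cross (U₁ ∪ U₂)ᶜ) = 0 := by
    refine measure_union_null ?_ ?_
    · rw [Measure.volume_eq_prod, Measure.prod_prod, hU.null, zero_mul]
    · rw [Measure.volume_eq_prod, Measure.prod_prod, hU.null, mul_zero]
  have h3 : ∫⁻ p, ‖diffQuot s ζ p‖ₑ ^ 2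
      ≤ (∫⁻ p in U₁ ×ˢ U₁, ‖diffQuot s ζ p‖ₑ ^ 2) + 2 * Q := by
    calc ∫⁻ p, ‖diffQuot s ζ p‖ₑ ^ 2
        ≤ ∫⁻ p in U₁ ×ˢ U₁ ∪ cross U₂ ∪ cross (U₁ ∪ U₂)ᶜ, ‖diffQuot s ζ p‖ₑ ^ 2 := by
          rw [← setLIntegral_univ]
          exact lintegral_mono_set hcover
      _ ≤ (∫⁻ p in U₁ ×ˢ U₁ ∪ cross U₂, ‖diffQuot s ζ p‖ₑ ^ 2)
            + ∫⁻ p in cross (U₁ ∪ U₂)ᶜ, ‖diffQuot s ζ p‖ₑ ^ 2 := lintegral_union_le _ _ _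
      _ = ∫⁻ p in U₁ ×ˢ U₁ ∪ cross U₂, ‖diffQuot s ζ p‖ₑ ^ 2 := by
          rw [setLIntegral_measure_zero _ _ hnull, add_zero]
      _ ≤ (∫⁻ p in U₁ ×ˢ U₁, ‖diffQuot s ζ p‖ₑ ^ 2)
            + ∫⁻ p in cross U₂, ‖diffQuot s ζ p‖ₑ ^ 2 := lintegral_union_le _ _ _
      _ ≤ _ := by
          gcongr
          exact setLIntegral_diffQuot_cross_le s ζ U₂
  calc I + ∫⁻ p, ‖diffQuot s ζ p‖ₑ ^ 2 ≤ C₁ * Q + (C₂ * (C₁ * Q + G + Q) + 2 * Q) := by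
        gcongr
        refine h3.trans ?_
        gcongr
        refine h2.trans ?_
        gcongr
    _ = (C₁ + C₂ * (C₁ + 1) + 2) * Q + C₂ * G := by ring
    _ ≤ (C₁ + C₂ * (C₁ + 1) + 2) * Q + (C₁ + C₂ * (C₁ + 1) + 2) * G := by
        gcongr
        calc (C₂ : ℝ≥0∞) ≤ C₂ * C₁ + C₂ := le_add_self
          _ = C₂ * (C₁ + 1) := by ring
          _ ≤ _ := le_add_right le_add_self
    _ = _ := by push_cast; ring

/-! ### Lions' projection theorem -/

/-- No continuity of R is assumed. Coercivity gives c‖Jζ‖ ≤ ‖Sζ‖ for the projection S of R to the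
closure of the range of J, so ζ ↦ ⟨r, Jζ⟩ factors through S as a functional of norm at most ‖r‖/c.
Hahn–Banach extends it and Riesz represents the extension. -/
theorem exists_lions {H Φ : Type*} [NormedAddCommGroup H] [InnerProductSpace ℝ H] [CompleteSpace H]
    [AddCommGroup Φ] [Module ℝ Φ] (J R : Φ →ₗ[ℝ] H) (r : H) {c : ℝ} (hc : 0 < c)
    (hcoer : ∀ ζ, c * ‖J ζ‖ ^ 2 ≤ inner ℝ (R ζ) (J ζ)) :
    ∃ h ∈ (LinearMap.range J).topologicalClosure, ‖h‖ ≤ ‖r‖ / c ∧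
      ∀ ζ, inner ℝ (R ζ) h = inner ℝ r (J ζ) := by
  set W := (LinearMap.range J).topologicalClosure
  have hJW : ∀ ζ, J ζ ∈ W := fun ζ => Submodule.le_topologicalClosure _ ⟨ζ, rfl⟩
  have hWc : IsClosed (W : Set H) := Submodule.isClosed_topologicalClosure _
  have : CompleteSpace W := hWc.completeSpace_coe
  let S : Φ →ₗ[ℝ] W := (W.orthogonalProjectionOnto : H →ₗ[ℝ] W) ∘ₗ R
  have hS : ∀ ζ (w : W), inner ℝ (S ζ) w = inner ℝ (R ζ) (w : H) := fun ζ w =>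
    Submodule.inner_orthogonalProjectionOnto_eq_of_mem_right w (R ζ)
  have hbd : ∀ ζ, c * ‖J ζ‖ ≤ ‖S ζ‖ := by
    intro ζ
    rcases eq_or_lt_of_le (norm_nonneg (J ζ)) with h0 | h0
    · rw [← h0, mul_zero]; exact norm_nonneg _
    · have h1 := hcoer ζ
      rw [← hS ζ ⟨J ζ, hJW ζ⟩] at h1
      have h2 := real_inner_le_norm (S ζ) ⟨J ζ, hJW ζ⟩
      have h3 : ‖(⟨J ζ, hJW ζ⟩ : W)‖ = ‖J ζ‖ := rfl
      rw [h3] at h2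
      nlinarith
  let F : Φ →ₗ[ℝ] ℝ := (innerₛₗ ℝ r) ∘ₗ J
  have hker : LinearMap.ker S ≤ LinearMap.ker F := by
    intro ζ hζ
    rw [LinearMap.mem_ker] at hζ ⊢
    have h1 := hbd ζ
    rw [hζ, norm_zero] at h1
    have h2 : J ζ = 0 := by
      rw [← norm_eq_zero]
      exact le_antisymm (nonpos_of_mul_nonpos_right h1 hc) (norm_nonneg _)
    simp [F, h2]
  let ℓ : LinearMap.range S →ₗ[ℝ] ℝ := (LinearMap.ker S).liftQ F hker ∘ₗ
    (S.quotKerEquivRange.symm : LinearMap.range S →ₗ[ℝ] Φ ⧸ LinearMap.ker S)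
  have hℓ : ∀ ζ, ℓ ⟨S ζ, ⟨ζ, rfl⟩⟩ = inner ℝ r (J ζ) := by
    intro ζ
    have h1 : S.quotKerEquivRange.symm ⟨S ζ, ⟨ζ, rfl⟩⟩ = (LinearMap.ker S).mkQ ζ := by
      rw [LinearEquiv.symm_apply_eq]; rfl
    simp only [ℓ, LinearMap.comp_apply, LinearEquiv.coe_coe, h1]
    rfl
  have hℓb : ∀ x : LinearMap.range S, ‖ℓ x‖ ≤ ‖r‖ / c * ‖x‖ := by
    rintro ⟨_, ζ, rfl⟩
    rw [hℓ]
    calc ‖(inner ℝ r (J ζ) : ℝ)‖ ≤ ‖r‖ * ‖J ζ‖ := norm_inner_le_norm _ _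
      _ = ‖r‖ / c * (c * ‖J ζ‖) := by field_simp
      _ ≤ ‖r‖ / c * ‖S ζ‖ := by
          gcongr
          exact hbd ζ
  obtain ⟨g, hg, hgn⟩ := _root_.exists_extension_norm_eq (LinearMap.range S)
    (ℓ.mkContinuous (‖r‖ / c) hℓb)
  set w : W := (InnerProductSpace.toDual ℝ W).symm g
  refine ⟨w, w.2, ?_, fun ζ => ?_⟩
  · calc ‖(w : H)‖ = ‖g‖ := by
          change ‖w‖ = ‖g‖
          exact LinearIsometryEquiv.norm_map _ _
      _ ≤ ‖r‖ / c := by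
          rw [hgn]
          exact LinearMap.mkContinuous_norm_le _ (by positivity) _
  · rw [← hS, real_inner_comm, InnerProductSpace.toDual_symm_apply, ← hℓ ζ]
    exact hg ⟨S ζ, ⟨ζ, rfl⟩⟩

/-! ### The energy space -/

/-- Triples (function, gradient, difference quotient) of square-integrable functions. -/
abbrev EnergySpace (n : ℕ) : Type :=
  WithLp 2 (Lp ℝ 2 (volume : Measure (Rn n)) ×
    WithLp 2 (Lp (Rn n) 2 (volume : Measure (Rn n)) × Lp ℝ 2 (volume : Measure (Rn n × Rn n))))

/-- The triple with given components. -/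
def mkEnergy {f : Rn n → ℝ} {G : Rn n → Rn n} {d : Rn n × Rn n → ℝ} (hf : MemLp f 2 volume)
    (hG : MemLp G 2 volume) (hd : MemLp d 2 volume) : EnergySpace n :=
  WithLp.toLp 2 (hf.toLp f, WithLp.toLp 2 (hG.toLp G, hd.toLp d))

section mkEnergy

variable {f f' : Rn n → ℝ} {G G' : Rn n → Rn n} {d d' : Rn n × Rn n → ℝ}

theorem mkEnergy_congr (hf : MemLp f 2 volume) (hG : MemLp G 2 volume) (hd : MemLp d 2 volume)
    (hf' : MemLp f' 2 volume) (hG' : MemLp G' 2 volume) (hd' : MemLp d' 2 volume)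
    (h₁ : f =ᵐ[volume] f') (h₂ : G =ᵐ[volume] G') (h₃ : d =ᵐ[volume] d') :
    mkEnergy hf hG hd = mkEnergy hf' hG' hd' := by
  rw [mkEnergy, mkEnergy, (MemLp.toLp_eq_toLp_iff hf hf').2 h₁,
    (MemLp.toLp_eq_toLp_iff hG hG').2 h₂, (MemLp.toLp_eq_toLp_iff hd hd').2 h₃]

theorem mkEnergy_add (hf : MemLp f 2 volume) (hG : MemLp G 2 volume) (hd : MemLp d 2 volume)
    (hf' : MemLp f' 2 volume) (hG' : MemLp G' 2 volume) (hd' : MemLp d' 2 volume) :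
    mkEnergy hf hG hd + mkEnergy hf' hG' hd'
      = mkEnergy (hf.add hf') (hG.add hG') (hd.add hd') := rfl

theorem mkEnergy_sub (hf : MemLp f 2 volume) (hG : MemLp G 2 volume) (hd : MemLp d 2 volume)
    (hf' : MemLp f' 2 volume) (hG' : MemLp G' 2 volume) (hd' : MemLp d' 2 volume) :
    mkEnergy hf hG hd - mkEnergy hf' hG' hd'
      = mkEnergy (hf.sub hf') (hG.sub hG') (hd.sub hd') := rfl

theorem mkEnergy_smul (c : ℝ) (hf : MemLp f 2 volume) (hG : MemLp G 2 volume)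
    (hd : MemLp d 2 volume) : c • mkEnergy hf hG hd
      = mkEnergy (hf.const_smul c) (hG.const_smul c) (hd.const_smul c) := rfl

theorem inner_toLp {α E : Type*} [MeasurableSpace α] {μ : Measure α} [NormedAddCommGroup E]
    [InnerProductSpace ℝ E] {g g' : α → E} (hg : MemLp g 2 μ) (hg' : MemLp g' 2 μ) :
    inner ℝ (hg.toLp g) (hg'.toLp g') = ∫ x, (inner ℝ (g x) (g' x) : ℝ) ∂μ := by
  rw [L2.inner_def]
  refine integral_congr_ae ?_
  filter_upwards [hg.coeFn_toLp, hg'.coeFn_toLp] with x h1 h2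
  rw [h1, h2]

theorem inner_mkEnergy (hf : MemLp f 2 volume) (hG : MemLp G 2 volume) (hd : MemLp d 2 volume)
    (hf' : MemLp f' 2 volume) (hG' : MemLp G' 2 volume) (hd' : MemLp d' 2 volume) :
    inner ℝ (mkEnergy hf hG hd) (mkEnergy hf' hG' hd')
      = (∫ x, f x * f' x) + (∫ x, (inner ℝ (G x) (G' x) : ℝ)) + ∫ p, d p * d' p := by
  rw [mkEnergy, mkEnergy, WithLp.prod_inner_apply, WithLp.prod_inner_apply]
  simp only [inner_toLp]
  simp only [RCLike.inner_apply, conj_trivial]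
  rw [add_assoc]
  simp_rw [mul_comm]

theorem norm_sq_mkEnergy (hf : MemLp f 2 volume) (hG : MemLp G 2 volume) (hd : MemLp d 2 volume) :
    ‖mkEnergy hf hG hd‖ ^ 2 = (∫ x, f x ^ 2) + (∫ x, ‖G x‖ ^ 2) + ∫ p, d p ^ 2 := by
  rw [← real_inner_self_eq_norm_sq, inner_mkEnergy]
  simp_rw [real_inner_self_eq_norm_sq, ← sq]

end mkEnergy

theorem integrable_inner_of_memLp {α E : Type*} [MeasurableSpace α] {μ : Measure α}
    [NormedAddCommGroup E] [InnerProductSpace ℝ E] {g g' : α → E} (hg : MemLp g 2 μ)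
    (hg' : MemLp g' 2 μ) : Integrable (fun x => (inner ℝ (g x) (g' x) : ℝ)) μ := by
  refine (L2.integrable_inner (𝕜 := ℝ) (hg.toLp g) (hg'.toLp g')).congr ?_
  filter_upwards [hg.coeFn_toLp, hg'.coeFn_toLp] with x h1 h2
  rw [h1, h2]

theorem ofReal_integral_norm_sq {α E : Type*} [MeasurableSpace α] {μ : Measure α}
    [NormedAddCommGroup E] {g : α → E} (hg : MemLp g 2 μ) :
    ENNReal.ofReal (∫ x, ‖g x‖ ^ 2 ∂μ) = ∫⁻ x, ‖g x‖ₑ ^ 2 ∂μ := by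
  rw [ofReal_integral_eq_lintegral_ofReal (hg.integrable_norm_pow two_ne_zero)
    (Eventually.of_forall fun x => by positivity)]
  refine lintegral_congr fun x => ?_
  rw [ENNReal.ofReal_pow (norm_nonneg _), ofReal_norm]

/-! ### The coupled problem in rescaled variables -/

/-- A coupled local/nonlocal problem with all coefficients extended by zero; the drift satisfies
`div b = 0` against Lipschitz test functions. -/
structure CoupledProblem (n : ℕ) where
  s : ℝ
  lam : ℝ
  Lam : ℝ
  κ : ℝ
  U₁ : Set (Rn n)
  U₂ : Set (Rn n)
  Ω : Set (Rn n)
  A : Rn n → Rn n →L[ℝ] Rn n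
  a : Rn n × Rn n → ℝ
  b : Rn n → Rn n
  f : Rn n → ℝ
  hn : 1 ≤ n
  hs₀ : 0 < s
  hs₁ : s < 1
  hlam : 0 < lam
  hLam : 0 < Lam
  hκ : 0 < κ
  pair : IsCorkscrewPair U₁ U₂
  hΩ : IsOpen Ω
  hΩb : Bornology.IsBounded Ω
  A_meas : AEStronglyMeasurable A volume
  A_zero : ∀ x ∉ U₁, A x = 0
  A_symm : ∀ x ξ η, inner ℝ (A x ξ) η = inner ℝ ξ (A x η)
  A_lower : ∀ x ∈ U₁, ∀ ξ, lam * ‖ξ‖ ^ 2 ≤ inner ℝ (A x ξ) ξ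
  A_upper : ∀ x ξ, inner ℝ (A x ξ) ξ ≤ Lam * ‖ξ‖ ^ 2
  a_meas : AEStronglyMeasurable a volume
  a_nonneg : ∀ p, 0 ≤ a p
  a_upper : ∀ p, a p ≤ Lam
  a_lower : ∀ x ∈ U₂, ∀ y, lam ≤ a (x, y)
  b_memLp : MemLp b 2 volume
  b_div : ∀ ζ, LipTest Ω ζ → ∫ x, (inner ℝ (b x) (gradient ζ x) : ℝ) = 0
  f_memLp : MemLp f 2 volume

namespace CoupledProblem

variable (P : CoupledProblem n)

theorem A_nonneg (x ξ : Rn n) : 0 ≤ (inner ℝ (P.A x ξ) ξ : ℝ) := by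
  by_cases hx : x ∈ P.U₁
  · exact le_trans (mul_nonneg P.hlam.le (by positivity)) (P.A_lower x hx ξ)
  · simp [P.A_zero x hx]

/-- The Cauchy–Schwarz inequality for the quadratic form of `A x`, with a parameter. -/
theorem two_mul_abs_inner_A_le (x ξ η : Rn n) :
    2 * |(inner ℝ (P.A x ξ) η : ℝ)| ≤ inner ℝ (P.A x ξ) ξ + inner ℝ (P.A x η) η := by
  have h1 := P.A_nonneg x (ξ - η)
  have h2 := P.A_nonneg x (ξ + η)
  have h3 : (inner ℝ (P.A x η) ξ : ℝ) = inner ℝ (P.A x ξ) η := by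
    rw [P.A_symm, real_inner_comm]
  simp only [map_sub, map_add, inner_sub_left, inner_sub_right, inner_add_left,
    inner_add_right, h3] at h1 h2
  rcases abs_cases (inner ℝ (P.A x ξ) η : ℝ) with h | h <;> linarith

/-- The bound on the quadratic form becomes an operator bound because A is symmetric: Cauchy–Schwarz
for the form is applied to the pair Λξ and Aξ, and the term with Aξ is absorbed. -/
theorem norm_A_apply_le (x ξ : Rn n) : ‖P.A x ξ‖ ≤ P.Lam * ‖ξ‖ := by
  have h := P.two_mul_abs_inner_A_le x (P.Lam • ξ) (P.A x ξ)
  have h1 := P.A_upper x (P.Lam • ξ)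
  have h2 := P.A_upper x (P.A x ξ)
  simp only [map_smul, inner_smul_left, real_inner_self_eq_norm_sq, norm_smul,
    Real.norm_of_nonneg P.hLam.le, conj_trivial] at h h1 h2
  rw [abs_of_nonneg (mul_nonneg P.hLam.le (by positivity))] at h
  have h3 : ‖P.A x ξ‖ ^ 2 ≤ (P.Lam * ‖ξ‖) ^ 2 := by
    have h4 := P.hLam
    have h5 : P.Lam * ‖P.A x ξ‖ ^ 2 ≤ P.Lam * (P.Lam * ‖ξ‖) ^ 2 := by linarith
    exact le_of_mul_le_mul_left h5 h4
  exact le_of_sq_le_sq h3 (mul_nonneg P.hLam.le (norm_nonneg _))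

open Classical in
/-- The weight `1` on `U₁` and `τ` elsewhere. -/
def weight (τ : ℝ) (x : Rn n) : ℝ := if x ∈ P.U₁ then 1 else τ

theorem weight_of_mem (τ : ℝ) {x : Rn n} (hx : x ∈ P.U₁) : P.weight τ x = 1 := if_pos hx

theorem weight_of_notMem (τ : ℝ) {x : Rn n} (hx : x ∉ P.U₁) : P.weight τ x = τ := if_neg hx

theorem measurable_weight (τ : ℝ) : Measurable (P.weight τ) := by
  classical
  exact Measurable.ite P.pair.isOpen₁.measurableSet measurable_const measurable_const

theorem abs_weight_le {τ : ℝ} (h₀ : 0 ≤ τ) (h₁ : τ ≤ 1) (x : Rn n) : |P.weight τ x| ≤ 1 := by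
  by_cases hx : x ∈ P.U₁
  · simp [P.weight_of_mem τ hx]
  · rw [P.weight_of_notMem τ hx, abs_of_nonneg h₀]; exact h₁

theorem weight_pos {τ : ℝ} (h₀ : 0 < τ) (x : Rn n) : 0 < P.weight τ x := by
  by_cases hx : x ∈ P.U₁
  · simp [P.weight_of_mem τ hx]
  · rwa [P.weight_of_notMem τ hx]

theorem memLp_weight_smul {τ : ℝ} (h₀ : 0 ≤ τ) (h₁ : τ ≤ 1) {G : Rn n → Rn n}
    (hG : MemLp G 2 volume) : MemLp (fun x => P.weight τ x • G x) 2 volume := by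
  refine hG.of_le ((P.measurable_weight τ).aestronglyMeasurable.smul hG.1)
    (Eventually.of_forall fun x => ?_)
  rw [norm_smul, Real.norm_eq_abs]
  exact mul_le_of_le_one_left (norm_nonneg _) (P.abs_weight_le h₀ h₁ x)

/-- The embedding of Lipschitz test functions into the energy space. -/
def J {τ : ℝ} (h₀ : 0 ≤ τ) (h₁ : τ ≤ 1) : lipTest P.Ω →ₗ[ℝ] EnergySpace n where
  toFun ζ := mkEnergy (ζ.2.memLp 2) (P.memLp_weight_smul h₀ h₁ (ζ.2.memLp_gradient 2))
    (ζ.2.memLp_diffQuot P.hn P.hs₀ P.hs₁)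
  map_add' ζ w := by
    rw [mkEnergy_add]
    refine mkEnergy_congr _ _ _ _ _ _ (Eventually.of_forall fun x => rfl) ?_
      (Eventually.of_forall fun p => diffQuot_add _ _ _ _)
    filter_upwards [ζ.2.ae_differentiableAt, w.2.ae_differentiableAt] with x h1 h2
    rw [Pi.add_apply, ← smul_add, ← gradient_add h1 h2]
    rfl
  map_smul' c ζ := by
    rw [RingHom.id_apply, mkEnergy_smul]
    refine mkEnergy_congr _ _ _ _ _ _ (Eventually.of_forall fun x => rfl) ?_
      (Eventually.of_forall fun p => ?_)
    · filter_upwards [ζ.2.ae_differentiableAt] with x h1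
      have : gradient (fun y => c * (ζ : Rn n → ℝ) y) x = c • gradient (ζ : Rn n → ℝ) x :=
        gradient_comp (T := fun t => c * t) (by simpa using (hasDerivAt_id _).const_mul c) h1
      rw [Pi.smul_apply, smul_comm c, ← this]
      rfl
    · simp only [diffQuot, Pi.smul_apply, smul_eq_mul, Submodule.coe_smul]
      ring

theorem aestronglyMeasurable_A_apply {G : Rn n → Rn n} (hG : AEStronglyMeasurable G volume) :
    AEStronglyMeasurable (fun x => P.A x (G x)) volume :=
  isBoundedBilinearMap_apply.continuous.comp_aestronglyMeasurable (P.A_meas.prodMk hG)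

theorem memLp_A_apply {G : Rn n → Rn n} (hG : MemLp G 2 volume) :
    MemLp (fun x => P.A x (G x)) 2 volume :=
  hG.of_le_mul (P.aestronglyMeasurable_A_apply hG.1)
    (Eventually.of_forall fun x => P.norm_A_apply_le x (G x))

theorem memLp_smul_b {ζ : Rn n → ℝ} (hζ : LipTest P.Ω ζ) :
    MemLp (fun x => ζ x • P.b x) 2 volume := by
  obtain ⟨B, hB0, hB⟩ := hζ.exists_bound
  refine P.b_memLp.of_le_mul (c := B) (hζ.continuous.aestronglyMeasurable.smul P.b_memLp.1)
    (Eventually.of_forall fun x => ?_)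
  rw [norm_smul]
  exact mul_le_mul_of_nonneg_right (hB x) (norm_nonneg _)

theorem memLp_a_mul {d : Rn n × Rn n → ℝ} (hd : MemLp d 2 volume) :
    MemLp (fun p => P.κ * (P.a p * d p)) 2 volume := by
  refine MemLp.const_mul ?_ _
  refine hd.of_le_mul (c := P.Lam) (P.a_meas.mul hd.1) (Eventually.of_forall fun p => ?_)
  rw [norm_mul, Real.norm_of_nonneg (P.a_nonneg p)]
  exact mul_le_mul_of_nonneg_right (P.a_upper p) (norm_nonneg _)

/-- The flux of a test function, with viscosity `τ ^ 2` and the drift in skew form. -/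
def flux (τ : ℝ) (ζ : Rn n → ℝ) (x : Rn n) : Rn n :=
  P.A x (gradient ζ x) + τ ^ 2 • gradient ζ x + ζ x • P.b x

theorem memLp_flux (τ : ℝ) {ζ : Rn n → ℝ} (hζ : LipTest P.Ω ζ) :
    MemLp (P.flux τ ζ) 2 volume :=
  ((P.memLp_A_apply (hζ.memLp_gradient 2)).add ((hζ.memLp_gradient 2).const_smul (τ ^ 2))).add
    (P.memLp_smul_b hζ)

theorem memLp_weight_inv_smul {τ : ℝ} (h₀ : 0 < τ) (h₁ : τ ≤ 1) {G : Rn n → Rn n}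
    (hG : MemLp G 2 volume) : MemLp (fun x => (P.weight τ x)⁻¹ • G x) 2 volume := by
  refine hG.of_le_mul (c := τ⁻¹) ((P.measurable_weight τ).inv.aestronglyMeasurable.smul hG.1)
    (Eventually.of_forall fun x => ?_)
  rw [norm_smul, norm_inv, Real.norm_of_nonneg (P.weight_pos h₀ x).le]
  refine mul_le_mul_of_nonneg_right ?_ (norm_nonneg _)
  refine inv_anti₀ h₀ ?_
  by_cases hx : x ∈ P.U₁
  · rwa [P.weight_of_mem τ hx]
  · rw [P.weight_of_notMem τ hx]

/-- The bilinear form of the problem with viscosity `τ ^ 2`, represented in the energy space. -/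
def R {τ : ℝ} (h₀ : 0 < τ) (h₁ : τ ≤ 1) : lipTest P.Ω →ₗ[ℝ] EnergySpace n where
  toFun ζ := mkEnergy (f := fun _ => 0) MemLp.zero
    (P.memLp_weight_inv_smul h₀ h₁ (P.memLp_flux τ ζ.2))
    (P.memLp_a_mul (ζ.2.memLp_diffQuot P.hn P.hs₀ P.hs₁))
  map_add' ζ w := by
    rw [mkEnergy_add]
    refine mkEnergy_congr _ _ _ _ _ _ (Eventually.of_forall fun x => by simp) ?_
      (Eventually.of_forall fun p => ?_)
    · filter_upwards [ζ.2.ae_differentiableAt, w.2.ae_differentiableAt] with x h1 h2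
      rw [Pi.add_apply, ← smul_add]
      have : gradient ((ζ + w : lipTest P.Ω) : Rn n → ℝ) x
          = gradient (ζ : Rn n → ℝ) x + gradient (w : Rn n → ℝ) x :=
        gradient_add h1 h2
      simp only [flux, this, map_add, smul_add]
      simp only [Submodule.coe_add, Pi.add_apply, add_smul, smul_add]
      abel
    · simp only [diffQuot, Pi.add_apply, Submodule.coe_add]
      ring
  map_smul' c ζ := by
    rw [RingHom.id_apply, mkEnergy_smul]
    refine mkEnergy_congr _ _ _ _ _ _ (Eventually.of_forall fun x => by simp) ?_
      (Eventually.of_forall fun p => ?_)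
    · filter_upwards [ζ.2.ae_differentiableAt] with x h1
      have : gradient ((c • ζ : lipTest P.Ω) : Rn n → ℝ) x = c • gradient (ζ : Rn n → ℝ) x :=
        gradient_comp (T := fun t => c * t) (by simpa using (hasDerivAt_id _).const_mul c) h1
      rw [Pi.smul_apply, smul_comm c]
      simp only [flux, this, map_smul, smul_add]
      simp only [Submodule.coe_smul, Pi.smul_apply, smul_eq_mul, mul_smul]
      rw [smul_comm c (τ ^ 2)]
    · simp only [diffQuot, Pi.smul_apply, smul_eq_mul, Submodule.coe_smul]
      ring

/-- The inverse weight in the gradient slot of `R` cancels the weight carried by the second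
argument. The bilinear form appears here transposed: the test function comes first and the drift is
ζ⟨b, G⟩. -/
theorem inner_R {τ : ℝ} (h₀ : 0 < τ) (h₁ : τ ≤ 1) (ζ : lipTest P.Ω) {v : Rn n → ℝ}
    {G : Rn n → Rn n} {d : Rn n × Rn n → ℝ} (hv : MemLp v 2 volume)
    (hG : MemLp (fun x => P.weight τ x • G x) 2 volume) (hd : MemLp d 2 volume) :
    inner ℝ (P.R h₀ h₁ ζ) (mkEnergy hv hG hd)
      = (∫ x, (inner ℝ (P.flux τ ζ x) (G x) : ℝ))
        + P.κ * ∫ p, P.a p * (diffQuot P.s ζ p * d p) := by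
  change inner ℝ (mkEnergy _ _ _) _ = _
  rw [inner_mkEnergy]
  simp only [zero_mul, integral_zero, zero_add]
  rw [← integral_const_mul]
  congr 1
  · refine integral_congr_ae (Eventually.of_forall fun x => ?_)
    simp only
    rw [real_inner_smul_left, real_inner_smul_right, ← mul_assoc,
      inv_mul_cancel₀ (P.weight_pos h₀ x).ne', one_mul]
  · refine integral_congr_ae (Eventually.of_forall fun p => ?_)
    simp only
    ring

theorem inner_R_J {τ : ℝ} (h₀ : 0 < τ) (h₁ : τ ≤ 1) (ζ w : lipTest P.Ω) :
    inner ℝ (P.R h₀ h₁ ζ) (P.J h₀.le h₁ w)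
      = (∫ x, (inner ℝ (P.flux τ (ζ : Rn n → ℝ) x) (gradient (w : Rn n → ℝ) x) : ℝ))
        + P.κ * ∫ p, P.a p * (diffQuot P.s (ζ : Rn n → ℝ) p * diffQuot P.s (w : Rn n → ℝ) p) :=
  P.inner_R h₀ h₁ ζ _ _ _

/-- Here 2ζ∇ζ is the gradient of ζ², which is again an admissible test function for div b = 0. -/
theorem integral_mul_inner_b_self {ζ : Rn n → ℝ} (hζ : LipTest P.Ω ζ) :
    ∫ x, (inner ℝ (ζ x • P.b x) (gradient ζ x) : ℝ) = 0 := by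
  have h := P.b_div _ (hζ.mul hζ)
  have h2 : ∫ x, (inner ℝ (P.b x) (gradient (fun y => ζ y * ζ y) x) : ℝ)
      = 2 * ∫ x, (inner ℝ (ζ x • P.b x) (gradient ζ x) : ℝ) := by
    rw [← integral_const_mul]
    refine integral_congr_ae ?_
    filter_upwards [hζ.ae_differentiableAt] with x hx
    rw [gradient_mul hx hx, inner_add_right, real_inner_smul_right, real_inner_smul_left]
    ring
  rw [h2] at h
  linarith

/-- The constant is uniform in τ because outside U₁ the viscosity gives exactly τ²|∇ζ|², which is
what the weight puts into the norm; the drift contributes nothing. -/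
theorem exists_coercive : ∃ c > 0, ∀ (τ : ℝ) (h₀ : 0 < τ) (h₁ : τ ≤ 1) (ζ : lipTest P.Ω),
    c * ‖P.J h₀.le h₁ ζ‖ ^ 2 ≤ inner ℝ (P.R h₀ h₁ ζ) (P.J h₀.le h₁ ζ) := by
  obtain ⟨C, hC⟩ := exists_coercivity P.hn P.hs₀ P.hs₁ P.pair P.hΩb P.hΩ.measurableSet
  set m := min (min P.lam 1) (P.κ * P.lam) with hm
  have hm0 : 0 < m := lt_min (lt_min P.hlam one_pos) (mul_pos P.hκ P.hlam)
  refine ⟨m / (C + 1), by positivity, fun τ h₀ h₁ ζ => ?_⟩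
  set z : Rn n → ℝ := (ζ : Rn n → ℝ) with hz
  have hg := ζ.2.memLp_gradient 2
  have hd := ζ.2.memLp_diffQuot P.hn P.hs₀ P.hs₁
  have hw := P.memLp_weight_smul h₀.le h₁ hg
  set I := ∫ x, z x ^ 2 with hI
  set D := ∫ p, diffQuot P.s z p ^ 2 with hD
  set W := ∫ x, ‖P.weight τ x • gradient z x‖ ^ 2 with hW
  set G := ∫ x in P.U₁, ‖gradient z x‖ ^ 2 with hG
  set Q := ∫ p in P.U₂ ×ˢ Set.univ, diffQuot P.s z p ^ 2 with hQ
  have hU₁ := P.pair.isOpen₁.measurableSet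
  have hU₂ : MeasurableSet (P.U₂ ×ˢ (Set.univ : Set (Rn n))) :=
    P.pair.isOpen₂.measurableSet.prod MeasurableSet.univ
  have hQ0 : 0 ≤ Q := integral_nonneg fun p => by positivity
  have hG0 : 0 ≤ G := integral_nonneg fun p => by positivity
  have hW0 : 0 ≤ W := integral_nonneg fun p => by positivity
  have e1 : I + D ≤ C * (G + Q) := by
    have h := hC ζ ζ.2
    rw [← ofReal_integral_norm_sq (ζ.2.memLp 2), ← ofReal_integral_norm_sq hd,
      ← ofReal_integral_norm_sq (hg.restrict _), ← ofReal_integral_norm_sq (hd.restrict _)] at h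
    simp only [Real.norm_eq_abs, sq_abs] at h
    rw [← ENNReal.ofReal_add (by positivity) (by positivity), ← ENNReal.ofReal_add hG0 hQ0,
      ← ENNReal.ofReal_coe_nnreal, ← ENNReal.ofReal_mul (by positivity)] at h
    exact (ENNReal.ofReal_le_ofReal_iff (by positivity)).1 h
  have e2 : G ≤ W := by
    rw [hG, ← integral_indicator hU₁]
    refine integral_mono ((hg.integrable_norm_pow two_ne_zero).indicator hU₁)
      (hw.integrable_norm_pow two_ne_zero) fun x => ?_
    by_cases hx : x ∈ P.U₁
    · simp [hx, P.weight_of_mem τ hx]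
    · simp only [hx, not_false_eq_true, Set.indicator_of_notMem]; positivity
  have e3 : m * W ≤ ∫ x, (inner ℝ (P.flux τ z x) (gradient z x) : ℝ) := by
    have i1 : Integrable fun x => (inner ℝ (z x • P.b x) (gradient z x) : ℝ) :=
      integrable_inner_of_memLp (P.memLp_smul_b ζ.2) hg
    have i2 : Integrable fun x =>
        (inner ℝ (P.A x (gradient z x) + τ ^ 2 • gradient z x) (gradient z x) : ℝ) :=
      integrable_inner_of_memLp ((P.memLp_A_apply hg).add (hg.const_smul (τ ^ 2))) hg
    have : ∫ x, (inner ℝ (P.flux τ z x) (gradient z x) : ℝ)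
        = ∫ x, (inner ℝ (P.A x (gradient z x) + τ ^ 2 • gradient z x) (gradient z x) : ℝ) := by
      simp only [flux, inner_add_left (P.A _ _ + _)]
      rw [integral_add i2 i1, P.integral_mul_inner_b_self ζ.2, add_zero]
    rw [this, hW, ← integral_const_mul]
    refine integral_mono ((hw.integrable_norm_pow two_ne_zero).const_mul m) i2 fun x => ?_
    simp only
    rw [inner_add_left, real_inner_smul_left, real_inner_self_eq_norm_sq, norm_smul, mul_pow,
      Real.norm_eq_abs, sq_abs]
    by_cases hx : x ∈ P.U₁
    · rw [P.weight_of_mem τ hx]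
      have h1 := P.A_lower x hx (gradient z x)
      have h2 : m ≤ P.lam := (min_le_left _ _).trans (min_le_left _ _)
      nlinarith [sq_nonneg ‖gradient z x‖, mul_nonneg (sq_nonneg τ) (sq_nonneg ‖gradient z x‖)]
    · rw [P.weight_of_notMem τ hx]
      have h1 := P.A_nonneg x (gradient z x)
      have h2 : m ≤ 1 := (min_le_left _ _).trans (min_le_right _ _)
      nlinarith [mul_nonneg (sq_nonneg τ) (sq_nonneg ‖gradient z x‖)]
  have e4 : m * Q ≤ P.κ * ∫ p, P.a p * (diffQuot P.s z p * diffQuot P.s z p) := by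
    have i1 : Integrable (fun p => diffQuot P.s z p ^ 2) := hd.integrable_sq
    have i2 : Integrable (fun p => P.κ * (P.a p * diffQuot P.s z p) * diffQuot P.s z p) :=
      (P.memLp_a_mul hd).integrable_mul hd
    rw [hQ, ← integral_indicator hU₂, ← integral_const_mul m, ← integral_const_mul P.κ]
    refine integral_mono ((i1.indicator hU₂).const_mul m)
      (i2.congr (Eventually.of_forall fun p => by ring)) fun p => ?_
    by_cases hp : p ∈ P.U₂ ×ˢ (Set.univ : Set (Rn n))
    · simp only [hp, Set.indicator_of_mem]
      have h1 := P.a_lower p.1 hp.1 p.2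
      have h2 : m ≤ P.κ * P.lam := min_le_right _ _
      calc m * diffQuot P.s z p ^ 2 ≤ (P.κ * P.a p) * diffQuot P.s z p ^ 2 := by
            gcongr
            exact h2.trans (mul_le_mul_of_nonneg_left h1 P.hκ.le)
        _ = _ := by ring
    · simp only [hp, not_false_eq_true, Set.indicator_of_notMem, mul_zero]
      have := P.a_nonneg p
      have := P.hκ
      rw [← sq]
      positivity
  rw [P.inner_R_J]
  have e5 : ‖P.J h₀.le h₁ ζ‖ ^ 2 = I + W + D := norm_sq_mkEnergy _ _ _
  rw [e5, div_mul_eq_mul_div, div_le_iff₀ (by positivity)]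
  have hC0 : (0 : ℝ) ≤ C := C.2
  -- From I + D ≤ C (G + Q) and G ≤ W; this is the origin of the denominator C + 1 in the coercivity
  -- constant.
  have e6 : I + W + D ≤ (C + 1) * (W + Q) := by nlinarith
  nlinarith [mul_le_mul_of_nonneg_left e6 hm0.le,
    mul_le_mul_of_nonneg_left (add_le_add e3 e4) (show (0 : ℝ) ≤ C + 1 by positivity)]

end CoupledProblem

/-! ### Elements of the closure of the test functions -/

theorem exists_eq_mkEnergy (h : EnergySpace n) :
    ∃ (v : Rn n → ℝ) (g : Rn n → Rn n) (d : Rn n × Rn n → ℝ) (hv : MemLp v 2 volume)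
      (hg : MemLp g 2 volume) (hd : MemLp d 2 volume), h = mkEnergy hv hg hd := by
  refine ⟨h.fst, h.snd.fst, h.snd.snd, Lp.memLp _, Lp.memLp _, Lp.memLp _, ?_⟩
  simp only [mkEnergy, Lp.toLp_coeFn]
  rfl

/-- The gradient part of a limit of Lipschitz functions is a weak gradient. -/
theorem hasWeakGradient_of_tendsto {V : Set (Rn n)} {v : Rn n → ℝ} {G : Rn n → Rn n}
    (hv : MemLp v 2 volume) (hG : MemLp G 2 volume) {w : ℕ → Rn n → ℝ}
    (hw : ∀ k, ∃ K : ℝ≥0, LipschitzWith K (w k))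
    (h₁ : ∀ ψ : Rn n → ℝ, MemLp ψ 2 volume →
      Tendsto (fun k => ∫ x, ψ x * w k x) atTop (𝓝 (∫ x, ψ x * v x)))
    (h₂ : ∀ φ e, IsTestFunction V φ → Tendsto (fun k => ∫ x,
      (inner ℝ (φ x • e) (gradient (w k) x) : ℝ)) atTop (𝓝 (∫ x, (inner ℝ (φ x • e) (G x) : ℝ)))) :
    HasWeakGradient V v G where
  locInt := (hv.locallyIntegrable (by norm_num)).locallyIntegrableOn V
  locInt_grad := (hG.locallyIntegrable (by norm_num)).locallyIntegrableOn V
  parts := by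
    intro φ hφ
    have hl := hφ.lipTest
    rw [setIntegral_eq_integral_of_forall_compl_eq_zero
        (fun x hx => by rw [hl.gradient_eq_zero hx, smul_zero]),
      setIntegral_eq_integral_of_forall_compl_eq_zero
        (fun x hx => by rw [hl.eq_zero hx, zero_smul])]
    have j : ∀ {u : Rn n → ℝ} {F : Rn n → Rn n}, MemLp u 2 volume → MemLp F 2 volume →
        Integrable (fun x => u x • F x) := fun hu hF => by
      have := hF.smul (p := 2) (q := 2) (r := 1) hu
      exact memLp_one_iff_integrable.1 this
    have i1 : Integrable (fun x => v x • gradient φ x) := j hv (hl.memLp_gradient 2)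
    have i2 : Integrable (fun x => φ x • G x) := j (hl.memLp 2) hG
    refine ext_inner_left ℝ fun e => ?_
    rw [inner_neg_right, ← integral_inner i1, ← integral_inner i2]
    have c1 := h₁ (fun x => inner ℝ e (gradient φ x)) ((hl.memLp_gradient 2).const_inner e)
    have c2 := (h₂ φ e hφ).neg
    have e1 : ∀ k, ∫ x, (inner ℝ e (gradient φ x) : ℝ) * w k x
        = -∫ x, (inner ℝ (φ x • e) (gradient (w k) x) : ℝ) := by
      intro k
      obtain ⟨K, hK⟩ := hw k
      obtain ⟨L, hL⟩ := hl.lip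
      have h3 := integral_smul_gradient_eq_neg hK hL hφ.compact
      have j1 : Integrable (fun x => w k x • gradient φ x) := by
        refine (integrableOn_iff_integrable_of_support_subset (s := tsupport φ) ?_).1
          ((memLp_one_iff_integrable.1 (hl.memLp_gradient 1)).integrableOn.continuousOn_smul
            hK.continuous.continuousOn hφ.compact.isCompact)
        intro x hx
        by_contra h0
        exact hx (by simp [gradient_eq_zero_of_notMem_tsupport h0])
      have j2 : Integrable (fun x => φ x • gradient (w k) x) := by
        refine (integrableOn_iff_integrable_of_support_subset (s := tsupport φ) ?_).1
          (((locallyIntegrable_gradient hK).integrableOn_isCompact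
            hφ.compact.isCompact).continuousOn_smul hL.continuous.continuousOn
              hφ.compact.isCompact)
        intro x hx
        by_contra h0
        exact hx (by simp [image_eq_zero_of_notMem_tsupport h0])
      have h4 := congrArg (fun z => (inner ℝ e z : ℝ)) h3
      simp only [inner_neg_right] at h4
      rw [← integral_inner j1, ← integral_inner j2] at h4
      simpa only [inner_smul_right, inner_smul_left, conj_trivial, mul_comm] using h4
    simp only [e1] at c1
    have := tendsto_nhds_unique c1 c2
    simpa only [inner_smul_right, inner_smul_left, conj_trivial, mul_comm] using this

namespace CoupledProblem

variable (P : CoupledProblem n)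

/-- The form 1 + τ⁻¹ covers τ = 0 as well: there 0⁻¹ = 0, so the inverse weight is zero off U₁ and
the bound is 1. -/
theorem abs_weight_inv_le {τ : ℝ} (h₀ : 0 ≤ τ) (x : Rn n) : |(P.weight τ x)⁻¹| ≤ 1 + τ⁻¹ := by
  have := inv_nonneg.2 h₀
  by_cases hx : x ∈ P.U₁
  · rw [P.weight_of_mem τ hx]; simpa using this
  · rw [P.weight_of_notMem τ hx, abs_of_nonneg this]; linarith

theorem memLp_weight_inv_smul' {τ : ℝ} (h₀ : 0 ≤ τ) {G : Rn n → Rn n}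
    (hG : MemLp G 2 volume) : MemLp (fun x => (P.weight τ x)⁻¹ • G x) 2 volume := by
  refine hG.of_le_mul (c := 1 + τ⁻¹) ((P.measurable_weight τ).inv.aestronglyMeasurable.smul hG.1)
    (Eventually.of_forall fun x => ?_)
  rw [norm_smul]
  exact mul_le_mul_of_nonneg_right (P.abs_weight_inv_le h₀ x) (norm_nonneg _)

theorem exists_seq_tendsto_J {τ : ℝ} (h₀ : 0 ≤ τ) (h₁ : τ ≤ 1) {h : EnergySpace n}
    (hh : h ∈ (LinearMap.range (P.J h₀ h₁)).topologicalClosure) :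
    ∃ w : ℕ → lipTest P.Ω, Tendsto (fun k => P.J h₀ h₁ (w k)) atTop (𝓝 h) := by
  rw [← SetLike.mem_coe, Submodule.topologicalClosure_coe, mem_closure_iff_seq_limit] at hh
  obtain ⟨y, hy, hyt⟩ := hh
  choose w hw using hy
  exact ⟨w, by simpa only [hw] using hyt⟩

theorem mkEnergy_tendsto_components {f : Rn n → ℝ} {G : Rn n → Rn n} {d : Rn n × Rn n → ℝ}
    (hf : MemLp f 2 volume) (hG : MemLp G 2 volume) (hd : MemLp d 2 volume)
    {f' : ℕ → Rn n → ℝ} {G' : ℕ → Rn n → Rn n} {d' : ℕ → Rn n × Rn n → ℝ}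
    (hf' : ∀ k, MemLp (f' k) 2 volume) (hG' : ∀ k, MemLp (G' k) 2 volume)
    (hd' : ∀ k, MemLp (d' k) 2 volume)
    (h : Tendsto (fun k => mkEnergy (hf' k) (hG' k) (hd' k)) atTop (𝓝 (mkEnergy hf hG hd))) :
    Tendsto (fun k => eLpNorm (f' k - f) 2 volume) atTop (𝓝 0) ∧
      Tendsto (fun k => eLpNorm (d' k - d) 2 volume) atTop (𝓝 0) := by
  have h1 := ((WithLp.prod_continuous_ofLp 2 _ _).tendsto _).comp h
  have h2 := ((continuous_fst).tendsto _).comp h1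
  have h3 := ((continuous_snd).tendsto _).comp h1
  have h4 := ((WithLp.prod_continuous_ofLp 2 _ _).tendsto _).comp h3
  have h5 := ((continuous_snd).tendsto _).comp h4
  exact ⟨(Lp.tendsto_Lp_iff_tendsto_eLpNorm'' _ hf' _ hf).1 h2,
    (Lp.tendsto_Lp_iff_tendsto_eLpNorm'' _ hd' _ hd).1 h5⟩

/-- Approximating test functions converge almost everywhere along a subsequence. This identifies the
third slot as the difference quotient of the first and forces vanishing off Ω; the representative is
cut by the indicator so that it vanishes there everywhere. For τ > 0 the gradient is recovered on
every set, for τ = 0 on U₁. -/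
theorem exists_repr_of_mem_closure {τ : ℝ} (h₀ : 0 ≤ τ) (h₁ : τ ≤ 1) {h : EnergySpace n}
    (hh : h ∈ (LinearMap.range (P.J h₀ h₁)).topologicalClosure) :
    ∃ (v : Rn n → ℝ) (g : Rn n → Rn n) (hv : MemLp v 2 volume) (hg : MemLp g 2 volume)
      (hd : MemLp (diffQuot P.s v) 2 volume), h = mkEnergy hv hg hd ∧ (∀ x ∉ P.Ω, v x = 0) ∧
        ∀ V : Set (Rn n), (∀ x ∈ V, P.weight τ x ≠ 0) →
          HasWeakGradient V v (fun x => (P.weight τ x)⁻¹ • g x) := by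
  obtain ⟨w, hw⟩ := P.exists_seq_tendsto_J h₀ h₁ hh
  obtain ⟨f, g, d, hf, hg, hd, rfl⟩ := exists_eq_mkEnergy h
  obtain ⟨c1, c3⟩ := mkEnergy_tendsto_components hf hg hd (fun k => (w k).2.memLp 2)
    (fun k => P.memLp_weight_smul h₀ h₁ ((w k).2.memLp_gradient 2))
    (fun k => (w k).2.memLp_diffQuot P.hn P.hs₀ P.hs₁) hw
  obtain ⟨ns, hns, cns⟩ := (tendstoInMeasure_of_tendsto_eLpNorm two_ne_zero
    (fun k => ((w k).2.memLp 2).1) hf.1 c1).exists_seq_tendsto_ae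
  obtain ⟨ms, hms, cms⟩ := (tendstoInMeasure_of_tendsto_eLpNorm two_ne_zero
    (fun k => ((w (ns k)).2.memLp_diffQuot P.hn P.hs₀ P.hs₁).1) hd.1
    (c3.comp hns.tendsto_atTop)).exists_seq_tendsto_ae
  have hΩm := P.hΩ.measurableSet
  have hfv : P.Ω.indicator f =ᵐ[volume] f := by
    filter_upwards [cns] with x hx
    by_cases hxΩ : x ∈ P.Ω
    · simp [hxΩ]
    · rw [Set.indicator_of_notMem hxΩ]
      have : ∀ k, (w (ns k) : Rn n → ℝ) x = 0 := fun k => (w (ns k)).2.eq_zero hxΩ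
      simp only [this] at hx
      exact tendsto_nhds_unique tendsto_const_nhds hx
  have hdv : d =ᵐ[volume] diffQuot P.s (P.Ω.indicator f) := by
    refine EventuallyEq.trans ?_ (diffQuot_congr_ae hfv.symm)
    have a1 : ∀ᵐ p : Rn n × Rn n, Tendsto (fun k => (w (ns k) : Rn n → ℝ) p.1) atTop (𝓝 (f p.1)) :=
      Measure.quasiMeasurePreserving_fst.ae cns
    have a2 : ∀ᵐ p : Rn n × Rn n, Tendsto (fun k => (w (ns k) : Rn n → ℝ) p.2) atTop (𝓝 (f p.2)) :=
      Measure.quasiMeasurePreserving_snd.ae cns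
    filter_upwards [cms, a1, a2] with p h1 h2 h3
    have h4 := ((h2.sub h3).mul_const (‖p.1 - p.2‖ ^ (-(((n : ℝ) + 2 * P.s) / 2)))).comp
      hms.tendsto_atTop
    exact tendsto_nhds_unique h1 h4
  have hv : MemLp (P.Ω.indicator f) 2 volume := hf.indicator hΩm
  refine ⟨P.Ω.indicator f, g, hv, hg, hd.ae_eq hdv,
    mkEnergy_congr _ _ _ _ _ _ hfv.symm EventuallyEq.rfl hdv,
    fun x hx => Set.indicator_of_notMem hx f, fun V hV => ?_⟩
  refine hasWeakGradient_of_tendsto (w := fun k => w k) hv (P.memLp_weight_inv_smul' h₀ hg)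
    (fun k => (w k).2.lip) (fun ψ hψ => ?_) (fun φ e hφ => ?_)
  · have h5 := (tendsto_const_nhds (x := mkEnergy hψ (G := fun _ => 0) MemLp.zero
      (d := fun _ => 0) MemLp.zero)).inner (𝕜 := ℝ) hw
    simp only [J, LinearMap.coe_mk, AddHom.coe_mk, inner_mkEnergy, zero_mul, integral_zero,
      inner_zero_left, add_zero] at h5
    have e : ∫ x, ψ x * P.Ω.indicator f x = ∫ x, ψ x * f x := by
      refine integral_congr_ae ?_
      filter_upwards [hfv] with x hx
      rw [hx]
    rwa [e]
  · have hψ : MemLp (fun x => (P.weight τ x)⁻¹ • φ x • e) 2 volume :=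
      P.memLp_weight_inv_smul' h₀ ((hφ.lipTest.memLp 2).of_le_mul (c := ‖e‖)
        (hφ.lipTest.continuous.smul continuous_const).aestronglyMeasurable
        (Eventually.of_forall fun x => by rw [norm_smul, mul_comm]))
    have h5 := (tendsto_const_nhds (x := mkEnergy (f := fun _ => 0) MemLp.zero hψ
      (d := fun _ => 0) MemLp.zero)).inner (𝕜 := ℝ) hw
    simp only [J, LinearMap.coe_mk, AddHom.coe_mk, inner_mkEnergy, zero_mul, integral_zero,
      zero_add, add_zero] at h5
    refine (h5.congr fun k => ?_).trans (le_of_eq ?_)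
    · refine integral_congr_ae (Eventually.of_forall fun x => ?_)
      simp only
      rw [real_inner_smul_left, real_inner_smul_right]
      by_cases hx : x ∈ V
      · rw [← mul_assoc, inv_mul_cancel₀ (hV x hx), one_mul]
      · simp [hφ.lipTest.eq_zero hx]
    · congr 1
      refine integral_congr_ae (Eventually.of_forall fun x => ?_)
      simp only
      rw [real_inner_smul_left, real_inner_smul_right]

end CoupledProblem

/-! ### Viscous approximations -/

namespace CoupledProblem

variable (P : CoupledProblem n)

/-- The right-hand side of the problem for `u - u₀`, with viscosity `τ ^ 2`. -/
def load (u₀ : Rn n → ℝ) (τ : ℝ) (ζ : Rn n → ℝ) : ℝ :=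
  (∫ x, (P.f x - inner ℝ (P.b x) (gradient u₀ x)) * ζ x)
    - (∫ x, (inner ℝ (P.A x (gradient u₀ x) + τ ^ 2 • gradient u₀ x) (gradient ζ x) : ℝ))
    - P.κ * ∫ p, P.a p * (diffQuot P.s u₀ p * diffQuot P.s ζ p)

variable {P} {u₀ : Rn n → ℝ} {M : ℝ}

theorem memLp_inner_b_of_bound {g : Rn n → Rn n} (hg : AEStronglyMeasurable g volume)
    (hb : ∀ x, ‖g x‖ ≤ M) : MemLp (fun x => (inner ℝ (P.b x) (g x) : ℝ)) 2 volume := by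
  refine P.b_memLp.of_le_mul (c := M) (P.b_memLp.1.inner hg) (Eventually.of_forall fun x => ?_)
  calc ‖(inner ℝ (P.b x) (g x) : ℝ)‖ ≤ ‖P.b x‖ * ‖g x‖ := norm_inner_le_norm _ _
    _ ≤ M * ‖P.b x‖ := by rw [mul_comm]; exact mul_le_mul_of_nonneg_right (hb x) (norm_nonneg _)

theorem _root_.LocalNonlocal.HasGrowth.norm_gradient_le {s : ℝ} (h : HasGrowth s M u₀)
    (x : Rn n) : ‖gradient u₀ x‖ ≤ M :=
  LocalNonlocal.norm_gradient_le h.lipschitz x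

/-- Outside U₁ only the viscous part survives and τ²/τ = τ ≤ 1, so dividing by the weight costs
nothing as τ → 0. -/
theorem norm_weight_inv_smul_flux_le {τ : ℝ} (h₀ : 0 < τ) (h₁ : τ ≤ 1) (x ξ : Rn n) :
    ‖(P.weight τ x)⁻¹ • (P.A x ξ + τ ^ 2 • ξ)‖ ≤ (P.Lam + 1) * ‖ξ‖ := by
  have hL := P.hLam
  have h2 : ‖τ ^ 2 • ξ‖ ≤ 1 * ‖ξ‖ := by
    rw [norm_smul, Real.norm_of_nonneg (by positivity)]
    exact mul_le_mul_of_nonneg_right (by nlinarith) (norm_nonneg _)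
  by_cases hx : x ∈ P.U₁
  · rw [P.weight_of_mem τ hx, inv_one, one_smul, add_mul]
    exact (norm_add_le _ _).trans (add_le_add (P.norm_A_apply_le x ξ) h2)
  · rw [P.weight_of_notMem τ hx, P.A_zero x hx, zero_apply, zero_add, smul_smul,
      norm_smul, sq, inv_mul_cancel_left₀ h₀.ne', Real.norm_of_nonneg h₀.le]
    exact mul_le_mul_of_nonneg_right (by linarith) (norm_nonneg _)

/-- The datum u₀ need not lie in the energy space, but tests vanish off Ω, so its gradient may be
cut to Ω and its difference quotient to pairs meeting Ω. The cut quantities are square integrable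
with bounds independent of τ. -/
theorem exists_rhs (hu : HasGrowth P.s M u₀) : ∃ B : ℝ, ∀ (τ : ℝ) (h₀ : 0 < τ) (h₁ : τ ≤ 1),
    ∃ r : EnergySpace n, ‖r‖ ≤ B ∧
      ∀ ζ : lipTest P.Ω, inner ℝ r (P.J h₀.le h₁ ζ) = P.load u₀ τ ζ := by
  have hΩm := P.hΩ.measurableSet
  have hL := P.hLam
  have hgm := (measurable_gradient u₀).aestronglyMeasurable (μ := volume)
  have hF : MemLp (fun x => P.f x - inner ℝ (P.b x) (gradient u₀ x)) 2 volume :=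
    P.f_memLp.sub (memLp_inner_b_of_bound hgm hu.norm_gradient_le)
  have hd : MemLp (fun p => P.κ * (P.a p * (cross P.Ω).indicator (diffQuot P.s u₀) p)) 2 volume :=
    P.memLp_a_mul ((memLp_indicator_iff_restrict (measurableSet_cross hΩm)).2
      (hu.memLp_diffQuot_cross P.hn P.hs₀ P.hs₁ P.hΩb hΩm))
  set B₂ := ∫ x, P.Ω.indicator (fun _ => ((P.Lam + 1) * M) ^ 2) x with hB₂
  set B := (∫ x, (P.f x - inner ℝ (P.b x) (gradient u₀ x)) ^ 2) + B₂ +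
    ∫ p, (P.κ * (P.a p * (cross P.Ω).indicator (diffQuot P.s u₀) p)) ^ 2
  refine ⟨√B, fun τ h₀ h₁ => ?_⟩
  have hfin : volume P.Ω ≠ ⊤ := P.hΩb.measure_lt_top.ne
  set G : Rn n → Rn n := P.Ω.indicator
    (fun x => (P.weight τ x)⁻¹ • (P.A x (gradient u₀ x) + τ ^ 2 • gradient u₀ x)) with hGdef
  have hGb : ∀ x, ‖G x‖ ≤ ‖P.Ω.indicator (fun _ => (P.Lam + 1) * M) x‖ := by
    intro x
    by_cases hx : x ∈ P.Ω
    · simp only [hGdef, hx, Set.indicator_of_mem]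
      rw [Real.norm_of_nonneg (mul_nonneg (by linarith) hu.nonneg)]
      exact (norm_weight_inv_smul_flux_le h₀ h₁ x _).trans
        (mul_le_mul_of_nonneg_left (hu.norm_gradient_le x) (by linarith))
    · simp [hGdef, hx]
  have hGm : AEStronglyMeasurable G volume :=
    (((P.measurable_weight τ).inv.aestronglyMeasurable).smul
      ((P.aestronglyMeasurable_A_apply hgm).add (hgm.const_smul (τ ^ 2)))).indicator hΩm
  have hG : MemLp G 2 volume :=
    (memLp_indicator_const 2 hΩm ((P.Lam + 1) * M) (Or.inr hfin)).of_le hGm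
      (Eventually.of_forall hGb)
  refine ⟨mkEnergy hF hG.neg hd.neg, Real.le_sqrt_of_sq_le ?_, fun ζ => ?_⟩
  · rw [norm_sq_mkEnergy]
    simp only [Pi.neg_apply, norm_neg, neg_sq]
    refine add_le_add (add_le_add le_rfl ?_) le_rfl
    refine integral_mono (hG.integrable_norm_pow two_ne_zero) ?_ fun x => ?_
    · exact (integrableOn_const hfin).integrable_indicator hΩm
    · have h3 := hGb x
      by_cases hx : x ∈ P.Ω
      · simp only [hx, Set.indicator_of_mem] at h3 ⊢
        rw [Real.norm_of_nonneg (mul_nonneg (by linarith) hu.nonneg)] at h3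
        exact pow_le_pow_left₀ (norm_nonneg _) h3 2
      · simp [hGdef, hx]
  · change inner ℝ _ (mkEnergy _ _ _) = _
    rw [inner_mkEnergy, load, sub_eq_add_neg, sub_eq_add_neg, ← integral_neg,
      ← integral_const_mul, ← integral_neg]
    congr 1
    · congr 1
      refine integral_congr_ae (Eventually.of_forall fun x => ?_)
      simp only [Pi.neg_apply, inner_neg_left, hGdef]
      by_cases hx : x ∈ P.Ω
      · rw [Set.indicator_of_mem hx, real_inner_smul_left, real_inner_smul_right, ← mul_assoc,
          inv_mul_cancel₀ (P.weight_pos h₀ x).ne', one_mul]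
      · simp [ζ.2.gradient_eq_zero hx]
    · refine integral_congr_ae (Eventually.of_forall fun p => ?_)
      simp only [Pi.neg_apply]
      by_cases hp : p ∈ cross P.Ω
      · rw [Set.indicator_of_mem hp]; ring
      · simp [diffQuot_eq_zero_of_notMem_cross (fun x hx => ζ.2.eq_zero hx) hp]

/-- `v` with gradient `G` is the solution of the problem with viscosity `τ ^ 2`, minus `u₀`. -/
structure IsViscous (P : CoupledProblem n) (u₀ : Rn n → ℝ) (B τ : ℝ) (h₀ : 0 < τ) (h₁ : τ ≤ 1)
    (v : Rn n → ℝ) (G : Rn n → Rn n) : Prop where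
  memLp : MemLp v 2 volume
  memLp_grad : MemLp G 2 volume
  memLp_diffQuot : MemLp (diffQuot P.s v) 2 volume
  eq_zero : ∀ x ∉ P.Ω, v x = 0
  hasWeakGradient : ∀ V, HasWeakGradient V v G
  mem_closure : mkEnergy memLp (P.memLp_weight_smul h₀.le h₁ memLp_grad) memLp_diffQuot ∈
    (LinearMap.range (P.J h₀.le h₁)).topologicalClosure
  norm_le : ‖mkEnergy memLp (P.memLp_weight_smul h₀.le h₁ memLp_grad) memLp_diffQuot‖ ≤ B
  eqn : ∀ ζ : lipTest P.Ω, inner ℝ (P.R h₀ h₁ ζ)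
    (mkEnergy memLp (P.memLp_weight_smul h₀.le h₁ memLp_grad) memLp_diffQuot) = P.load u₀ τ ζ

theorem exists_isViscous (hu : HasGrowth P.s M u₀) : ∃ B : ℝ, ∀ (τ : ℝ) (h₀ : 0 < τ) (h₁ : τ ≤ 1),
    ∃ v G, IsViscous P u₀ B τ h₀ h₁ v G := by
  obtain ⟨B, hB⟩ := exists_rhs hu
  obtain ⟨c, hc, hcoer⟩ := P.exists_coercive
  refine ⟨B / c, fun τ h₀ h₁ => ?_⟩
  obtain ⟨r, hr, hrJ⟩ := hB τ h₀ h₁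
  obtain ⟨h, hmem, hnorm, heq⟩ := exists_lions (P.J h₀.le h₁) (P.R h₀ h₁) r hc (hcoer τ h₀ h₁)
  obtain ⟨v, g, hv, hg, hd, rfl, hz, hw⟩ := P.exists_repr_of_mem_closure h₀.le h₁ hmem
  have hG := P.memLp_weight_inv_smul h₀ h₁ hg
  have e : mkEnergy hv (P.memLp_weight_smul h₀.le h₁ hG) hd = mkEnergy hv hg hd :=
    mkEnergy_congr _ _ _ _ _ _ EventuallyEq.rfl (Eventually.of_forall fun x => by
      simp only
      rw [smul_smul, mul_inv_cancel₀ (P.weight_pos h₀ x).ne', one_smul]) EventuallyEq.rfl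
  exact ⟨v, _, hv, hG, hd, hz, fun V => hw V fun x _ => (P.weight_pos h₀ x).ne', by rwa [e],
    by rw [e]; exact hnorm.trans (by gcongr), fun ζ => by rw [e, heq, hrJ]⟩

variable {B τ : ℝ} {h₀ : 0 < τ} {h₁ : τ ≤ 1} {v : Rn n → ℝ} {G : Rn n → Rn n}

theorem _root_.LocalNonlocal.LipTest.memLp_inner_b {ζ : Rn n → ℝ} (hζ : LipTest P.Ω ζ) :
    MemLp (fun x => (inner ℝ (P.b x) (gradient ζ x) : ℝ)) 2 volume := by
  obtain ⟨K, hK⟩ := hζ.lip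
  exact memLp_inner_b_of_bound (measurable_gradient ζ).aestronglyMeasurable
    (LocalNonlocal.norm_gradient_le hK)

theorem integral_inner_smul_b_add {ζ w : Rn n → ℝ} (hζ : LipTest P.Ω ζ)
    (hw : ∃ K : ℝ≥0, LipschitzWith K w) :
    ∫ x, ((inner ℝ (ζ x • P.b x) (gradient w x) : ℝ) + inner ℝ (P.b x) (gradient ζ x) * w x)
      = 0 := by
  obtain ⟨K, hK⟩ := hw
  rw [← P.b_div _ (hζ.mul_lipschitz hK)]
  refine integral_congr_ae ?_
  filter_upwards [hζ.ae_differentiableAt, hK.ae_differentiableAt] with x h1 h2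
  rw [gradient_mul h1 h2, inner_add_right, real_inner_smul_left, real_inner_smul_right,
    real_inner_smul_right, mul_comm (w x)]

/-- The identity holds for the Lipschitz approximations of v by div b = 0. Both sides are pairings
with fixed L² functions, since ζ and its gradient are bounded, and so they pass to the limit. This
turns the skew drift of `R` into the drift of the weak formulation. -/
theorem IsViscous.integral_inner_smul_b (h : IsViscous P u₀ B τ h₀ h₁ v G) {ζ : Rn n → ℝ}
    (hζ : LipTest P.Ω ζ) : ∫ x, (inner ℝ (ζ x • P.b x) (G x) : ℝ)
      = -∫ x, v x * inner ℝ (P.b x) (gradient ζ x) := by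
  obtain ⟨w, hw⟩ := P.exists_seq_tendsto_J h₀.le h₁ h.mem_closure
  have c1 := (tendsto_const_nhds (x := mkEnergy hζ.memLp_inner_b
    (P.memLp_weight_inv_smul h₀ h₁ (P.memLp_smul_b hζ)) (d := fun _ => 0) MemLp.zero)).inner
    (𝕜 := ℝ) hw
  simp only [J, LinearMap.coe_mk, AddHom.coe_mk, inner_mkEnergy, zero_mul, integral_zero,
      add_zero] at c1
  have e : ∀ x ξ, (inner ℝ ((P.weight τ x)⁻¹ • ζ x • P.b x) (P.weight τ x • ξ) : ℝ)
      = inner ℝ (ζ x • P.b x) ξ := by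
    intro x ξ
    rw [real_inner_smul_left, real_inner_smul_right, ← mul_assoc,
      inv_mul_cancel₀ (P.weight_pos h₀ x).ne', one_mul]
  simp only [e] at c1
  have e2 : ∀ k, (∫ x, (inner ℝ (P.b x) (gradient ζ x) : ℝ) * (w k : Rn n → ℝ) x) +
      ∫ x, (inner ℝ (ζ x • P.b x) (gradient (w k : Rn n → ℝ) x) : ℝ) = 0 := by
    intro k
    have i1 : Integrable fun x => (inner ℝ (P.b x) (gradient ζ x) : ℝ) * (w k : Rn n → ℝ) x :=
      hζ.memLp_inner_b.integrable_mul ((w k).2.memLp 2)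
    rw [← integral_add i1
      (integrable_inner_of_memLp (P.memLp_smul_b hζ) ((w k).2.memLp_gradient 2)),
      ← integral_inner_smul_b_add hζ (w k).2.lip]
    exact integral_congr_ae (Eventually.of_forall fun x => add_comm _ _)
  simp only [e2] at c1
  have := tendsto_nhds_unique c1 tendsto_const_nhds
  simp_rw [mul_comm (v _)]
  linarith

theorem IsViscous.equation (h : IsViscous P u₀ B τ h₀ h₁ v G) {ζ : Rn n → ℝ}
    (hζ : LipTest P.Ω ζ) :
    (∫ x, (inner ℝ (P.A x (G x)) (gradient ζ x) : ℝ))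
      + τ ^ 2 * (∫ x, (inner ℝ (G x) (gradient ζ x) : ℝ))
      - (∫ x, v x * inner ℝ (P.b x) (gradient ζ x))
      + P.κ * ∫ p, P.a p * (diffQuot P.s v p * diffQuot P.s ζ p) = P.load u₀ τ ζ := by
  have h1 := h.eqn ⟨ζ, hζ⟩
  rw [P.inner_R] at h1
  rw [← h1, sub_eq_add_neg, ← h.integral_inner_smul_b hζ, ← integral_const_mul (τ ^ 2)]
  have hg := hζ.memLp_gradient 2
  have i1 := integrable_inner_of_memLp (P.memLp_A_apply h.memLp_grad) hg
  have i2 := (integrable_inner_of_memLp h.memLp_grad hg).const_mul (τ ^ 2)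
  have i3 : Integrable fun x => (inner ℝ (P.A x (G x)) (gradient ζ x) : ℝ)
    + τ ^ 2 * inner ℝ (G x) (gradient ζ x) := i1.add i2
  rw [← integral_add i1 i2,
    ← integral_add i3 (integrable_inner_of_memLp (P.memLp_smul_b hζ) h.memLp_grad)]
  congr 1
  · refine integral_congr_ae (Eventually.of_forall fun x => ?_)
    simp only [flux, inner_add_left, real_inner_smul_left]
    rw [P.A_symm]
    simp only [real_inner_comm (G x)]
  · simp_rw [mul_comm (diffQuot P.s ζ _)]

end CoupledProblem

/-! ### Weak compactness and lower semicontinuity -/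

/-- The closed span of the sequence is separable, so the sequential Banach–Alaoglu theorem applies
in it; a general z is tested through its orthogonal projection. -/
theorem exists_weak_subseq {H : Type*} [NormedAddCommGroup H] [InnerProductSpace ℝ H]
    [CompleteSpace H] {x : ℕ → H} {B : ℝ} (hB : ∀ k, ‖x k‖ ≤ B) :
    ∃ (y : H) (ns : ℕ → ℕ), StrictMono ns ∧
      ∀ z, Tendsto (fun k => (inner ℝ (x (ns k)) z : ℝ)) atTop (𝓝 (inner ℝ y z)) := by
  set W := (Submodule.span ℝ (Set.range x)).topologicalClosure with hWdef
  have hxW : ∀ k, x k ∈ W := fun k =>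
    Submodule.le_topologicalClosure _ (Submodule.subset_span ⟨k, rfl⟩)
  have hWc : IsClosed (W : Set H) := Submodule.isClosed_topologicalClosure _
  have : CompleteSpace W := hWc.completeSpace_coe
  have hsep : TopologicalSpace.IsSeparable (W : Set H) := by
    rw [hWdef, Submodule.topologicalClosure_coe]
    exact ((Set.countable_range x).isSeparable.span (R := ℝ)).closure
  have : TopologicalSpace.SeparableSpace W := hsep.separableSpace
  let x' : ℕ → W := fun k => ⟨x k, hxW k⟩
  let φ : ℕ → WeakDual ℝ W := fun k =>
    StrongDual.toWeakDual (InnerProductSpace.toDual ℝ W (x' k))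
  have hφ : ∀ k, φ k ∈ WeakDual.toStrongDual ⁻¹' Metric.closedBall (0 : StrongDual ℝ W) B := by
    intro k
    refine (mem_closedBall_zero_iff (E := StrongDual ℝ W)).2 (le_trans (le_of_eq ?_) (hB k))
    exact LinearIsometryEquiv.norm_map (InnerProductSpace.toDual ℝ W) (x' k)
  obtain ⟨a, -, ns, hns, hlim⟩ := WeakDual.isSeqCompact_closedBall ℝ W 0 B hφ
  set y : W := (InnerProductSpace.toDual ℝ W).symm (WeakDual.toStrongDual a)
  refine ⟨y, ns, hns, fun z => ?_⟩
  have h1 := ((WeakDual.eval_continuous (W.orthogonalProjectionOnto z)).tendsto a).comp hlim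
  have h2 : ∀ w : W, (inner ℝ (w : H) z : ℝ) = inner ℝ w (W.orthogonalProjectionOnto z) :=
    fun w => (Submodule.inner_orthogonalProjectionOnto_eq_of_mem_left w z).symm
  have h3 : (inner ℝ (y : H) z : ℝ) = a (W.orthogonalProjectionOnto z) := by
    rw [h2, InnerProductSpace.toDual_symm_apply]; rfl
  rw [h3]
  refine h1.congr fun k => ?_
  exact (h2 (x' (ns k))).symm

/-- Orthogonality to each element of the orthogonal complement survives weak limits, and a closed
subspace is its own double complement. -/
theorem mem_of_weak_tendsto {H : Type*} [NormedAddCommGroup H] [InnerProductSpace ℝ H]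
    [CompleteSpace H] {W : Submodule ℝ H} (hW : IsClosed (W : Set H)) {x : ℕ → H} {y : H}
    (hx : ∀ k, x k ∈ W)
    (h : ∀ z, Tendsto (fun k => (inner ℝ (x k) z : ℝ)) atTop (𝓝 (inner ℝ y z))) : y ∈ W := by
  have : CompleteSpace W := hW.completeSpace_coe
  rw [← W.orthogonal_orthogonal, Submodule.mem_orthogonal']
  intro z hz
  have h1 := h z
  simp only [fun k => (Submodule.mem_orthogonal _ _).1 hz _ (hx k)] at h1
  exact tendsto_nhds_unique h1 tendsto_const_nhds

theorem tendsto_integral_mul_of_tendsto_eLpNorm {α : Type*} [MeasurableSpace α] {μ : Measure α}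
    {z : ℕ → α → ℝ} {v ψ : α → ℝ} (hz : ∀ k, MemLp (z k) 2 μ) (hv : MemLp v 2 μ)
    (hψ : MemLp ψ 2 μ) (h : Tendsto (fun k => eLpNorm (z k - v) 2 μ) atTop (𝓝 0)) :
    Tendsto (fun k => ∫ x, ψ x * z k x ∂μ) atTop (𝓝 (∫ x, ψ x * v x ∂μ)) := by
  have h1 := (tendsto_const_nhds (x := hψ.toLp ψ)).inner (𝕜 := ℝ)
    ((Lp.tendsto_Lp_iff_tendsto_eLpNorm'' z hz v hv).2 h)
  simp only [inner_toLp, RCLike.inner_apply, conj_trivial] at h1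
  simpa only [mul_comm] using h1

/-- Lower semicontinuity of the energy along sequences of Lipschitz functions. -/
theorem exists_hasWeakGradient_of_energy_le {s κ : ℝ} (hκ : 0 < κ) {U₁ U₂ Ω : Set (Rn n)}
    (hU₁ : IsOpen U₁) {z : ℕ → Rn n → ℝ} (hz : ∀ k, LipTest Ω (z k))
    (hd : ∀ k, MemLp (diffQuot s (z k)) 2 volume) {v : Rn n → ℝ} (hv : MemLp v 2 volume)
    (hlim : Tendsto (fun k => eLpNorm (z k - v) 2 volume) atTop (𝓝 0)) {r : ℕ → ℝ} {r' : ℝ}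
    (hr : Tendsto r atTop (𝓝 r'))
    (hle : ∀ k, (∫ x in U₁, ‖gradient (z k) x‖ ^ 2)
      + κ * ∫ p in U₂ ×ˢ Set.univ, diffQuot s (z k) p ^ 2 ≤ r k) :
    ∃ g : Rn n → Rn n, HasWeakGradient U₁ v g ∧ MemLp g 2 volume ∧
      (∫⁻ x in U₁, ‖g x‖ₑ ^ 2) + ENNReal.ofReal κ *
        ∫⁻ p in U₂ ×ˢ Set.univ, ‖diffQuot s v p‖ₑ ^ 2 ≤ ENNReal.ofReal r' := by
  obtain ⟨ns, hns, cns⟩ := (tendstoInMeasure_of_tendsto_eLpNorm two_ne_zero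
    (fun k => ((hz k).memLp 2).1) hv.1 hlim).exists_seq_tendsto_ae
  have hU₁m := hU₁.measurableSet
  have hg : ∀ k, MemLp (U₁.indicator (gradient (z k))) 2 volume :=
    fun k => ((hz k).memLp_gradient 2).indicator hU₁m
  have hA : ∀ k, ‖(hg k).toLp _‖ ^ 2 = ∫ x in U₁, ‖gradient (z k) x‖ ^ 2 := by
    intro k
    rw [← real_inner_self_eq_norm_sq, inner_toLp, ← integral_indicator hU₁m]
    refine integral_congr_ae (Eventually.of_forall fun x => ?_)
    by_cases hx : x ∈ U₁ <;> simp [hx]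
  have hN0 : ∀ k, 0 ≤ ∫ p in U₂ ×ˢ Set.univ, diffQuot s (z k) p ^ 2 := fun k =>
    integral_nonneg fun p => sq_nonneg _
  obtain ⟨C, hC⟩ := hr.bddAbove_range
  have hbd : ∀ k, ‖(hg (ns k)).toLp _‖ ≤ √C := by
    intro k
    refine Real.le_sqrt_of_sq_le ?_
    rw [hA]
    have := hC ⟨ns k, rfl⟩
    nlinarith [hle (ns k), mul_nonneg hκ.le (hN0 (ns k))]
  obtain ⟨y, ms, hms, hy⟩ := exists_weak_subseq hbd
  set js := fun k => ns (ms k) with hjs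
  have hjt : Tendsto js atTop atTop := hns.tendsto_atTop.comp hms.tendsto_atTop
  have hymem : MemLp (y : Rn n → Rn n) 2 volume := Lp.memLp y
  have hyeq : hymem.toLp _ = y := Lp.toLp_coeFn _ _
  refine ⟨y, ?_, hymem, ?_⟩
  · refine hasWeakGradient_of_tendsto (w := fun k => z (js k)) hv hymem (fun k => (hz _).lip)
      (fun ψ hψ => tendsto_integral_mul_of_tendsto_eLpNorm (fun k => (hz _).memLp 2) hv hψ
        (hlim.comp hjt)) (fun φ e hφ => ?_)
    have hψ : MemLp (fun x => φ x • e) 2 volume := (hφ.lipTest.memLp 2).of_le_mul (c := ‖e‖)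
        (hφ.lipTest.continuous.smul continuous_const).aestronglyMeasurable
        (Eventually.of_forall fun x => by rw [norm_smul, mul_comm])
    have h1 := hy (hψ.toLp _)
    rw [← hyeq, inner_toLp] at h1
    simp only [inner_toLp] at h1
    simp only [real_inner_comm (φ _ • e)] at h1 ⊢
    refine h1.congr fun k => integral_congr_ae (Eventually.of_forall fun x => ?_)
    by_cases hx : x ∈ U₁
    · simp [hx, hjs]
    · simp [hφ.lipTest.eq_zero hx]
  -- The sum of the two energies has to be semicontinuous jointly. As ‖g_k‖² ≥ 2⟨g_k, y⟩ - ‖y‖², the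
  -- nonlocal part has at most r_k - 2⟨g_k, y⟩ + ‖y‖² left, which tends to r' - ‖y‖²; Fatou then
  -- handles the nonlocal part alone.
  · have hN : ∀ k, ∫⁻ p in U₂ ×ˢ Set.univ, ‖diffQuot s (z (js k)) p‖ₑ ^ 2
        ≤ ENNReal.ofReal ((r (js k) - 2 * inner ℝ ((hg (js k)).toLp _) y + ‖y‖ ^ 2) / κ) := by
      intro k
      have h0 := ofReal_integral_norm_sq
        ((hd (js k)).restrict (U₂ ×ˢ (Set.univ : Set (Rn n))))
      simp only [Real.norm_eq_abs, sq_abs] at h0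
      rw [← h0]
      refine ENNReal.ofReal_le_ofReal ?_
      rw [le_div_iff₀ hκ]
      have h1 := hle (js k)
      rw [← hA] at h1
      have h2 := norm_sub_sq_real ((hg (js k)).toLp _) y
      nlinarith [sq_nonneg ‖(hg (js k)).toLp _ - y‖]
    have hlimR : Tendsto (fun k => ENNReal.ofReal
        ((r (js k) - 2 * inner ℝ ((hg (js k)).toLp _) y + ‖y‖ ^ 2) / κ)) atTop
        (𝓝 (ENNReal.ofReal ((r' - 2 * inner ℝ y y + ‖y‖ ^ 2) / κ))) :=
      ENNReal.tendsto_ofReal ((((hr.comp hjt).sub ((hy y).const_mul 2)).add_const _).div_const κ)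
    rw [real_inner_self_eq_norm_sq] at hlimR
    have hlow : ‖y‖ ^ 2 ≤ r' := by
      have h1 : Tendsto (fun k => 2 * (inner ℝ ((hg (js k)).toLp _) y : ℝ) - ‖y‖ ^ 2) atTop
        (𝓝 (2 * inner ℝ y y - ‖y‖ ^ 2)) := ((hy y).const_mul 2).sub_const _
      rw [real_inner_self_eq_norm_sq] at h1
      have h2 := le_of_tendsto_of_tendsto h1 (hr.comp hjt) (Eventually.of_forall fun k => ?_)
      · linarith
      · have h3 := hle (js k)
        rw [← hA] at h3
        have h2 := norm_sub_sq_real ((hg (js k)).toLp _) y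
        simp only [Function.comp]
        nlinarith [sq_nonneg ‖(hg (js k)).toLp _ - y‖, mul_nonneg hκ.le (hN0 (js k))]
    have hF : ∫⁻ p in U₂ ×ˢ Set.univ, ‖diffQuot s v p‖ₑ ^ 2
        ≤ ENNReal.ofReal ((r' - ‖y‖ ^ 2) / κ) := by
      have a1 : ∀ᵐ p : Rn n × Rn n, Tendsto (fun k => z (ns k) p.1) atTop (𝓝 (v p.1)) :=
        Measure.quasiMeasurePreserving_fst.ae cns
      have a2 : ∀ᵐ p : Rn n × Rn n, Tendsto (fun k => z (ns k) p.2) atTop (𝓝 (v p.2)) :=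
        Measure.quasiMeasurePreserving_snd.ae cns
      calc _ = ∫⁻ p in U₂ ×ˢ Set.univ,
            liminf (fun k => ‖diffQuot s (z (js k)) p‖ₑ ^ 2) atTop := by
            refine lintegral_congr_ae (ae_restrict_of_ae ?_)
            filter_upwards [a1, a2] with p h1 h2
            have h3 := (((h1.sub h2).mul_const
              (‖p.1 - p.2‖ ^ (-(((n : ℝ) + 2 * s) / 2)))).comp hms.tendsto_atTop).enorm
            exact ((((ENNReal.continuous_pow 2).tendsto _).comp h3).liminf_eq).symm
        _ ≤ liminf (fun k => ∫⁻ p in U₂ ×ˢ Set.univ, ‖diffQuot s (z (js k)) p‖ₑ ^ 2) atTop :=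
            lintegral_liminf_le' fun k => ((hd _).1.enorm.pow_const 2).restrict
        _ ≤ liminf (fun k => ENNReal.ofReal
            ((r (js k) - 2 * inner ℝ ((hg (js k)).toLp _) y + ‖y‖ ^ 2) / κ)) atTop :=
            liminf_le_liminf (Eventually.of_forall hN)
        _ = _ := by rw [hlimR.liminf_eq]; congr 2; ring
    calc _ ≤ ENNReal.ofReal (‖y‖ ^ 2) + ENNReal.ofReal κ *
          ENNReal.ofReal ((r' - ‖y‖ ^ 2) / κ) := by
          refine add_le_add ?_ (mul_le_mul_right hF _)
          refine (setLIntegral_le_lintegral _ _).trans (le_of_eq ?_)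
          rw [← ofReal_integral_norm_sq hymem, ← real_inner_self_eq_norm_sq y]
          conv_rhs => rw [← hyeq, inner_toLp]
          simp_rw [real_inner_self_eq_norm_sq]
      _ = _ := by
          rw [← ENNReal.ofReal_mul hκ.le, mul_div_cancel₀ _ hκ.ne', ← ENNReal.ofReal_add
            (by positivity) (by linarith)]
          congr 1; ring

/-! ### Compactness -/

/-- Jensen on the ball, followed by a bound of the kernel from below there. The factor behaves like
h^(2s), so replacing a function by its local averages is uniformly good on bounded sets of H^s. -/
theorem enorm_sub_average_sq_le {s : ℝ} (hs : 0 < s) {v : Rn n → ℝ} (hv : MemLp v 2 volume)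
    {h : ℝ} (hh : 0 < h) (x : Rn n) :
    ‖v x - (volume.real (Metric.ball x h))⁻¹ * ∫ y in Metric.ball x h, v y‖ₑ ^ 2
      ≤ (volume (Metric.ball (0 : Rn n) h))⁻¹ * ENNReal.ofReal (h ^ ((n : ℝ) + 2 * s)) *
        ∫⁻ y, ‖diffQuot s v (x, y)‖ₑ ^ 2 := by
  have hfin : volume (Metric.ball x h) ≠ ⊤ := measure_ball_lt_top.ne
  have hpos : volume (Metric.ball x h) ≠ 0 := (Metric.measure_ball_pos _ _ hh).ne'
  have hball : volume (Metric.ball (0 : Rn n) h) = volume (Metric.ball x h) :=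
    (Measure.addHaar_ball_center volume x h).symm
  rw [hball]
  set μ : Measure (Rn n) := (volume (Metric.ball x h))⁻¹ • volume.restrict (Metric.ball x h)
    with hμ
  have hprob : IsProbabilityMeasure μ := ⟨by
    rw [hμ, Measure.smul_apply, Measure.restrict_apply_univ, smul_eq_mul,
      ENNReal.inv_mul_cancel hpos hfin]⟩
  have hvm : AEStronglyMeasurable v μ := (hv.1.restrict).smul_measure _
  have : IsFiniteMeasure (volume.restrict (Metric.ball x h)) :=
    ⟨by rw [Measure.restrict_apply_univ]; exact hfin.lt_top⟩
  have hvi : Integrable v μ :=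
    (memLp_one_iff_integrable.1 ((hv.restrict (Metric.ball x h)).mono_exponent
      (by norm_num))).smul_measure (ENNReal.inv_ne_top.2 hpos)
  have e1 : v x - (volume.real (Metric.ball x h))⁻¹ * ∫ y in Metric.ball x h, v y
      = ∫ y, (v x - v y) ∂μ := by
    rw [integral_sub (integrable_const _) hvi, integral_const, probReal_univ, one_smul, hμ,
      integral_smul_measure, ENNReal.toReal_inv, smul_eq_mul]
    rfl
  rw [e1]
  have h2 : ‖∫ y, (v x - v y) ∂μ‖ₑ ≤ eLpNorm (fun y => v x - v y) 2 μ := by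
    refine (enorm_integral_le_lintegral_enorm _).trans ?_
    rw [← eLpNorm_one_eq_lintegral_enorm]
    exact eLpNorm_le_eLpNorm_of_exponent_le (by norm_num)
      (aestronglyMeasurable_const.sub hvm)
  calc _ ≤ eLpNorm (fun y => v x - v y) 2 μ ^ 2 := by gcongr
    _ = (volume (Metric.ball x h))⁻¹ * ∫⁻ y in Metric.ball x h, ‖v x - v y‖ₑ ^ 2 := by
        rw [eLpNorm_two_sq, hμ, lintegral_smul_measure, smul_eq_mul]
    _ ≤ (volume (Metric.ball x h))⁻¹ * ∫⁻ y in Metric.ball x h,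
          ENNReal.ofReal (h ^ ((n : ℝ) + 2 * s)) * ‖diffQuot s v (x, y)‖ₑ ^ 2 := by
        gcongr 1
        refine setLIntegral_mono' measurableSet_ball fun y hy => ?_
        refine enorm_sub_sq_le_diffQuot hs v ?_
        rw [Metric.mem_ball, dist_comm, dist_eq_norm] at hy
        exact hy.le
    _ ≤ (volume (Metric.ball x h))⁻¹ * ∫⁻ y,
          ENNReal.ofReal (h ^ ((n : ℝ) + 2 * s)) * ‖diffQuot s v (x, y)‖ₑ ^ 2 := by
        gcongr 1
        exact setLIntegral_le_lintegral _ _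
    _ = _ := by
        rw [lintegral_const_mul' _ _ ENNReal.ofReal_ne_top, mul_assoc]

theorem tendsto_ball_inv_mul_rpow {s : ℝ} (hn : 1 ≤ n) (hs : 0 < s) :
    Tendsto (fun h : ℝ => (volume (Metric.ball (0 : Rn n) h))⁻¹ *
      ENNReal.ofReal (h ^ ((n : ℝ) + 2 * s))) (𝓝[>] 0) (𝓝 0) := by
  have : Nontrivial (Rn n) := by
    have : Nonempty (Fin n) := ⟨⟨0, hn⟩⟩
    infer_instance
  have h1 : Tendsto (fun h : ℝ => (volume (Metric.ball (0 : Rn n) 1))⁻¹ *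
      ENNReal.ofReal (h ^ (2 * s))) (𝓝[>] 0) (𝓝 0) := by
    have h2 : Tendsto (fun h : ℝ => h ^ (2 * s)) (𝓝[>] 0) (𝓝 0) := by
      have := (Real.continuousAt_rpow_const 0 (2 * s) (Or.inr (by positivity))).tendsto
      rw [Real.zero_rpow (by positivity)] at this
      exact this.mono_left nhdsWithin_le_nhds
    have h3 := ENNReal.Tendsto.const_mul (a := (volume (Metric.ball (0 : Rn n) 1))⁻¹)
      (ENNReal.tendsto_ofReal h2)
      (Or.inr (ENNReal.inv_ne_top.2 (Metric.measure_ball_pos _ _ one_pos).ne'))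
    simpa using h3
  refine h1.congr' ?_
  filter_upwards [self_mem_nhdsWithin] with h hh
  have hh : 0 < h := hh
  rw [Measure.addHaar_ball _ _ hh.le, finrank_euclideanSpace_fin, Real.rpow_add hh,
    Real.rpow_natCast, ENNReal.ofReal_mul (by positivity),
    ENNReal.mul_inv (Or.inr measure_ball_lt_top.ne)
      (Or.inr (Metric.measure_ball_pos _ _ one_pos).ne')]
  have h0 : ENNReal.ofReal (h ^ n) ≠ 0 := by
    rw [ENNReal.ofReal_ne_zero_iff]; positivity
  calc (volume (Metric.ball (0 : Rn n) 1))⁻¹ * ENNReal.ofReal (h ^ (2 * s))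
      = ((ENNReal.ofReal (h ^ n))⁻¹ * ENNReal.ofReal (h ^ n)) *
        ((volume (Metric.ball (0 : Rn n) 1))⁻¹ * ENNReal.ofReal (h ^ (2 * s))) := by
        rw [ENNReal.inv_mul_cancel h0 ENNReal.ofReal_ne_top, one_mul]
    _ = _ := by ring

/-- A sequence bounded in `H^s`, supported in a bounded set and weakly null, is strongly null. -/
theorem tendsto_eLpNorm_of_weak {s : ℝ} (hn : 1 ≤ n) (hs : 0 < s) {Ω : Set (Rn n)}
    (hΩ : Bornology.IsBounded Ω) (hΩm : MeasurableSet Ω) {v : ℕ → Rn n → ℝ}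
    (hv : ∀ k, MemLp (v k) 2 volume) (hz : ∀ k, ∀ x ∉ Ω, v k x = 0) {B : ℝ≥0}
    (hB : ∀ k, eLpNorm (v k) 2 volume ≤ B)
    (hD : ∀ k, ∫⁻ p, ‖diffQuot s (v k) p‖ₑ ^ 2 ≤ B)
    (hw : ∀ ψ : Rn n → ℝ, MemLp ψ 2 volume →
      Tendsto (fun k => ∫ x, ψ x * v k x) atTop (𝓝 0)) :
    Tendsto (fun k => eLpNorm (v k) 2 volume) atTop (𝓝 0) := by
  have hfin : volume Ω ≠ ⊤ := hΩ.measure_lt_top.ne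
  have key : ∀ h : ℝ, 0 < h → limsup (fun k => eLpNorm (v k) 2 volume ^ 2) atTop
      ≤ 2 * ((volume (Metric.ball (0 : Rn n) h))⁻¹ *
        ENNReal.ofReal (h ^ ((n : ℝ) + 2 * s)) * B) := by
    intro h hh
    set m : ℕ → Rn n → ℝ := fun k x =>
      (volume.real (Metric.ball x h))⁻¹ * ∫ y in Metric.ball x h, v k y with hm
    have hfb : ∀ x : Rn n, volume (Metric.ball x h) ≠ ⊤ := fun x => measure_ball_lt_top.ne
    have hind : ∀ x : Rn n, MemLp ((Metric.ball x h).indicator fun _ => (1 : ℝ)) 2 volume :=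
      fun x => memLp_indicator_const 2 measurableSet_ball 1 (Or.inr (hfb x))
    have hm2 : ∀ k x, m k x = (volume.real (Metric.ball (0 : Rn n) h))⁻¹ *
        ∫ y, (Metric.ball x h).indicator (fun _ => (1 : ℝ)) y * v k y := by
      intro k x
      simp only [hm, Measure.real]
      rw [Measure.addHaar_ball_center, ← integral_indicator measurableSet_ball]
      congr 2
      ext y
      by_cases hy : y ∈ Metric.ball x h <;> simp [hy]
    -- At a fixed scale h an average is a pairing with the indicator of a ball, so weak convergence
    -- makes it tend to zero at each point; the Cauchy–Schwarz bound `hmb` and the finite measure of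
    -- Ω allow dominated convergence.
    have hmt : ∀ x, Tendsto (fun k => ‖m k x‖ₑ ^ 2) atTop (𝓝 0) := by
      intro x
      have h1 := ((hw _ (hind x)).const_mul (volume.real (Metric.ball (0 : Rn n) h))⁻¹).enorm
      have h2 := ((ENNReal.continuous_pow 2).tendsto _).comp h1
      simp only [mul_zero, enorm_zero, ne_eq, OfNat.ofNat_ne_zero, not_false_eq_true,
        zero_pow] at h2
      refine h2.congr fun k => ?_
      simp only [Function.comp, hm2]
    have hmm : ∀ k, AEMeasurable (fun x => ‖m k x‖ₑ ^ 2) (volume.restrict Ω) := by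
      intro k
      have h1 : AEStronglyMeasurable (fun p : Rn n × Rn n =>
          {q : Rn n × Rn n | dist q.2 q.1 < h}.indicator (fun _ => (1 : ℝ)) p * v k p.2)
          (volume.prod volume) :=
        (aestronglyMeasurable_const.indicator
          ((isOpen_lt (by fun_prop) continuous_const).measurableSet)).mul (hv k).1.comp_snd
      have h2 := h1.integral_prod_right'
      have h3 : m k = fun x => (volume.real (Metric.ball (0 : Rn n) h))⁻¹ *
          ∫ y, {q : Rn n × Rn n | dist q.2 q.1 < h}.indicator (fun _ => (1 : ℝ)) (x, y) * v k y := by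
        ext x
        rw [hm2]
        rfl
      rw [h3]
      exact ((h2.const_mul _).enorm.pow_const 2).restrict
    have hmb : ∀ k x, ‖m k x‖ₑ ^ 2 ≤ (‖(volume.real (Metric.ball (0 : Rn n) h))⁻¹‖ₑ *
        (volume (Metric.ball (0 : Rn n) h) ^ (1 / 2 : ℝ) * B)) ^ 2 := by
      intro k x
      rw [hm2, enorm_mul]
      gcongr
      have h1 := inner_toLp (hind x) (hv k)
      simp only [RCLike.inner_apply, conj_trivial] at h1
      simp_rw [mul_comm _ (v k _)]
      rw [← h1]
      have h2 : ‖(inner ℝ ((hind x).toLp _) ((hv k).toLp _) : ℝ)‖ₑ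
          ≤ ‖(hind x).toLp _‖ₑ * ‖(hv k).toLp _‖ₑ := by
        simp only [enorm_eq_nnnorm]
        exact_mod_cast nnnorm_inner_le_nnnorm (𝕜 := ℝ) _ _
      refine h2.trans ?_
      rw [Lp.enorm_toLp, Lp.enorm_toLp]
      refine mul_le_mul' ?_ (hB k)
      rw [eLpNorm_indicator_const measurableSet_ball (by norm_num) (by norm_num),
        Measure.addHaar_ball_center]
      simp
    have hT : Tendsto (fun k => ∫⁻ x in Ω, ‖m k x‖ₑ ^ 2) atTop (𝓝 0) := by
      have := tendsto_lintegral_of_dominated_convergence' (μ := volume.restrict Ω)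
        (fun _ => (‖(volume.real (Metric.ball (0 : Rn n) h))⁻¹‖ₑ *
        (volume (Metric.ball (0 : Rn n) h) ^ (1 / 2 : ℝ) * B)) ^ 2) hmm
        (fun k => Eventually.of_forall (hmb k)) ?_ (Eventually.of_forall hmt)
      · simpa using this
      · rw [lintegral_const, Measure.restrict_apply_univ]
        refine ENNReal.mul_ne_top (ENNReal.pow_ne_top (ENNReal.mul_ne_top enorm_ne_top
          (ENNReal.mul_ne_top (ENNReal.rpow_ne_top_of_nonneg (by norm_num) (hfb 0))
            ENNReal.coe_ne_top))) hfin
    set c := (volume (Metric.ball (0 : Rn n) h))⁻¹ * ENNReal.ofReal (h ^ ((n : ℝ) + 2 * s))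
    have hle : ∀ k, eLpNorm (v k) 2 volume ^ 2
        ≤ 2 * (c * B) + 2 * ∫⁻ x in Ω, ‖m k x‖ₑ ^ 2 := by
      intro k
      have h1 : eLpNorm (v k) 2 volume ^ 2 = ∫⁻ x in Ω, ‖v k x‖ₑ ^ 2 := by
        rw [eLpNorm_two_sq, ← lintegral_indicator hΩm]
        refine lintegral_congr fun x => ?_
        by_cases hx : x ∈ Ω <;> simp [hx, hz k]
      rw [h1]
      calc _ ≤ ∫⁻ x in Ω, (2 * (c * ∫⁻ y, ‖diffQuot s (v k) (x, y)‖ₑ ^ 2)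
              + 2 * ‖m k x‖ₑ ^ 2) := by
            refine lintegral_mono fun x => ?_
            have h2 := enorm_sq_sub_le (v k x) 0 (m k x)
            rw [sub_zero, zero_sub, enorm_neg] at h2
            refine h2.trans ?_
            gcongr
            exact enorm_sub_average_sq_le hs (hv k) hh x
        _ = 2 * (c * ∫⁻ x in Ω, ∫⁻ y, ‖diffQuot s (v k) (x, y)‖ₑ ^ 2)
              + 2 * ∫⁻ x in Ω, ‖m k x‖ₑ ^ 2 := by
            have hc : c ≠ ⊤ := ENNReal.mul_ne_top
              (ENNReal.inv_ne_top.2 (Metric.measure_ball_pos _ _ hh).ne') ENNReal.ofReal_ne_top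
            rw [lintegral_add_right' _ ((hmm k).const_mul 2), lintegral_const_mul' _ _ (by simp),
              lintegral_const_mul' _ _ hc, lintegral_const_mul' _ _ (by simp)]
        _ ≤ _ := by
            gcongr
            refine le_trans ?_ (hD k)
            rw [Measure.volume_eq_prod, lintegral_prod _
              ((aestronglyMeasurable_diffQuot s (hv k).1).enorm.pow_const 2)]
            exact setLIntegral_le_lintegral _ _
    calc _ ≤ limsup (fun k => 2 * (c * B) + 2 * ∫⁻ x in Ω, ‖m k x‖ₑ ^ 2) atTop :=
          limsup_le_limsup (Eventually.of_forall hle)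
      _ = 2 * (c * B) + 2 * 0 :=
          ((ENNReal.Tendsto.const_mul hT (Or.inr (by simp))).const_add _).limsup_eq
      _ = _ := by simp
  have h0 : limsup (fun k => eLpNorm (v k) 2 volume ^ 2) atTop ≤ 0 := by
    have h1 := ENNReal.Tendsto.const_mul (a := 2) (ENNReal.Tendsto.mul_const (b := (B : ℝ≥0∞))
      (tendsto_ball_inv_mul_rpow hn hs) (Or.inr ENNReal.coe_ne_top)) (Or.inr (by simp))
    simp only [zero_mul, mul_zero] at h1
    refine ge_of_tendsto h1 ?_
    filter_upwards [self_mem_nhdsWithin] with h hh using key h hh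
  have h1 : Tendsto (fun k => eLpNorm (v k) 2 volume ^ 2) atTop (𝓝 0) :=
    tendsto_of_le_liminf_of_limsup_le zero_le h0
  have h2 := ((ENNReal.continuous_rpow_const (y := (1 / 2 : ℝ))).tendsto _).comp h1
  rw [ENNReal.zero_rpow_of_pos (by norm_num)] at h2
  refine h2.congr fun k => ?_
  simp only [Function.comp]
  rw [← ENNReal.rpow_natCast, ← ENNReal.rpow_mul]
  norm_num

/-! ### Smooth truncations -/

/-- The derivative of the truncation `softPos m`. -/
def softStep (m : ℕ) (t : ℝ) : ℝ := max 0 (min 1 (min ((m + 1) * t - 1) (m + 2 - t)))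

/-- A bounded `C¹` approximation of the positive part, vanishing for `t ≤ 1 / (m + 1)`. -/
def softPos (m : ℕ) (t : ℝ) : ℝ := ∫ r in (0 : ℝ)..t, softStep m r

/-- The primitive of `softPos m`. -/
def softPosInt (m : ℕ) (t : ℝ) : ℝ := ∫ r in (0 : ℝ)..t, softPos m r

theorem continuous_softStep (m : ℕ) : Continuous (softStep m) := by
  unfold softStep; fun_prop

theorem softStep_nonneg (m : ℕ) (t : ℝ) : 0 ≤ softStep m t := le_max_left _ _

theorem softStep_le_one (m : ℕ) (t : ℝ) : softStep m t ≤ 1 :=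
  max_le zero_le_one (min_le_left _ _)

theorem softStep_eq_zero {m : ℕ} {t : ℝ} (ht : t ≤ 1 / (m + 1)) : softStep m t = 0 := by
  rw [le_div_iff₀ (by positivity)] at ht
  exact max_eq_left ((min_le_right _ _).trans ((min_le_left _ _).trans (by linarith)))

theorem softStep_eq_zero_of_le {m : ℕ} {t : ℝ} (ht : (m : ℝ) + 2 ≤ t) : softStep m t = 0 :=
  max_eq_left ((min_le_right _ _).trans ((min_le_right _ _).trans (by linarith)))

theorem hasDerivAt_softPos (m : ℕ) (t : ℝ) : HasDerivAt (softPos m) (softStep m t) t :=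
  ((continuous_softStep m).integral_hasStrictDerivAt 0 t).hasDerivAt

theorem continuous_softPos (m : ℕ) : Continuous (softPos m) :=
  continuous_iff_continuousAt.2 fun t => (hasDerivAt_softPos m t).continuousAt

theorem hasDerivAt_softPosInt (m : ℕ) (t : ℝ) : HasDerivAt (softPosInt m) (softPos m t) t :=
  ((continuous_softPos m).integral_hasStrictDerivAt 0 t).hasDerivAt

theorem softPos_eq_zero {m : ℕ} {t : ℝ} (ht : t ≤ 1 / (m + 1)) : softPos m t = 0 := by
  have h : ∀ r ∈ Set.uIcc 0 t, softStep m r = (fun _ => (0 : ℝ)) r := fun r hr =>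
    softStep_eq_zero (hr.2.trans (max_le (by positivity) ht))
  rw [softPos, intervalIntegral.integral_congr h, intervalIntegral.integral_zero]

theorem softPosInt_eq_zero {m : ℕ} {t : ℝ} (ht : t ≤ 1 / (m + 1)) : softPosInt m t = 0 := by
  have h : ∀ r ∈ Set.uIcc 0 t, softPos m r = (fun _ => (0 : ℝ)) r := fun r hr =>
    softPos_eq_zero (hr.2.trans (max_le (by positivity) ht))
  rw [softPosInt, intervalIntegral.integral_congr h, intervalIntegral.integral_zero]

theorem monotone_softPos (m : ℕ) : Monotone (softPos m) :=
  monotone_of_hasDerivAt_nonneg (fun t => hasDerivAt_softPos m t) (softStep_nonneg m)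

theorem softPos_nonneg (m : ℕ) (t : ℝ) : 0 ≤ softPos m t := by
  rcases le_total t 0 with h | h
  · rw [softPos_eq_zero (h.trans (by positivity))]
  · have := monotone_softPos m h
    rwa [softPos_eq_zero (show (0 : ℝ) ≤ 1 / (m + 1) by positivity)] at this

theorem abs_softPos_sub_le (m : ℕ) (a b : ℝ) : |softPos m a - softPos m b| ≤ |a - b| := by
  have := Convex.norm_image_sub_le_of_norm_hasDerivWithin_le (C := 1) (s := Set.univ)
    (fun t _ => (hasDerivAt_softPos m t).hasDerivWithinAt)
    (fun t _ => by
      rw [Real.norm_of_nonneg (softStep_nonneg m t)]; exact softStep_le_one m t)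
    convex_univ (Set.mem_univ b) (Set.mem_univ a)
  simpa using this

theorem softPos_le (m : ℕ) (t : ℝ) : softPos m t ≤ max t 0 := by
  rcases le_total t 0 with h | h
  · rw [softPos_eq_zero (h.trans (by positivity))]; exact le_max_right _ _
  · have := abs_softPos_sub_le m t 0
    rw [softPos_eq_zero (show (0 : ℝ) ≤ 1 / (m + 1) by positivity), sub_zero, sub_zero,
      abs_of_nonneg h] at this
    exact (le_abs_self _).trans (this.trans (le_max_left _ _))

/-- The slope vanishes beyond m + 2. Boundedness of the truncation is what keeps its product with b
in L². -/
theorem softPos_le_const (m : ℕ) (t : ℝ) : softPos m t ≤ m + 2 := by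
  rcases le_total t (m + 2) with h | h
  · exact (softPos_le m t).trans (max_le h (by positivity))
  · have h1 : ∀ r ∈ Set.uIcc ((m : ℝ) + 2) t, softStep m r = (fun _ => (0 : ℝ)) r := fun r hr =>
      softStep_eq_zero_of_le (by rw [Set.uIcc_of_le h] at hr; exact hr.1)
    have h2 : softPos m t = softPos m (m + 2) := by
      rw [softPos, softPos, ← intervalIntegral.integral_add_adjacent_intervals
        ((continuous_softStep m).intervalIntegrable 0 ((m : ℝ) + 2))
        ((continuous_softStep m).intervalIntegrable _ t), intervalIntegral.integral_congr h1,
        intervalIntegral.integral_zero, add_zero]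
    rw [h2]
    exact (softPos_le m _).trans (max_le le_rfl (by positivity))

/-- Monotonicity together with slope at most 1. In the nonlocal form this replaces the chain rule.
-/
theorem sq_softPos_sub_le (m : ℕ) (a b : ℝ) :
    (softPos m a - softPos m b) ^ 2 ≤ (softPos m a - softPos m b) * (a - b) := by
  have h := abs_softPos_sub_le m a b
  rcases le_total a b with hab | hab
  · have h1 := monotone_softPos m hab
    rw [abs_of_nonpos (by linarith), abs_of_nonpos (by linarith)] at h
    nlinarith
  · have h1 := monotone_softPos m hab
    rw [abs_of_nonneg (by linarith), abs_of_nonneg (by linarith)] at h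
    nlinarith

theorem tendsto_softPos (t : ℝ) : Tendsto (fun m => softPos m t) atTop (𝓝 (max t 0)) := by
  rcases le_total t 0 with h | h
  · simp only [fun m : ℕ => softPos_eq_zero (m := m) (t := t) (h.trans (by positivity)),
      max_eq_right h]
    exact tendsto_const_nhds
  · have h1 : Tendsto (fun m => softPos m t) atTop (𝓝 (∫ _ in (0 : ℝ)..t, (1 : ℝ))) := by
      refine intervalIntegral.tendsto_integral_filter_of_dominated_convergence (fun _ => 1)
        (Eventually.of_forall fun m => (continuous_softStep m).aestronglyMeasurable)
        (Eventually.of_forall fun m => Eventually.of_forall fun r _ => ?_)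
        intervalIntegrable_const (Eventually.of_forall fun r hr => ?_)
      · rw [Real.norm_of_nonneg (softStep_nonneg m r)]; exact softStep_le_one m r
      · rw [Set.uIoc_of_le h] at hr
        refine tendsto_const_nhds.congr' ?_
        -- The bound m ≥ 2/r makes the rising ramp at least 1 at r, and m ≥ r - 1 does the same for
        -- the falling ramp, so the slope equals 1 there.
        obtain ⟨N, hN⟩ := exists_nat_ge (max (2 / r) (r - 1))
        filter_upwards [eventually_ge_atTop N] with m hm
        have h2 : (N : ℝ) ≤ m := by exact_mod_cast hm
        have h3 := (le_max_left _ _).trans (hN.trans h2)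
        have h4 := (le_max_right _ _).trans (hN.trans h2)
        rw [div_le_iff₀ hr.1] at h3
        have hr0 := hr.1
        have h5 : (1 : ℝ) ≤ min ((m + 1) * r - 1) (m + 2 - r) := le_min (by nlinarith) (by linarith)
        rw [softStep, min_eq_left h5, max_eq_right zero_le_one]
    simpa [max_eq_left h] using h1

/-- Composition with a Lipschitz function vanishing near the non-positive half-line. -/
theorem lipTest_comp {Ω : Set (Rn n)} (hΩ : Bornology.IsBounded Ω) {H : Rn n → ℝ} {K L : ℝ≥0}
    (hH : LipschitzWith K H) (hle : ∀ x ∉ Ω, H x ≤ 0) {F : ℝ → ℝ} (hF : LipschitzWith L F) {η : ℝ}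
    (hη : 0 < η) (hFη : ∀ t ≤ η, F t = 0) : LipTest Ω (fun x => F (H x)) := by
  have hcl : IsClosed {x | η ≤ H x} := isClosed_le continuous_const hH.continuous
  have hsub : {x | η ≤ H x} ⊆ Ω := fun x hx => by
    by_contra h
    exact absurd (hle x h) (not_le.2 (hη.trans_le hx))
  have hts : tsupport (fun x => F (H x)) ⊆ {x | η ≤ H x} := by
    refine closure_minimal (fun x hx => ?_) hcl
    by_contra h
    exact hx (hFη _ (not_le.1 h).le)
  exact ⟨⟨L * K, hF.comp hH⟩,
    (Metric.isCompact_of_isClosed_isBounded hcl (hΩ.subset hsub)).of_isClosed_subset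
      (isClosed_tsupport _) hts, hts.trans hsub⟩

theorem lipschitz_softPos (m : ℕ) : LipschitzWith 1 (softPos m) :=
  LipschitzWith.of_dist_le_mul fun a b => by
    rw [Real.dist_eq, Real.dist_eq, NNReal.coe_one, one_mul]; exact abs_softPos_sub_le m a b

theorem lipschitz_softPosInt (m : ℕ) : LipschitzWith (m + 2) (softPosInt m) :=
  LipschitzWith.of_dist_le_mul fun a b => by
    have := Convex.norm_image_sub_le_of_norm_hasDerivWithin_le (C := m + 2) (s := Set.univ)
      (fun t _ => (hasDerivAt_softPosInt m t).hasDerivWithinAt)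
      (fun t _ => by
        rw [Real.norm_of_nonneg (softPos_nonneg m t)]; exact softPos_le_const m t)
      convex_univ (Set.mem_univ b) (Set.mem_univ a)
    rw [Real.dist_eq, Real.dist_eq]
    push_cast
    exact this

/-! ### The truncated test function -/

theorem HasGrowth.memLp_cross_indicator {s M : ℝ} (hn : 1 ≤ n) (hs₀ : 0 < s) (hs₁ : s < 1)
    {Ω : Set (Rn n)} (hΩ : Bornology.IsBounded Ω) (hΩm : MeasurableSet Ω) {g : Rn n → ℝ}
    (hg : HasGrowth s M g) : MemLp ((cross Ω).indicator (diffQuot s g)) 2 volume :=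
  (memLp_indicator_iff_restrict (measurableSet_cross hΩm)).2
    (hg.memLp_diffQuot_cross hn hs₀ hs₁ hΩ hΩm)

theorem HasGrowth.memLp_indicator_gradient {s M : ℝ} {Ω : Set (Rn n)} (hΩ : Bornology.IsBounded Ω)
    (hΩm : MeasurableSet Ω) {g : Rn n → ℝ} (hg : HasGrowth s M g) :
    MemLp (Ω.indicator (gradient g)) 2 volume := by
  refine (memLp_indicator_const 2 hΩm M (Or.inr hΩ.measure_lt_top.ne)).of_le
    ((measurable_gradient g).indicator hΩm).aestronglyMeasurable
    (Eventually.of_forall fun x => ?_)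
  by_cases hx : x ∈ Ω
  · simp only [hx, Set.indicator_of_mem]
    exact (LocalNonlocal.norm_gradient_le hg.lipschitz x).trans (le_abs_self _)
  · simp [hx]

namespace CoupledProblem

variable {P : CoupledProblem n} {u₀ φ : Rn n → ℝ} {M₀ M : ℝ}

/-- Cutting the data of u₀ to where tests can act changes no integral but makes every factor square
integrable, so that the integrals can be split and estimated. -/
theorem load_eq (u₀ : Rn n → ℝ) (τ : ℝ) {ζ : Rn n → ℝ} (hζ : LipTest P.Ω ζ) :
    P.load u₀ τ ζ = (∫ x, (P.f x - inner ℝ (P.b x) (P.Ω.indicator (gradient u₀) x)) * ζ x)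
    - (∫ x, (inner ℝ (P.A x (P.Ω.indicator (gradient u₀) x)
        + τ ^ 2 • P.Ω.indicator (gradient u₀) x) (gradient ζ x) : ℝ))
    - P.κ * ∫ p, P.a p * ((cross P.Ω).indicator (diffQuot P.s u₀) p * diffQuot P.s ζ p) := by
  rw [load]
  congr 1
  · congr 1
    · refine integral_congr_ae (Eventually.of_forall fun x => ?_)
      by_cases hx : x ∈ P.Ω
      · simp [hx]
      · simp [hζ.eq_zero hx]
    · refine integral_congr_ae (Eventually.of_forall fun x => ?_)
      by_cases hx : x ∈ P.Ω
      · simp [hx]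
      · simp [hζ.gradient_eq_zero hx]
  · congr 1
    refine integral_congr_ae (Eventually.of_forall fun p => ?_)
    by_cases hp : p ∈ cross P.Ω
    · simp [hp]
    · simp [diffQuot_eq_zero_of_notMem_cross (fun x hx => hζ.eq_zero hx) hp]

theorem exists_lipschitz_gap (hu : HasGrowth P.s M₀ u₀) (hφ : HasGrowth P.s M φ)
    (w : lipTest P.Ω) : ∃ K : ℝ≥0, LipschitzWith K
      fun x => (w : Rn n → ℝ) x + u₀ x - φ x := by
  obtain ⟨K, hK⟩ := w.2.lip
  exact ⟨_, (hK.add hu.lipschitz).sub hφ.lipschitz⟩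

theorem gap_nonpos (hle : ∀ x ∉ P.Ω, u₀ x ≤ φ x) (w : lipTest P.Ω) {x : Rn n} (hx : x ∉ P.Ω) :
    (w : Rn n → ℝ) x + u₀ x - φ x ≤ 0 := by
  rw [w.2.eq_zero hx, zero_add]
  linarith [hle x hx]

theorem lipTest_softPos (hu : HasGrowth P.s M₀ u₀) (hφ : HasGrowth P.s M φ)
    (hle : ∀ x ∉ P.Ω, u₀ x ≤ φ x) (m : ℕ) (w : lipTest P.Ω) : LipTest P.Ω
      (fun x => softPos m ((w : Rn n → ℝ) x + u₀ x - φ x)) := by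
  obtain ⟨K, hK⟩ := exists_lipschitz_gap hu hφ w
  exact lipTest_comp P.hΩb hK (fun x hx => gap_nonpos hle w hx) (lipschitz_softPos m)
    (show (0 : ℝ) < 1 / (m + 1) by positivity) fun t => softPos_eq_zero

theorem lipTest_softPosInt (hu : HasGrowth P.s M₀ u₀) (hφ : HasGrowth P.s M φ)
    (hle : ∀ x ∉ P.Ω, u₀ x ≤ φ x) (m : ℕ) (w : lipTest P.Ω) : LipTest P.Ω
      (fun x => softPosInt m ((w : Rn n → ℝ) x + u₀ x - φ x)) := by
  obtain ⟨K, hK⟩ := exists_lipschitz_gap hu hφ w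
  exact lipTest_comp P.hΩb hK (fun x hx => gap_nonpos hle w hx) (lipschitz_softPosInt m)
    (show (0 : ℝ) < 1 / (m + 1) by positivity) fun t => softPosInt_eq_zero

theorem ae_gradient_gap (hu : HasGrowth P.s M₀ u₀) (hφ : HasGrowth P.s M φ) (m : ℕ)
    (w : lipTest P.Ω) : ∀ᵐ x,
    let g := gradient (w : Rn n → ℝ) x + gradient u₀ x - gradient φ x
    gradient (fun x => softPos m ((w : Rn n → ℝ) x + u₀ x - φ x)) x
      = softStep m ((w : Rn n → ℝ) x + u₀ x - φ x) • g ∧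
    gradient (fun x => softPosInt m ((w : Rn n → ℝ) x + u₀ x - φ x)) x
      = softPos m ((w : Rn n → ℝ) x + u₀ x - φ x) • g := by
  filter_upwards [w.2.ae_differentiableAt, hu.lipschitz.ae_differentiableAt,
    hφ.lipschitz.ae_differentiableAt] with x h1 h2 h3
  have h4 : DifferentiableAt ℝ (fun x => (w : Rn n → ℝ) x + u₀ x) x := h1.add h2
  have h5 : DifferentiableAt ℝ (fun x => (w : Rn n → ℝ) x + u₀ x - φ x) x := h4.sub h3
  have e : gradient (fun x => (w : Rn n → ℝ) x + u₀ x - φ x) x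
      = gradient (w : Rn n → ℝ) x + gradient u₀ x - gradient φ x := by
    rw [gradient_sub h4 h3, gradient_add h1 h2]
  simp only
  rw [← e]
  exact ⟨gradient_comp (hasDerivAt_softPos m _) h5, gradient_comp (hasDerivAt_softPosInt m _) h5⟩

/-- The elementary inequality behind the energy estimate, local part. -/
theorem local_pointwise {τ : ℝ} (h₁ : τ ^ 2 ≤ 1) {x g ξ η : Rn n} {t : ℝ} (ht₀ : 0 ≤ t)
    (ht₁ : t ≤ 1) (hg : g = t • (ξ - η)) (hη : ‖η‖ ≤ M) :
    (P.U₁.indicator (fun _ => P.lam / 2 * ‖g‖ ^ 2) x)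
      - (if t = 0 then 0 else (P.Lam + 1) / 2 * M ^ 2)
      ≤ inner ℝ (P.A x g + τ ^ 2 • g) ξ := by
  have hQ : ∀ ζ : Rn n, 0 ≤ (inner ℝ (P.A x ζ + τ ^ 2 • ζ) ζ : ℝ) := fun ζ => by
    rw [inner_add_left, real_inner_smul_left, real_inner_self_eq_norm_sq]
    have := P.A_nonneg x ζ
    positivity
  -- With q the quadratic form of A + τ², the left side is t² q(ξ - η) and the right side is t q(ξ -
  -- η); here q ≥ 0 and 0 ≤ t ≤ 1. Half of it is kept for the estimate and the other half absorbs
  -- the cross term with η.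
  have h1 : (inner ℝ (P.A x g + τ ^ 2 • g) g : ℝ) ≤ inner ℝ (P.A x g + τ ^ 2 • g) (ξ - η) := by
    rw [hg]
    simp only [map_smul, smul_comm (τ ^ 2) t, ← smul_add, real_inner_smul_left,
      real_inner_smul_right]
    have h2 := hQ (ξ - η)
    have h3 : t * (t * inner ℝ (P.A x (ξ - η) + τ ^ 2 • (ξ - η)) (ξ - η))
        ≤ t * (1 * inner ℝ (P.A x (ξ - η) + τ ^ 2 • (ξ - η)) (ξ - η)) := by gcongr
    simpa using h3
  have h4 : (P.U₁.indicator (fun _ => P.lam / 2 * ‖g‖ ^ 2) x)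
      ≤ 1 / 2 * inner ℝ (P.A x g + τ ^ 2 • g) g := by
    by_cases hx : x ∈ P.U₁
    · rw [Set.indicator_of_mem hx, inner_add_left, real_inner_smul_left,
        real_inner_self_eq_norm_sq]
      have := P.A_lower x hx g
      have h5 : 0 ≤ τ ^ 2 * ‖g‖ ^ 2 := by positivity
      linarith
    · rw [Set.indicator_of_notMem hx]
      have := hQ g
      positivity
  have h6 : -(if t = 0 then 0 else (P.Lam + 1) / 2 * M ^ 2)
      - 1 / 2 * inner ℝ (P.A x g + τ ^ 2 • g) g ≤ inner ℝ (P.A x g + τ ^ 2 • g) η := by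
    split_ifs with h0
    · rw [h0, zero_smul] at hg
      simp [hg]
    · have h7 := P.two_mul_abs_inner_A_le x g η
      have h8 := neg_abs_le (inner ℝ (P.A x g) η : ℝ)
      have h9 := P.A_upper x η
      have h10 : ‖η‖ ^ 2 ≤ M ^ 2 := pow_le_pow_left₀ (norm_nonneg _) hη 2
      have h11 := norm_add_sq_real g η
      rw [inner_add_left, inner_add_left, real_inner_smul_left, real_inner_smul_left,
        real_inner_self_eq_norm_sq]
      have h12 : 0 ≤ τ ^ 2 * ‖g + η‖ ^ 2 := by positivity
      rw [h11] at h12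
      have h13 : P.Lam * ‖η‖ ^ 2 ≤ P.Lam * M ^ 2 := mul_le_mul_of_nonneg_left h10 P.hLam.le
      have h14 : τ ^ 2 * ‖η‖ ^ 2 ≤ 1 * M ^ 2 := mul_le_mul h₁ h10 (by positivity) zero_le_one
      nlinarith
  have h15 : (inner ℝ (P.A x g + τ ^ 2 • g) ξ : ℝ)
      = inner ℝ (P.A x g + τ ^ 2 • g) (ξ - η) + inner ℝ (P.A x g + τ ^ 2 • g) η := by
    rw [← inner_add_right, sub_add_cancel]
  rw [h15]
  linarith

/-- The elementary inequality behind the energy estimate, nonlocal part. -/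
theorem nonlocal_pointwise {p : Rn n × Rn n} {d e c : ℝ} (hd : d ^ 2 ≤ d * (e - c)) :
    ((P.U₂ ×ˢ Set.univ).indicator (fun _ => P.lam / 2 * d ^ 2) p)
      - (if d = 0 then 0 else P.Lam / 2 * c ^ 2) ≤ P.a p * (d * e) := by
  have ha := P.a_nonneg p
  have h1 : (P.U₂ ×ˢ Set.univ).indicator (fun _ => P.lam / 2 * d ^ 2) p
      ≤ P.a p * (1 / 2 * d ^ 2) := by
    by_cases hp : p ∈ P.U₂ ×ˢ (Set.univ : Set (Rn n))
    · rw [Set.indicator_of_mem hp]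
      have := P.a_lower p.1 hp.1 p.2
      have h2 : P.lam * (1 / 2 * d ^ 2) ≤ P.a p * (1 / 2 * d ^ 2) := by gcongr
      linarith
    · rw [Set.indicator_of_notMem hp]; positivity
  split_ifs with h0
  · simp [h0] at h1 ⊢
  · have h3 : P.a p * (1 / 2 * c ^ 2) ≤ P.Lam * (1 / 2 * c ^ 2) := by
      gcongr; exact P.a_upper p
    -- From d e ≥ d² + d c and Young's inequality d c ≥ -½d² - ½c².
    have h4 : P.a p * (1 / 2 * d ^ 2) - P.a p * (1 / 2 * c ^ 2) ≤ P.a p * (d * e) := by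
      rw [← mul_sub]
      refine mul_le_mul_of_nonneg_left ?_ ha
      nlinarith [sq_nonneg (d + c)]
    linarith

end CoupledProblem

/-! ### Lower bound for the form on truncated test functions -/

namespace CoupledProblem

variable {P : CoupledProblem n} {u₀ φ : Rn n → ℝ} {M₀ M : ℝ}

/-- The superlevel set on which the truncated test function may be nonzero. -/
def gapSet (u₀ φ : Rn n → ℝ) (m : ℕ) (w : Rn n → ℝ) : Set (Rn n) :=
  {x | (1 : ℝ) / (m + 1) < w x + u₀ x - φ x}

theorem measurableSet_gapSet (hu : HasGrowth P.s M₀ u₀) (hφ : HasGrowth P.s M φ) (m : ℕ)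
    (w : lipTest P.Ω) : MeasurableSet (gapSet u₀ φ m w) := by
  obtain ⟨K, hK⟩ := exists_lipschitz_gap hu hφ w
  exact (isOpen_lt continuous_const hK.continuous).measurableSet

theorem gapSet_subset (hle : ∀ x ∉ P.Ω, u₀ x ≤ φ x) (m : ℕ) (w : lipTest P.Ω) :
    gapSet u₀ φ m w ⊆ P.Ω := fun x hx => by
  by_contra h
  have h1 : (0 : ℝ) < 1 / (m + 1) := by positivity
  exact absurd (gap_nonpos hle w h) (not_le.2 (h1.trans hx))

/-- The terms with w and u₀ recombine into the gradient of w + u₀, to which the elementary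
inequality applies. The drift leaves an exact term ⟨b, ∇Q⟩, removed later by integration, and terms
with ∇φ and f that Young's inequality charges to the superlevel set and to ζ². -/
theorem local_lower {τ : ℝ} (h₁ : τ ^ 2 ≤ 1) (hu : HasGrowth P.s M₀ u₀)
    (hφ : HasGrowth P.s M φ) (hle : ∀ x ∉ P.Ω, u₀ x ≤ φ x) (m : ℕ) (w : lipTest P.Ω)
    {ζ Q : Rn n → ℝ} (hζ : ζ = fun x => softPos m ((w : Rn n → ℝ) x + u₀ x - φ x))
    (hQ : Q = fun x => softPosInt m ((w : Rn n → ℝ) x + u₀ x - φ x)) :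
    ∀ᵐ x, (P.U₁.indicator (fun x => P.lam / 2 * ‖gradient ζ x‖ ^ 2) x)
      - (gapSet u₀ φ m w).indicator
        (fun x => (P.Lam + 1) / 2 * M ^ 2 + (M ^ 2 / 2 * ‖P.b x‖ ^ 2 + 1 / 2 * P.f x ^ 2)) x
      + inner ℝ (P.b x) (gradient Q x) - ζ x ^ 2
      ≤ inner ℝ (P.flux τ ζ x) (gradient (w : Rn n → ℝ) x)
        - (P.f x - inner ℝ (P.b x) (P.Ω.indicator (gradient u₀) x)) * ζ x
        + inner ℝ (P.A x (P.Ω.indicator (gradient u₀) x)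
          + τ ^ 2 • P.Ω.indicator (gradient u₀) x) (gradient ζ x) := by
  have hLζ : LipTest P.Ω ζ := hζ ▸ lipTest_softPos hu hφ hle m w
  have hLQ : LipTest P.Ω Q := hQ ▸ lipTest_softPosInt hu hφ hle m w
  filter_upwards [ae_gradient_gap hu hφ m w] with x hx
  rw [← hζ, ← hQ] at hx
  obtain ⟨hx1, hx2⟩ := hx
  by_cases hxΩ : x ∈ P.Ω
  · rw [Set.indicator_of_mem hxΩ]
    set ξ := gradient (w : Rn n → ℝ) x
    set ξ₀ := gradient u₀ x
    set η := gradient φ x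
    set g := gradient ζ x
    have hη : ‖η‖ ≤ M := hφ.norm_gradient_le x
    have h2 := local_pointwise (P := P) h₁ (x := x) (g := g) (ξ := ξ + ξ₀) (η := η)
      (softStep_nonneg m _) (softStep_le_one m _) hx1 hη
    -- As ∇Q = ζ (∇w + ∇u₀ - ∇φ), the drift ζ⟨b, ∇w + ∇u₀⟩ equals ⟨b, ∇Q⟩ + ζ⟨b, ∇φ⟩. Symmetry of A
    -- puts both forms into the same order.
    have e1 : inner ℝ (P.flux τ ζ x) ξ - (P.f x - inner ℝ (P.b x) ξ₀) * ζ x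
        + inner ℝ (P.A x ξ₀ + τ ^ 2 • ξ₀) g
        = inner ℝ (P.A x g + τ ^ 2 • g) (ξ + ξ₀) + inner ℝ (P.b x) (gradient Q x)
          + ζ x * inner ℝ (P.b x) η - P.f x * ζ x := by
      rw [hx2, ← congrFun hζ x]
      simp only [flux, inner_add_left, inner_add_right, inner_sub_right, real_inner_smul_left,
        real_inner_smul_right]
      rw [P.A_symm x ξ₀ g, real_inner_comm ξ₀ (P.A x g)]
      change _ + τ ^ 2 * inner ℝ g ξ + _ - _ + (_ + τ ^ 2 * inner ℝ ξ₀ g) = _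
      rw [real_inner_comm g ξ₀]
      ring
    rw [e1]
    by_cases hE : x ∈ gapSet u₀ φ m w
    · rw [Set.indicator_of_mem hE]
      have h3 : (if softStep m ((w : Rn n → ℝ) x + u₀ x - φ x) = 0 then 0
          else (P.Lam + 1) / 2 * M ^ 2) ≤ (P.Lam + 1) / 2 * M ^ 2 := by
        have := P.hLam
        split_ifs
        · positivity
        · exact le_rfl
      have h4 : |(inner ℝ (P.b x) η : ℝ)| ≤ M * ‖P.b x‖ := by
        rw [mul_comm]
        exact (abs_real_inner_le_norm _ _).trans
          (mul_le_mul_of_nonneg_left hη (norm_nonneg _))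
      have h5 : (inner ℝ (P.b x) η : ℝ) ^ 2 ≤ M ^ 2 * ‖P.b x‖ ^ 2 := by
        rw [← sq_abs, ← mul_pow]
        exact pow_le_pow_left₀ (abs_nonneg _) h4 2
      have h6 := sq_nonneg (ζ x + inner ℝ (P.b x) η)
      have h7 := sq_nonneg (ζ x - P.f x)
      have h8 : (P.U₁.indicator (fun x => P.lam / 2 * ‖gradient ζ x‖ ^ 2) x)
        = (P.U₁.indicator (fun _ => P.lam / 2 * ‖g‖ ^ 2) x) := rfl
      rw [h8]
      nlinarith
    · rw [Set.indicator_of_notMem hE]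
      have hE' : (w : Rn n → ℝ) x + u₀ x - φ x ≤ 1 / (m + 1) := not_lt.1 hE
      have h3 : ζ x = 0 := by rw [hζ]; exact softPos_eq_zero hE'
      rw [if_pos (softStep_eq_zero hE')] at h2
      have h8 : (P.U₁.indicator (fun x => P.lam / 2 * ‖gradient ζ x‖ ^ 2) x)
        = (P.U₁.indicator (fun _ => P.lam / 2 * ‖g‖ ^ 2) x) := rfl
      rw [h8, h3]
      linarith
  · have hE : x ∉ gapSet u₀ φ m w := fun h => hxΩ (gapSet_subset hle m w h)
    simp [hE, hLζ.gradient_eq_zero hxΩ, hLζ.eq_zero hxΩ, hLQ.gradient_eq_zero hxΩ, flux, hxΩ]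
    exact le_of_eq (Set.indicator_apply_eq_zero.2 fun _ => by simp [hLζ.gradient_eq_zero hxΩ])

theorem nonlocal_lower (hle : ∀ x ∉ P.Ω, u₀ x ≤ φ x) (m : ℕ) (w : lipTest P.Ω)
    {ζ : Rn n → ℝ} (hζ : ζ = fun x => softPos m ((w : Rn n → ℝ) x + u₀ x - φ x))
    (p : Rn n × Rn n) :
    ((P.U₂ ×ˢ Set.univ).indicator (fun p => P.lam / 2 * diffQuot P.s ζ p ^ 2) p)
      - (cross (gapSet u₀ φ m w)).indicator (fun p => P.Lam / 2 * diffQuot P.s φ p ^ 2) p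
      ≤ P.a p * (diffQuot P.s ζ p * diffQuot P.s (w : Rn n → ℝ) p)
        + P.a p * ((cross P.Ω).indicator (diffQuot P.s u₀) p * diffQuot P.s ζ p) := by
  have hz : ∀ x ∉ gapSet u₀ φ m w, ζ x = 0 := fun x hx => by
    rw [hζ]; exact softPos_eq_zero (not_lt.1 hx)
  by_cases hp : p ∈ cross (gapSet u₀ φ m w)
  · have hpΩ : p ∈ cross P.Ω := by
      rcases hp with hp | hp
      · exact Or.inl ⟨gapSet_subset hle m w hp.1, trivial⟩
      · exact Or.inr ⟨trivial, gapSet_subset hle m w hp.2⟩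
    rw [Set.indicator_of_mem hp, Set.indicator_of_mem hpΩ]
    have h1 := nonlocal_pointwise (P := P) (p := p) (d := diffQuot P.s ζ p)
      (e := diffQuot P.s (w : Rn n → ℝ) p + diffQuot P.s u₀ p) (c := diffQuot P.s φ p) (by
        have h2 := sq_softPos_sub_le m ((w : Rn n → ℝ) p.1 + u₀ p.1 - φ p.1)
          ((w : Rn n → ℝ) p.2 + u₀ p.2 - φ p.2)
        have h3 := mul_le_mul_of_nonneg_right h2
          (sq_nonneg (‖p.1 - p.2‖ ^ (-(((n : ℝ) + 2 * P.s) / 2))))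
        simp only [diffQuot, hζ]
        generalize ‖p.1 - p.2‖ ^ (-(((n : ℝ) + 2 * P.s) / 2)) = k at h3 ⊢
        linarith)
    have h4 : (if diffQuot P.s ζ p = 0 then 0 else P.Lam / 2 * diffQuot P.s φ p ^ 2)
        ≤ P.Lam / 2 * diffQuot P.s φ p ^ 2 := by
      have := P.hLam
      split_ifs
      · positivity
      · exact le_rfl
    have h8 : (P.U₂ ×ˢ Set.univ).indicator (fun p => P.lam / 2 * diffQuot P.s ζ p ^ 2) p
      = (P.U₂ ×ˢ Set.univ).indicator (fun _ => P.lam / 2 * diffQuot P.s ζ p ^ 2) p := rfl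
    rw [h8]
    nlinarith
  · have h0 := diffQuot_eq_zero_of_notMem_cross (s := P.s) hz hp
    rw [Set.indicator_of_notMem hp]
    simp only [h0, zero_mul, mul_zero, add_zero, sub_zero]
    refine le_of_eq (Set.indicator_apply_eq_zero.2 fun _ => ?_)
    simp [h0]

/-- Integrating the two pointwise bounds, where div b = 0 kills ⟨b, ∇Q⟩. The constants involve only
the ellipticity bounds and κ, neither coercivity nor τ, which is why the final estimate does not
depend on the interface. -/
theorem energy_lower {τ : ℝ} (h₀ : 0 < τ) (h₁ : τ ≤ 1) (hu : HasGrowth P.s M₀ u₀)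
    (hφ : HasGrowth P.s M φ) (hle : ∀ x ∉ P.Ω, u₀ x ≤ φ x) (m : ℕ) (w ζ : lipTest P.Ω)
    (hζ : (ζ : Rn n → ℝ) = fun x => softPos m ((w : Rn n → ℝ) x + u₀ x - φ x)) :
    P.lam / 2 * ((∫ x in P.U₁, ‖gradient (ζ : Rn n → ℝ) x‖ ^ 2)
      + P.κ * ∫ p in P.U₂ ×ˢ Set.univ, diffQuot P.s (ζ : Rn n → ℝ) p ^ 2)
    ≤ inner ℝ (P.R h₀ h₁ ζ) (P.J h₀.le h₁ w) - P.load u₀ τ ζ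
      + ((∫ x, (ζ : Rn n → ℝ) x ^ 2) + (P.Lam + 1) / 2 * M ^ 2 * volume.real (gapSet u₀ φ m w)
      + (M ^ 2 / 2 * (∫ x in gapSet u₀ φ m w, ‖P.b x‖ ^ 2)
        + 1 / 2 * ∫ x in gapSet u₀ φ m w, P.f x ^ 2)
      + P.κ * (P.Lam / 2 * ∫ p in cross (gapSet u₀ φ m w), diffQuot P.s φ p ^ 2)) := by
  set z : Rn n → ℝ := (ζ : Rn n → ℝ) with hz
  set E := gapSet u₀ φ m w with hE
  have hEm : MeasurableSet E := measurableSet_gapSet hu hφ m w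
  have hEΩ : E ⊆ P.Ω := gapSet_subset hle m w
  have hEfin : volume E ≠ ⊤ := (P.hΩb.subset hEΩ).measure_lt_top.ne
  have hΩm := P.hΩ.measurableSet
  have hLQ := lipTest_softPosInt hu hφ hle m w
  set Q := fun x => softPosInt m ((w : Rn n → ℝ) x + u₀ x - φ x) with hQ
  have hU₁ := P.pair.isOpen₁.measurableSet
  have hU₂ : MeasurableSet (P.U₂ ×ˢ (Set.univ : Set (Rn n))) :=
    P.pair.isOpen₂.measurableSet.prod MeasurableSet.univ
  have hGu := hu.memLp_indicator_gradient P.hΩb hΩm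
  have hdu := hu.memLp_cross_indicator P.hn P.hs₀ P.hs₁ P.hΩb hΩm
  have hgz := ζ.2.memLp_gradient 2
  have hdz := ζ.2.memLp_diffQuot P.hn P.hs₀ P.hs₁
  have hdw := w.2.memLp_diffQuot P.hn P.hs₀ P.hs₁
  have hbu : MemLp (fun x => P.f x - inner ℝ (P.b x) (P.Ω.indicator (gradient u₀) x)) 2 volume :=
    P.f_memLp.sub (memLp_inner_b_of_bound (M := M₀) hGu.1 fun x => by
      by_cases hx : x ∈ P.Ω
      · rw [Set.indicator_of_mem hx]; exact hu.norm_gradient_le x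
      · rw [Set.indicator_of_notMem hx, norm_zero]; exact hu.nonneg)
  have i1 : Integrable fun x => (inner ℝ (P.flux τ z x) (gradient (w : Rn n → ℝ) x) : ℝ) :=
    integrable_inner_of_memLp (P.memLp_flux τ ζ.2) (w.2.memLp_gradient 2)
  have i2 : Integrable fun x => (P.f x - inner ℝ (P.b x) (P.Ω.indicator (gradient u₀) x)) * z x :=
    hbu.integrable_mul (ζ.2.memLp 2)
  have i3 : Integrable fun x => (inner ℝ (P.A x (P.Ω.indicator (gradient u₀) x)
      + τ ^ 2 • P.Ω.indicator (gradient u₀) x) (gradient z x) : ℝ) :=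
    integrable_inner_of_memLp ((P.memLp_A_apply hGu).add (hGu.const_smul (τ ^ 2))) hgz
  have j0 : ∀ {d d' : Rn n × Rn n → ℝ}, MemLp d 2 volume → MemLp d' 2 volume →
      Integrable fun p => P.a p * (d p * d' p) := fun {d d'} hd hd' => by
    have h1 : Integrable fun p => P.κ * (P.a p * d p) * d' p :=
      (P.memLp_a_mul hd).integrable_mul hd'
    refine (h1.const_mul P.κ⁻¹).congr (Eventually.of_forall fun p => ?_)
    have := P.hκ.ne'
    simp only
    field_simp
  have j1 := j0 hdz hdw
  have j2 := j0 hdu hdz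
  have e0 : inner ℝ (P.R h₀ h₁ ζ) (P.J h₀.le h₁ w) - P.load u₀ τ z
      = (∫ x, (inner ℝ (P.flux τ z x) (gradient (w : Rn n → ℝ) x)
          - (P.f x - inner ℝ (P.b x) (P.Ω.indicator (gradient u₀) x)) * z x
          + inner ℝ (P.A x (P.Ω.indicator (gradient u₀) x)
            + τ ^ 2 • P.Ω.indicator (gradient u₀) x) (gradient z x)))
        + P.κ * ∫ p, (P.a p * (diffQuot P.s z p * diffQuot P.s (w : Rn n → ℝ) p)
        + P.a p * ((cross P.Ω).indicator (diffQuot P.s u₀) p * diffQuot P.s z p)) := by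
    have i12 : Integrable fun x => inner ℝ (P.flux τ z x) (gradient (w : Rn n → ℝ) x)
        - (P.f x - inner ℝ (P.b x) (P.Ω.indicator (gradient u₀) x)) * z x := i1.sub i2
    rw [P.inner_R_J, load_eq u₀ τ ζ.2, integral_add i12 i3, integral_sub i1 i2,
      integral_add j1 j2]
    ring
  rw [e0]
  have k1 : Integrable (P.U₁.indicator fun x => P.lam / 2 * ‖gradient z x‖ ^ 2) :=
    ((hgz.integrable_norm_pow two_ne_zero).const_mul _).indicator hU₁
  have k2a : IntegrableOn (fun x => M ^ 2 / 2 * ‖P.b x‖ ^ 2) E :=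
    ((P.b_memLp.integrable_norm_pow two_ne_zero).const_mul _).integrableOn
  have k2b : IntegrableOn (fun x => 1 / 2 * P.f x ^ 2) E :=
    (P.f_memLp.integrable_sq.const_mul _).integrableOn
  have k2c : IntegrableOn (fun _ : Rn n => (P.Lam + 1) / 2 * M ^ 2) E := integrableOn_const hEfin
  have k2d : IntegrableOn (fun x => M ^ 2 / 2 * ‖P.b x‖ ^ 2 + 1 / 2 * P.f x ^ 2) E := k2a.add k2b
  have k2e : IntegrableOn (fun x => (P.Lam + 1) / 2 * M ^ 2
      + (M ^ 2 / 2 * ‖P.b x‖ ^ 2 + 1 / 2 * P.f x ^ 2)) E := k2c.add k2d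
  have k2 := k2e.integrable_indicator hEm
  have k3 : Integrable fun x => (inner ℝ (P.b x) (gradient Q x) : ℝ) :=
    integrable_inner_of_memLp P.b_memLp (hLQ.memLp_gradient 2)
  have k4 : Integrable fun x => z x ^ 2 := (ζ.2.memLp 2).integrable_sq
  have m1 := integral_mono_ae (((k1.sub k2).add k3).sub k4) ((i1.sub i2).add i3)
    (local_lower (τ := τ) (by nlinarith) hu hφ hle m w hζ hQ)
  have hcE := measurableSet_cross hEm
  have l1 : Integrable ((P.U₂ ×ˢ Set.univ).indicator fun p => P.lam / 2 * diffQuot P.s z p ^ 2) :=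
    (hdz.integrable_sq.const_mul _).indicator hU₂
  have l2' : IntegrableOn (fun p => P.Lam / 2 * diffQuot P.s φ p ^ 2) (cross E) :=
    (hφ.memLp_diffQuot_cross P.hn P.hs₀ P.hs₁ (P.hΩb.subset hEΩ) hEm).integrable_sq.const_mul _
  have l2 := l2'.integrable_indicator hcE
  have m2 := integral_mono (l1.sub l2) (j1.add j2) (nonlocal_lower hle m w hζ)
  have e1 : ∫ x, (P.U₁.indicator (fun x => P.lam / 2 * ‖gradient z x‖ ^ 2) x
      - E.indicator (fun x => (P.Lam + 1) / 2 * M ^ 2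
        + (M ^ 2 / 2 * ‖P.b x‖ ^ 2 + 1 / 2 * P.f x ^ 2)) x
      + inner ℝ (P.b x) (gradient Q x) - z x ^ 2)
      = P.lam / 2 * (∫ x in P.U₁, ‖gradient z x‖ ^ 2) - ((P.Lam + 1) / 2 * M ^ 2 * volume.real E
        + (M ^ 2 / 2 * (∫ x in E, ‖P.b x‖ ^ 2) + 1 / 2 * ∫ x in E, P.f x ^ 2))
        - ∫ x, z x ^ 2 := by
    have k12 : Integrable fun x => P.U₁.indicator (fun x => P.lam / 2 * ‖gradient z x‖ ^ 2) x
      - E.indicator (fun x => (P.Lam + 1) / 2 * M ^ 2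
        + (M ^ 2 / 2 * ‖P.b x‖ ^ 2 + 1 / 2 * P.f x ^ 2)) x := k1.sub k2
    have k123 : Integrable fun x => P.U₁.indicator (fun x => P.lam / 2 * ‖gradient z x‖ ^ 2) x
      - E.indicator (fun x => (P.Lam + 1) / 2 * M ^ 2
        + (M ^ 2 / 2 * ‖P.b x‖ ^ 2 + 1 / 2 * P.f x ^ 2)) x
        + inner ℝ (P.b x) (gradient Q x) := k12.add k3
    rw [integral_sub k123 k4, integral_add k12 k3, integral_sub k1 k2, P.b_div Q hLQ,
      integral_indicator hU₁, integral_indicator hEm, integral_const_mul,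
      integral_add k2c k2d, integral_add k2a k2b, integral_const_mul, integral_const_mul,
      integral_const_mul, setIntegral_const, smul_eq_mul]
    ring
  have e2 : ∫ p, ((P.U₂ ×ˢ Set.univ).indicator (fun p => P.lam / 2 * diffQuot P.s z p ^ 2) p
      - (cross E).indicator (fun p => P.Lam / 2 * diffQuot P.s φ p ^ 2) p)
      = P.lam / 2 * (∫ p in P.U₂ ×ˢ Set.univ, diffQuot P.s z p ^ 2)
        - P.Lam / 2 * ∫ p in cross E, diffQuot P.s φ p ^ 2 := by
    rw [integral_sub l1 l2, integral_indicator hU₂, integral_indicator hcE, integral_const_mul,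
      integral_const_mul]
  have m1' := e1.symm.le.trans m1
  have m2' := mul_le_mul_of_nonneg_left (e2.symm.le.trans m2) P.hκ.le
  refine le_trans ?_ (add_le_add_left (add_le_add m1' m2') _)
  apply le_of_eq
  ring

end CoupledProblem

/-! ### Truncations of Lipschitz approximations as test functions -/

namespace CoupledProblem

variable {P : CoupledProblem n} {u₀ φ : Rn n → ℝ} {M₀ M : ℝ}

/-- Truncation does not enlarge the gradient of w + u₀ - φ and is bounded by m + 2, so the weighted
flux is controlled by the gradient of w and one fixed L² function. Factors growing with m and τ⁻¹
are harmless, both being fixed at this stage. -/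
theorem ae_norm_flux_le {τ : ℝ} (h₀ : 0 < τ) (h₁ : τ ≤ 1) (hu : HasGrowth P.s M₀ u₀)
    (hφ : HasGrowth P.s M φ) (hle : ∀ x ∉ P.Ω, u₀ x ≤ φ x) (m : ℕ) (w : lipTest P.Ω)
    {ζ : Rn n → ℝ} (hζ : ζ = fun x => softPos m ((w : Rn n → ℝ) x + u₀ x - φ x)) :
    ∀ᵐ x, ‖(P.weight τ x)⁻¹ • P.flux τ ζ x‖
      ≤ (P.Lam + 1) * (1 + τ⁻¹) * ‖P.weight τ x • gradient (w : Rn n → ℝ) x‖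
        + ((P.Lam + 1) * P.Ω.indicator (fun _ => M₀ + M) x
          + (1 + τ⁻¹) * (m + 2) * ‖P.b x‖) := by
  have hLζ : LipTest P.Ω ζ := hζ ▸ lipTest_softPos hu hφ hle m w
  have hL := P.hLam
  filter_upwards [ae_gradient_gap hu hφ m w] with x hx
  rw [← hζ] at hx
  have h1 : ‖gradient ζ x‖ ≤ ‖gradient (w : Rn n → ℝ) x‖ + P.Ω.indicator (fun _ => M₀ + M) x := by
    by_cases hxΩ : x ∈ P.Ω
    · rw [Set.indicator_of_mem hxΩ, hx.1, norm_smul, Real.norm_of_nonneg (softStep_nonneg m _)]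
      have h2 := norm_sub_le (gradient (w : Rn n → ℝ) x + gradient u₀ x) (gradient φ x)
      have h3 := norm_add_le (gradient (w : Rn n → ℝ) x) (gradient u₀ x)
      have h4 := hu.norm_gradient_le x
      have h5 := hφ.norm_gradient_le x
      have h6 := mul_le_mul_of_nonneg_right (softStep_le_one m ((w : Rn n → ℝ) x + u₀ x - φ x))
        (norm_nonneg (gradient (w : Rn n → ℝ) x + gradient u₀ x - gradient φ x))
      linarith
    · simp [hxΩ, hLζ.gradient_eq_zero hxΩ]
  have h2 : ‖gradient (w : Rn n → ℝ) x‖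
      ≤ (1 + τ⁻¹) * ‖P.weight τ x • gradient (w : Rn n → ℝ) x‖ := by
    calc ‖gradient (w : Rn n → ℝ) x‖
        = ‖(P.weight τ x)⁻¹ • P.weight τ x • gradient (w : Rn n → ℝ) x‖ := by
          rw [smul_smul, inv_mul_cancel₀ (P.weight_pos h₀ x).ne', one_smul]
      _ ≤ _ := by
          rw [norm_smul (P.weight τ x)⁻¹]
          exact mul_le_mul_of_nonneg_right (P.abs_weight_inv_le h₀.le x) (norm_nonneg _)
  have h3 : ‖(P.weight τ x)⁻¹ • ζ x • P.b x‖ ≤ (1 + τ⁻¹) * (m + 2) * ‖P.b x‖ := by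
    rw [norm_smul, norm_smul, ← mul_assoc]
    have h4 : ‖ζ x‖ ≤ m + 2 := by
      rw [hζ, Real.norm_of_nonneg (softPos_nonneg m _)]; exact softPos_le_const m _
    refine mul_le_mul_of_nonneg_right ?_ (norm_nonneg _)
    exact mul_le_mul (P.abs_weight_inv_le h₀.le x) h4 (norm_nonneg _) (by positivity)
  rw [flux, smul_add]
  refine (norm_add_le _ _).trans ?_
  have h5 := norm_weight_inv_smul_flux_le (P := P) h₀ h₁ x (gradient ζ x)
  have h6 : (P.Lam + 1) * ‖gradient ζ x‖ ≤ (P.Lam + 1) *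
      ((1 + τ⁻¹) * ‖P.weight τ x • gradient (w : Rn n → ℝ) x‖
        + P.Ω.indicator (fun _ => M₀ + M) x) := by
    gcongr
    linarith
  nlinarith

theorem sq_diffQuot_softPos_le (hu : HasGrowth P.s M₀ u₀)
    (hφ : HasGrowth P.s M φ) (hle : ∀ x ∉ P.Ω, u₀ x ≤ φ x) (m : ℕ) (w : lipTest P.Ω)
    {ζ : Rn n → ℝ} (hζ : ζ = fun x => softPos m ((w : Rn n → ℝ) x + u₀ x - φ x))
    (p : Rn n × Rn n) : (P.κ * (P.a p * diffQuot P.s ζ p)) ^ 2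
      ≤ 2 * (P.κ * P.Lam) ^ 2 * (diffQuot P.s (w : Rn n → ℝ) p ^ 2
        + (cross P.Ω).indicator (diffQuot P.s fun x => u₀ x - φ x) p ^ 2) := by
  have hLζ : LipTest P.Ω ζ := hζ ▸ lipTest_softPos hu hφ hle m w
  by_cases hp : p ∈ cross P.Ω
  · rw [Set.indicator_of_mem hp]
    have h1 : diffQuot P.s ζ p ^ 2 ≤ (diffQuot P.s (w : Rn n → ℝ) p
        + diffQuot P.s (fun x => u₀ x - φ x) p) ^ 2 := by
      have h2 := abs_softPos_sub_le m ((w : Rn n → ℝ) p.1 + u₀ p.1 - φ p.1)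
          ((w : Rn n → ℝ) p.2 + u₀ p.2 - φ p.2)
      have h3 := sq_le_sq.2 h2
      have h4 := mul_le_mul_of_nonneg_right h3
          (sq_nonneg (‖p.1 - p.2‖ ^ (-(((n : ℝ) + 2 * P.s) / 2))))
      simp only [diffQuot, hζ]
      generalize ‖p.1 - p.2‖ ^ (-(((n : ℝ) + 2 * P.s) / 2)) = k at h4 ⊢
      linarith
    have h5 : P.a p ^ 2 ≤ P.Lam ^ 2 := pow_le_pow_left₀ (P.a_nonneg p) (P.a_upper p) 2
    have h6 : P.a p ^ 2 * diffQuot P.s ζ p ^ 2 ≤ P.Lam ^ 2 * (2 * (diffQuot P.s (w : Rn n → ℝ) p ^ 2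
        + diffQuot P.s (fun x => u₀ x - φ x) p ^ 2)) := by
      refine mul_le_mul h5 (h1.trans ?_) (sq_nonneg _) (sq_nonneg _)
      exact add_sq_le
    have h7 := mul_le_mul_of_nonneg_left h6 (sq_nonneg P.κ)
    linarith
  · rw [diffQuot_eq_zero_of_notMem_cross (fun x hx => hLζ.eq_zero hx) hp]
    simp only [mul_zero, ne_eq, OfNat.ofNat_ne_zero, not_false_eq_true, zero_pow]
    positivity

/-- `R` is unbounded because of the drift, but on truncations of w at a fixed level it grows at most
linearly in the norm of `J w`. Along a convergent sequence of approximations it therefore remains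
bounded. -/
theorem exists_norm_R_le {τ : ℝ} (h₀ : 0 < τ) (h₁ : τ ≤ 1) (hu : HasGrowth P.s M₀ u₀)
    (hφ : HasGrowth P.s M φ) (hle : ∀ x ∉ P.Ω, u₀ x ≤ φ x) (m : ℕ) :
    ∃ K : ℝ, 0 ≤ K ∧ ∀ w ζ : lipTest P.Ω,
      ((ζ : Rn n → ℝ) = fun x => softPos m ((w : Rn n → ℝ) x + u₀ x - φ x)) →
      ‖P.R h₀ h₁ ζ‖ ^ 2 ≤ K * (1 + ‖P.J h₀.le h₁ w‖ ^ 2) := by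
  have hΩm := P.hΩ.measurableSet
  set g₀ : Rn n → ℝ := fun x => (P.Lam + 1) * P.Ω.indicator (fun _ => M₀ + M) x
    + (1 + τ⁻¹) * (m + 2) * ‖P.b x‖ with hg₀
  have hg : MemLp g₀ 2 volume :=
    ((memLp_indicator_const 2 hΩm (M₀ + M) (Or.inr P.hΩb.measure_lt_top.ne)).const_mul _).add
      (P.b_memLp.norm.const_mul _)
  set c := (P.Lam + 1) * (1 + τ⁻¹)
  set e := 2 * (P.κ * P.Lam) ^ 2
  have hd := (hu.sub hφ).memLp_cross_indicator P.hn P.hs₀ P.hs₁ P.hΩb hΩm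
  set d₀ := (cross P.Ω).indicator (diffQuot P.s fun x => u₀ x - φ x)
  have hI1 : 0 ≤ ∫ x, g₀ x ^ 2 := integral_nonneg fun x => sq_nonneg _
  have hI2 : 0 ≤ ∫ p, d₀ p ^ 2 := integral_nonneg fun x => sq_nonneg _
  refine ⟨2 * c ^ 2 + 2 * (∫ x, g₀ x ^ 2) + e + e * ∫ p, d₀ p ^ 2, by positivity,
    fun w ζ hζ => ?_⟩
  have hdw := w.2.memLp_diffQuot P.hn P.hs₀ P.hs₁
  have hw := P.memLp_weight_smul h₀.le h₁ (w.2.memLp_gradient 2)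
  have e1 : ‖P.R h₀ h₁ ζ‖ ^ 2 = (∫ x, (0 : ℝ) ^ 2)
      + (∫ x, ‖(P.weight τ x)⁻¹ • P.flux τ (ζ : Rn n → ℝ) x‖ ^ 2)
      + ∫ p, (P.κ * (P.a p * diffQuot P.s (ζ : Rn n → ℝ) p)) ^ 2 := norm_sq_mkEnergy _ _ _
  have e2 : ‖P.J h₀.le h₁ w‖ ^ 2 = (∫ x, (w : Rn n → ℝ) x ^ 2)
      + (∫ x, ‖P.weight τ x • gradient (w : Rn n → ℝ) x‖ ^ 2)
      + ∫ p, diffQuot P.s (w : Rn n → ℝ) p ^ 2 := norm_sq_mkEnergy _ _ _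
  have i1 := hw.integrable_norm_pow two_ne_zero
  have i2 := hdw.integrable_sq
  have b1 : ∫ x, ‖(P.weight τ x)⁻¹ • P.flux τ (ζ : Rn n → ℝ) x‖ ^ 2
      ≤ 2 * c ^ 2 * (∫ x, ‖P.weight τ x • gradient (w : Rn n → ℝ) x‖ ^ 2)
        + 2 * ∫ x, g₀ x ^ 2 := by
    rw [← integral_const_mul, ← integral_const_mul,
      ← integral_add (i1.const_mul _) (hg.integrable_sq.const_mul _)]
    refine integral_mono_ae ((P.memLp_weight_inv_smul h₀ h₁
      (P.memLp_flux τ ζ.2)).integrable_norm_pow two_ne_zero)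
      ((i1.const_mul _).add (hg.integrable_sq.const_mul _)) ?_
    filter_upwards [ae_norm_flux_le h₀ h₁ hu hφ hle m w hζ] with x hx
    have h2 := pow_le_pow_left₀ (norm_nonneg _) hx 2
    refine h2.trans (add_sq_le.trans (le_of_eq ?_))
    simp only [hg₀, c]
    ring
  have b2 : ∫ p, (P.κ * (P.a p * diffQuot P.s (ζ : Rn n → ℝ) p)) ^ 2
      ≤ e * ((∫ p, diffQuot P.s (w : Rn n → ℝ) p ^ 2) + ∫ p, d₀ p ^ 2) := by
    rw [← integral_add i2 hd.integrable_sq, ← integral_const_mul]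
    exact integral_mono (P.memLp_a_mul (ζ.2.memLp_diffQuot P.hn P.hs₀ P.hs₁)).integrable_sq
      ((i2.add hd.integrable_sq).const_mul e)
      (fun p => sq_diffQuot_softPos_le hu hφ hle m w hζ p)
  have n1 : 0 ≤ ∫ x, (w : Rn n → ℝ) x ^ 2 := integral_nonneg fun x => sq_nonneg _
  have n2 : 0 ≤ ∫ x, ‖P.weight τ x • gradient (w : Rn n → ℝ) x‖ ^ 2 :=
    integral_nonneg fun x => sq_nonneg _
  have n3 : 0 ≤ ∫ p, diffQuot P.s (w : Rn n → ℝ) p ^ 2 := integral_nonneg fun x => sq_nonneg _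
  rw [e1, e2]
  simp only [ne_eq, OfNat.ofNat_ne_zero, not_false_eq_true, zero_pow, integral_zero, zero_add]
  generalize (∫ x, (w : Rn n → ℝ) x ^ 2) = W₀ at *
  generalize (∫ x, ‖P.weight τ x • gradient (w : Rn n → ℝ) x‖ ^ 2) = W₁ at *
  generalize (∫ p, diffQuot P.s (w : Rn n → ℝ) p ^ 2) = W₂ at *
  generalize (∫ x, g₀ x ^ 2) = I₁ at *
  generalize (∫ p, d₀ p ^ 2) = I₂ at *
  have he : 0 ≤ e := by positivity
  have hc2 : 0 ≤ c ^ 2 := sq_nonneg c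
  have hS : 0 ≤ W₀ + W₁ + W₂ := by positivity
  have t1 : c ^ 2 * W₁ ≤ c ^ 2 * (W₀ + W₁ + W₂) := mul_le_mul_of_nonneg_left (by linarith) hc2
  have t2 : e * W₂ ≤ e * (W₀ + W₁ + W₂) := mul_le_mul_of_nonneg_left (by linarith) he
  have t3 : 0 ≤ I₁ * (W₀ + W₁ + W₂) := mul_nonneg hI1 hS
  have t4 : 0 ≤ e * I₂ * (W₀ + W₁ + W₂) := mul_nonneg (mul_nonneg he hI2) hS
  nlinarith

/-- The energy estimate for Lipschitz approximations of a viscous solution. -/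
theorem IsViscous.exists_test {B τ : ℝ} {h₀ : 0 < τ} {h₁ : τ ≤ 1} {v : Rn n → ℝ}
    {G : Rn n → Rn n} (h : IsViscous P u₀ B τ h₀ h₁ v G) (hu : HasGrowth P.s M₀ u₀)
    (hφ : HasGrowth P.s M φ) (hle : ∀ x ∉ P.Ω, u₀ x ≤ φ x) (m : ℕ) {ρ : ℝ} (hρ : 0 < ρ) :
    ∃ w ζ : lipTest P.Ω,
      ((ζ : Rn n → ℝ) = fun x => softPos m ((w : Rn n → ℝ) x + u₀ x - φ x)) ∧
      eLpNorm ((w : Rn n → ℝ) - v) 2 volume ≤ ENNReal.ofReal ρ ∧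
      P.lam / 2 * ((∫ x in P.U₁, ‖gradient (ζ : Rn n → ℝ) x‖ ^ 2)
        + P.κ * ∫ p in P.U₂ ×ˢ Set.univ, diffQuot P.s (ζ : Rn n → ℝ) p ^ 2)
      ≤ ρ + ((∫ x, (ζ : Rn n → ℝ) x ^ 2)
        + (P.Lam + 1) / 2 * M ^ 2 * volume.real (gapSet u₀ φ m w)
        + (M ^ 2 / 2 * (∫ x in gapSet u₀ φ m w, ‖P.b x‖ ^ 2)
          + 1 / 2 * ∫ x in gapSet u₀ φ m w, P.f x ^ 2)
        + P.κ * (P.Lam / 2 * ∫ p in cross (gapSet u₀ φ m w), diffQuot P.s φ p ^ 2)) := by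
  obtain ⟨w, hw⟩ := P.exists_seq_tendsto_J h₀.le h₁ h.mem_closure
  obtain ⟨K, hK0, hK⟩ := exists_norm_R_le h₀ h₁ hu hφ hle m
  obtain ⟨c1, -⟩ := mkEnergy_tendsto_components h.memLp
    (P.memLp_weight_smul h₀.le h₁ h.memLp_grad) h.memLp_diffQuot
    (fun k => (w k).2.memLp 2)
    (fun k => P.memLp_weight_smul h₀.le h₁ ((w k).2.memLp_gradient 2))
    (fun k => (w k).2.memLp_diffQuot P.hn P.hs₀ P.hs₁) hw
  set y := mkEnergy h.memLp (P.memLp_weight_smul h₀.le h₁ h.memLp_grad) h.memLp_diffQuot with hy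
  have ev1 : ∀ᶠ k in atTop, eLpNorm ((w k : Rn n → ℝ) - v) 2 volume ≤ ENNReal.ofReal ρ :=
    c1.eventually (Iic_mem_nhds (ENNReal.ofReal_pos.2 hρ))
  -- By the equation for the solution y, the excess ⟨Rζ, Jw⟩ - load(ζ) equals ⟨Rζ, Jw - y⟩, whose
  -- absolute value is at most this product, a bounded factor times one that vanishes.
  have hlim : Tendsto (fun k => √(K * (1 + ‖P.J h₀.le h₁ (w k)‖ ^ 2)) *
      ‖P.J h₀.le h₁ (w k) - y‖) atTop (𝓝 (√(K * (1 + ‖y‖ ^ 2)) * ‖y - y‖)) :=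
    (((hw.norm.pow 2).const_add 1).const_mul K).sqrt.mul (hw.sub_const y).norm
  rw [sub_self, norm_zero, mul_zero] at hlim
  have ev2 := hlim.eventually (Iic_mem_nhds hρ)
  obtain ⟨k, hk1, hk2⟩ := (ev1.and ev2).exists
  set ζ : lipTest P.Ω := ⟨_, lipTest_softPos hu hφ hle m (w k)⟩
  refine ⟨w k, ζ, rfl, hk1, (energy_lower h₀ h₁ hu hφ hle m (w k) ζ rfl).trans ?_⟩
  refine add_le_add_left ?_ _
  rw [← h.eqn ζ, ← inner_sub_right]
  refine (real_inner_le_norm _ _).trans (le_trans ?_ hk2)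
  refine mul_le_mul_of_nonneg_right (Real.le_sqrt_of_sq_le (hK _ _ rfl)) (norm_nonneg _)

end CoupledProblem

/-! ### The energy estimate in the limit -/

theorem tendsto_eLpNorm_two_of_dominated {α : Type*} [MeasurableSpace α] {μ : Measure α}
    {F : ℕ → α → ℝ} {f g : α → ℝ} (hF : ∀ k, AEStronglyMeasurable (F k) μ)
    (hf : AEStronglyMeasurable f μ) (hg : MemLp g 2 μ) (hb : ∀ k x, |F k x - f x| ≤ g x)
    (hlim : ∀ x, Tendsto (fun k => F k x) atTop (𝓝 (f x))) :
    Tendsto (fun k => eLpNorm (F k - f) 2 μ) atTop (𝓝 0) := by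
  have h1 : Tendsto (fun k => ∫⁻ x, ‖F k x - f x‖ₑ ^ 2 ∂μ) atTop (𝓝 (∫⁻ _, 0 ∂μ)) := by
    refine tendsto_lintegral_of_dominated_convergence' (fun x => ‖g x‖ₑ ^ 2)
      (fun k => ((hF k).sub hf).enorm.pow_const 2)
      (fun k => Eventually.of_forall fun x => ?_) ?_ (Eventually.of_forall fun x => ?_)
    · have h2 : ‖F k x - f x‖ₑ ≤ ‖g x‖ₑ := by
        rw [enorm_le_iff_norm_le]
        exact (hb k x).trans (le_abs_self _)
      exact pow_le_pow_left' h2 2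
    · rw [← eLpNorm_two_sq]
      exact ENNReal.pow_ne_top hg.2.ne
    · have h3 := ((hlim x).sub_const (f x)).enorm
      rw [sub_self, enorm_zero] at h3
      have h4 := ((ENNReal.continuous_pow 2).tendsto 0).comp h3
      rwa [zero_pow two_ne_zero] at h4
  rw [lintegral_zero] at h1
  have h2 := ((ENNReal.continuous_rpow_const (y := (1 / 2 : ℝ))).tendsto _).comp h1
  rw [ENNReal.zero_rpow_of_pos (by norm_num)] at h2
  refine h2.congr fun k => ?_
  simp only [Function.comp]
  have h3 := eLpNorm_two_sq (μ := μ) (f := F k - f)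
  simp only [Pi.sub_apply] at h3
  rw [← h3, ← ENNReal.rpow_natCast, ← ENNReal.rpow_mul]
  norm_num

theorem tendsto_integral_sq_of_tendsto_eLpNorm {α : Type*} [MeasurableSpace α] {μ : Measure α}
    {z : ℕ → α → ℝ} {v : α → ℝ} (hz : ∀ k, MemLp (z k) 2 μ) (hv : MemLp v 2 μ)
    (h : Tendsto (fun k => eLpNorm (z k - v) 2 μ) atTop (𝓝 0)) :
    Tendsto (fun k => ∫ x, z k x ^ 2 ∂μ) atTop (𝓝 (∫ x, v x ^ 2 ∂μ)) := by
  have h0 := (Lp.tendsto_Lp_iff_tendsto_eLpNorm'' z hz v hv).2 h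
  have h1 := h0.inner (𝕜 := ℝ) h0
  simp only [inner_toLp, RCLike.inner_apply, conj_trivial] at h1
  simpa only [sq] using h1

namespace CoupledProblem

variable {P : CoupledProblem n} {u₀ φ : Rn n → ℝ} {M₀ M : ℝ}

/-- Every term is brought to the power |E|^θ. Those linear in |E| use |E| ≤ |Ω|^(1-θ) |E|^θ; those
with b and f use the Hölder bounds supplied as hypotheses. -/
theorem source_terms_le {θ Nf Nb κ₀ : ℝ} {C : ℝ≥0} (hθ₀ : 0 ≤ θ) (hθ₁ : θ ≤ 1)
    (hf : ∀ E ⊆ P.Ω, MeasurableSet E → ∫ x in E, P.f x ^ 2 ≤ Nf ^ 2 * volume.real E ^ θ)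
    (hb : ∀ E ⊆ P.Ω, MeasurableSet E → ∫ x in E, ‖P.b x‖ ^ 2 ≤ Nb ^ 2 * volume.real E ^ θ)
    (hC : ∀ (g : Rn n → ℝ) (M : ℝ), HasGrowth P.s M g → ∀ E ⊆ P.Ω, MeasurableSet E →
      ∫⁻ p in E ×ˢ Set.univ, ‖diffQuot P.s g p‖ₑ ^ 2 ≤ C * ENNReal.ofReal (M ^ 2) * volume E)
    (hκ : P.κ ≤ κ₀) (hφ : HasGrowth P.s M φ) {E : Set (Rn n)} (hE : E ⊆ P.Ω)
    (hEm : MeasurableSet E) :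
    (P.Lam + 1) / 2 * M ^ 2 * volume.real E
      + (M ^ 2 / 2 * (∫ x in E, ‖P.b x‖ ^ 2) + 1 / 2 * ∫ x in E, P.f x ^ 2)
      + P.κ * (P.Lam / 2 * ∫ p in cross E, diffQuot P.s φ p ^ 2)
    ≤ ((((P.Lam + 1) / 2 + κ₀ * P.Lam * C) * volume.real P.Ω ^ (1 - θ) + Nb ^ 2 / 2) * M ^ 2
      + Nf ^ 2 / 2) * volume.real E ^ θ := by
  have hL := P.hLam
  have hk := P.hκ
  have hEfin : volume E ≠ ⊤ := (P.hΩb.subset hE).measure_lt_top.ne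
  have h1 : volume.real E ≤ volume.real P.Ω ^ (1 - θ) * volume.real E ^ θ := by
    calc volume.real E = volume.real E ^ (1 - θ) * volume.real E ^ θ := by
          rw [← Real.rpow_add_of_nonneg measureReal_nonneg (by linarith) hθ₀]; simp
      _ ≤ _ := by
          gcongr
          exact (P.hΩb.measure_lt_top (μ := volume)).ne
  have h2 : ∫ p in cross E, diffQuot P.s φ p ^ 2 ≤ 2 * (C * M ^ 2 * volume.real E) := by
    have h3 := (setLIntegral_diffQuot_cross_le P.s φ E).trans
      (mul_le_mul_right (hC φ M hφ E hE hEm) 2)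
    have h4 := ofReal_integral_norm_sq
      (hφ.memLp_diffQuot_cross P.hn P.hs₀ P.hs₁ (P.hΩb.subset hE) hEm)
    simp only [Real.norm_eq_abs, sq_abs] at h4
    rw [← h4, ← ofReal_measureReal hEfin, ← ENNReal.ofReal_coe_nnreal] at h3
    refine (ENNReal.ofReal_le_ofReal_iff (by positivity)).1 (h3.trans (le_of_eq ?_))
    rw [ENNReal.ofReal_mul (by norm_num), ENNReal.ofReal_mul (by positivity),
      ENNReal.ofReal_mul (by positivity), ENNReal.ofReal_ofNat]
  have h5 := hf E hE hEm
  have h6 := hb E hE hEm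
  set e := volume.real E ^ θ
  have t1 : (P.Lam + 1) / 2 * M ^ 2 * volume.real E
      ≤ (P.Lam + 1) / 2 * M ^ 2 * (volume.real P.Ω ^ (1 - θ) * e) := by gcongr
  have t2 : M ^ 2 / 2 * (∫ x in E, ‖P.b x‖ ^ 2) ≤ M ^ 2 / 2 * (Nb ^ 2 * e) := by gcongr
  have t3 : P.κ * (P.Lam / 2 * ∫ p in cross E, diffQuot P.s φ p ^ 2)
      ≤ κ₀ * (P.Lam / 2 * (2 * (C * M ^ 2 * (volume.real P.Ω ^ (1 - θ) * e)))) := by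
    have : 0 ≤ κ₀ := hk.le.trans hκ
    have h7 : 2 * (C * M ^ 2 * volume.real E)
      ≤ 2 * (C * M ^ 2 * (volume.real P.Ω ^ (1 - θ) * e)) := by gcongr
    have h8 := h2.trans h7
    have h9 : P.Lam / 2 * ∫ p in cross E, diffQuot P.s φ p ^ 2
      ≤ P.Lam / 2 * (2 * (C * M ^ 2 * (volume.real P.Ω ^ (1 - θ) * e))) :=
      mul_le_mul_of_nonneg_left h8 (by positivity)
    exact mul_le_mul hκ h9 (mul_nonneg (by positivity)
      (integral_nonneg fun p => sq_nonneg _)) this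
  nlinarith

/-- Where the truncation of w is active but u ≤ φ, the approximation differs from v by more than
1/(m + 1). Chebyshev bounds that set by (m + 1)² · (2/(m + 1)²)² = 4/(m + 1)². -/
theorem measureReal_gapSet_le {m : ℕ} {w v : Rn n → ℝ} (hw : MemLp w 2 volume)
    (hv : MemLp v 2 volume) (hfin : volume {x | φ x < v x + u₀ x} ≠ ⊤)
    (h : eLpNorm (w - v) 2 volume ≤ ENNReal.ofReal (2 * (1 / ((m : ℝ) + 1) ^ 2))) :
    volume.real (gapSet u₀ φ m w)
      ≤ volume.real {x | φ x < v x + u₀ x} + 4 * (1 / ((m : ℝ) + 1) ^ 2) := by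
  have hsub : gapSet u₀ φ m w ⊆ {x | φ x < v x + u₀ x} ∪
      {x | ENNReal.ofReal (1 / ((m : ℝ) + 1)) ≤ ‖(w - v) x‖ₑ} := by
    intro x hx
    by_cases h1 : φ x < v x + u₀ x
    · exact Or.inl h1
    · refine Or.inr ?_
      have h2 : 1 / ((m : ℝ) + 1) < w x + u₀ x - φ x := hx
      rw [Set.mem_ofPred_eq, ← ofReal_norm]
      refine ENNReal.ofReal_le_ofReal ?_
      rw [Pi.sub_apply, Real.norm_eq_abs]
      refine le_trans ?_ (le_abs_self _)
      linarith
  have hpos : (0 : ℝ) < m + 1 := by positivity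
  have hch := meas_ge_le_mul_pow_eLpNorm_enorm volume (p := 2) two_ne_zero (by norm_num)
    (hw.1.sub hv.1) (ε := ENNReal.ofReal (1 / ((m : ℝ) + 1)))
    (ENNReal.ofReal_pos.2 (by positivity)).ne' fun h => absurd h ENNReal.ofReal_ne_top
  have hch2 : volume {x | ENNReal.ofReal (1 / ((m : ℝ) + 1)) ≤ ‖(w - v) x‖ₑ}
      ≤ ENNReal.ofReal (4 * (1 / ((m : ℝ) + 1) ^ 2)) := by
    refine hch.trans ?_
    rw [ENNReal.toReal_ofNat, ← ENNReal.ofReal_inv_of_pos (by positivity),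
      ENNReal.ofReal_rpow_of_nonneg (by positivity) (by norm_num)]
    calc _ ≤ ENNReal.ofReal ((1 / ((m : ℝ) + 1))⁻¹ ^ (2 : ℝ)) *
          ENNReal.ofReal (2 * (1 / ((m : ℝ) + 1) ^ 2)) ^ (2 : ℝ) := by gcongr
      _ = _ := by
          rw [ENNReal.ofReal_rpow_of_nonneg (by positivity) (by norm_num),
            ← ENNReal.ofReal_mul (by positivity)]
          congr 1
          rw [Real.rpow_two, Real.rpow_two]
          field_simp
          norm_num
  have h3 : volume (gapSet u₀ φ m w) ≤ volume {x | φ x < v x + u₀ x}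
      + ENNReal.ofReal (4 * (1 / ((m : ℝ) + 1) ^ 2)) :=
    (measure_mono hsub).trans ((measure_union_le _ _).trans (add_le_add le_rfl hch2))
  have h4 := ENNReal.toReal_mono (ENNReal.add_ne_top.2 ⟨hfin, ENNReal.ofReal_ne_top⟩) h3
  rwa [ENNReal.toReal_add hfin ENNReal.ofReal_ne_top, ENNReal.toReal_ofReal (by positivity)] at h4

theorem memLp_posPart (hu : HasGrowth P.s M₀ u₀) (hφ : HasGrowth P.s M φ)
    (hle : ∀ x ∉ P.Ω, u₀ x ≤ φ x) {v : Rn n → ℝ} (hv : MemLp v 2 volume)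
    (hz : ∀ x ∉ P.Ω, v x = 0) : MemLp (fun x => max (v x + u₀ x - φ x) 0) 2 volume := by
  have hd : Continuous fun x => u₀ x - φ x := hu.lipschitz.continuous.sub hφ.lipschitz.continuous
  obtain ⟨K, hK⟩ := P.hΩb.isCompact_closure.exists_bound_of_continuousOn hd.continuousOn
  have h1 : MemLp (fun x => |v x| + P.Ω.indicator (fun _ => |K|) x) 2 volume :=
    hv.norm.add (memLp_indicator_const 2 P.hΩ.measurableSet |K|
      (Or.inr P.hΩb.measure_lt_top.ne))
  refine h1.of_le (((hv.1.add hu.lipschitz.continuous.aestronglyMeasurable).sub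
    hφ.lipschitz.continuous.aestronglyMeasurable).sup aestronglyMeasurable_const)
    (Eventually.of_forall fun x => ?_)
  rw [Real.norm_of_nonneg (le_max_right _ _)]
  refine le_trans ?_ (le_abs_self _)
  by_cases hx : x ∈ P.Ω
  · rw [Set.indicator_of_mem hx]
    have h2 := (le_abs_self _).trans ((hK x (subset_closure hx)).trans (le_abs_self K))
    have h3 := le_abs_self (v x)
    exact max_le (by linarith) (by positivity)
  · rw [Set.indicator_of_notMem hx, hz x hx]
    simp [hle x hx]

/-- A diagonal argument: for each truncation level m a viscous solution close to v' is chosen, then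
a Lipschitz approximation of it. The estimate for the truncations has a convergent right-hand side,
and lower semicontinuity transfers it to (u-φ)_+. -/
theorem energy_limit {θ Nf Nb κ₀ : ℝ} {C : ℝ≥0} (hθ₀ : 0 ≤ θ) (hθ₁ : θ ≤ 1)
    (hf : ∀ E ⊆ P.Ω, MeasurableSet E → ∫ x in E, P.f x ^ 2 ≤ Nf ^ 2 * volume.real E ^ θ)
    (hb : ∀ E ⊆ P.Ω, MeasurableSet E → ∫ x in E, ‖P.b x‖ ^ 2 ≤ Nb ^ 2 * volume.real E ^ θ)
    (hC : ∀ (g : Rn n → ℝ) (M : ℝ), HasGrowth P.s M g → ∀ E ⊆ P.Ω, MeasurableSet E →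
      ∫⁻ p in E ×ˢ Set.univ, ‖diffQuot P.s g p‖ₑ ^ 2 ≤ C * ENNReal.ofReal (M ^ 2) * volume E)
    (hκ : P.κ ≤ κ₀) (hu : HasGrowth P.s M₀ u₀) (hφ : HasGrowth P.s M φ)
    (hle : ∀ x ∉ P.Ω, u₀ x ≤ φ x) {B : ℝ} {τ : ℕ → ℝ} {h₀ : ∀ k, 0 < τ k} {h₁ : ∀ k, τ k ≤ 1}
    {v : ℕ → Rn n → ℝ} {G : ℕ → Rn n → Rn n}
    (h : ∀ k, IsViscous P u₀ B (τ k) (h₀ k) (h₁ k) (v k) (G k)) {v' : Rn n → ℝ}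
    (hv : MemLp v' 2 volume) (hz : ∀ x ∉ P.Ω, v' x = 0)
    (hlim : Tendsto (fun k => eLpNorm (v k - v') 2 volume) atTop (𝓝 0)) :
    ∃ g : Rn n → Rn n, HasWeakGradient P.U₁ (fun x => max (v' x + u₀ x - φ x) 0) g ∧
      MemLp g 2 volume ∧ (∫⁻ x in P.U₁, ‖g x‖ₑ ^ 2) + ENNReal.ofReal P.κ *
        ∫⁻ p in P.U₂ ×ˢ Set.univ, ‖diffQuot P.s (fun x => max (v' x + u₀ x - φ x) 0) p‖ₑ ^ 2
      ≤ ENNReal.ofReal (2 / P.lam * ((∫ x, max (v' x + u₀ x - φ x) 0 ^ 2) +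
        ((((P.Lam + 1) / 2 + κ₀ * P.Lam * C) * volume.real P.Ω ^ (1 - θ) + Nb ^ 2 / 2) * M ^ 2
        + Nf ^ 2 / 2) * volume.real {x | φ x < v' x + u₀ x} ^ θ)) := by
  have hlam := P.hlam
  -- The L² error must be small compared with the truncation threshold 1/(m + 1); its square makes
  -- the Chebyshev bound vanish as m → ∞.
  set δ : ℕ → ℝ := fun m => 1 / ((m : ℝ) + 1) ^ 2 with hδ
  have hδ0 : ∀ m, 0 < δ m := fun m => by positivity
  have hδt : Tendsto δ atTop (𝓝 0) := by
    have := (tendsto_one_div_add_atTop_nhds_zero_nat (𝕜 := ℝ)).pow 2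
    simpa [hδ] using this
  have hsub : {x | φ x < v' x + u₀ x} ⊆ P.Ω := fun x hx => by
    by_contra hxΩ
    have h1 : φ x < v' x + u₀ x := hx
    rw [hz x hxΩ] at h1
    linarith [hle x hxΩ]
  have hfin : volume {x | φ x < v' x + u₀ x} ≠ ⊤ := (P.hΩb.subset hsub).measure_lt_top.ne
  have hex : ∀ m, ∃ k, eLpNorm (v k - v') 2 volume ≤ ENNReal.ofReal (δ m) := fun m =>
    (hlim.eventually (Iic_mem_nhds (ENNReal.ofReal_pos.2 (hδ0 m)))).exists
  choose k hk using hex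
  choose w ζ hζ hwv hen using fun m => (h (k m)).exists_test hu hφ hle m (hδ0 m)
  have hwv' : ∀ m, eLpNorm ((w m : Rn n → ℝ) - v') 2 volume ≤ ENNReal.ofReal (2 * δ m) := by
    intro m
    have h1 := eLpNorm_add_le (((w m).2.memLp 2).sub (h (k m)).memLp).1
      ((h (k m)).memLp.sub hv).1 (p := 2) (by norm_num)
    rw [sub_add_sub_cancel] at h1
    refine h1.trans ((add_le_add (hwv m) (hk m)).trans (le_of_eq ?_))
    rw [← ENNReal.ofReal_add (hδ0 m).le (hδ0 m).le, two_mul]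
  set p : Rn n → ℝ := fun x => max (v' x + u₀ x - φ x) 0 with hp
  have hpm : MemLp p 2 volume := memLp_posPart hu hφ hle hv hz
  have hum : AEStronglyMeasurable (fun x => v' x + u₀ x - φ x) volume :=
    (hv.1.add hu.lipschitz.continuous.aestronglyMeasurable).sub
      hφ.lipschitz.continuous.aestronglyMeasurable
  have hζlim : Tendsto (fun m => eLpNorm ((ζ m : Rn n → ℝ) - p) 2 volume) atTop (𝓝 0) := by
    set Z : ℕ → Rn n → ℝ := fun m x => softPos m (v' x + u₀ x - φ x) with hZ
    have hZm : ∀ m, AEStronglyMeasurable (Z m) volume := fun m =>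
      (continuous_softPos m).comp_aestronglyMeasurable hum
    have c1 : Tendsto (fun m => eLpNorm (Z m - p) 2 volume) atTop (𝓝 0) := by
      refine tendsto_eLpNorm_two_of_dominated hZm hpm.1 hpm (fun m x => ?_)
        (fun x => tendsto_softPos _)
      have h1 := softPos_le m (v' x + u₀ x - φ x)
      have h2 := softPos_nonneg m (v' x + u₀ x - φ x)
      simp only [hZ, hp]
      rw [abs_of_nonpos (by linarith)]
      linarith
    have c2 : Tendsto (fun m => ENNReal.ofReal (2 * δ m)) atTop (𝓝 0) := by
      have := ENNReal.tendsto_ofReal (hδt.const_mul 2)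
      simpa using this
    have c3 := c2.add c1
    rw [add_zero] at c3
    refine tendsto_of_tendsto_of_tendsto_of_le_of_le tendsto_const_nhds c3 (fun m => zero_le)
      fun m => ?_
    have h1 := eLpNorm_add_le (((ζ m).2.memLp 2).1.sub (hZm m)) ((hZm m).sub hpm.1) (p := 2)
      (by norm_num)
    rw [sub_add_sub_cancel] at h1
    refine h1.trans (add_le_add (le_trans ?_ (hwv' m)) le_rfl)
    -- All the truncations are 1-Lipschitz, so the error of w passes to ζ unchanged whatever m is;
    -- what remains is softPos m → (·)_+ at the fixed function.
    refine eLpNorm_mono fun x => ?_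
    simp only [hζ m, hZ, Pi.sub_apply, Real.norm_eq_abs]
    refine (abs_softPos_sub_le m _ _).trans (le_of_eq ?_)
    congr 1; ring
  set K := ((((P.Lam + 1) / 2 + κ₀ * P.Lam * C) * volume.real P.Ω ^ (1 - θ) + Nb ^ 2 / 2) * M ^ 2
        + Nf ^ 2 / 2) with hK
  have hK0 : 0 ≤ K := by
    have := P.hLam
    have : 0 ≤ κ₀ := P.hκ.le.trans hκ
    positivity
  set e := volume.real {x | φ x < v' x + u₀ x} with he
  -- The exponent θ may be zero, when q = 2; t ↦ t^θ is still continuous at 0 since 0⁰ = 1.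
  have hr : Tendsto (fun m => 2 / P.lam * (δ m + ((∫ x, (ζ m : Rn n → ℝ) x ^ 2)
      + K * (e + 4 * δ m) ^ θ))) atTop
      (𝓝 (2 / P.lam * (0 + ((∫ x, p x ^ 2) + K * (e + 4 * 0) ^ θ)))) := by
    refine (hδt.add ((tendsto_integral_sq_of_tendsto_eLpNorm (fun m => (ζ m).2.memLp 2) hpm
      hζlim).add (Tendsto.const_mul K ?_))).const_mul _
    exact ((Real.continuous_rpow_const hθ₀).tendsto _).comp ((hδt.const_mul 4).const_add e)
  rw [mul_zero, add_zero, zero_add] at hr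
  refine exists_hasWeakGradient_of_energy_le P.hκ P.pair.isOpen₁ (fun m => (ζ m).2)
    (fun m => (ζ m).2.memLp_diffQuot P.hn P.hs₀ P.hs₁) hpm hζlim hr fun m => ?_
  have hEm : MeasurableSet (gapSet u₀ φ m (w m)) := measurableSet_gapSet hu hφ m (w m)
  have hEΩ : gapSet u₀ φ m (w m) ⊆ P.Ω := gapSet_subset hle m (w m)
  have h1 := source_terms_le hθ₀ hθ₁ hf hb hC hκ hφ hEΩ hEm
  have h2 := measureReal_gapSet_le ((w m).2.memLp 2) hv hfin (hwv' m)
  have h3 : K * volume.real (gapSet u₀ φ m (w m)) ^ θ ≤ K * (e + 4 * δ m) ^ θ := by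
    gcongr
  have h4 := hen m
  rw [← hK] at h1
  rw [div_mul_eq_mul_div, le_div_iff₀ hlam]
  linarith

end CoupledProblem

/-! ### The vanishing viscosity limit -/

theorem HasWeakGradient.congr {U : Set (Rn n)} (hU : MeasurableSet U) {v : Rn n → ℝ}
    {G H : Rn n → Rn n} (h : HasWeakGradient U v G) (hH : MemLp H 2 volume)
    (hGH : ∀ x ∈ U, G x = H x) : HasWeakGradient U v H where
  locInt := h.locInt
  locInt_grad := (hH.locallyIntegrable (by norm_num)).locallyIntegrableOn U
  parts φ hφ := by
    rw [h.parts φ hφ]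
    congr 1
    exact setIntegral_congr_fun hU fun x hx => by simp only [hGH x hx]

namespace CoupledProblem

variable {P : CoupledProblem n} {u₀ : Rn n → ℝ} {M₀ : ℝ}

theorem norm_mkEnergy_weight_zero_le {τ : ℝ} (h₀ : 0 ≤ τ) (h₁ : τ ≤ 1) {v : Rn n → ℝ}
    {G : Rn n → Rn n} {d : Rn n × Rn n → ℝ} (hv : MemLp v 2 volume) (hG : MemLp G 2 volume)
    (hd : MemLp d 2 volume) :
    ‖mkEnergy hv (P.memLp_weight_smul le_rfl zero_le_one hG) hd‖
      ≤ ‖mkEnergy hv (P.memLp_weight_smul h₀ h₁ hG) hd‖ := by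
  refine le_of_sq_le_sq ?_ (norm_nonneg _)
  rw [norm_sq_mkEnergy, norm_sq_mkEnergy]
  refine add_le_add (add_le_add le_rfl ?_) le_rfl
  refine integral_mono
    ((P.memLp_weight_smul le_rfl zero_le_one hG).integrable_norm_pow two_ne_zero)
    ((P.memLp_weight_smul h₀ h₁ hG).integrable_norm_pow two_ne_zero) fun x => ?_
  by_cases hx : x ∈ P.U₁
  · simp only [P.weight_of_mem _ hx, le_refl]
  · simp only [P.weight_of_notMem 0 hx, zero_smul, norm_zero, ne_eq, OfNat.ofNat_ne_zero,
      not_false_eq_true, zero_pow]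
    exact sq_nonneg _

section

variable {B τ : ℝ} {h₀ : 0 < τ} {h₁ : τ ≤ 1} {v : Rn n → ℝ} {G : Rn n → Rn n}

/-- The element of the energy space with gradient restricted to `U₁`. -/
def IsViscous.energy (h : IsViscous P u₀ B τ h₀ h₁ v G) : EnergySpace n :=
  mkEnergy h.memLp (P.memLp_weight_smul le_rfl zero_le_one h.memLp_grad) h.memLp_diffQuot

theorem IsViscous.norm_energy_le (h : IsViscous P u₀ B τ h₀ h₁ v G) : ‖h.energy‖ ≤ B :=
  (norm_mkEnergy_weight_zero_le h₀.le h₁ h.memLp h.memLp_grad h.memLp_diffQuot).trans h.norm_le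

/-- Lowering the weight off U₁ from τ to 0 decreases the norm, so the same test functions
approximate in the weaker space. All viscous solutions then live in one closed subspace, stable
under weak limits. -/
theorem IsViscous.energy_mem_closure (h : IsViscous P u₀ B τ h₀ h₁ v G) :
    h.energy ∈ (LinearMap.range (P.J le_rfl zero_le_one)).topologicalClosure := by
  obtain ⟨w, hw⟩ := P.exists_seq_tendsto_J h₀.le h₁ h.mem_closure
  rw [← SetLike.mem_coe, Submodule.topologicalClosure_coe, mem_closure_iff_seq_limit]
  refine ⟨fun k => P.J le_rfl zero_le_one (w k), fun k => ⟨w k, rfl⟩, ?_⟩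
  rw [tendsto_iff_norm_sub_tendsto_zero] at hw ⊢
  refine squeeze_zero (fun _ => norm_nonneg _) (fun k => ?_) hw
  have e : ∀ (σ : ℝ) (hσ₀ : 0 ≤ σ) (hσ₁ : σ ≤ 1), P.J hσ₀ hσ₁ (w k)
      - mkEnergy h.memLp (P.memLp_weight_smul hσ₀ hσ₁ h.memLp_grad) h.memLp_diffQuot
      = mkEnergy (((w k).2.memLp 2).sub h.memLp) (P.memLp_weight_smul hσ₀ hσ₁
        (((w k).2.memLp_gradient 2).sub h.memLp_grad))
        (((w k).2.memLp_diffQuot P.hn P.hs₀ P.hs₁).sub h.memLp_diffQuot) := by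
    intro σ hσ₀ hσ₁
    change mkEnergy _ _ _ - mkEnergy _ _ _ = _
    rw [mkEnergy_sub]
    refine mkEnergy_congr _ _ _ _ _ _ EventuallyEq.rfl (Eventually.of_forall fun x => ?_)
      EventuallyEq.rfl
    simp only [Pi.sub_apply, smul_sub]
  rw [IsViscous.energy, e, e]
  exact norm_mkEnergy_weight_zero_le h₀.le h₁ (((w k).2.memLp 2).sub h.memLp)
    (((w k).2.memLp_gradient 2).sub h.memLp_grad)
    (((w k).2.memLp_diffQuot P.hn P.hs₀ P.hs₁).sub h.memLp_diffQuot)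

/-- In τ²⟨G, ∇ζ⟩ one factor τ stays with G, where the energy norm bounds it uniformly; the other
gives the decay. -/
theorem IsViscous.abs_viscous_le (h : IsViscous P u₀ B τ h₀ h₁ v G) {ζ : Rn n → ℝ}
    (hζ : LipTest P.Ω ζ) : |τ ^ 2 * ∫ x, (inner ℝ (G x) (gradient ζ x) : ℝ)|
      ≤ B * (τ * √(∫ x, ‖gradient ζ x‖ ^ 2)) := by
  have hg := hζ.memLp_gradient 2
  have hw : MemLp (fun x => τ ^ 2 • (P.weight τ x)⁻¹ • gradient ζ x) 2 volume :=
    (P.memLp_weight_inv_smul h₀ h₁ hg).const_smul (τ ^ 2)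
  have e1 : τ ^ 2 * ∫ x, (inner ℝ (G x) (gradient ζ x) : ℝ)
      = inner ℝ (mkEnergy h.memLp (P.memLp_weight_smul h₀.le h₁ h.memLp_grad) h.memLp_diffQuot)
        (mkEnergy (f := fun _ => 0) MemLp.zero hw (d := fun _ => 0) MemLp.zero) := by
    rw [inner_mkEnergy, ← integral_const_mul]
    simp only [mul_zero, integral_zero, zero_add, add_zero]
    refine integral_congr_ae (Eventually.of_forall fun x => ?_)
    simp only
    rw [real_inner_smul_left, real_inner_smul_right, real_inner_smul_right]
    have := (P.weight_pos h₀ x).ne'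
    field_simp
  rw [e1]
  refine (abs_real_inner_le_norm _ _).trans (mul_le_mul h.norm_le ?_ (norm_nonneg _)
    ((norm_nonneg _).trans h.norm_le))
  refine le_of_sq_le_sq ?_ (by positivity)
  rw [norm_sq_mkEnergy, mul_pow, Real.sq_sqrt (integral_nonneg fun x => sq_nonneg _),
    ← integral_const_mul]
  simp only [ne_eq, OfNat.ofNat_ne_zero, not_false_eq_true, zero_pow, integral_zero, zero_add,
    add_zero]
  refine integral_mono (hw.integrable_norm_pow two_ne_zero)
    ((hg.integrable_norm_pow two_ne_zero).const_mul _) fun x => ?_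
  simp only
  rw [← mul_pow, smul_smul, norm_smul]
  refine pow_le_pow_left₀ (by positivity) (mul_le_mul_of_nonneg_right ?_ (norm_nonneg _)) 2
  rw [Real.norm_of_nonneg (mul_nonneg (sq_nonneg τ) (inv_nonneg.2 (P.weight_pos h₀ x).le))]
  by_cases hx : x ∈ P.U₁
  · rw [P.weight_of_mem _ hx]; nlinarith
  · rw [P.weight_of_notMem _ hx]
    exact le_of_eq (by field_simp)

end

/-- The bilinear form without viscosity, represented in the energy space. -/
def dualElement {ζ : Rn n → ℝ} (hζ : LipTest P.Ω ζ) : EnergySpace n :=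
  mkEnergy hζ.memLp_inner_b.neg (P.memLp_A_apply (hζ.memLp_gradient 2))
    (P.memLp_a_mul (hζ.memLp_diffQuot P.hn P.hs₀ P.hs₁))

theorem inner_dualElement {ζ v : Rn n → ℝ} {G : Rn n → Rn n} {d : Rn n × Rn n → ℝ}
    (hζ : LipTest P.Ω ζ) (hv : MemLp v 2 volume) (hG : MemLp G 2 volume) (hd : MemLp d 2 volume) :
    inner ℝ (mkEnergy hv hG hd) (dualElement hζ) = (∫ x, (inner ℝ (P.A x (G x)) (gradient ζ x) : ℝ))
      - (∫ x, v x * inner ℝ (P.b x) (gradient ζ x))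
      + P.κ * ∫ p, P.a p * (d p * diffQuot P.s ζ p) := by
  rw [dualElement, inner_mkEnergy, ← integral_const_mul, sub_eq_add_neg, ← integral_neg,
    add_comm (∫ x, (inner ℝ (P.A x (G x)) (gradient ζ x) : ℝ))]
  congr 1
  · simp only [Pi.neg_apply, mul_neg, P.A_symm]
  · refine integral_congr_ae (Eventually.of_forall fun p => ?_)
    simp only
    ring

theorem load_eq_sub (hu : HasGrowth P.s M₀ u₀) (τ : ℝ) {ζ : Rn n → ℝ} (hζ : LipTest P.Ω ζ) :
    P.load u₀ τ ζ = P.load u₀ 0 ζ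
      - τ ^ 2 * ∫ x, (inner ℝ (P.Ω.indicator (gradient u₀) x) (gradient ζ x) : ℝ) := by
  have hGu := hu.memLp_indicator_gradient P.hΩb P.hΩ.measurableSet
  have hg := hζ.memLp_gradient 2
  have i1 := integrable_inner_of_memLp (P.memLp_A_apply hGu) hg
  have i2 := (integrable_inner_of_memLp hGu hg).const_mul (τ ^ 2)
  rw [load_eq u₀ τ hζ, load_eq u₀ 0 hζ]
  simp only [inner_add_left, real_inner_smul_left, ne_eq, OfNat.ofNat_ne_zero, not_false_eq_true,
    zero_pow, zero_mul, add_zero]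
  rw [integral_add i1 i2, integral_const_mul]
  ring

theorem IsViscous.inner_energy {B τ : ℝ} {h₀ : 0 < τ} {h₁ : τ ≤ 1} {v : Rn n → ℝ}
    {G : Rn n → Rn n} (h : IsViscous P u₀ B τ h₀ h₁ v G) {ζ : Rn n → ℝ} (hζ : LipTest P.Ω ζ) :
    inner ℝ h.energy (dualElement hζ)
      = P.load u₀ τ ζ - τ ^ 2 * ∫ x, (inner ℝ (G x) (gradient ζ x) : ℝ) := by
  rw [IsViscous.energy, inner_dualElement, ← h.equation hζ]
  have e : ∀ x, P.A x (P.weight 0 x • G x) = P.A x (G x) := by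
    intro x
    by_cases hx : x ∈ P.U₁
    · rw [P.weight_of_mem _ hx, one_smul]
    · simp [P.A_zero x hx]
  simp only [e]
  ring

/-- Uniform bounds give a weak limit of the energies with gradient restricted to U₁. The equation
passes to the limit because, for each Lipschitz ζ, it is a pairing with the fixed element
`dualElement` up to terms that vanish with τ. Strong L² convergence is needed later, for the
truncations. -/
theorem exists_limit (hu : HasGrowth P.s M₀ u₀) :
    ∃ (B : ℝ) (τ : ℕ → ℝ) (h₀ : ∀ k, 0 < τ k) (h₁ : ∀ k, τ k ≤ 1) (v : ℕ → Rn n → ℝ)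
      (G : ℕ → Rn n → Rn n) (h : ∀ k, IsViscous P u₀ B (τ k) (h₀ k) (h₁ k) (v k) (G k))
      (v' : Rn n → ℝ) (g : Rn n → Rn n) (hv : MemLp v' 2 volume) (hg : MemLp g 2 volume)
      (hd : MemLp (diffQuot P.s v') 2 volume), Tendsto τ atTop (𝓝 0) ∧ (∀ x ∉ P.Ω, v' x = 0) ∧
      HasWeakGradient P.U₁ v' g ∧
      (∀ z, Tendsto (fun k => (inner ℝ (h k).energy z : ℝ)) atTop
        (𝓝 (inner ℝ (mkEnergy hv hg hd) z))) ∧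
      Tendsto (fun k => eLpNorm (v k - v') 2 volume) atTop (𝓝 0) ∧
      ∀ ζ, LipTest P.Ω ζ → (∫ x, (inner ℝ (P.A x (g x)) (gradient ζ x) : ℝ))
        - (∫ x, v' x * inner ℝ (P.b x) (gradient ζ x))
        + P.κ * ∫ p, P.a p * (diffQuot P.s v' p * diffQuot P.s ζ p) = P.load u₀ 0 ζ := by
  obtain ⟨B, hB⟩ := exists_isViscous hu
  set σ : ℕ → ℝ := fun k => 1 / ((k : ℝ) + 1) with hσ
  have hσ₀ : ∀ k, 0 < σ k := fun k => by positivity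
  have hσ₁ : ∀ k, σ k ≤ 1 := fun k => by
    rw [hσ, div_le_one (by positivity)]
    linarith [Nat.cast_nonneg (α := ℝ) k]
  choose v G h using fun k => hB (σ k) (hσ₀ k) (hσ₁ k)
  obtain ⟨y, ns, hns, hy⟩ := exists_weak_subseq fun k => (h k).norm_energy_le
  have hmem : y ∈ (LinearMap.range (P.J le_rfl zero_le_one)).topologicalClosure :=
    mem_of_weak_tendsto (Submodule.isClosed_topologicalClosure _)
      (fun k => (h (ns k)).energy_mem_closure) hy
  obtain ⟨v', g, hv, hg, hd, rfl, hz, hw⟩ := P.exists_repr_of_mem_closure le_rfl zero_le_one hmem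
  have hτ : Tendsto (fun k => σ (ns k)) atTop (𝓝 0) :=
    (tendsto_one_div_add_atTop_nhds_zero_nat (𝕜 := ℝ)).comp hns.tendsto_atTop
  refine ⟨B, fun k => σ (ns k), fun k => hσ₀ _, fun k => hσ₁ _, fun k => v (ns k),
    fun k => G (ns k), fun k => h (ns k), v', g, hv, hg, hd, hτ, hz, ?_, hy, ?_, fun ζ hζ => ?_⟩
  · refine (hw P.U₁ fun x hx => by rw [P.weight_of_mem _ hx]; norm_num).congr
      P.pair.isOpen₁.measurableSet hg fun x hx => ?_
    rw [P.weight_of_mem _ hx, inv_one, one_smul]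
  · set N := B + ‖mkEnergy hv hg hd‖ with hN
    have hnorm : ∀ k, ‖(h (ns k)).energy - mkEnergy hv hg hd‖ ≤ N := fun k =>
      (norm_sub_le _ _).trans (add_le_add_left (h _).norm_energy_le _)
    have hN0 : 0 ≤ N := (norm_nonneg _).trans (hnorm 0)
    have hsq : ∀ k, (∫ x, (v (ns k) x - v' x) ^ 2) ≤ N ^ 2 ∧
        (∫ p, (diffQuot P.s (v (ns k)) p - diffQuot P.s v' p) ^ 2) ≤ N ^ 2 := by
      intro k
      have h1 := pow_le_pow_left₀ (norm_nonneg _) (hnorm k) 2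
      rw [IsViscous.energy, mkEnergy_sub, norm_sq_mkEnergy] at h1
      simp only [Pi.sub_apply] at h1
      have n1 : 0 ≤ ∫ x, (v (ns k) x - v' x) ^ 2 := integral_nonneg fun x => sq_nonneg _
      have n2 : 0 ≤ ∫ x, ‖P.weight 0 x • G (ns k) x - g x‖ ^ 2 :=
        integral_nonneg fun x => sq_nonneg _
      have n3 : 0 ≤ ∫ p, (diffQuot P.s (v (ns k)) p - diffQuot P.s v' p) ^ 2 :=
        integral_nonneg fun x => sq_nonneg _
      constructor <;> linarith
    -- Compactness is applied to the differences. One constant must bound both an L² norm, at most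
    -- N, and a squared seminorm, at most N²; hence N² + N.
    refine tendsto_eLpNorm_of_weak P.hn P.hs₀ P.hΩb P.hΩ.measurableSet
      (v := fun k => v (ns k) - v') (B := (N ^ 2 + N).toNNReal)
      (fun k => (h _).memLp.sub hv) (fun k x hx => ?_) (fun k => ?_) (fun k => ?_) (fun ψ hψ => ?_)
    · rw [Pi.sub_apply, (h _).eq_zero x hx, hz x hx, sub_zero]
    · have h1 := ofReal_integral_norm_sq ((h (ns k)).memLp.sub hv)
      rw [← eLpNorm_two_sq] at h1
      simp only [Pi.sub_apply, Real.norm_eq_abs, sq_abs] at h1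
      have h2 : eLpNorm (v (ns k) - v') 2 volume ^ 2 ≤ ENNReal.ofReal N ^ 2 := by
        rw [← h1, ← ENNReal.ofReal_pow hN0]
        exact ENNReal.ofReal_le_ofReal (hsq k).1
      refine ((ENNReal.pow_le_pow_left_iff two_ne_zero).1 h2).trans ?_
      exact ENNReal.ofReal_le_ofReal (by nlinarith)
    · have e : ∀ p, diffQuot P.s (v (ns k) - v') p
          = diffQuot P.s (v (ns k)) p - diffQuot P.s v' p := fun p => diffQuot_sub _ _ _ _
      simp only [e]
      have h1 := ofReal_integral_norm_sq ((h (ns k)).memLp_diffQuot.sub hd)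
      simp only [Pi.sub_apply, Real.norm_eq_abs, sq_abs] at h1
      rw [← h1]
      exact ENNReal.ofReal_le_ofReal ((hsq k).2.trans (by linarith))
    · have h1 := hy (mkEnergy hψ (G := fun _ => 0) MemLp.zero (d := fun _ => 0) MemLp.zero)
      simp only [IsViscous.energy, inner_mkEnergy, inner_zero_right, mul_zero, integral_zero,
        add_zero] at h1
      have h2 := h1.sub_const (∫ x, v' x * ψ x)
      rw [sub_self] at h2
      refine h2.congr fun k => ?_
      have i1 : Integrable fun x => v (ns k) x * ψ x := (h _).memLp.integrable_mul hψ
      have i2 : Integrable fun x => v' x * ψ x := hv.integrable_mul hψ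
      rw [← integral_sub i1 i2]
      refine integral_congr_ae (Eventually.of_forall fun x => ?_)
      simp only [Pi.sub_apply]
      ring
  · have h1 := hy (dualElement hζ)
    -- Both the viscosity of the solution and that of u₀ on Ω are separated off; the former is O(τ)
    -- and the latter O(τ²).
    have e : ∀ k, (inner ℝ (h (ns k)).energy (dualElement hζ) : ℝ) = P.load u₀ 0 ζ
        - σ (ns k) ^ 2 * (∫ x, (inner ℝ (P.Ω.indicator (gradient u₀) x) (gradient ζ x) : ℝ))
        - σ (ns k) ^ 2 * ∫ x, (inner ℝ (G (ns k) x) (gradient ζ x) : ℝ) := fun k => by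
      rw [(h _).inner_energy hζ, load_eq_sub hu (σ (ns k)) hζ]
    simp only [e] at h1
    rw [inner_dualElement] at h1
    have t1 : Tendsto (fun k => σ (ns k) ^ 2 * ∫ x,
        (inner ℝ (P.Ω.indicator (gradient u₀) x) (gradient ζ x) : ℝ)) atTop (𝓝 0) := by
      have := (hτ.pow 2).mul_const (∫ x,
        (inner ℝ (P.Ω.indicator (gradient u₀) x) (gradient ζ x) : ℝ))
      simpa using this
    have t2 : Tendsto (fun k => σ (ns k) ^ 2 * ∫ x,
        (inner ℝ (G (ns k) x) (gradient ζ x) : ℝ)) atTop (𝓝 0) := by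
      have := (hτ.mul_const √(∫ x, ‖gradient ζ x‖ ^ 2)).const_mul B
      rw [zero_mul, mul_zero] at this
      exact squeeze_zero_norm (fun k => (h _).abs_viscous_le hζ) this
    have t3 := (tendsto_const_nhds (x := P.load u₀ 0 ζ)).sub t1 |>.sub t2
    rw [sub_zero, sub_zero] at t3
    exact tendsto_nhds_unique h1 t3

end CoupledProblem

/-! ### Growth of barriers and Hölder bounds -/

theorem hasGrowth_of_flatness_lt_top {s : ℝ} {φ : Rn n → ℝ} (h₀ : ∀ x, 0 ≤ φ x)
    (h : flatness s φ < ⊤) : HasGrowth s (flatness s φ).toReal φ where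
  nonneg := ENNReal.toReal_nonneg
  lip x y := by
    rcases eq_or_ne x y with rfl | hxy
    · simp
    have h1 : edist (φ x) (φ y) / edist x y ≤ flatness s φ :=
      (le_iSup₂ (f := fun x y : Rn n => edist (φ x) (φ y) / edist x y) x y).trans
        (le_max_left _ _)
    rw [ENNReal.div_le_iff (edist_pos.2 hxy).ne' (edist_ne_top x y)] at h1
    have h2 := ENNReal.toReal_mono (ENNReal.mul_ne_top h.ne (edist_ne_top x y)) h1
    rwa [ENNReal.toReal_mul, ← dist_edist, ← dist_edist, Real.dist_eq, dist_eq_norm] at h2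
  bound x := by
    have h1 : ENNReal.ofReal (φ x / (1 + ‖x‖ ^ (s / 2))) ≤ flatness s φ :=
      (le_iSup (fun x : Rn n => ENNReal.ofReal (φ x / (1 + ‖x‖ ^ (s / 2)))) x).trans
        (le_max_right _ _)
    have h2 := (ENNReal.ofReal_le_iff_le_toReal h.ne).1 h1
    rw [abs_of_nonneg (h₀ x)]
    rwa [div_le_iff₀ (by positivity)] at h2

theorem hasGrowth_of_abs_le {s : ℝ} {u ψ : Rn n → ℝ} {K : ℝ≥0} (hu : LipschitzWith K u)
    (hle : ∀ x, |u x| ≤ ψ x) (h : flatness s ψ < ⊤) :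
    HasGrowth s (max K (flatness s ψ).toReal) u where
  nonneg := K.2.trans (le_max_left _ _)
  lip x y := by
    have h1 := hu.dist_le_mul x y
    rw [Real.dist_eq, dist_eq_norm] at h1
    exact h1.trans (mul_le_mul_of_nonneg_right (le_max_left _ _) (norm_nonneg _))
  bound x := by
    have h1 := (hasGrowth_of_flatness_lt_top (fun x => (abs_nonneg _).trans (hle x)) h).bound x
    exact (hle x).trans ((le_abs_self _).trans (h1.trans
      (mul_le_mul_of_nonneg_right (le_max_right _ _) (by positivity))))

/-- Hölder between L² and L^q on T gives the factor |T|^(1/2 - 1/q), whose square has the exponent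
(q - 2)/q. -/
theorem setIntegral_norm_sq_le_of_memLp {E : Type*} [NormedAddCommGroup E] {F : Rn n → E} {q N : ℝ}
    (hq : 2 ≤ q) {U T : Set (Rn n)} (hF : MemLp F (ENNReal.ofReal q) (volume.restrict U))
    (hN₀ : 0 ≤ N) (hN : eLpNorm F (ENNReal.ofReal q) (volume.restrict U) ≤ ENNReal.ofReal N)
    (hT : T ⊆ U) (hfin : volume T ≠ ⊤) :
    ∫ x in T, ‖F x‖ ^ 2 ≤ N ^ 2 * volume.real T ^ ((q - 2) / q) := by
  have hq0 : 0 < q := by linarith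
  have hq2 : (2 : ℝ≥0∞) ≤ ENNReal.ofReal q := by
    rw [← ENNReal.ofReal_ofNat]; exact ENNReal.ofReal_le_ofReal hq
  have : IsFiniteMeasure (volume.restrict T) := ⟨by simpa using hfin.lt_top⟩
  have hFT : MemLp F (ENNReal.ofReal q) (volume.restrict T) :=
    hF.mono_measure (Measure.restrict_mono hT le_rfl)
  have hF2 : MemLp F 2 (volume.restrict T) := hFT.mono_exponent hq2
  have h1 := eLpNorm_le_eLpNorm_mul_rpow_measure_univ hq2 hFT.1
  have h2 : eLpNorm F 2 (volume.restrict T)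
      ≤ ENNReal.ofReal (N * volume.real T ^ (1 / 2 - 1 / q)) := by
    refine h1.trans ?_
    rw [ENNReal.ofReal_mul hN₀, ← ENNReal.ofReal_rpow_of_nonneg measureReal_nonneg
      (sub_nonneg.2 (one_div_le_one_div_of_le two_pos hq)), ofReal_measureReal hfin,
      Measure.restrict_apply_univ, ENNReal.toReal_ofReal hq0.le, ENNReal.toReal_ofNat]
    gcongr
    exact (eLpNorm_mono_measure F (Measure.restrict_mono hT le_rfl)).trans hN
  have h3 := pow_le_pow_left₀ bot_le h2 2
  rw [eLpNorm_two_sq, ← ofReal_integral_norm_sq hF2, ← ENNReal.ofReal_pow (by positivity),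
    ENNReal.ofReal_le_ofReal_iff (by positivity), mul_pow, ← Real.rpow_natCast,
    ← Real.rpow_natCast (volume.real T ^ _), ← Real.rpow_mul measureReal_nonneg] at h3
  rw [← Real.rpow_natCast N]
  convert h3 using 3
  field_simp
  push_cast
  ring

/-! ### The coupled problem of a Lipschitz interface -/

theorem quasiMeasurePreserving_const_smul {E : Type*} [NormedAddCommGroup E] [NormedSpace ℝ E]
    [MeasurableSpace E] [BorelSpace E] [FiniteDimensional ℝ E] (μ : Measure E)
    [μ.IsAddHaarMeasure] {ε : ℝ} (hε : ε ≠ 0) :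
    Measure.QuasiMeasurePreserving (fun x : E => ε • x) μ μ := by
  refine ⟨measurable_const_smul ε, Measure.AbsolutelyContinuous.mk fun s hs h0 => ?_⟩
  rw [Measure.map_apply (measurable_const_smul ε) hs, Measure.addHaar_preimage_smul μ hε, h0,
    mul_zero]

/-- `P` is the coupled problem with the given data, in the variables rescaled by `ε`. -/
structure IsRescaling (P : CoupledProblem n) (Ω₁ Ω₂ : Set (Rn n)) (A : Rn n → Rn n →L[ℝ] Rn n)
    (a : Rn n → Rn n → ℝ) (f : Rn n → ℝ) (b : Rn n → Rn n) (ε : ℝ) : Prop where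
  pos : 0 < ε
  U₁_eq : P.U₁ = rescale ε Ω₁
  U₂_eq : P.U₂ = rescale ε Ω₂
  κ_eq : P.κ = ε ^ (2 * (1 - P.s))
  A_eq : P.A = (rescale ε Ω₁).indicator fun x => A (ε • x)
  a_eq : P.a = (rescale ε Ω₁ ×ˢ rescale ε Ω₁)ᶜ.indicator fun p => a (ε • p.1) (ε • p.2)
  b_eq : P.b = P.Ω.indicator fun x => ε • b (ε • x)
  f_eq : P.f = P.Ω.indicator fun x => ε ^ 2 * f (ε • x)

/-- Extension by zero turns every integral into one over the whole space. The interface enters the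
abstract problem solely through its corkscrew property, which dilations preserve; measurability of
the rescaled coefficients holds because dilations preserve null sets. -/
theorem exists_isRescaling (hn : 1 ≤ n) {s lam Lam : ℝ} (hs₀ : 0 < s) (hs₁ : s < 1)
    (hlam : 0 < lam) (hLam : lam ≤ Lam) {Ω : Set (Rn n)} (hΩ : IsOpen Ω)
    (hΩb : Bornology.IsBounded Ω) {Γ Ω₁ Ω₂ : Set (Rn n)} (hΓ : IsLipschitzInterface Γ Ω₁ Ω₂)
    {A : Rn n → Rn n →L[ℝ] Rn n} (hA : IsEllipticMatrix lam Lam Ω₁ A) {a : Rn n → Rn n → ℝ}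
    (ha : IsEllipticKernel lam Lam Ω₁ Ω₂ a) {ε : ℝ} (hε : 0 < ε) {f : Rn n → ℝ}
    (hf : MemLp (fun x => f (ε • x)) 2 (volume.restrict Ω)) {b : Rn n → Rn n}
    (hb : MemLp (fun x => b (ε • x)) 2 (volume.restrict Ω))
    (hdiv : IsDivFree Ω (fun x => b (ε • x))) :
    ∃ P : CoupledProblem n, P.s = s ∧ P.lam = lam ∧ P.Lam = Lam ∧ P.Ω = Ω ∧
      IsRescaling P Ω₁ Ω₂ A a f b ε := by
  have hΩm := hΩ.measurableSet
  have hL : 0 < Lam := hlam.trans_le hLam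
  have hd := hΓ.isCorkscrewPair.disjoint
  have : IsFiniteMeasure (volume.restrict Ω) := ⟨by simpa using hΩb.measure_lt_top⟩
  refine ⟨{
    s := s, lam := lam, Lam := Lam, κ := ε ^ (2 * (1 - s)), U₁ := rescale ε Ω₁
    U₂ := rescale ε Ω₂, Ω := Ω
    A := (rescale ε Ω₁).indicator fun x => A (ε • x)
    a := (rescale ε Ω₁ ×ˢ rescale ε Ω₁)ᶜ.indicator fun p => a (ε • p.1) (ε • p.2)
    b := Ω.indicator fun x => ε • b (ε • x)
    f := Ω.indicator fun x => ε ^ 2 * f (ε • x)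
    hn := hn, hs₀ := hs₀, hs₁ := hs₁, hlam := hlam, hLam := hL
    hκ := Real.rpow_pos_of_pos hε _
    pair := hΓ.isCorkscrewPair.rescale hε
    hΩ := hΩ, hΩb := hΩb
    A_meas := ?_
    A_zero := fun x hx => Set.indicator_of_notMem hx _
    A_symm := fun x ξ η => ?_
    A_lower := fun x hx ξ => ?_
    A_upper := fun x ξ => ?_
    a_meas := ?_
    a_nonneg := fun p => Set.indicator_nonneg (fun p hp => ha.nonneg _ _ hp) p
    a_upper := fun p => Set.indicator_le' (fun p hp => ha.upper _ _ hp) (fun _ _ => hL.le) p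
    a_lower := fun x hx y => ?_
    b_memLp := (memLp_indicator_iff_restrict hΩm).2 (hb.const_smul ε)
    b_div := fun ζ hζ => ?_
    f_memLp := (memLp_indicator_iff_restrict hΩm).2 (hf.const_mul _) },
    rfl, rfl, rfl, rfl, hε, rfl, rfl, rfl, rfl, rfl, rfl, rfl⟩
  · have h1 := (aestronglyMeasurable_indicator_iff hΓ.isOpen₁.measurableSet).2 hA.measurable
    exact h1.comp_quasiMeasurePreserving (quasiMeasurePreserving_const_smul volume hε.ne')
  · by_cases hx : x ∈ rescale ε Ω₁
    · rw [Set.indicator_of_mem hx]; exact hA.symm _ hx ξ η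
    · simp [Set.indicator_of_notMem hx]
  · rw [Set.indicator_of_mem hx]; exact hA.lower _ hx ξ
  · by_cases hx : x ∈ rescale ε Ω₁
    · rw [Set.indicator_of_mem hx]; exact hA.upper _ hx ξ
    · rw [Set.indicator_of_notMem hx]
      simpa using mul_nonneg hL.le (sq_nonneg _)
  · have hm := hΓ.isOpen₁.measurableSet
    have h1 := (aestronglyMeasurable_indicator_iff (hm.prod hm).compl).2 ha.measurable
    have : (volume : Measure (Rn n × Rn n)).IsAddHaarMeasure :=
      Measure.prod.instIsAddHaarMeasure _ _
    exact h1.comp_quasiMeasurePreserving (quasiMeasurePreserving_const_smul volume hε.ne')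
  · have hxy : (x, y) ∈ (rescale ε Ω₁ ×ˢ rescale ε Ω₁)ᶜ := fun h =>
      Set.disjoint_left.1 hd h.1 hx
    rw [Set.indicator_of_mem hxy]
    exact ha.lower _ hx _
  · have h1 := integral_inner_gradient_eq_zero hΩ (hb.integrable one_le_two) hdiv hζ
    have h2 : (fun x => (inner ℝ (Ω.indicator (fun x => ε • b (ε • x)) x) (gradient ζ x) : ℝ))
        = Ω.indicator fun x => ε * inner ℝ (b (ε • x)) (gradient ζ x) := by
      ext x
      by_cases hx : x ∈ Ω
      · simp only [Set.indicator_of_mem hx, real_inner_smul_left]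
      · simp only [Set.indicator_of_notMem hx, inner_zero_left]
    rw [h2, integral_indicator hΩm, integral_const_mul, h1, mul_zero]

/-! ### Transfer to the original formulation -/

section WeakGradient

variable {U : Set (Rn n)} {v w : Rn n → ℝ} {G H : Rn n → Rn n} {φ : Rn n → ℝ}

theorem IsTestFunction.continuous_gradient (hφ : IsTestFunction U φ) : Continuous (gradient φ) :=
  (InnerProductSpace.toDual ℝ (Rn n)).symm.continuous.comp
    (hφ.smooth.continuous_fderiv (by simp))

theorem IsTestFunction.integrableOn_smul (hφ : IsTestFunction U φ)
    (hG : LocallyIntegrableOn G U volume) : IntegrableOn (fun x => φ x • G x) U := by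
  have h1 : IntegrableOn (fun x => φ x • G x) (tsupport φ) :=
    (hG.integrableOn_compact_subset hφ.supp hφ.compact.isCompact).continuousOn_smul
      hφ.smooth.continuous.continuousOn hφ.compact.isCompact
  rw [integrableOn_iff_integrable_of_support_subset] at h1
  · exact h1.integrableOn
  · intro x hx
    exact subset_tsupport φ fun h0 => hx (by simp [h0])

theorem IsTestFunction.integrableOn_smul_gradient (hφ : IsTestFunction U φ)
    (hv : LocallyIntegrableOn v U volume) : IntegrableOn (fun x => v x • gradient φ x) U := by
  have h1 : IntegrableOn (fun x => v x • gradient φ x) (tsupport φ) :=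
    (hv.integrableOn_compact_subset hφ.supp hφ.compact.isCompact).smul_continuousOn
      hφ.continuous_gradient.continuousOn hφ.compact.isCompact
  rw [integrableOn_iff_integrable_of_support_subset] at h1
  · exact h1.integrableOn
  · intro x hx
    by_contra h0
    exact hx (by simp [gradient_eq_zero_of_notMem_tsupport h0])

theorem HasWeakGradient.add (hv : HasWeakGradient U v G) (hw : HasWeakGradient U w H) :
    HasWeakGradient U (fun x => v x + w x) (fun x => G x + H x) where
  locInt := hv.locInt.add hw.locInt
  locInt_grad := hv.locInt_grad.add hw.locInt_grad
  parts φ hφ := by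
    simp only [add_smul, smul_add]
    rw [integral_add (hφ.integrableOn_smul_gradient hv.locInt)
      (hφ.integrableOn_smul_gradient hw.locInt), integral_add
      (hφ.integrableOn_smul hv.locInt_grad) (hφ.integrableOn_smul hw.locInt_grad),
      hv.parts φ hφ, hw.parts φ hφ, neg_add]

theorem HasWeakGradient.weakGrad_ae_eq (hU : IsOpen U) (h : HasWeakGradient U v G) :
    ∀ᵐ x, x ∈ U → weakGrad U v x = G x :=
  (hasWeakGradient_weakGrad ⟨G, h⟩).ae_eq hU h

theorem HasWeakGradient.memH1 (hU : IsOpen U) (h : HasWeakGradient U v G)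
    (hv : MemLp v 2 volume) (hG : MemLp G 2 volume) : MemH1 U v where
  memLp := hv.restrict U
  weakDiff := ⟨G, h⟩
  memLp_grad := (memLp_congr_ae ((ae_restrict_iff' hU.measurableSet).2
    (h.weakGrad_ae_eq hU))).2 (hG.restrict U)

end WeakGradient

namespace CoupledProblem

variable {P : CoupledProblem n} {u₀ : Rn n → ℝ} {M : ℝ} {v : Rn n → ℝ} {G : Rn n → Rn n}
  {φ : Rn n → ℝ}

theorem integrable_a_mul {d e : Rn n × Rn n → ℝ} (hd : MemLp d 2 volume) (he : MemLp e 2 volume) :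
    Integrable fun p => P.a p * (d p * e p) := by
  have h : MemLp (fun p => P.a p * d p) 2 volume :=
    hd.of_le_mul (c := P.Lam) (P.a_meas.mul hd.1) (Eventually.of_forall fun p => by
      rw [norm_mul, Real.norm_of_nonneg (P.a_nonneg p)]
      exact mul_le_mul_of_nonneg_right (P.a_upper p) (norm_nonneg _))
  refine (h.integrable_mul he).congr (Eventually.of_forall fun p => ?_)
  simp only [Pi.mul_apply, mul_assoc]

theorem inner_A_indicator_gradient (hφ : LipTest P.Ω φ) (F : Rn n → Rn n) (x : Rn n) :
    (inner ℝ (P.A x (P.Ω.indicator F x)) (gradient φ x) : ℝ)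
      = inner ℝ (P.A x (F x)) (gradient φ x) := by
  by_cases hx : x ∈ P.Ω
  · rw [Set.indicator_of_mem hx]
  · simp [hφ.gradient_eq_zero hx]

theorem indicator_cross_mul (hφ : LipTest P.Ω φ) (d : Rn n × Rn n → ℝ) (p : Rn n × Rn n) :
    (cross P.Ω).indicator d p * diffQuot P.s φ p = d p * diffQuot P.s φ p := by
  by_cases hp : p ∈ cross P.Ω
  · rw [Set.indicator_of_mem hp]
  · simp [diffQuot_eq_zero_of_notMem_cross (fun x hx => hφ.eq_zero hx) hp]

/-- The datum u₀ is not square integrable, but it is bounded on the support of the test function. -/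
theorem integrable_mul_inner_b (hu : HasGrowth P.s M u₀) (hφ : LipTest P.Ω φ) :
    Integrable fun x => u₀ x * (inner ℝ (P.b x) (gradient φ x) : ℝ) := by
  obtain ⟨B, hB⟩ := hφ.compact.isCompact.exists_bound_of_continuousOn
    hu.lipschitz.continuous.continuousOn
  refine ((integrable_inner_of_memLp P.b_memLp (hφ.memLp_gradient 2)).norm.const_mul B).mono'
    (hu.lipschitz.continuous.aestronglyMeasurable.mul
      (P.b_memLp.1.inner (hφ.memLp_gradient 2).1)) (Eventually.of_forall fun x => ?_)
  by_cases hx : x ∈ tsupport φ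
  · rw [norm_mul]
    exact mul_le_mul_of_nonneg_right (hB x hx) (norm_nonneg _)
  · simp [gradient_eq_zero_of_notMem_tsupport hx]

/-- The load, with the drift of `u₀` integrated by parts. -/
theorem load_eq_integral (hu : HasGrowth P.s M u₀) (hφ : LipTest P.Ω φ) (τ : ℝ) :
    P.load u₀ τ φ = (∫ x, P.f x * φ x) + (∫ x, u₀ x * (inner ℝ (P.b x) (gradient φ x) : ℝ))
      - (∫ x, (inner ℝ (P.A x (gradient u₀ x)) (gradient φ x) : ℝ))
      - τ ^ 2 * (∫ x, (inner ℝ (P.Ω.indicator (gradient u₀) x) (gradient φ x) : ℝ))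
      - P.κ * ∫ p, P.a p * (diffQuot P.s u₀ p * diffQuot P.s φ p) := by
  have hGu := hu.memLp_indicator_gradient P.hΩb P.hΩ.measurableSet
  have i1 : Integrable fun x => P.f x * φ x := P.f_memLp.integrable_mul (hφ.memLp 2)
  have i2 := integrable_inner_of_memLp (P.memLp_smul_b hφ) hGu
  have e2 : ∀ x, (inner ℝ (φ x • P.b x) (P.Ω.indicator (gradient u₀) x) : ℝ)
      = inner ℝ (φ x • P.b x) (gradient u₀ x) := by
    intro x
    by_cases hx : x ∈ P.Ω
    · rw [Set.indicator_of_mem hx]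
    · simp [hφ.eq_zero hx]
  simp only [e2] at i2
  have i3 := integrable_mul_inner_b hu hφ
  have h3 := integral_inner_smul_b_add hφ ⟨_, hu.lipschitz⟩
  simp only [mul_comm _ (u₀ _)] at h3
  rw [integral_add i2 i3] at h3
  have h4 : (∫ x, (P.f x - inner ℝ (P.b x) (gradient u₀ x)) * φ x) = (∫ x, P.f x * φ x)
      - ∫ x, (inner ℝ (φ x • P.b x) (gradient u₀ x) : ℝ) := by
    rw [← integral_sub i1 i2]
    refine integral_congr_ae (Eventually.of_forall fun x => ?_)
    simp only [real_inner_smul_left]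
    ring
  rw [load_eq_sub hu τ hφ, load]
  simp only [ne_eq, OfNat.ofNat_ne_zero, not_false_eq_true, zero_pow, zero_smul, add_zero]
  rw [h4]
  linarith

end CoupledProblem

namespace IsRescaling

open CoupledProblem

variable {P : CoupledProblem n} {Ω₁ Ω₂ : Set (Rn n)} {A : Rn n → Rn n →L[ℝ] Rn n}
  {a : Rn n → Rn n → ℝ} {f : Rn n → ℝ} {b : Rn n → Rn n} {ε : ℝ} {u₀ : Rn n → ℝ} {M : ℝ}
  {v : Rn n → ℝ} {G : Rn n → Rn n} {φ : Rn n → ℝ}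

theorem isOpen₁ (h : IsRescaling P Ω₁ Ω₂ A a f b ε) : IsOpen (rescale ε Ω₁) :=
  h.U₁_eq ▸ P.pair.isOpen₁

/-- Uniqueness of weak gradients lets the chosen `weakGrad` of v + u₀ be replaced by G + ∇u₀. The
integral extends to the whole space because A vanishes outside the rescaled Ω₁. -/
theorem local_integrand (h : IsRescaling P Ω₁ Ω₂ A a f b ε) (hu : HasGrowth P.s M u₀)
    (hG : MemLp G 2 volume) (hw : HasWeakGradient (rescale ε Ω₁) v G) (hφ : LipTest P.Ω φ) :
    IntegrableOn (localIntegrand Ω₁ A ε (fun x => v x + u₀ x) φ) (rescale ε Ω₁) ∧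
    formL Ω₁ A ε (fun x => v x + u₀ x) φ = (∫ x, (inner ℝ (P.A x (G x)) (gradient φ x) : ℝ))
      + ∫ x, (inner ℝ (P.A x (gradient u₀ x)) (gradient φ x) : ℝ) := by
  have hGu := hu.memLp_indicator_gradient P.hΩb P.hΩ.measurableSet
  have hg := hφ.memLp_gradient 2
  have i1 := integrable_inner_of_memLp (P.memLp_A_apply hG) hg
  have i2 := integrable_inner_of_memLp (P.memLp_A_apply hGu) hg
  simp only [inner_A_indicator_gradient hφ] at i2
  have hae : ∀ᵐ x, x ∈ rescale ε Ω₁ → (inner ℝ (P.A x (G x)) (gradient φ x) : ℝ)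
      + inner ℝ (P.A x (gradient u₀ x)) (gradient φ x)
      = localIntegrand Ω₁ A ε (fun x => v x + u₀ x) φ x := by
    filter_upwards [(hw.add (hasWeakGradient_of_lipschitz hu.lipschitz _)).weakGrad_ae_eq
      h.isOpen₁] with x hx hxU
    rw [localIntegrand, hx hxU, h.A_eq, Set.indicator_of_mem hxU, map_add, inner_add_left]
  refine ⟨(i1.add i2).integrableOn.congr ((ae_restrict_iff' h.isOpen₁.measurableSet).2 hae), ?_⟩
  rw [formL, ← setIntegral_congr_ae h.isOpen₁.measurableSet hae, ← integral_add i1 i2]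
  refine setIntegral_eq_integral_of_forall_compl_eq_zero fun x hx => ?_
  rw [P.A_zero x (h.U₁_eq ▸ hx)]
  simp

theorem nonlocal_integrand (h : IsRescaling P Ω₁ Ω₂ A a f b ε) (hu : HasGrowth P.s M u₀)
    (hd : MemLp (diffQuot P.s v) 2 volume) (hφ : LipTest P.Ω φ) :
    IntegrableOn (nonlocalIntegrand P.s a ε (fun x => v x + u₀ x) φ)
      (rescale ε Ω₁ ×ˢ rescale ε Ω₁)ᶜ ∧
    formN P.s Ω₁ a ε (fun x => v x + u₀ x) φ
      = (∫ p, P.a p * (diffQuot P.s v p * diffQuot P.s φ p))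
        + ∫ p, P.a p * (diffQuot P.s u₀ p * diffQuot P.s φ p) := by
  have hm : MeasurableSet (rescale ε Ω₁ ×ˢ rescale ε Ω₁)ᶜ :=
    (h.isOpen₁.measurableSet.prod h.isOpen₁.measurableSet).compl
  have hdu := hu.memLp_cross_indicator P.hn P.hs₀ P.hs₁ P.hΩb P.hΩ.measurableSet
  have hdφ := hφ.memLp_diffQuot P.hn P.hs₀ P.hs₁
  have i1 := P.integrable_a_mul hd hdφ
  have i2 := P.integrable_a_mul hdu hdφ
  simp only [indicator_cross_mul hφ] at i2
  have he : ∀ p ∈ (rescale ε Ω₁ ×ˢ rescale ε Ω₁)ᶜ, P.a p * (diffQuot P.s v p * diffQuot P.s φ p)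
      + P.a p * (diffQuot P.s u₀ p * diffQuot P.s φ p)
      = nonlocalIntegrand P.s a ε (fun x => v x + u₀ x) φ p := by
    intro p hp
    rw [← mul_add, ← add_mul, ← diffQuot_add, diffQuot_mul, h.a_eq, Set.indicator_of_mem hp,
      nonlocalIntegrand]
    ring
  refine ⟨(i1.add i2).integrableOn.congr_fun he hm, ?_⟩
  rw [formN, ← setIntegral_congr_fun hm he, ← integral_add i1 i2]
  refine setIntegral_eq_integral_of_forall_compl_eq_zero fun p hp => ?_
  rw [h.a_eq, Set.indicator_of_notMem hp]
  simp

theorem source (h : IsRescaling P Ω₁ Ω₂ A a f b ε) (hφ : LipTest P.Ω φ) :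
    IntegrableOn (fun x => f (ε • x) * φ x) P.Ω ∧
      ε ^ 2 * (∫ x in P.Ω, f (ε • x) * φ x) = ∫ x, P.f x * φ x := by
  have hΩm := P.hΩ.measurableSet
  have i1 : Integrable fun x => P.f x * φ x := P.f_memLp.integrable_mul (hφ.memLp 2)
  have e : (fun x => P.f x * φ x) = P.Ω.indicator fun x => ε ^ 2 * (f (ε • x) * φ x) := by
    ext x
    rw [h.f_eq]
    by_cases hx : x ∈ P.Ω
    · simp only [Set.indicator_of_mem hx, mul_assoc]
    · simp only [Set.indicator_of_notMem hx, zero_mul]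
  rw [e, integrable_indicator_iff hΩm] at i1
  refine ⟨?_, by rw [e, integral_indicator hΩm, integral_const_mul]⟩
  exact (integrable_const_mul_iff (IsUnit.mk0 _ (pow_ne_zero 2 h.pos.ne')) _).1 i1

theorem drift (h : IsRescaling P Ω₁ Ω₂ A a f b ε) (hu : HasGrowth P.s M u₀)
    (hv : MemLp v 2 volume) (hφ : LipTest P.Ω φ) :
    IntegrableOn (fun x => (v x + u₀ x) * (inner ℝ (b (ε • x)) (gradient φ x) : ℝ)) P.Ω ∧
      ε * (∫ x in P.Ω, (v x + u₀ x) * (inner ℝ (b (ε • x)) (gradient φ x) : ℝ))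
        = (∫ x, v x * (inner ℝ (P.b x) (gradient φ x) : ℝ))
          + ∫ x, u₀ x * (inner ℝ (P.b x) (gradient φ x) : ℝ) := by
  have hΩm := P.hΩ.measurableSet
  have i1 : Integrable fun x => v x * (inner ℝ (P.b x) (gradient φ x) : ℝ) :=
    hv.integrable_mul hφ.memLp_inner_b
  have i2 := integrable_mul_inner_b hu hφ
  have i3 := i1.add i2
  have e : ((fun x => v x * (inner ℝ (P.b x) (gradient φ x) : ℝ))
      + fun x => u₀ x * (inner ℝ (P.b x) (gradient φ x) : ℝ))
      = P.Ω.indicator fun x => ε * ((v x + u₀ x) * inner ℝ (b (ε • x)) (gradient φ x)) := by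
    ext x
    rw [Pi.add_apply, h.b_eq]
    by_cases hx : x ∈ P.Ω
    · simp only [Set.indicator_of_mem hx, real_inner_smul_left]
      ring
    · simp only [Set.indicator_of_notMem hx, inner_zero_left, mul_zero, add_zero]
  rw [← integral_add i1 i2]
  rw [e, integrable_indicator_iff hΩm] at i3
  refine ⟨(integrable_const_mul_iff (IsUnit.mk0 _ h.pos.ne') _).1 i3, ?_⟩
  have e' : (∫ x, (v x * (inner ℝ (P.b x) (gradient φ x) : ℝ)
      + u₀ x * inner ℝ (P.b x) (gradient φ x)))
      = ∫ x, P.Ω.indicator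
        (fun x => ε * ((v x + u₀ x) * (inner ℝ (b (ε • x)) (gradient φ x) : ℝ))) x := by
    rw [← e]; rfl
  rw [e', integral_indicator hΩm, integral_const_mul]

theorem solves (h : IsRescaling P Ω₁ Ω₂ A a f b ε) (hu : HasGrowth P.s M u₀)
    (hv : MemLp v 2 volume) (hG : MemLp G 2 volume) (hd : MemLp (diffQuot P.s v) 2 volume)
    (hw : HasWeakGradient (rescale ε Ω₁) v G)
    (heq : ∀ φ, LipTest P.Ω φ → (∫ x, (inner ℝ (P.A x (G x)) (gradient φ x) : ℝ))
        - (∫ x, v x * inner ℝ (P.b x) (gradient φ x))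
        + P.κ * ∫ p, P.a p * (diffQuot P.s v p * diffQuot P.s φ p) = P.load u₀ 0 φ) :
    Solves P.s Ω₁ P.Ω A a f b ε (fun x => v x + u₀ x) where
  weakDiff₁ := ⟨_, hw.add (hasWeakGradient_of_lipschitz hu.lipschitz _)⟩
  integrable_local φ hφ := (h.local_integrand hu hG hw hφ.lipTest).1
  integrable_nonlocal φ hφ := (h.nonlocal_integrand hu hd hφ.lipTest).1
  integrable_source φ hφ := (h.source hφ.lipTest).1
  integrable_drift φ hφ := (h.drift hu hv hφ.lipTest).1
  equation φ hφ := by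
    have h1 := heq φ hφ.lipTest
    rw [load_eq_integral hu hφ.lipTest] at h1
    rw [(h.local_integrand hu hG hw hφ.lipTest).2, (h.nonlocal_integrand hu hd hφ.lipTest).2,
      (h.source hφ.lipTest).2, (h.drift hu hv hφ.lipTest).2, ← h.κ_eq]
    linarith

theorem solvesViscous (h : IsRescaling P Ω₁ Ω₂ A a f b ε) (hu : HasGrowth P.s M u₀)
    {B τ : ℝ} {h₀ : 0 < τ} {h₁ : τ ≤ 1} (hvG : IsViscous P u₀ B τ h₀ h₁ v G) :
    SolvesViscous P.s Ω₁ P.Ω A a f b ε (τ ^ 2) (fun x => v x + u₀ x) := by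
  have hu' := fun V => hasWeakGradient_of_lipschitz hu.lipschitz V
  have hΩm := P.hΩ.measurableSet
  have hvis : ∀ φ, IsTestFunction P.Ω φ →
      IntegrableOn (fun x => (inner ℝ (weakGrad P.Ω (fun x => v x + u₀ x) x) (gradient φ x) : ℝ))
        P.Ω ∧ ∫ x in P.Ω, (inner ℝ (weakGrad P.Ω (fun x => v x + u₀ x) x) (gradient φ x) : ℝ)
        = (∫ x, (inner ℝ (G x) (gradient φ x) : ℝ))
          + ∫ x, (inner ℝ (P.Ω.indicator (gradient u₀) x) (gradient φ x) : ℝ) := by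
    intro φ hφ
    have hg := hφ.lipTest.memLp_gradient 2
    have i1 := integrable_inner_of_memLp hvG.memLp_grad hg
    have i2 := integrable_inner_of_memLp (hu.memLp_indicator_gradient P.hΩb hΩm) hg
    have hae : ∀ᵐ x, x ∈ P.Ω → (inner ℝ (G x) (gradient φ x) : ℝ)
        + inner ℝ (P.Ω.indicator (gradient u₀) x) (gradient φ x)
        = inner ℝ (weakGrad P.Ω (fun x => v x + u₀ x) x) (gradient φ x) := by
      filter_upwards [((hvG.hasWeakGradient P.Ω).add (hu' P.Ω)).weakGrad_ae_eq P.hΩ] with x hx hxΩ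
      rw [hx hxΩ, Set.indicator_of_mem hxΩ, inner_add_left]
    refine ⟨(i1.add i2).integrableOn.congr ((ae_restrict_iff' hΩm).2 hae), ?_⟩
    rw [← setIntegral_congr_ae hΩm hae, ← integral_add i1 i2]
    refine setIntegral_eq_integral_of_forall_compl_eq_zero fun x hx => ?_
    simp [hφ.lipTest.gradient_eq_zero hx]
  have hw := hvG.hasWeakGradient (rescale ε Ω₁)
  refine ⟨⟨_, hw.add (hu' _)⟩, ⟨_, (hvG.hasWeakGradient P.Ω).add (hu' _)⟩,
    fun φ hφ => (h.local_integrand hu hvG.memLp_grad hw hφ.lipTest).1,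
    fun φ hφ => (h.nonlocal_integrand hu hvG.memLp_diffQuot hφ.lipTest).1,
    fun φ hφ => (hvis φ hφ).1, fun φ hφ => (h.source hφ.lipTest).1,
    fun φ hφ => (h.drift hu hvG.memLp hφ.lipTest).1, fun φ hφ => ?_⟩
  have h1 := hvG.equation hφ.lipTest
  rw [load_eq_integral hu hφ.lipTest] at h1
  rw [(h.local_integrand hu hvG.memLp_grad hw hφ.lipTest).2,
    (h.nonlocal_integrand hu hvG.memLp_diffQuot hφ.lipTest).2, (hvis φ hφ).2,
    (h.source hφ.lipTest).2, (h.drift hu hvG.memLp hφ.lipTest).2, ← h.κ_eq]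
  linarith

end IsRescaling

/-! ### Energy space and energy inequality -/

section Energy

variable {s : ℝ} {U : Set (Rn n)} {v : Rn n → ℝ} {G : Rn n → Rn n}

theorem MemHs.memLp_diffQuot (h : MemHs s v) : MemLp (diffQuot s v) 2 volume := by
  rw [lintegral_enorm_sq_lt_top_iff_memLp (aestronglyMeasurable_diffQuot s h.memLp.1),
    lintegral_diffQuot s h.memLp.1]
  exact h.gagliardo_lt

theorem HasWeakGradient.memEnergy (hU : IsOpen U) (h : HasWeakGradient U v G)
    (hv : MemLp v 2 volume) (hG : MemLp G 2 volume) (hd : MemLp (diffQuot s v) 2 volume) :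
    MemEnergy s U v where
  memH1 := h.memH1 hU hv hG
  memHs := ⟨hv, by
    rw [← lintegral_diffQuot s hv.1]
    exact (lintegral_enorm_sq_lt_top_iff_memLp hd.1).1 hd⟩

/-- With the gradient of z cut to U, the inner product of the concrete space becomes that of the L²
triples, so weak convergence of triples is the weak convergence demanded. -/
theorem energyInner_eq (hU : IsOpen U) (h : HasWeakGradient U v G) (hv : MemLp v 2 volume)
    (hG : MemLp G 2 volume) (hd : MemLp (diffQuot s v) 2 volume) {z : Rn n → ℝ}
    (hz : MemLp z 2 volume) (hzG : MemLp (U.indicator (weakGrad U z)) 2 volume)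
    (hzd : MemLp (diffQuot s z) 2 volume) :
    energyInner s U v z = inner ℝ (mkEnergy hv hG hd) (mkEnergy hz hzG hzd) := by
  rw [inner_mkEnergy, energyInner]
  simp only [diffQuot_mul]
  congr 2
  have e : (fun x => (inner ℝ (G x) (U.indicator (weakGrad U z) x) : ℝ))
      = U.indicator fun x => inner ℝ (G x) (weakGrad U z x) := by
    ext x
    by_cases hx : x ∈ U
    · simp only [Set.indicator_of_mem hx]
    · simp only [Set.indicator_of_notMem hx, inner_zero_right]
  rw [e, integral_indicator hU.measurableSet]
  refine setIntegral_congr_ae hU.measurableSet ?_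
  filter_upwards [h.weakGrad_ae_eq hU] with x hx hxU
  rw [hx hxU]

end Energy

namespace IsRescaling

open CoupledProblem

variable {P : CoupledProblem n} {Ω₁ Ω₂ : Set (Rn n)} {A : Rn n → Rn n →L[ℝ] Rn n}
  {a : Rn n → Rn n → ℝ} {f : Rn n → ℝ} {b : Rn n → Rn n} {ε : ℝ} {u₀ φ : Rn n → ℝ}

theorem setIntegral_f_sq_le (h : IsRescaling P Ω₁ Ω₂ A a f b ε) {q : ℝ} (hq : 2 ≤ q)
    (hf : MemLp (fun x => ε ^ 2 * f (ε • x)) (ENNReal.ofReal q) (volume.restrict P.Ω))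
    {E : Set (Rn n)} (hE : E ⊆ P.Ω) (hEm : MeasurableSet E) :
    ∫ x in E, P.f x ^ 2 ≤ (eLpNorm (fun x => ε ^ 2 * f (ε • x)) (ENNReal.ofReal q)
      (volume.restrict P.Ω)).toReal ^ 2 * volume.real E ^ ((q - 2) / q) := by
  refine le_trans (le_of_eq ?_) (setIntegral_norm_sq_le_of_memLp hq hf ENNReal.toReal_nonneg
    (ENNReal.ofReal_toReal hf.2.ne).ge hE (P.hΩb.subset hE).measure_lt_top.ne)
  refine setIntegral_congr_fun hEm fun x hx => ?_
  simp only [h.f_eq, Set.indicator_of_mem (hE hx), Real.norm_eq_abs, sq_abs]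

theorem setIntegral_b_sq_le (h : IsRescaling P Ω₁ Ω₂ A a f b ε) {q : ℝ} (hq : 2 ≤ q)
    (hb : MemLp (fun x => ε • b (ε • x)) (ENNReal.ofReal q) (volume.restrict P.Ω)) {S : ℝ≥0}
    (hS : eLpNorm (fun x => ε • b (ε • x)) (ENNReal.ofReal q) (volume.restrict P.Ω) ≤ S)
    {E : Set (Rn n)} (hE : E ⊆ P.Ω) (hEm : MeasurableSet E) :
    ∫ x in E, ‖P.b x‖ ^ 2 ≤ (S : ℝ) ^ 2 * volume.real E ^ ((q - 2) / q) := by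
  refine le_trans (le_of_eq ?_) (setIntegral_norm_sq_le_of_memLp hq hb S.2
    (hS.trans_eq (ENNReal.ofReal_coe_nnreal).symm) hE (P.hΩb.subset hE).measure_lt_top.ne)
  refine setIntegral_congr_fun hEm fun x hx => ?_
  simp only [h.b_eq, Set.indicator_of_mem (hE hx)]

theorem weakTendsto (h : IsRescaling P Ω₁ Ω₂ A a f b ε) {B : ℝ} {τ : ℕ → ℝ} {h₀ : ∀ k, 0 < τ k}
    {h₁ : ∀ k, τ k ≤ 1} {v : ℕ → Rn n → ℝ} {G : ℕ → Rn n → Rn n}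
    (hvG : ∀ k, IsViscous P u₀ B (τ k) (h₀ k) (h₁ k) (v k) (G k)) {v' : Rn n → ℝ}
    {g : Rn n → Rn n} (hv : MemLp v' 2 volume) (hg : MemLp g 2 volume)
    (hd : MemLp (diffQuot P.s v') 2 volume) (hw : HasWeakGradient P.U₁ v' g)
    (hlim : ∀ z, Tendsto (fun k => (inner ℝ (hvG k).energy z : ℝ)) atTop
      (𝓝 (inner ℝ (mkEnergy hv hg hd) z))) :
    WeakTendsto P.s (rescale ε Ω₁) v v' := by
  have hU := P.pair.isOpen₁
  rw [← h.U₁_eq]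
  have hk : ∀ k, HasWeakGradient P.U₁ (v k) (fun x => P.weight 0 x • G k x) := fun k =>
    ((hvG k).hasWeakGradient P.U₁).congr hU.measurableSet
      (P.memLp_weight_smul le_rfl zero_le_one (hvG k).memLp_grad) fun x hx => by
      rw [P.weight_of_mem _ hx, one_smul]
  refine ⟨fun k => ((hvG k).hasWeakGradient P.U₁).memEnergy hU (hvG k).memLp (hvG k).memLp_grad
    (hvG k).memLp_diffQuot, hw.memEnergy hU hv hg hd, fun z hz => ?_⟩
  have hzG := (memLp_indicator_iff_restrict hU.measurableSet).2 hz.memH1.memLp_grad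
  have e := fun k => energyInner_eq hU (hk k) (hvG k).memLp
    (P.memLp_weight_smul le_rfl zero_le_one (hvG k).memLp_grad) (hvG k).memLp_diffQuot
    hz.memHs.memLp hzG hz.memHs.memLp_diffQuot
  simp only [e, energyInner_eq hU hw hv hg hd hz.memHs.memLp hzG hz.memHs.memLp_diffQuot]
  exact hlim _

/-- Translates the bound for (v + u₀ - φ)_+ into extended nonnegative reals. The positive part
vanishes off Ω, so its integral over the whole space is the one over Ω. -/
theorem energyInequality (h : IsRescaling P Ω₁ Ω₂ A a f b ε) {q : ℝ}
    (hf : MemLp (fun x => ε ^ 2 * f (ε • x)) (ENNReal.ofReal q) (volume.restrict P.Ω))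
    (hq : 2 ≤ q) (hφM : flatness P.s φ < ⊤) (hle : ∀ x ∉ P.Ω, u₀ x ≤ φ x) {v : Rn n → ℝ}
    (hz : ∀ x ∉ P.Ω, v x = 0) {K : ℝ} (hK : 0 ≤ K)
    {g : Rn n → Rn n} (hw : HasWeakGradient P.U₁ (fun x => max (v x + u₀ x - φ x) 0) g)
    (hI : MemLp (fun x => max (v x + u₀ x - φ x) 0) 2 volume)
    (hle' : (∫⁻ x in P.U₁, ‖g x‖ₑ ^ 2) + ENNReal.ofReal P.κ *
        ∫⁻ p in P.U₂ ×ˢ Set.univ, ‖diffQuot P.s (fun x => max (v x + u₀ x - φ x) 0) p‖ₑ ^ 2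
      ≤ ENNReal.ofReal (2 / P.lam * ((∫ x, max (v x + u₀ x - φ x) 0 ^ 2) +
        (K * (flatness P.s φ).toReal ^ 2 + (eLpNorm (fun x => ε ^ 2 * f (ε • x)) (ENNReal.ofReal q)
          (volume.restrict P.Ω)).toReal ^ 2 / 2)
          * volume.real {x | φ x < v x + u₀ x} ^ ((q - 2) / q)))) :
    EnergyInequality P.s q Ω₁ Ω₂ P.Ω f ε (2 / P.lam * (K + 1)).toNNReal
      (fun x => v x + u₀ x) φ := by
  have hlam := P.hlam
  have hU := P.pair.isOpen₁
  have htr : truncation (fun x => v x + u₀ x) φ = fun x => max (v x + u₀ x - φ x) 0 := rfl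
  have hsub : {x | φ x < v x + u₀ x} ⊆ P.Ω := fun x hx => by
    by_contra hxΩ
    have h1 : φ x < v x + u₀ x := hx
    rw [hz x hxΩ] at h1
    linarith [hle x hxΩ]
  have hfin : volume {x | φ x < v x + u₀ x} ≠ ⊤ := (P.hΩb.subset hsub).measure_lt_top.ne
  have hθ : 0 ≤ (q - 2) / q := div_nonneg (by linarith) (by linarith)
  set N := eLpNorm (fun x => ε ^ 2 * f (ε • x)) (ENNReal.ofReal q) (volume.restrict P.Ω) with hN
  have hNtop : N ≠ ⊤ := hf.2.ne
  set T := volume.real {x | φ x < v x + u₀ x} with hT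
  have hint : ∫⁻ x in P.Ω, ENNReal.ofReal (truncation (fun x => v x + u₀ x) φ x ^ 2)
      = ENNReal.ofReal (∫ x, max (v x + u₀ x - φ x) 0 ^ 2) := by
    have h1 := ofReal_integral_norm_sq hI
    simp only [Real.norm_eq_abs, sq_abs] at h1
    rw [h1]
    simp only [enorm_sq_eq_ofReal, htr]
    refine setLIntegral_eq_of_support_subset ?_
    intro x hx
    by_contra hxΩ
    refine hx ?_
    have : v x + u₀ x - φ x ≤ 0 := by rw [hz x hxΩ]; linarith [hle x hxΩ]
    simp [max_eq_right this]
  refine ⟨htr ▸ h.U₁_eq ▸ ⟨g, hw⟩, ?_⟩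
  rw [hint, htr, ← h.U₁_eq, ← h.U₂_eq, ← h.κ_eq, ← setLIntegral_diffQuot_prod_univ P.s hI.1,
    setLIntegral_congr_fun_ae hU.measurableSet (g := fun x => ‖g x‖ₑ ^ 2) (by
      filter_upwards [hw.weakGrad_ae_eq hU] with x hx hxU
      rw [hx hxU])]
  refine hle'.trans ?_
  have hMt : flatness P.s φ ^ 2 = ENNReal.ofReal ((flatness P.s φ).toReal ^ 2) := by
    rw [ENNReal.ofReal_pow ENNReal.toReal_nonneg, ENNReal.ofReal_toReal hφM.ne]
  have hNt : N ^ 2 = ENNReal.ofReal (N.toReal ^ 2) := by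
    rw [ENNReal.ofReal_pow ENNReal.toReal_nonneg, ENNReal.ofReal_toReal hNtop]
  have hTt : volume {x | φ x < v x + u₀ x} = ENNReal.ofReal T := (ofReal_measureReal hfin).symm
  have hT0 : 0 ≤ T := measureReal_nonneg
  set m := (flatness P.s φ).toReal
  set I := ∫ x, max (v x + u₀ x - φ x) 0 ^ 2
  have hI0 : 0 ≤ I := integral_nonneg fun x => sq_nonneg _
  rw [← hN, hMt, hNt, hTt, ENNReal.ofReal_rpow_of_nonneg hT0 hθ,
    ← ENNReal.ofReal_add (sq_nonneg _) (sq_nonneg _), ← ENNReal.ofReal_mul (by positivity),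
    ← ENNReal.ofReal_add (by positivity) hI0]
  change _ ≤ ENNReal.ofReal _ * _
  rw [← ENNReal.ofReal_mul (by positivity)]
  refine ENNReal.ofReal_le_ofReal ?_
  rw [mul_assoc]
  refine mul_le_mul_of_nonneg_left ?_ (by positivity)
  have hTθ : 0 ≤ T ^ ((q - 2) / q) := by positivity
  -- The single factor K + 1 dominates the coefficient K of M(φ)², the ½ of the source norm, and the
  -- 1 in front of the integral of the squared positive part.
  have h1 : K * m ^ 2 + N.toReal ^ 2 / 2 ≤ (K + 1) * (N.toReal ^ 2 + m ^ 2) := by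
    nlinarith [sq_nonneg m, mul_nonneg hK (sq_nonneg N.toReal), sq_nonneg N.toReal]
  have h2 := mul_le_mul_of_nonneg_right h1 hTθ
  nlinarith [mul_nonneg hK hI0]

end IsRescaling

/-- An interface point comes with a unit normal, and there is none in dimension zero. -/
theorem IsLipschitzInterface.one_le {Γ Ω₁ Ω₂ : Set (Rn n)} (h : IsLipschitzInterface Γ Ω₁ Ω₂) :
    1 ≤ n := by
  obtain ⟨p, hp⟩ := h.connected.nonempty
  obtain ⟨ν, hν, -⟩ := h.graph p hp
  rcases Nat.eq_zero_or_pos n with rfl | hn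
  · rw [Subsingleton.elim ν 0, norm_zero] at hν
    exact absurd hν zero_ne_one
  · exact hn

end LocalNonlocal

end

/-! ### The main theorem -/

open LocalNonlocal
theorem mainTheorem6 (n : ℕ) (s : ℝ) (hs₀ : 0 < s) (hs₁ : s < 1)
    (lam Lam : ℝ) (hlam : 0 < lam) (hLam : lam ≤ Lam)
    (Ω : Set (Rn n)) (hΩ : IsOpen Ω) (hΩb : Bornology.IsBounded Ω)
    (q : ℝ) (hq : 2 ≤ q) (S : ℝ≥0) (ε₀ : ℝ) :
    ∃ C₀ : ℝ≥0,
      ∀ (Γ Ω₁ Ω₂ : Set (Rn n)), IsLipschitzInterface Γ Ω₁ Ω₂ →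
      ∀ A : Rn n → Rn n →L[ℝ] Rn n, IsEllipticMatrix lam Lam Ω₁ A →
      ∀ a : Rn n → Rn n → ℝ, IsEllipticKernel lam Lam Ω₁ Ω₂ a →
      ∀ ε : ℝ, 0 < ε → ε ≤ ε₀ →
      ∀ f : Rn n → ℝ,
        MemLp (fun x => f (ε • x)) (ENNReal.ofReal q) (volume.restrict Ω) →
      ∀ b : Rn n → Rn n,
        MemLp (fun x => b (ε • x)) (ENNReal.ofReal q) (volume.restrict Ω) →
        IsDivFree Ω (fun x => b (ε • x)) →
        eLpNorm (fun x => ε • b (ε • x)) (ENNReal.ofReal q) (volume.restrict Ω) ≤ S →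
      ∀ u₀ : Rn n → ℝ, (∃ K : ℝ≥0, LipschitzWith K u₀) →
        (∃ ψ : Rn n → ℝ, (∀ x, |u₀ x| ≤ ψ x) ∧ flatness s ψ < ⊤) →
      ∃ u : Rn n → ℝ,
        MemEnergy s (rescale ε Ω₁) (fun x => u x - u₀ x) ∧
        (∀ x ∉ Ω, u x = u₀ x) ∧
        Solves s Ω₁ Ω A a f b ε u ∧
        (∃ (δ : ℕ → ℝ) (w : ℕ → Rn n → ℝ),
          (∀ k, 0 < δ k) ∧ Tendsto δ atTop (𝓝 0) ∧
          (∀ k, MemH1 Set.univ (fun x => w k x - u₀ x)) ∧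
          (∀ k, ∀ x ∉ Ω, w k x = u₀ x) ∧
          (∀ k, SolvesViscous s Ω₁ Ω A a f b ε (δ k) (w k)) ∧
          WeakTendsto s (rescale ε Ω₁) (fun k x => w k x - u₀ x) (fun x => u x - u₀ x)) ∧
        ∀ φ : Rn n → ℝ, (∀ x, 0 ≤ φ x) → (∀ x ∉ Ω, |u₀ x| ≤ φ x) → flatness s φ < ⊤ →
          EnergyInequality s q Ω₁ Ω₂ Ω f ε C₀ u φ := by
  set κ₀ : ℝ := ε₀ ^ (2 * (1 - s)) with hκ₀
  have hC : 1 ≤ n → ∃ C : ℝ≥0, ∀ (g : Rn n → ℝ) (M : ℝ), HasGrowth s M g → ∀ E ⊆ Ω,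
      MeasurableSet E →
      ∫⁻ p in E ×ˢ Set.univ, ‖diffQuot s g p‖ₑ ^ 2 ≤ C * ENNReal.ofReal (M ^ 2) * volume E :=
    fun hn => exists_setLIntegral_diffQuot_le hn hs₀ hs₁ hΩb
  -- The constant is chosen before any interface is given, so n ≥ 1 is not yet known and has to move
  -- inside the existential; for n = 0 any value will do.
  have hC' : ∃ C : ℝ≥0, 1 ≤ n → ∀ (g : Rn n → ℝ) (M : ℝ), HasGrowth s M g → ∀ E ⊆ Ω,
      MeasurableSet E →
      ∫⁻ p in E ×ˢ Set.univ, ‖diffQuot s g p‖ₑ ^ 2 ≤ C * ENNReal.ofReal (M ^ 2) * volume E := by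
    by_cases hn : 1 ≤ n
    · obtain ⟨C, hC⟩ := hC hn
      exact ⟨C, fun _ => hC⟩
    · exact ⟨0, fun h => absurd h hn⟩
  obtain ⟨C, hC⟩ := hC'
  have hq0 : 0 < q := by linarith
  have hq2 : (2 : ℝ≥0∞) ≤ ENNReal.ofReal q := by
    rw [← ENNReal.ofReal_ofNat]; exact ENNReal.ofReal_le_ofReal hq
  have : IsFiniteMeasure (volume.restrict Ω) := ⟨by simpa using hΩb.measure_lt_top⟩
  -- This is (2/λ)(K + 1), with K the coefficient of M(φ)² in `CoupledProblem.energy_limit` for θ =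
  -- (q - 2)/q. The power of ε in front of the nonlocal form is bounded through κ₀, and the drift
  -- through S.
  refine ⟨(2 / lam * (((Lam + 1) / 2 + κ₀ * Lam * C) * volume.real Ω ^ (1 - (q - 2) / q)
    + (S : ℝ) ^ 2 / 2 + 1)).toNNReal, ?_⟩
  rintro Γ Ω₁ Ω₂ hΓ A hA a ha ε hε hεε f hf b hb hdiv hS u₀ ⟨K, hK⟩ ⟨ψ, hψ, hψM⟩
  have hn := hΓ.one_le
  obtain ⟨P, rfl, rfl, rfl, rfl, hP⟩ := exists_isRescaling hn hs₀ hs₁ hlam hLam hΩ hΩb hΓ hA ha hε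
    (hf.mono_exponent hq2) (hb.mono_exponent hq2) hdiv
  have hu := hasGrowth_of_abs_le hK hψ hψM
  obtain ⟨B, τ, h₀, h₁, v, G, hvG, v', g, hv, hg, hd, hτ, hz, hw, hweak, hstrong, heq⟩ :=
    CoupledProblem.exists_limit hu
  refine ⟨fun x => v' x + u₀ x, ?_, fun x hx => by simp only [hz x hx, zero_add], ?_,
    ⟨fun k => τ k ^ 2, fun k x => v k x + u₀ x, fun k => pow_pos (h₀ k) 2, ?_, fun k => ?_,
      fun k x hx => by simp only [(hvG k).eq_zero x hx, zero_add],
      fun k => hP.solvesViscous hu (hvG k), ?_⟩, fun φ hφ₀ hφ hφM => ?_⟩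
  · simp only [add_sub_cancel_right]
    rw [← hP.U₁_eq]
    exact hw.memEnergy P.pair.isOpen₁ hv hg hd
  · exact hP.solves hu hv hg hd (hP.U₁_eq ▸ hw) heq
  · simpa using hτ.pow 2
  · simp only [add_sub_cancel_right]
    exact ((hvG k).hasWeakGradient Set.univ).memH1 isOpen_univ (hvG k).memLp (hvG k).memLp_grad
  · simp only [add_sub_cancel_right]
    exact hP.weakTendsto hvG hv hg hd hw hweak
  · have hle : ∀ x ∉ P.Ω, u₀ x ≤ φ x := fun x hx => (le_abs_self _).trans (hφ x hx)
    have hφg := hasGrowth_of_flatness_lt_top hφ₀ hφM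
    have hκ : P.κ ≤ κ₀ := by
      rw [hP.κ_eq]
      exact Real.rpow_le_rpow hε.le hεε (by linarith)
    have hκ₀' : 0 ≤ κ₀ := P.hκ.le.trans hκ
    have hf' : MemLp (fun x => ε ^ 2 * f (ε • x)) (ENNReal.ofReal q) (volume.restrict P.Ω) :=
      hf.const_mul _
    have hb' : MemLp (fun x => ε • b (ε • x)) (ENNReal.ofReal q) (volume.restrict P.Ω) :=
      hb.const_smul ε
    obtain ⟨g', hg', -, hen⟩ := CoupledProblem.energy_limit (θ := (q - 2) / q)
      (div_nonneg (by linarith) hq0.le) ((div_le_one hq0).2 (by linarith))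
      (fun E hE hEm => hP.setIntegral_f_sq_le hq hf' hE hEm)
      (fun E hE hEm => hP.setIntegral_b_sq_le hq hb' hS hE hEm) (hC hn) hκ hu hφg hle hvG hv hz
      hstrong
    have hL := P.hLam
    exact hP.energyInequality hf' hq hφM hle hz (by positivity) hg'
      (CoupledProblem.memLp_posPart hu hφg hle hv hz) hen
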